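/- Fix $\kappa>0$. Plane symmetric metrics are written in null coordinates as $g=e^{2a}\,dU\,dV-e^{2b}(e^{2c}dy^2+e^{-2c}dz^2)$, where $a,b,c$ and a fluid potential $\psi$ depend on $(U,V)$ only. Such a spacetime is called *$W^{1,2}$ regular* on a domain $S$ of the $(U,V)$-plane if $a,b,c,\psi$ are continuous, $b$ is $C^1$, and $c,\psi,a$ have weak derivatives such that on every rectangle contained in $S$ the integrals $\int(|c_U|^2+|\psi_U|^2+|a_U|)\,dU$ are bounded uniformly in $V$ and the integrals $\int(|c_V|^2+|\psi_V|^2+|a_V|)\,dV$ are bounded uniformly in $U$. The Einstein equations for a self-gravitating irrotational fluid with pressure equal to mass-energy density are, in the sense of distributions, $$\psi_{UV}+b_V\psi_U+b_U\psi_V=0,\quad c_{UV}+b_Vc_U+b_Uc_V=0,\quad b_{UV}+2b_Ub_V=0,$$ $$2a_Ub_U-b_{UU}-b_U^2-c_U^2=\kappa\psi_U^2,\quad 2a_Vb_V-b_{VV}-b_V^2-c_V^2=\kappa\psi_V^2,\quad a_{UV}-b_Ub_V+c_Uc_V=-\kappa\psi_U\psi_V.$$ With respect to the null vectors $\partial_U$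 and $e^{-2a}\partial_V$ the Newman–Penrose (NP) scalars include $\rho=-b_U$, $\sigma=-c_U$, $\mu=e^{-2a}b_V$, $\lambda=e^{-2a}c_V$, $\Phi_{00}=-b_{UU}+2a_Ub_U-b_U^2-c_U^2$, $\Psi_0=-c_{UU}+2(a_U-b_U)c_U$, $\Phi_{22}=e^{-4a}(-b_{VV}+2a_Vb_V-b_V^2-c_V^2)$, $\Psi_4=e^{-4a}(-c_{VV}+2(a_V-b_V)c_V)$, $\Lambda=\frac16e^{-2a}(a_{UV}+2b_{UV}+3b_Ub_V+c_Uc_V)$ and $\Psi_2=\frac13e^{-2a}(-a_{UV}+b_{UV}+2c_Uc_V)$. *Initial data with weak regularity* consist of $(U_0,V_0)$, real numbers $\rho_0,\sigma_0,\lambda_0,\mu_0$, functions $\overline a,\overline\Phi_{00},\overline\Psi{}^{(1)}_0$ on $\overline{\mathcal N}=\{U\ge U_0,\ V=V_0\}$ and functions $\underline a,\underline\Phi_{22},\underline\Psi{}^{(1)}_4$ on $\underline{\mathcal N}=\{U=U_0,\ V\ge V_0\}$ such that $\overline a$ is locally absolutely continuous, $\overline a(U_0)=0$, $\overline\Phi_{00}\ge0$,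 the integrals $\int(|\overline a|+|\overline a_U|)e^{\overline a}dU$, $\int\overline\Phi_{00}e^{\overline a}dU$, $\int|\overline\Psi{}_0^{(1)}|^2e^{\overline a}dU$ are finite, the product $\overline a_U\overline\Psi{}_0^{(1)}$ is locally integrable on $[U_0,\infty)$, and likewise on $\underline{\mathcal N}$. The prescribed Weyl scalars are $\overline\Psi_0=\partial_U\overline\Psi{}_0^{(1)}$ and $\underline\Psi_4=\partial_V\underline\Psi{}_4^{(1)}$, as distributions up to and including the plane $\mathcal P=\{U=U_0,V=V_0\}$ (tested against functions that need not vanish at $\mathcal P$). A *development* of the data is a $W^{1,2}$ regular solution of the Einstein equations on a relatively open set $S\ni(U_0,V_0)$ of $[U_0,\infty)\times[V_0,\infty)$ which contains $[U_0,U]\times[V_0,V]$ whenever it contains $(U,V)$, such that $b=c=\psi=0$ on $\mathcal P$, $(\rho,\sigma,\lambda,\mu)=(\rho_0,\sigma_0,\lambda_0,\mu_0)$ on $\mathcal P$, $(a,\Psi_0,\Phi_{00})=(\overline a,\overline\Psi_0,\overline\Phi_{00})$ on $\overline{\mathcal N}$ and $(a,\Psi_4,\Phi_{22})=(\underline a,\underline\Psi_4,\underline\Phi_{22})$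 on $\underline{\mathcal N}$ in the sense of distributions, and $\psi_U\ge0$ on $\overline{\mathcal N}$, $\psi_V\ge0$ on $\underline{\mathcal N}$. **Theorem.** (1) Every initial data set with weak regularity has a unique maximal development: a development of which every other development of the same data is a restriction. (2) Suppose moreover that $\rho_0\ge0$ and $\mu_0\le0$ (the area of the orbits is non-increasing toward the future). Then there are $\overline U_0\in(U_0,\infty]$ and $\underline V_0\in(V_0,\infty]$ such that the domain $S$ of the maximal development meets $\overline{\mathcal N}$ in $\{U_0\le U<\overline U_0\}$ and $\underline{\mathcal N}$ in $\{V_0\le V<\underline V_0\}$, and there are nondecreasing functions $F,G$ with two locally integrable derivatives such that $$e^{2b}=-\tfrac12\big(F(U)+G(V)\big)\ \text{ on } S=\{U\ge U_0,\ V\ge V_0,\ F(U)+G(V)<0\},$$ and the future boundary of $S$ in $\{U>U_0,V>V_0\}$ is $\mathcal B_0=\{F(U)+G(V)=0\}$. (3) For generic initial data as in (2), at every point of $\mathcal B_0$ the curvature blows up, that is, $|\Lambda|+|\Psi_2|$ tends (essentially) to $+\infty$ and is not integrable for the spacetime volume $e^{2a+2b}dU\,dV\,dy\,dz$ in any neighborhood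 of the point (so that the curvature makes no sense there even as a distribution), and the development cannot be extended through any point of $\mathcal B_0$ as a plane symmetric $W^{1,2}$ regular spacetime. Here generic means: for every initial data set with weak regularity as in (2) and every $\varepsilon>0$ there is another one with this property, with the same $(U_0,V_0)$, at distance less than $\varepsilon$, where the distance is the sum of the weighted norms $W^{1,1}$ for the difference of the coefficients $a$, $L^1$ for that of $\Phi_{00},\Phi_{22}$, $L^2$ for that of $\Psi_0^{(1)},\Psi_4^{(1)}$ (weights $e^{\overline a}$, $e^{\underline a}$ of the given data), and of $|\rho_0-\rho_0'|$, $|\sigma_0-\sigma_0'|$, $|\lambda_0-\lambda_0'|$, $|\mu_0-\mu_0'|$. Moreover $\mathcal B_0$ is nonempty for the perturbed data if it is nonempty for the given data. -/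

import Mathlib

open MeasureTheory Set Filter Topology
open scoped NNReal ENNReal ContDiff

noncomputable section

namespace PlaneSymmetric

/-! ### Weak derivatives in null coordinates

Points of the quotient of the spacetime by the symmetry group are pairs `(U, V)` of null
coordinates. -/

/-- The partial derivative `∂φ/∂U`, used on smooth test functions only. -/
def dU (φ : ℝ × ℝ → ℝ) (p : ℝ × ℝ) : ℝ := fderiv ℝ φ p (1, 0)

/-- The partial derivative `∂φ/∂V`, used on smooth test functions only. -/
def dV (φ : ℝ × ℝ → ℝ) (p : ℝ × ℝ) : ℝ := fderiv ℝ φ p (0, 1)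

/-- Smooth test functions with compact support in the interior of `S`. -/
structure IsTest (S : Set (ℝ × ℝ)) (φ : ℝ × ℝ → ℝ) : Prop where
  smooth : ContDiff ℝ ∞ φ
  compact : HasCompactSupport φ
  supp : tsupport φ ⊆ interior S

/-- `g` is the weak derivative `∂f/∂U` in the interior of `S`. -/
def IsWeakDU (S : Set (ℝ × ℝ)) (f g : ℝ × ℝ → ℝ) : Prop :=
  ∀ φ, IsTest S φ → ∫ p, f p * dU φ p = - ∫ p, g p * φ p

/-- `g` is the weak derivative `∂f/∂V` in the interior of `S`. -/
def IsWeakDV (S : Set (ℝ × ℝ)) (f g : ℝ × ℝ → ℝ) : Prop :=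
  ∀ φ, IsTest S φ → ∫ p, f p * dV φ p = - ∫ p, g p * φ p

/-- On every characteristic rectangle in `S`, the integrals of `|w|^r` along the null lines
`V = const` are bounded uniformly with respect to `V`. -/
def SliceBoundU (S : Set (ℝ × ℝ)) (r : ℝ) (w : ℝ × ℝ → ℝ) : Prop :=
  ∀ U₁ U₂ V₁ V₂ : ℝ, Icc U₁ U₂ ×ˢ Icc V₁ V₂ ⊆ S →
    ∃ C : ℝ≥0, ∀ V ∈ Icc V₁ V₂, ∫⁻ U in Icc U₁ U₂, ‖w (U, V)‖ₑ ^ r ≤ C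

/-- On every characteristic rectangle in `S`, the integrals of `|w|^r` along the null lines
`U = const` are bounded uniformly with respect to `U`. -/
def SliceBoundV (S : Set (ℝ × ℝ)) (r : ℝ) (w : ℝ × ℝ → ℝ) : Prop :=
  ∀ U₁ U₂ V₁ V₂ : ℝ, Icc U₁ U₂ ×ˢ Icc V₁ V₂ ⊆ S →
    ∃ C : ℝ≥0, ∀ U ∈ Icc U₁ U₂, ∫⁻ V in Icc V₁ V₂, ‖w (U, V)‖ₑ ^ r ≤ C

/-! ### Regular spacetimes and the field equations -/

/-- The coefficients of the metric
`e^{2a} dU dV - e^{2b} (e^{2c} dy² + e^{-2c} dz²)` and the fluid potential `ψ`. -/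
structure Fields where
  a : ℝ × ℝ → ℝ
  b : ℝ × ℝ → ℝ
  c : ℝ × ℝ → ℝ
  ψ : ℝ × ℝ → ℝ

/-- Candidates for the first-order derivatives of the metric coefficients and the potential. -/
structure Derivs where
  aU : ℝ × ℝ → ℝ
  aV : ℝ × ℝ → ℝ
  bU : ℝ × ℝ → ℝ
  bV : ℝ × ℝ → ℝ
  cU : ℝ × ℝ → ℝ
  cV : ℝ × ℝ → ℝ
  ψU : ℝ × ℝ → ℝ
  ψV : ℝ × ℝ → ℝ

/-- `W^{1,2}` regularity on `S`: `a, b, c, ψ` are continuous; the first-order weak derivatives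
of `c, ψ` are square-integrable, and those of `a` are integrable, along null lines, uniformly on
characteristic rectangles. The area coefficient `b` is better behaved (it is even smooth in a
suitable gauge): in a general null chart it is continuously differentiable. -/
structure IsRegular (S : Set (ℝ × ℝ)) (f : Fields) (d : Derivs) : Prop where
  a_cont : ContinuousOn f.a S
  b_cont : ContinuousOn f.b S
  c_cont : ContinuousOn f.c S
  ψ_cont : ContinuousOn f.ψ S
  aU_meas : Measurable d.aU
  aV_meas : Measurable d.aV
  cU_meas : Measurable d.cU
  cV_meas : Measurable d.cV
  ψU_meas : Measurable d.ψU
  ψV_meas : Measurable d.ψV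
  aU_weak : IsWeakDU S f.a d.aU
  aV_weak : IsWeakDV S f.a d.aV
  bU_weak : IsWeakDU S f.b d.bU
  bV_weak : IsWeakDV S f.b d.bV
  cU_weak : IsWeakDU S f.c d.cU
  cV_weak : IsWeakDV S f.c d.cV
  ψU_weak : IsWeakDU S f.ψ d.ψU
  ψV_weak : IsWeakDV S f.ψ d.ψV
  aU_bound : SliceBoundU S 1 d.aU
  aV_bound : SliceBoundV S 1 d.aV
  bU_cont : ContinuousOn d.bU S
  bV_cont : ContinuousOn d.bV S
  cU_bound : SliceBoundU S 2 d.cU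
  cV_bound : SliceBoundV S 2 d.cV
  ψU_bound : SliceBoundU S 2 d.ψU
  ψV_bound : SliceBoundV S 2 d.ψV

/-- The Einstein equations for a self-gravitating irrotational fluid with pressure equal to its
mass-energy density, in arbitrary null coordinates and in the sense of distributions. Each
second-order derivative is tested by moving one derivative onto the test function. -/
structure SolvesEinstein (κ : ℝ) (S : Set (ℝ × ℝ)) (d : Derivs) : Prop where
  /-- `ψ_UV + b_V ψ_U + b_U ψ_V = 0` -/
  potential : ∀ φ, IsTest S φ →
    ∫ p, (- d.ψU p * dV φ p + (d.bV p * d.ψU p + d.bU p * d.ψV p) * φ p) = 0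
  /-- `c_UV + b_V c_U + b_U c_V = 0` -/
  wave_c : ∀ φ, IsTest S φ →
    ∫ p, (- d.cU p * dV φ p + (d.bV p * d.cU p + d.bU p * d.cV p) * φ p) = 0
  /-- `b_UV + 2 b_U b_V = 0` -/
  wave_b : ∀ φ, IsTest S φ →
    ∫ p, (- d.bU p * dV φ p + 2 * d.bU p * d.bV p * φ p) = 0
  /-- `2 a_U b_U - b_UU - b_U² - c_U² = κ ψ_U²` -/
  constraint_U : ∀ φ, IsTest S φ →
    ∫ p, (d.bU p * dU φ p + (2 * d.aU p * d.bU p - d.bU p ^ 2 - d.cU p ^ 2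
      - κ * d.ψU p ^ 2) * φ p) = 0
  /-- `2 a_V b_V - b_VV - b_V² - c_V² = κ ψ_V²` -/
  constraint_V : ∀ φ, IsTest S φ →
    ∫ p, (d.bV p * dV φ p + (2 * d.aV p * d.bV p - d.bV p ^ 2 - d.cV p ^ 2
      - κ * d.ψV p ^ 2) * φ p) = 0
  /-- `a_UV - b_U b_V + c_U c_V = - κ ψ_U ψ_V` -/
  wave_a : ∀ φ, IsTest S φ →
    ∫ p, (- d.aU p * dV φ p + (- d.bU p * d.bV p + d.cU p * d.cV p
      + κ * d.ψU p * d.ψV p) * φ p) = 0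

/-! ### Initial data -/

/-- Data on one null hypersurface `{x ≥ x₀}`: the conformal coefficient `a`, the Ricci scalar `Φ`
(`Φ₀₀` or `Φ₂₂`), and a function `Ψ₁` whose distributional derivative is the Weyl scalar
(`Ψ₀` or `Ψ₄`). -/
structure NullData where
  a : ℝ → ℝ
  Φ : ℝ → ℝ
  Ψ₁ : ℝ → ℝ

/-- Weak regularity of the data on a null hypersurface `{x ≥ x₀}` with volume form `e^a dx`. The
last condition says that the product of `∂a` with the Weyl scalar is meaningful. -/
structure NullData.IsWeaklyRegular (D : NullData) (x₀ : ℝ) : Prop where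
  a_ac : ∀ x, x₀ ≤ x → AbsolutelyContinuousOnInterval D.a x₀ x
  a_int : IntegrableOn (fun x => (|D.a x| + |deriv D.a x|) * Real.exp (D.a x)) (Ici x₀)
  a_zero : D.a x₀ = 0
  Φ_nonneg : ∀ᵐ x ∂(volume.restrict (Ici x₀)), 0 ≤ D.Φ x
  Φ_int : IntegrableOn (fun x => D.Φ x * Real.exp (D.a x)) (Ici x₀)
  Ψ_meas : AEStronglyMeasurable D.Ψ₁ (volume.restrict (Ici x₀))
  Ψ_int : IntegrableOn (fun x => D.Ψ₁ x ^ 2 * Real.exp (D.a x)) (Ici x₀)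
  product_int : LocallyIntegrableOn (fun x => deriv D.a x * D.Ψ₁ x) (Ici x₀)

/-- The distance between two data sets on `{x ≥ x₀}`, in the norms of the data spaces: `W^{1,1}`
for `a`, `L¹` for the Ricci scalar, `W^{-1,2}` for the Weyl scalar. -/
def NullData.dist (x₀ : ℝ) (D D' : NullData) : ℝ≥0∞ :=
  (∫⁻ x in Ici x₀, (‖D'.a x - D.a x‖ₑ + ‖deriv D'.a x - deriv D.a x‖ₑ)
      * ENNReal.ofReal (Real.exp (D.a x)))
  + (∫⁻ x in Ici x₀, ‖D'.Φ x - D.Φ x‖ₑ * ENNReal.ofReal (Real.exp (D.a x)))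
  + (∫⁻ x in Ici x₀, ‖D'.Ψ₁ x - D.Ψ₁ x‖ₑ ^ (2 : ℝ) * ENNReal.ofReal (Real.exp (D.a x)))
      ^ (1 / 2 : ℝ)

/-- Characteristic initial data: data `(a, Φ₀₀, Ψ₀)` on `{U ≥ U₀, V = V₀}`, data `(a, Φ₂₂, Ψ₄)` on
`{U = U₀, V ≥ V₀}`, and the connection scalars on the plane `{U = U₀, V = V₀}`. -/
structure InitialData where
  U₀ : ℝ
  V₀ : ℝ
  out : NullData
  inc : NullData
  ρ₀ : ℝ
  σ₀ : ℝ
  lam₀ : ℝ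
  μ₀ : ℝ

/-- Initial data with weak regularity. -/
def InitialData.IsWeaklyRegular (D : InitialData) : Prop :=
  D.out.IsWeaklyRegular D.U₀ ∧ D.inc.IsWeaklyRegular D.V₀

/-- The area of the surfaces of symmetry is initially non-increasing toward the future along both
null directions, that is, `b_U = -ρ₀ ≤ 0` and `b_V = μ₀ ≤ 0` on the initial plane. -/
def InitialData.NonExpanding (D : InitialData) : Prop := 0 ≤ D.ρ₀ ∧ D.μ₀ ≤ 0

/-- The energy-type distance between two initial data sets with the same `U₀, V₀`. -/
def InitialData.dist (D D' : InitialData) : ℝ≥0∞ :=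
  D.out.dist D.U₀ D'.out + D.inc.dist D.V₀ D'.inc
    + ‖D'.ρ₀ - D.ρ₀‖ₑ + ‖D'.σ₀ - D.σ₀‖ₑ + ‖D'.lam₀ - D.lam₀‖ₑ + ‖D'.μ₀ - D.μ₀‖ₑ

/-- Smooth functions on the line whose support meets `[x₀, ∞)` in a compact subset of the
interval `I ∋ x₀`. They need not vanish at `x₀`. -/
structure IsTestOn (x₀ : ℝ) (I : Set ℝ) (φ : ℝ → ℝ) : Prop where
  smooth : ContDiff ℝ ∞ φ
  compact : HasCompactSupport φ
  supp : tsupport φ ∩ Ici x₀ ⊆ I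

/-- The functions `b, c` of one null variable `x ∈ I` (where `I` is an interval with least element
`x₀`) have Ricci scalar `Φ` and Weyl scalar `∂Ψ₁`, that is,
`e^{-ka} (- b'' + 2 a' b' - b'² - c'²) = Φ` and `e^{-ka} (- c'' + 2 (a' - b') c') = ∂Ψ₁`,
and initial values `b'(x₀) = β₀`, `c'(x₀) = γ₀`, in the sense of distributions on `I`, up to and
including the boundary point `x₀`. -/
structure HasNPData (k x₀ : ℝ) (I : Set ℝ) (D : NullData) (b c : ℝ → ℝ) (β₀ γ₀ : ℝ) :
    Prop where
  b_ac : ∀ x ∈ I, AbsolutelyContinuousOnInterval b x₀ x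
  c_ac : ∀ x ∈ I, AbsolutelyContinuousOnInterval c x₀ x
  db_bound : ∀ x ∈ I, ∃ C : ℝ, ∀ᵐ y ∂(volume.restrict (Icc x₀ x)), |deriv b y| ≤ C
  dc_sq : ∀ x ∈ I, IntegrableOn (fun y => deriv c y ^ 2) (Icc x₀ x)
  product : ∀ x ∈ I, IntegrableOn (fun y => deriv D.a y * deriv c y) (Icc x₀ x)
  ricci : ∀ φ, IsTestOn x₀ I φ →
    β₀ * φ x₀ + ∫ x in Ici x₀, Real.exp (- k * D.a x) * (deriv b x * deriv φ x
        - k * deriv D.a x * deriv b x * φ x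
        + (2 * deriv D.a x * deriv b x - deriv b x ^ 2 - deriv c x ^ 2) * φ x)
      = ∫ x in Ici x₀, D.Φ x * φ x
  weyl : ∀ φ, IsTestOn x₀ I φ →
    γ₀ * φ x₀ + ∫ x in Ici x₀, Real.exp (- k * D.a x) * (deriv c x * deriv φ x
        - k * deriv D.a x * deriv c x * φ x
        + 2 * (deriv D.a x - deriv b x) * deriv c x * φ x)
      = - ∫ x in Ici x₀, D.Ψ₁ x * deriv φ x

/-- `S` is the domain of a future development: it contains the initial plane and the past, within
the quadrant `{U ≥ U₀, V ≥ V₀}`, of each of its points, and it is open relative to the quadrant. -/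
structure IsFutureDomain (U₀ V₀ : ℝ) (S : Set (ℝ × ℝ)) : Prop where
  mem : (U₀, V₀) ∈ S
  subset : S ⊆ Ici U₀ ×ˢ Ici V₀
  past : ∀ p ∈ S, Icc U₀ p.1 ×ˢ Icc V₀ p.2 ⊆ S
  relOpen : ∃ O : Set (ℝ × ℝ), IsOpen O ∧ S = O ∩ (Ici U₀ ×ˢ Ici V₀)

/-- The fields `f` on `S` form a `W^{1,2}` regular future development of the initial data `D`.
With the null tetrad `l = ∂_U`, `n = e^{-2a} ∂_V`, one has `ρ = - b_U`, `σ = - c_U`,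
`μ = e^{-2a} b_V`, `λ = e^{-2a} c_V`, and
`Φ₀₀ = - b_UU + 2 a_U b_U - b_U² - c_U²`, `Ψ₀ = - c_UU + 2 (a_U - b_U) c_U`,
`Φ₂₂ = e^{-4a} (- b_VV + 2 a_V b_V - b_V² - c_V²)`, `Ψ₄ = e^{-4a} (- c_VV + 2 (a_V - b_V) c_V)`.
As `ψ` enters the geometry only quadratically, it is normalized by `ψ = 0` on the initial plane,
and its gradient (the fluid velocity, up to a factor) is future-directed on the initial
hypersurfaces. -/
structure IsDevelopment (κ : ℝ) (D : InitialData) (S : Set (ℝ × ℝ)) (f : Fields) : Prop where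
  domain : IsFutureDomain D.U₀ D.V₀ S
  solution : ∃ d : Derivs, IsRegular S f d ∧ SolvesEinstein κ S d
  b_zero : f.b (D.U₀, D.V₀) = 0
  c_zero : f.c (D.U₀, D.V₀) = 0
  ψ_zero : f.ψ (D.U₀, D.V₀) = 0
  a_out : ∀ U, (U, D.V₀) ∈ S → f.a (U, D.V₀) = D.out.a U
  a_inc : ∀ V, (D.U₀, V) ∈ S → f.a (D.U₀, V) = D.inc.a V
  np_out : HasNPData 0 D.U₀ {U | (U, D.V₀) ∈ S} D.out
    (fun U => f.b (U, D.V₀)) (fun U => f.c (U, D.V₀)) (- D.ρ₀) (- D.σ₀)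
  np_inc : HasNPData 4 D.V₀ {V | (D.U₀, V) ∈ S} D.inc
    (fun V => f.b (D.U₀, V)) (fun V => f.c (D.U₀, V)) D.μ₀ D.lam₀
  ψ_out : ∀ᵐ U : ℝ, (U, D.V₀) ∈ S → 0 ≤ deriv (fun U' => f.ψ (U', D.V₀)) U
  ψ_inc : ∀ᵐ V : ℝ, (D.U₀, V) ∈ S → 0 ≤ deriv (fun V' => f.ψ (D.U₀, V')) V

/-- `(S, f)` is the unique maximal development: every development of the same data is the
restriction of `f` to a subdomain of `S`. -/
def IsMaximalDevelopment (κ : ℝ) (D : InitialData) (S : Set (ℝ × ℝ)) (f : Fields) : Prop :=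
  IsDevelopment κ D S f ∧
  ∀ (S' : Set (ℝ × ℝ)) (f' : Fields), IsDevelopment κ D S' f' →
    S' ⊆ S ∧ ∀ p ∈ S', f'.a p = f.a p ∧ f'.b p = f.b p ∧ f'.c p = f.c p ∧ f'.ψ p = f.ψ p

/-! ### Future boundary, curvature, extensions -/

/-- `F` is continuously differentiable on `[x₀, ∞)` and `F'` is locally absolutely continuous:
two derivatives in `L¹` on bounded intervals. -/
def IsW21 (x₀ : ℝ) (F : ℝ → ℝ) : Prop :=
  ∃ F' : ℝ → ℝ, (∀ x, x₀ ≤ x → HasDerivWithinAt F (F' x) (Ici x₀) x) ∧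
    ∀ x, x₀ ≤ x → AbsolutelyContinuousOnInterval F' x₀ x

/-- The future boundary of a future domain (initial hypersurfaces excluded). -/
def futureBoundary (U₀ V₀ : ℝ) (S : Set (ℝ × ℝ)) : Set (ℝ × ℝ) :=
  frontier S ∩ (Ioi U₀ ×ˢ Ioi V₀)

/-- `L` and `P` are the Ricci scalar `Λ` (equal to `R / 24` for the scalar curvature `R`) and the
Weyl scalar `Ψ₂` of the metric, as locally integrable functions:
`Λ = (1/6) e^{-2a} (a_UV + 2 b_UV + 3 b_U b_V + c_U c_V)` and
`Ψ₂ = (1/3) e^{-2a} (- a_UV + b_UV + 2 c_U c_V)`. -/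
def AreCurvatureScalars (S : Set (ℝ × ℝ)) (f : Fields) (L P : ℝ × ℝ → ℝ) : Prop :=
  ∃ (d : Derivs) (aUV bUV : ℝ × ℝ → ℝ), IsRegular S f d ∧
    LocallyIntegrableOn aUV (interior S) ∧ LocallyIntegrableOn bUV (interior S) ∧
    IsWeakDV S d.aU aUV ∧ IsWeakDV S d.bU bUV ∧
    (∀ p ∈ S, L p = 1 / 6 * Real.exp (- 2 * f.a p)
      * (aUV p + 2 * bUV p + 3 * d.bU p * d.bV p + d.cU p * d.cV p)) ∧
    (∀ p ∈ S, P p = 1 / 3 * Real.exp (- 2 * f.a p)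
      * (- aUV p + bUV p + 2 * d.cU p * d.cV p))

/-- The curvature blows up on the set `B`: at every point of `B` the curvature scalars tend to
infinity, and they are not integrable with respect to the spacetime volume
`e^{2a + 2b} dU dV dy dz` in any neighborhood (so that they do not define distributions there). -/
def CurvatureBlowsUpOn (S : Set (ℝ × ℝ)) (f : Fields) (B : Set (ℝ × ℝ)) : Prop :=
  ∃ L P : ℝ × ℝ → ℝ, AreCurvatureScalars S f L P ∧ ∀ p ∈ B,
    (∀ K : ℝ, ∃ N ∈ 𝓝 p, ∀ᵐ q ∂(volume.restrict (N ∩ S)), K ≤ |L q| + |P q|) ∧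
    (∀ N ∈ 𝓝 p, ¬ IntegrableOn
      (fun q => (|L q| + |P q|) * Real.exp (2 * f.a q + 2 * f.b q)) (N ∩ S))

/-- `(S, f)` extends through the boundary point `p` as a `W^{1,2}` regular metric: for some open
`W ⊆ S` with `p` in its closure, there is an isometry, given by a change of null coordinates
`(U, V) ↦ (X U, Y V)` (and a rescaling of `y` and `z`), from `W` into a plane symmetric
`W^{1,2}` regular spacetime `(O, f')`, which sends `p` to a point of `O`. -/
def ExtendsThrough (S : Set (ℝ × ℝ)) (f : Fields) (p : ℝ × ℝ) : Prop :=
  ∃ (O : Set (ℝ × ℝ)) (f' : Fields) (d' : Derivs) (W : Set (ℝ × ℝ)) (X Y : ℝ → ℝ)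
    (β γ : ℝ) (q₀ : ℝ × ℝ),
    IsOpen O ∧ IsRegular O f' d' ∧ IsOpen W ∧ W ⊆ S ∧ p ∈ closure W ∧ q₀ ∈ O ∧
    Tendsto (fun q : ℝ × ℝ => (X q.1, Y q.2)) (𝓝[W] p) (𝓝 q₀) ∧
    ∀ q ∈ W, (X q.1, Y q.2) ∈ O ∧ 0 < deriv X q.1 ∧ 0 < deriv Y q.2 ∧
      Real.exp (2 * f.a q)
        = Real.exp (2 * f'.a (X q.1, Y q.2)) * deriv X q.1 * deriv Y q.2 ∧
      f'.b (X q.1, Y q.2) = f.b q + β ∧ f'.c (X q.1, Y q.2) = f.c q + γ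

/-- The data `D` are generic, in the sense that their development is singular: the curvature blows
up on the whole future boundary and the development cannot be extended through it within the
class of `W^{1,2}` regular spacetimes. -/
def HasSingularDevelopment (κ : ℝ) (D : InitialData) : Prop :=
  ∃ (S : Set (ℝ × ℝ)) (f : Fields), IsMaximalDevelopment κ D S f ∧
    CurvatureBlowsUpOn S f (futureBoundary D.U₀ D.V₀ S) ∧
    ∀ p ∈ futureBoundary D.U₀ D.V₀ S, ¬ ExtendsThrough S f p

end PlaneSymmetric

end

/-!
The equation `b_UV + 2 b_U b_V = 0` says that `e^{2b}` is a sum `f(U) + g(V) - 1` with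
`f(U₀) = g(V₀) = 1`, and the functions `f`, `g` are determined on the two initial hypersurfaces. There
the prescribed scalars `Φ₀₀`, `Ψ₀` (and `Φ₂₂`, `Ψ₄`), read as distributions up to the initial plane,
are equivalent to a Riccati system for `(b, c)` (`HasNPData.exists_isRiccati`,
`hasNPData_of_isRiccati`). The substitution `A = e^{b+c}`, `B = e^{b-c}` makes it linear (`IsJacobi`),
so `A` and `B` exist globally (`Axis`), `f = A B`, and the metric data exist as long as `A`, `B` remain
positive.

Once `b` is known, the equations for `c` and `ψ` become `w_UV = - b_U b_V w` for `w = e^b c`, `e^b ψ`: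
a Volterra equation on characteristic rectangles (`IsFutureDomain.exists_volterra`,
`volterra_unique`). Then `a` is obtained by a quadrature, and the two constraints propagate from the
initial hypersurfaces (`Solution.constraint_eq`). Such an integrated solution (`Solution`,
`IsCanonical`) is a development (`IsCanonical.isDevelopment`). Conversely, by Fubini's theorem and the
lemma of du Bois-Reymond, every development is of this form (`IsDevelopment.exists_isCanonical`), and
two of them agree where both are defined (`IsCanonical.unique`). Hence the maximal development lives on
the set of points whose past is covered by positive `A`, `B` and where `f + g - 1` is positive
(`maximalDomain`).

If the orbits contract initially, then `f` and `g` are non-increasing as long as the data exist, and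
`F = 1 - 2 f`, `G = 1 - 2 g` are continued as nondecreasing functions beyond the end of the data
(`Axis.exists_extension`). This describes the domain and its boundary (`maximalDomain_structure`).

For the generic statement, `InitialData.addMatter` adds a positive multiple of a positive function to
`Φ₀₀` and `Φ₂₂` and makes the initial contraction strict. Comparison of Jacobi fields
(`IsJacobi.comparison`) shows that the area function only decreases, so that a nonempty boundary stays
nonempty. For the perturbed data, `ψ_U ≥ - δ b_U` and `ψ_V ≥ - δ b_V` with some `δ > 0`: this holds on
the initial hypersurfaces, and `ψ + δ b` satisfies the linear wave equation of `ψ`, which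
preserves the sign of both derivatives when `b_U, b_V ≤ 0`, by a Gronwall estimate for their negative
parts (`Solution.le_ψ_of_axis`). The constraint equation yields `e^{2a} ≤ C (- b_U)`
(`IsCanonical.exists_exp_le`). Since the field equations give `Λ = - (κ / 6) e^{-2a} ψ_U ψ_V`, both
`|Λ|` and `e^{2a+2b} |Λ|` are bounded below by multiples of `e^{-2b}`
(`IsCanonical.exists_curvature_bound`). The area function `e^{2b}` is Lipschitz and vanishes on the
boundary, so its inverse is not integrable near any boundary point (`not_integrableOn_inv_area`). No
extension exists, because `b` is, up to a constant, independent of the null coordinates and tends to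
`-∞` (`IsCanonical.not_extendsThrough`).
-/

noncomputable section

namespace PlaneSymmetric

variable {U₀ V₀ : ℝ} {S : Set (ℝ × ℝ)}

section

/-! ### Absolutely continuous functions and their derivatives -/

/-- `f` is absolutely continuous between `a` and `b`, with derivative `g` almost everywhere. -/
structure HasACDeriv (f g : ℝ → ℝ) (a b : ℝ) : Prop where
  ac : AbsolutelyContinuousOnInterval f a b
  hasDeriv : ∀ᵐ t : ℝ, t ∈ uIcc a b → HasDerivAt f (g t) t

theorem absolutelyContinuousOnInterval_congr {f f' : ℝ → ℝ} {a b : ℝ}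
    (hf : AbsolutelyContinuousOnInterval f a b) (h : EqOn f f' (uIcc a b)) :
    AbsolutelyContinuousOnInterval f' a b := by
  rw [absolutelyContinuousOnInterval_iff] at hf ⊢
  intro ε hε
  obtain ⟨δ, hδ, H⟩ := hf ε hε
  refine ⟨δ, hδ, fun E hE hl => ?_⟩
  have := H E hE hl
  refine lt_of_le_of_lt (le_of_eq ?_) this
  refine Finset.sum_congr rfl fun i hi => ?_
  have h1 := hE.1 i hi
  rw [h h1.1, h h1.2]

namespace HasACDeriv

variable {f g f₁ g₁ f₂ g₂ : ℝ → ℝ} {a b c d : ℝ}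

theorem of_ac (hf : AbsolutelyContinuousOnInterval f a b) : HasACDeriv f (deriv f) a b :=
  ⟨hf, by filter_upwards [hf.ae_differentiableAt] with t ht h using (ht h).hasDerivAt⟩

theorem deriv_eq (h : HasACDeriv f g a b) : ∀ᵐ t : ℝ, t ∈ uIcc a b → deriv f t = g t := by
  filter_upwards [h.hasDeriv] with t ht h using (ht h).deriv

theorem mono (h : HasACDeriv f g a b) (hs : uIcc c d ⊆ uIcc a b) : HasACDeriv f g c d :=
  ⟨h.ac.mono hs, by filter_upwards [h.hasDeriv] with t ht h using ht (hs h)⟩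

theorem congr_deriv (h : HasACDeriv f g a b) (he : ∀ᵐ t : ℝ, t ∈ uIcc a b → g t = g₁ t) :
    HasACDeriv f g₁ a b :=
  ⟨h.ac, by filter_upwards [h.hasDeriv, he] with t ht h' h using h' h ▸ ht h⟩

theorem congr (h : HasACDeriv f g a b) (he : EqOn f f₁ (uIcc a b)) : HasACDeriv f₁ g a b := by
  refine ⟨absolutelyContinuousOnInterval_congr h.ac he, ?_⟩
  have h1 : ∀ᵐ t : ℝ, t ≠ min a b := by simp [ae_iff, measure_singleton]
  have h2 : ∀ᵐ t : ℝ, t ≠ max a b := by simp [ae_iff, measure_singleton]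
  filter_upwards [h.hasDeriv, h1, h2] with t ht n1 n2 hm
  refine (ht hm).congr_of_eventuallyEq ?_
  have : uIcc a b ∈ 𝓝 t := Icc_mem_nhds (lt_of_le_of_ne hm.1 n1.symm) (lt_of_le_of_ne hm.2 n2)
  filter_upwards [this] with x hx using (he hx).symm

theorem continuousOn (h : HasACDeriv f g a b) : ContinuousOn f (uIcc a b) := h.ac.continuousOn

theorem intervalIntegrable (h : HasACDeriv f g a b) : IntervalIntegrable g volume a b := by
  refine h.ac.intervalIntegrable_deriv.congr_ae ?_
  rw [EventuallyEq, ae_restrict_iff' measurableSet_uIoc]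
  filter_upwards [h.deriv_eq] with t ht hm using ht (uIoc_subset_uIcc hm)

theorem integral_eq (h : HasACDeriv f g a b) : ∫ t in a..b, g t = f b - f a := by
  rw [← h.ac.integral_deriv_eq_sub]
  refine intervalIntegral.integral_congr_ae ?_
  filter_upwards [h.deriv_eq] with t ht hm using (ht (uIoc_subset_uIcc hm)).symm

theorem add (h₁ : HasACDeriv f₁ g₁ a b) (h₂ : HasACDeriv f₂ g₂ a b) :
    HasACDeriv (fun t => f₁ t + f₂ t) (fun t => g₁ t + g₂ t) a b :=
  ⟨h₁.ac.fun_add h₂.ac, by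
    filter_upwards [h₁.hasDeriv, h₂.hasDeriv] with t h h' hm using (h hm).add (h' hm)⟩

theorem sub (h₁ : HasACDeriv f₁ g₁ a b) (h₂ : HasACDeriv f₂ g₂ a b) :
    HasACDeriv (fun t => f₁ t - f₂ t) (fun t => g₁ t - g₂ t) a b :=
  ⟨h₁.ac.fun_sub h₂.ac, by
    filter_upwards [h₁.hasDeriv, h₂.hasDeriv] with t h h' hm using (h hm).sub (h' hm)⟩

theorem neg (h₁ : HasACDeriv f₁ g₁ a b) :
    HasACDeriv (fun t => - f₁ t) (fun t => - g₁ t) a b :=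
  ⟨h₁.ac.fun_neg, by filter_upwards [h₁.hasDeriv] with t h hm using (h hm).neg⟩

theorem mul (h₁ : HasACDeriv f₁ g₁ a b) (h₂ : HasACDeriv f₂ g₂ a b) :
    HasACDeriv (fun t => f₁ t * f₂ t) (fun t => g₁ t * f₂ t + f₁ t * g₂ t) a b :=
  ⟨h₁.ac.fun_mul h₂.ac, by
    filter_upwards [h₁.hasDeriv, h₂.hasDeriv] with t h h' hm using (h hm).mul (h' hm)⟩

theorem const (k : ℝ) : HasACDeriv (fun _ => k) (fun _ => 0) a b := by
  refine ⟨(LipschitzWith.const k).lipschitzOnWith.absolutelyContinuousOnInterval, ?_⟩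
  exact Eventually.of_forall fun t _ => hasDerivAt_const t k

theorem const_mul (k : ℝ) (h₁ : HasACDeriv f₁ g₁ a b) :
    HasACDeriv (fun t => k * f₁ t) (fun t => k * g₁ t) a b :=
  ⟨h₁.ac.const_mul k, by filter_upwards [h₁.hasDeriv] with t h hm using (h hm).const_mul k⟩

theorem of_integral (h : IntervalIntegrable g volume a b) (hc : c ∈ uIcc a b) :
    HasACDeriv (fun x => ∫ t in c..x, g t) g a b :=
  ⟨h.absolutelyContinuousOnInterval_intervalIntegral hc, by
    filter_upwards [h.ae_hasDerivAt_integral] with t ht hm using ht hm c hc⟩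

theorem of_eq_integral (h : IntervalIntegrable g volume a b)
    (he : ∀ x ∈ uIcc a b, f x = f a + ∫ t in a..x, g t) : HasACDeriv f g a b := by
  have h1 := (const (a := a) (b := b) (f a)).add (of_integral h left_mem_uIcc)
  simp only [zero_add] at h1
  exact h1.congr fun x hx => (he x hx).symm

theorem lipschitz_comp {φ φ' : ℝ → ℝ} {K : ℝ≥0} (h : HasACDeriv f g a b)
    (hL : LipschitzOnWith K φ (f '' uIcc a b))
    (hφ : ∀ t ∈ uIcc a b, HasDerivAt φ (φ' (f t)) (f t)) :
    HasACDeriv (fun t => φ (f t)) (fun t => φ' (f t) * g t) a b := by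
  constructor
  · have hf := h.ac
    rw [absolutelyContinuousOnInterval_iff] at hf ⊢
    intro ε hε
    obtain ⟨δ, hδ, H⟩ := hf (ε / (K + 1)) (by positivity)
    refine ⟨δ, hδ, fun E hE hl => ?_⟩
    have h1 := H E hE hl
    have h2 : ∑ i ∈ Finset.range E.1, dist (φ (f (E.2 i).1)) (φ (f (E.2 i).2))
        ≤ K * ∑ i ∈ Finset.range E.1, dist (f (E.2 i).1) (f (E.2 i).2) := by
      rw [Finset.mul_sum]
      refine Finset.sum_le_sum fun i hi => ?_
      exact hL.dist_le_mul _ (mem_image_of_mem f (hE.1 i hi).1) _ (mem_image_of_mem f (hE.1 i hi).2)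
    have h3 : (0 : ℝ) ≤ ∑ i ∈ Finset.range E.1, dist (f (E.2 i).1) (f (E.2 i).2) :=
      Finset.sum_nonneg fun _ _ => dist_nonneg
    have hK : (0 : ℝ) ≤ K := K.2
    rw [lt_div_iff₀ (by positivity)] at h1
    nlinarith
  · filter_upwards [h.hasDeriv] with t ht hm
    exact (hφ t hm).comp t (ht hm)

/-- Chain rule for the composition with a function that is `C¹` on an interval. -/
theorem comp {φ φ' : ℝ → ℝ} {D : Set ℝ} (h : HasACDeriv f g a b)
    (hf : ∀ t ∈ uIcc a b, f t ∈ D) (hφ : ∀ y ∈ D, HasDerivAt φ (φ' y) y)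
    (hφ' : ContinuousOn φ' D) :
    HasACDeriv (fun t => φ (f t)) (fun t => φ' (f t) * g t) a b := by
  have hK : IsCompact (f '' uIcc a b) := isCompact_uIcc.image_of_continuousOn h.continuousOn
  have hKD : f '' uIcc a b ⊆ D := by rintro _ ⟨t, ht, rfl⟩; exact hf t ht
  have hconv : Convex ℝ (f '' uIcc a b) :=
    ((isPreconnected_uIcc).image f h.continuousOn).convex
  obtain ⟨C, hC⟩ := hK.exists_bound_of_continuousOn (hφ'.mono hKD)
  have hL : LipschitzOnWith (Real.toNNReal C) φ (f '' uIcc a b) := by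
    refine hconv.lipschitzOnWith_of_nnnorm_hasDerivWithin_le
      (fun x hx => (hφ x (hKD hx)).hasDerivWithinAt) fun x hx => ?_
    rw [← NNReal.coe_le_coe, coe_nnnorm]
    exact (hC x hx).trans (Real.le_coe_toNNReal C)
  exact h.lipschitz_comp hL fun t ht => hφ _ (hf t ht)

theorem of_hasDerivAt (hf : ∀ t ∈ uIcc a b, HasDerivAt f (g t) t)
    (hg : ContinuousOn g (uIcc a b)) : HasACDeriv f g a b := by
  obtain ⟨C, hC⟩ := isCompact_uIcc.exists_bound_of_continuousOn hg
  have hL : LipschitzOnWith (Real.toNNReal C) f (uIcc a b) := by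
    refine (convex_uIcc a b).lipschitzOnWith_of_nnnorm_hasDerivWithin_le
      (fun x hx => (hf x hx).hasDerivWithinAt) fun x hx => ?_
    rw [← NNReal.coe_le_coe, coe_nnnorm]
    exact (hC x hx).trans (Real.le_coe_toNNReal C)
  exact ⟨hL.absolutelyContinuousOnInterval, Eventually.of_forall hf⟩

theorem exp (h : HasACDeriv f g a b) :
    HasACDeriv (fun t => Real.exp (f t)) (fun t => Real.exp (f t) * g t) a b :=
  h.comp (D := univ) (fun _ _ => mem_univ _) (fun y _ => Real.hasDerivAt_exp y)
    Real.continuous_exp.continuousOn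

theorem log (h : HasACDeriv f g a b) (hf : ∀ t ∈ uIcc a b, 0 < f t) :
    HasACDeriv (fun t => Real.log (f t)) (fun t => (f t)⁻¹ * g t) a b :=
  h.comp (D := Ioi 0) (φ' := fun y => y⁻¹) hf (fun _ hy => Real.hasDerivAt_log (ne_of_gt hy))
    (continuousOn_inv₀.mono fun _ hy => ne_of_gt hy)

theorem inv (h : HasACDeriv f g a b) (hf : ∀ t ∈ uIcc a b, 0 < f t) :
    HasACDeriv (fun t => (f t)⁻¹) (fun t => - (f t ^ 2)⁻¹ * g t) a b :=
  h.comp (D := Ioi 0) (φ' := fun y => - (y ^ 2)⁻¹) hf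
    (fun _ hy => hasDerivAt_inv (ne_of_gt hy))
    (((continuousOn_id.pow 2).inv₀ fun _ hy => pow_ne_zero 2 (ne_of_gt hy)).neg)

theorem sqrt (h : HasACDeriv f g a b) (hf : ∀ t ∈ uIcc a b, 0 < f t) :
    HasACDeriv (fun t => √(f t)) (fun t => 1 / (2 * √(f t)) * g t) a b :=
  h.comp (D := Ioi 0) (φ' := fun y => 1 / (2 * √y)) hf
    (fun _ hy => Real.hasDerivAt_sqrt (ne_of_gt hy))
    (continuousOn_const.div (continuousOn_const.mul Real.continuous_sqrt.continuousOn)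
      fun _ hy => mul_ne_zero two_ne_zero (Real.sqrt_ne_zero'.2 hy))

theorem div (h₁ : HasACDeriv f₁ g₁ a b) (h₂ : HasACDeriv f₂ g₂ a b)
    (hf : ∀ t ∈ uIcc a b, 0 < f₂ t) :
    HasACDeriv (fun t => f₁ t / f₂ t) (fun t => (g₁ t * f₂ t - f₁ t * g₂ t) / f₂ t ^ 2) a b := by
  have := h₁.mul (h₂.inv hf)
  simp only [← div_eq_mul_inv] at this
  refine this.congr_deriv (Eventually.of_forall fun t ht => ?_)
  have := (hf t ht).ne'
  field_simp
  ring

theorem antitone_of_nonpos (h : HasACDeriv f g a b) (hab : a ≤ b)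
    (hg : ∀ᵐ t : ℝ, t ∈ Icc a b → g t ≤ 0) : f b ≤ f a := by
  have h1 := h.integral_eq
  have h2 : ∫ t in a..b, g t ≤ ∫ t in a..b, (0 : ℝ) := by
    refine intervalIntegral.integral_mono_ae_restrict hab h.intervalIntegrable (by simp) ?_
    rw [EventuallyLE, ae_restrict_iff' measurableSet_Icc]
    exact hg
  simp only [intervalIntegral.integral_zero] at h2
  linarith

theorem eq_of_deriv_zero (h : HasACDeriv f g a b)
    (hg : ∀ᵐ t : ℝ, t ∈ uIcc a b → g t = 0) : f b = f a := by
  have h1 := h.integral_eq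
  have h2 : ∫ t in a..b, g t = ∫ t in a..b, (0 : ℝ) := by
    refine intervalIntegral.integral_congr_ae ?_
    filter_upwards [hg] with t ht hm using ht (uIoc_subset_uIcc hm)
  simp only [intervalIntegral.integral_zero] at h2
  linarith

/-- A solution of `f' = m f - n` with `n ≥ 0` that starts from a nonpositive value remains
nonpositive, by the integrating factor `exp (-∫ m)`. -/
theorem nonpos_of_linear {m n : ℝ → ℝ} (h : HasACDeriv f g a b) (hab : a ≤ b)
    (hm : IntervalIntegrable m volume a b) (ha : f a ≤ 0)
    (hg : ∀ᵐ t : ℝ, t ∈ Icc a b → g t = m t * f t - n t)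
    (hn : ∀ᵐ t : ℝ, t ∈ Icc a b → 0 ≤ n t) : f b ≤ 0 := by
  have h1 := ((of_integral (c := a) hm left_mem_uIcc).neg.exp).mul h
  have h2 := h1.antitone_of_nonpos hab (by
    filter_upwards [hg, hn] with t h3 h4 ht
    rw [h3 ht]
    have := Real.exp_pos (-∫ s in a..t, m s)
    nlinarith [mul_nonneg this.le (h4 ht)])
  simp only [intervalIntegral.integral_same, neg_zero, Real.exp_zero, one_mul] at h2
  have := Real.exp_pos (-∫ s in a..b, m s)
  by_contra hc
  push Not at hc
  nlinarith [mul_pos this hc]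

theorem zero_of_linear {m : ℝ → ℝ} (h : HasACDeriv f g a b) (hab : a ≤ b)
    (hm : IntervalIntegrable m volume a b) (ha : f a = 0)
    (hg : ∀ᵐ t : ℝ, t ∈ Icc a b → g t = m t * f t) : f b = 0 := by
  refine le_antisymm (h.nonpos_of_linear (n := 0) hab hm ha.le ?_ ?_) ?_
  · filter_upwards [hg] with t ht hm
    simp [ht hm]
  · simp
  · have := h.neg.nonpos_of_linear (m := m) (n := 0) hab hm (by simp [ha]) ?_ (by simp)
    · simpa using this
    · filter_upwards [hg] with t ht hm
      simp [ht hm]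

end HasACDeriv

end

section

/-! ### The lemma of du Bois-Reymond -/

theorem integral_eq_intervalIntegral {F : ℝ → ℝ} {a b : ℝ} (hab : a ≤ b)
    (h : ∀ x, x ∉ Ioc a b → F x = 0) : ∫ x, F x = ∫ x in a..b, F x := by
  rw [intervalIntegral.integral_of_le hab, setIntegral_eq_integral_of_forall_compl_eq_zero h]

theorem exists_Ioo_of_compact {K : Set ℝ} {a b : ℝ} (hab : a < b) (hK : IsCompact K)
    (hs : K ⊆ Ioo a b) : ∃ α β, a < α ∧ α < β ∧ β < b ∧ K ⊆ Ioo α β := by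
  rcases K.eq_empty_or_nonempty with rfl | hne
  · exact ⟨a + (b - a) / 3, a + 2 * (b - a) / 3, by linarith, by linarith, by linarith, by simp⟩
  · obtain ⟨m, hm, hm'⟩ := hK.exists_isLeast hne
    obtain ⟨M, hM, hM'⟩ := hK.exists_isGreatest hne
    have h1 := hs hm
    have h2 := hs hM
    have h3 := hm' hM
    refine ⟨(a + m) / 2, (M + b) / 2, ?_, ?_, ?_, fun x hx => ?_⟩
    · linarith [h1.1]
    · linarith [h1.1, h2.2]
    · linarith [h2.2]
    · have h4 := hm' hx
      have h5 := hM' hx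
      constructor
      · linarith [h1.1]
      · linarith [h2.2]

theorem contDiff_primitive {ζ : ℝ → ℝ} (hζ : ContDiff ℝ ∞ ζ) (a : ℝ) :
    ContDiff ℝ ∞ (fun x => ∫ t in a..x, ζ t) ∧
      ∀ x, HasDerivAt (fun x => ∫ t in a..x, ζ t) (ζ x) x := by
  have h : ∀ x, HasDerivAt (fun x => ∫ t in a..x, ζ t) (ζ x) x := fun x =>
    intervalIntegral.integral_hasDerivAt_right (hζ.continuous.intervalIntegrable _ _)
      (hζ.continuous.stronglyMeasurableAtFilter _ _) hζ.continuous.continuousAt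
  refine ⟨contDiff_infty_iff_deriv.2 ⟨fun x => (h x).differentiableAt, ?_⟩, h⟩
  rw [show deriv (fun x => ∫ t in a..x, ζ t) = ζ from funext fun x => (h x).deriv]
  exact hζ

theorem eq_zero_of_notMem_tsupport {X : Type*} [TopologicalSpace X] {φ : X → ℝ} {s : Set X}
    (h : tsupport φ ⊆ s) {x : X} (hx : x ∉ s) : φ x = 0 :=
  image_eq_zero_of_notMem_tsupport fun h' => hx (h h')

theorem deriv_eq_zero_of_notMem_tsupport {φ : ℝ → ℝ} {s : Set ℝ}
    (h : tsupport φ ⊆ s) {x : ℝ} (hx : x ∉ s) : deriv φ x = 0 :=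
  image_eq_zero_of_notMem_tsupport fun h' => hx (h (tsupport_deriv_subset h'))

theorem tsupport_subset_Icc {φ : ℝ → ℝ} {α β : ℝ} (h : ∀ x, x ∉ Icc α β → φ x = 0) :
    tsupport φ ⊆ Icc α β :=
  closure_minimal (fun x hx => by by_contra hn; exact hx (h x hn)) isClosed_Icc

/-- If the continuous function `w` has the integrable weak derivative `g`, then it is a primitive
of `g`. -/
theorem sub_eq_integral_of_weak {x₀ x₁ : ℝ} {w g : ℝ → ℝ}
    (hw : ContinuousOn w (Ioo x₀ x₁)) (hg : IntegrableOn g (Ioo x₀ x₁))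
    (H : ∀ χ : ℝ → ℝ, ContDiff ℝ ∞ χ → HasCompactSupport χ → tsupport χ ⊆ Ioo x₀ x₁ →
      ∫ x, w x * deriv χ x = - ∫ x, g x * χ x) :
    ∀ u ∈ Ioo x₀ x₁, ∀ v ∈ Ioo x₀ x₁, w v - w u = ∫ x in u..v, g x := by
  intro u hu v hv
  have h01 : x₀ < x₁ := hu.1.trans hu.2
  have hgi : ∀ a ∈ Ioo x₀ x₁, ∀ b ∈ Ioo x₀ x₁, IntervalIntegrable g volume a b := by
    intro a ha b hb
    rw [intervalIntegrable_iff]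
    exact hg.mono_set (uIoc_subset_uIcc.trans (ordConnected_Ioo.uIcc_subset ha hb))
  set Γ : ℝ → ℝ := fun x => ∫ t in u..x, g t with hΓ
  have hΓc : ContinuousOn Γ (Ioo x₀ x₁) := by
    intro x hx
    obtain ⟨a, ha1, ha2⟩ := exists_between (lt_min hx.1 hu.1)
    obtain ⟨b, hb1, hb2⟩ := exists_between (max_lt hx.2 hu.2)
    have ha : a ∈ Ioo x₀ x₁ := ⟨ha1, (ha2.trans_le (min_le_left _ _)).trans hx.2⟩
    have hb : b ∈ Ioo x₀ x₁ := ⟨hx.1.trans ((le_max_left _ _).trans_lt hb1), hb2⟩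
    have hab : a ≤ b := ((ha2.trans_le (min_le_left _ _)).trans
      ((le_max_left _ _).trans_lt hb1)).le
    have := (HasACDeriv.of_integral (c := u) (hgi a ha b hb) (by
      rw [uIcc_of_le hab]
      exact ⟨(ha2.trans_le (min_le_right _ _)).le, ((le_max_right _ _).trans_lt hb1).le⟩)).continuousOn
    rw [uIcc_of_le hab] at this
    exact (this.continuousAt (Icc_mem_nhds (ha2.trans_le (min_le_left _ _))
      ((le_max_left _ _).trans_lt hb1))).continuousWithinAt
  -- the primitive of `g` has the same weak derivative
  have H2 : ∀ χ : ℝ → ℝ, ContDiff ℝ ∞ χ → HasCompactSupport χ → tsupport χ ⊆ Ioo x₀ x₁ →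
      ∫ x, (w x - Γ x) * deriv χ x = 0 := by
    intro χ h1 h2 h3
    obtain ⟨α, β, hα, hαβ, hβ, hsub⟩ := exists_Ioo_of_compact h01 h2 h3
    have hαm : α ∈ Ioo x₀ x₁ := ⟨hα, hαβ.trans hβ⟩
    have hβm : β ∈ Ioo x₀ x₁ := ⟨hα.trans hαβ, hβ⟩
    have hIcc : uIcc α β ⊆ Ioo x₀ x₁ := ordConnected_Ioo.uIcc_subset hαm hβm
    have z1 : ∀ x, x ∉ Ioc α β → χ x = 0 := fun x hx =>
      eq_zero_of_notMem_tsupport hsub fun h => hx (Ioo_subset_Ioc_self h)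
    have z2 : ∀ x, x ∉ Ioc α β → deriv χ x = 0 := fun x hx =>
      deriv_eq_zero_of_notMem_tsupport hsub fun h => hx (Ioo_subset_Ioc_self h)
    have e := H χ h1 h2 h3
    rw [integral_eq_intervalIntegral hαβ.le (fun x hx => by rw [z2 x hx, mul_zero]),
      integral_eq_intervalIntegral hαβ.le (fun x hx => by rw [z1 x hx, mul_zero])] at e
    rw [integral_eq_intervalIntegral hαβ.le (fun x hx => by rw [z2 x hx, mul_zero])]
    have hd : Continuous (deriv χ) := h1.continuous_deriv (by simp)
    have hχ : HasACDeriv χ (deriv χ) α β := HasACDeriv.of_hasDerivAt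
      (fun t _ => (h1.differentiable (by simp) t).hasDerivAt) hd.continuousOn
    have hΓ' : HasACDeriv Γ g α β := by
      have h4 : HasACDeriv (fun x => Γ α + ∫ t in α..x, g t) (fun x => 0 + g x) α β :=
        (HasACDeriv.const _).add (HasACDeriv.of_integral (hgi α hαm β hβm) left_mem_uIcc)
      simp only [zero_add] at h4
      refine h4.congr fun x hx => ?_
      exact intervalIntegral.integral_add_adjacent_intervals (hgi u hu α hαm)
        (hgi α hαm x (hIcc hx))
    have e2 := (hΓ'.mul hχ).integral_eq
    have zα : χ α = 0 := z1 α (by simp)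
    have zβ : χ β = 0 := eq_zero_of_notMem_tsupport hsub (by simp)
    rw [zα, zβ, mul_zero, mul_zero, sub_zero] at e2
    have i1 : IntervalIntegrable (fun x => g x * χ x) volume α β :=
      (hgi α hαm β hβm).mul_continuousOn h1.continuous.continuousOn
    have i2 : IntervalIntegrable (fun x => Γ x * deriv χ x) volume α β :=
      ((hΓc.mono hIcc).mul hd.continuousOn).intervalIntegrable
    have i3 : IntervalIntegrable (fun x => w x * deriv χ x) volume α β :=
      ((hw.mono hIcc).mul hd.continuousOn).intervalIntegrable
    rw [intervalIntegral.integral_add i1 i2] at e2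
    simp only [sub_mul]
    rw [intervalIntegral.integral_sub i3 i2]
    linarith
  -- a normalized bump function near `u`
  obtain ⟨δ, hδ, hδs⟩ := Metric.isOpen_iff.1 isOpen_Ioo u hu
  let bmp : ContDiffBump u := ⟨δ / 4, δ / 2, by positivity, by linarith⟩
  set η : ℝ → ℝ := bmp.normed volume with hη
  have η1 : ContDiff ℝ ∞ η := bmp.contDiff_normed
  have η2 : HasCompactSupport η := bmp.hasCompactSupport_normed
  have η3 : tsupport η ⊆ Ioo x₀ x₁ := by
    rw [hη, bmp.tsupport_normed_eq]
    exact (Metric.closedBall_subset_ball (by change δ / 2 < δ; linarith)).trans hδs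
  have η4 : ∫ x, η x = 1 := bmp.integral_normed
  set C : ℝ := ∫ x, (w x - Γ x) * η x with hC
  have hcont : ContinuousOn (fun x => w x - Γ x) (Ioo x₀ x₁) := hw.sub hΓc
  have hint : ∀ ξ : ℝ → ℝ, ContDiff ℝ ∞ ξ → HasCompactSupport ξ → tsupport ξ ⊆ Ioo x₀ x₁ →
      Integrable (fun x => (w x - Γ x) * ξ x) := by
    intro ξ h1 h2 h3
    have : IntegrableOn (fun x => (w x - Γ x) * ξ x) (tsupport ξ) :=
      ((hcont.mono h3).mul h1.continuous.continuousOn).integrableOn_compact h2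
    refine this.integrable_of_forall_notMem_eq_zero fun x hx => ?_
    rw [image_eq_zero_of_notMem_tsupport hx, mul_zero]
  have hae : ∀ᵐ x : ℝ, x ∈ Ioo x₀ x₁ → (w x - Γ x - C) = 0 := by
    refine isOpen_Ioo.ae_eq_zero_of_integral_contDiff_smul_eq_zero
      ((hcont.sub continuousOn_const).locallyIntegrableOn measurableSet_Ioo) ?_
    intro ξ h1 h2 h3
    -- `ξ - k η` has vanishing integral, so that its primitive is again a test function
    set k : ℝ := ∫ x, ξ x with hk
    have ζ1 : ContDiff ℝ ∞ (fun x => ξ x - k * η x) := h1.sub (contDiff_const.mul η1)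
    have ζ2 : tsupport (fun x => ξ x - k * η x) ⊆ tsupport ξ ∪ tsupport η := by
      refine closure_minimal (fun x hx => ?_) ((isClosed_tsupport _).union (isClosed_tsupport _))
      by_contra hn
      rw [mem_union, not_or] at hn
      apply hx
      simp [image_eq_zero_of_notMem_tsupport hn.1, image_eq_zero_of_notMem_tsupport hn.2]
    obtain ⟨α, β, hα, hαβ, hβ, hsub⟩ := exists_Ioo_of_compact h01 (h2.union η2)
      (union_subset h3 η3)
    have z : ∀ x, x ∉ Ioo α β → ξ x - k * η x = 0 := fun x hx =>
      eq_zero_of_notMem_tsupport (ζ2.trans hsub) hx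
    obtain ⟨χ1, χd⟩ := contDiff_primitive ζ1 α
    set χ : ℝ → ℝ := fun x => ∫ t in α..x, (ξ t - k * η t) with hχ
    have iξ : Integrable ξ := h1.continuous.integrable_of_hasCompactSupport h2
    have iη : Integrable η := η1.continuous.integrable_of_hasCompactSupport η2
    have tot : ∫ t in α..β, (ξ t - k * η t) = 0 := by
      rw [← integral_eq_intervalIntegral hαβ.le
        (fun x hx => z x fun h => hx (Ioo_subset_Ioc_self h)),
        integral_sub iξ (iη.const_mul k), integral_const_mul, η4, hk, mul_one, sub_self]
    have χz : ∀ x, x ∉ Icc α β → χ x = 0 := by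
      intro x hx
      rcases lt_or_ge x α with h | h
      · refine (intervalIntegral.integral_congr (g := fun _ => 0) fun t ht => ?_).trans (by simp)
        rw [uIcc_of_ge h.le] at ht
        exact z t fun h' => absurd ht.2 (not_le.2 h'.1)
      · have hxβ : β < x := by by_contra hn; exact hx ⟨h, not_lt.1 hn⟩
        have : χ x = (∫ t in α..β, (ξ t - k * η t)) + ∫ t in β..x, (ξ t - k * η t) :=
          (intervalIntegral.integral_add_adjacent_intervals
            (ζ1.continuous.intervalIntegrable _ _) (ζ1.continuous.intervalIntegrable _ _)).symm
        rw [this, tot, zero_add]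
        refine (intervalIntegral.integral_congr (g := fun _ => 0) fun t ht => ?_).trans (by simp)
        rw [uIcc_of_le hxβ.le] at ht
        exact z t fun h' => absurd ht.1 (not_le.2 h'.2)
    have χs : tsupport χ ⊆ Icc α β := tsupport_subset_Icc χz
    have e := H2 χ χ1 (IsCompact.of_isClosed_subset isCompact_Icc (isClosed_tsupport _) χs)
      (χs.trans fun x hx => ⟨hα.trans_le hx.1, hx.2.trans_lt hβ⟩)
    simp only [(χd _).deriv] at e
    have e1 : ∫ x, (w x - Γ x) * (ξ x - k * η x)
        = (∫ x, (w x - Γ x) * ξ x) - k * C := by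
      rw [hC, ← integral_const_mul, ← integral_sub (hint ξ h1 h2 h3) ((hint η η1 η2 η3).const_mul k)]
      congr 1; ext x; ring
    have e2 : ∫ x, ξ x • (w x - Γ x - C) = (∫ x, (w x - Γ x) * ξ x) - k * C := by
      rw [hk, ← integral_mul_const, ← integral_sub (hint ξ h1 h2 h3) (iξ.mul_const C)]
      congr 1; ext x; simp only [smul_eq_mul]; ring
    rw [e2, ← e1, e]
  have heq : EqOn (fun x => w x - Γ x) (fun _ => C) (Ioo x₀ x₁) := by
    refine Measure.eqOn_open_of_ae_eq (μ := volume) ?_ isOpen_Ioo hcont continuousOn_const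
    rw [EventuallyEq, ae_restrict_iff' measurableSet_Ioo]
    filter_upwards [hae] with x hx hm
    linarith [hx hm]
  have eu := heq hu
  have ev := heq hv
  simp only [hΓ, intervalIntegral.integral_same] at eu ev
  linarith

/-- The half-line version: the test functions need not vanish at the initial point, where the
weak identity encodes the initial value `β`. -/
theorem ae_eq_integral_of_weak_half {x₀ x₁ β : ℝ} {P Q : ℝ → ℝ} (h01 : x₀ < x₁)
    (hP : IntegrableOn P (Icc x₀ x₁)) (hQ : IntegrableOn Q (Icc x₀ x₁))
    (H : ∀ φ : ℝ → ℝ, IsTestOn x₀ (Ico x₀ x₁) φ →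
      β * φ x₀ + ∫ x in Ici x₀, (P x * deriv φ x + Q x * φ x) = 0) :
    ∀ᵐ x : ℝ, x ∈ Ioo x₀ x₁ → P x = β + ∫ t in x₀..x, Q t := by
  have iP : IntervalIntegrable P volume x₀ x₁ := by
    rw [intervalIntegrable_iff, uIoc_of_le h01.le]; exact hP.mono_set Ioc_subset_Icc_self
  have iQ : IntervalIntegrable Q volume x₀ x₁ := by
    rw [intervalIntegrable_iff, uIoc_of_le h01.le]; exact hQ.mono_set Ioc_subset_Icc_self
  have hΓ : HasACDeriv (fun x => β + ∫ t in x₀..x, Q t) Q x₀ x₁ := by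
    have := (HasACDeriv.const (a := x₀) (b := x₁) β).add (HasACDeriv.of_integral iQ left_mem_uIcc)
    simpa only [zero_add] using this
  have hΓc := hΓ.continuousOn
  rw [uIcc_of_le h01.le] at hΓc
  have hloc : LocallyIntegrableOn (fun x => P x - (β + ∫ t in x₀..x, Q t)) (Ioo x₀ x₁) :=
    ((hP.sub (hΓc.integrableOn_compact isCompact_Icc)).mono_set
      Ioo_subset_Icc_self).locallyIntegrableOn
  have key := isOpen_Ioo.ae_eq_zero_of_integral_contDiff_smul_eq_zero (U := Ioo x₀ x₁) hloc ?_
  · filter_upwards [key] with x hx hm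
    linarith [hx hm]
  intro ξ h1 h2 h3
  obtain ⟨α, b, hα, hαb, hb, hsub⟩ := exists_Ioo_of_compact h01 h2 h3
  obtain ⟨p1, pd⟩ := contDiff_primitive h1 x₁
  let bmp : ContDiffBump x₀ := ⟨x₁ - x₀ + 1, x₁ - x₀ + 2, by linarith, by linarith⟩
  -- the primitive that vanishes to the right, cut off far to the left
  set φ : ℝ → ℝ := fun x => bmp x * ∫ t in x₁..x, ξ t with hφ
  have pz : ∀ x, b ≤ x → ∫ t in x₁..x, ξ t = 0 := by
    intro x hx
    refine (intervalIntegral.integral_congr (g := fun _ => 0) fun t ht => ?_).trans (by simp)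
    refine eq_zero_of_notMem_tsupport hsub fun h' => absurd h'.2 (not_lt.2 ?_)
    exact (le_min hb.le hx).trans ht.1
  have φ1 : ContDiff ℝ ∞ φ := bmp.contDiff.mul p1
  have φ2 : HasCompactSupport φ := bmp.hasCompactSupport.mul_right
  have φ3 : tsupport φ ⊆ Iic b := by
    refine closure_minimal (fun x hx => ?_) isClosed_Iic
    by_contra hn
    exact hx (by simp only [hφ, pz x (not_le.1 hn).le, mul_zero])
  have φd : ∀ x, x₀ ≤ x → x ≤ x₁ → φ x = (∫ t in x₁..x, ξ t) ∧ HasDerivAt φ (ξ x) x := by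
    intro x hx hx'
    have hball : ∀ y ∈ Metric.ball x₀ (x₁ - x₀ + 1), bmp y = 1 := fun y hy =>
      bmp.one_of_mem_closedBall (Metric.ball_subset_closedBall hy)
    have hxb : x ∈ Metric.ball x₀ (x₁ - x₀ + 1) := by
      rw [Metric.mem_ball, Real.dist_eq, abs_of_nonneg (by linarith)]; linarith
    refine ⟨by simp only [hφ, hball x hxb, one_mul], ?_⟩
    refine (pd x).congr_of_eventuallyEq ?_
    filter_upwards [Metric.isOpen_ball.mem_nhds hxb] with y hy
    simp only [hφ, hball y hy, one_mul]
  have e := H φ ⟨φ1, φ2, fun x hx => ⟨hx.2, (φ3 hx.1).trans_lt hb⟩⟩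
  have z0 : ∀ x, x₁ < x → φ x = 0 := fun x hx =>
    eq_zero_of_notMem_tsupport φ3 (by simp; linarith)
  have zd : ∀ x, x₁ < x → deriv φ x = 0 := fun x hx =>
    deriv_eq_zero_of_notMem_tsupport φ3 (by simp; linarith)
  have e1 : ∫ x in Ici x₀, (P x * deriv φ x + Q x * φ x)
      = ∫ x in x₀..x₁, (P x * ξ x + Q x * ∫ t in x₁..x, ξ t) := by
    rw [intervalIntegral.integral_of_le h01.le, integral_Ici_eq_integral_Ioi]
    rw [setIntegral_eq_of_subset_of_forall_sdiff_eq_zero measurableSet_Ioi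
      (Ioc_subset_Ioi_self : Ioc x₀ x₁ ⊆ Ioi x₀)]
    · refine setIntegral_congr_fun measurableSet_Ioc fun x hx => ?_
      simp only [(φd x hx.1.le hx.2).1, (φd x hx.1.le hx.2).2.deriv]
    · intro x hx
      have : x₁ < x := by by_contra hn; exact hx.2 ⟨hx.1, not_lt.1 hn⟩
      simp [z0 x this, zd x this]
  rw [e1, (φd x₀ le_rfl h01.le).1] at e
  have hp : HasACDeriv (fun x => ∫ t in x₁..x, ξ t) ξ x₀ x₁ :=
    HasACDeriv.of_hasDerivAt (fun t _ => pd t) h1.continuous.continuousOn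
  have e2 := (hΓ.mul hp).integral_eq
  simp only [intervalIntegral.integral_same, mul_zero, add_zero, zero_sub] at e2
  have e3 : ∫ x, ξ x • (P x - (β + ∫ t in x₀..x, Q t))
      = ∫ x in x₀..x₁, (P x * ξ x - (β + ∫ t in x₀..x, Q t) * ξ x) := by
    rw [integral_eq_intervalIntegral h01.le]
    · refine intervalIntegral.integral_congr fun x _ => ?_
      simp only [smul_eq_mul]; ring
    · intro x hx
      rw [eq_zero_of_notMem_tsupport h3 (fun h => hx (Ioo_subset_Ioc_self h)), zero_smul]
  have j1 : IntervalIntegrable (fun x => P x * ξ x) volume x₀ x₁ :=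
    iP.mul_continuousOn h1.continuous.continuousOn
  have j2 : IntervalIntegrable (fun x => (β + ∫ t in x₀..x, Q t) * ξ x) volume x₀ x₁ := by
    refine ContinuousOn.intervalIntegrable ?_
    rw [uIcc_of_le h01.le]
    exact hΓc.mul h1.continuous.continuousOn
  have j3 : IntervalIntegrable (fun x => Q x * ∫ t in x₁..x, ξ t) volume x₀ x₁ :=
    iQ.mul_continuousOn p1.continuous.continuousOn
  rw [intervalIntegral.integral_add j3 j2] at e2
  rw [intervalIntegral.integral_add j1 j3] at e
  rw [e3, intervalIntegral.integral_sub j1 j2]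
  linarith

end

section

/-! ### Linear systems with integrable coefficients -/

open BoundedContinuousFunction in
/-- The weighted Picard operator of a linear system is a contraction of the space of pairs of
bounded continuous functions when the weight is `exp (-2 ∫ N)`, where `N` bounds the
coefficients. -/
theorem exists_linear_system_of_locallyIntegrable {m₁₁ m₁₂ m₂₁ m₂₂ : ℝ → ℝ} (x₀ u₀ v₀ : ℝ)
    (i₁₁ : LocallyIntegrable m₁₁) (i₁₂ : LocallyIntegrable m₁₂) (i₂₁ : LocallyIntegrable m₂₁)
    (i₂₂ : LocallyIntegrable m₂₂)
    (hz : ∀ x < x₀, m₁₁ x = 0 ∧ m₁₂ x = 0 ∧ m₂₁ x = 0 ∧ m₂₂ x = 0) :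
    ∃ u v : ℝ → ℝ, Continuous u ∧ Continuous v ∧
      (∀ x, u x = u₀ + ∫ t in x₀..x, (m₁₁ t * u t + m₁₂ t * v t)) ∧
      ∀ x, v x = v₀ + ∫ t in x₀..x, (m₂₁ t * u t + m₂₂ t * v t) := by
  set N : ℝ → ℝ := fun x => |m₁₁ x| + |m₁₂ x| + |m₂₁ x| + |m₂₂ x| with hN
  have nrm : ∀ {f : ℝ → ℝ}, LocallyIntegrable f → LocallyIntegrable fun x => |f x| :=
    fun hf x => by
      obtain ⟨t, ht, h⟩ := hf x
      exact ⟨t, ht, h.norm⟩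
  have iN : LocallyIntegrable N := (((nrm i₁₁).add (nrm i₁₂)).add (nrm i₂₁)).add (nrm i₂₂)
  have hN0 : ∀ x, 0 ≤ N x := fun x => by positivity
  have hNz : ∀ x < x₀, N x = 0 := fun x hx => by
    obtain ⟨h1, h2, h3, h4⟩ := hz x hx; simp [hN, h1, h2, h3, h4]
  have ii : ∀ {f : ℝ → ℝ}, LocallyIntegrable f → ∀ a b, IntervalIntegrable f volume a b :=
    fun {f} hf a b => (hf.integrableOn_isCompact isCompact_uIcc).intervalIntegrable
  set E : ℝ → ℝ := fun x => Real.exp (2 * ∫ t in x₀..x, N t) with hE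
  have E0 : ∀ x, 0 < E x := fun x => Real.exp_pos _
  have Ec : Continuous E := Real.continuous_exp.comp
    (continuous_const.mul (intervalIntegral.continuous_primitive (fun a b => ii iN a b) x₀))
  have Eone : ∀ x, x ≤ x₀ → E x = 1 := fun x hx => by
    have : ∫ t in x₀..x, N t = ∫ t in x₀..x, (0 : ℝ) := by
      refine intervalIntegral.integral_congr_ae ?_
      have hne : ∀ᵐ t : ℝ, t ≠ x₀ := by simp [ae_iff, measure_singleton]
      filter_upwards [hne] with t ht hm
      rw [uIoc_of_ge hx] at hm
      exact hNz t (lt_of_le_of_ne hm.2 ht)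
    simp [hE, this]
  have hEint : ∀ x, x₀ ≤ x → ∫ t in x₀..x, E t * N t = (E x - 1) / 2 := fun x hx => by
    have h1 := ((HasACDeriv.of_integral (c := x₀) (ii iN x₀ x) left_mem_uIcc).const_mul 2).exp
    have h2 := h1.integral_eq
    simp only [intervalIntegral.integral_same, mul_zero, Real.exp_zero] at h2
    have h3 : ∫ t in x₀..x, E t * (2 * N t) = 2 * ∫ t in x₀..x, E t * N t := by
      rw [← intervalIntegral.integral_const_mul]; congr 1; ext t; ring
    change ∫ t in x₀..x, E t * (2 * N t) = E x - 1 at h2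
    linarith
  -- the basic estimate
  have est : ∀ (h : ℝ → ℝ) (K : ℝ), 0 ≤ K → (∀ t, |h t| ≤ N t * K) → ∀ x,
      |(E x)⁻¹ * ∫ t in x₀..x, E t * h t| ≤ K / 2 := by
    intro h K hK hh x
    rcases le_or_gt x₀ x with hx | hx
    · have h1 : |∫ t in x₀..x, E t * h t| ≤ ∫ t in x₀..x, (E t * N t) * K := by
        have h1i : IntervalIntegrable (fun t => (E t * N t) * K) volume x₀ x :=
          ((ii iN x₀ x).continuousOn_mul Ec.continuousOn).mul_const K
        rw [← Real.norm_eq_abs]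
        refine intervalIntegral.norm_integral_le_of_norm_le hx ?_ h1i
        refine Eventually.of_forall fun t _ => ?_
        rw [Real.norm_eq_abs, abs_mul, abs_of_pos (E0 t), mul_assoc]
        exact mul_le_mul_of_nonneg_left (hh t) (E0 t).le
      rw [intervalIntegral.integral_mul_const, hEint x hx] at h1
      rw [abs_mul, abs_of_pos (inv_pos.2 (E0 x)), inv_mul_le_iff₀ (E0 x)]
      refine h1.trans ?_
      nlinarith [E0 x]
    · have : ∫ t in x₀..x, E t * h t = 0 := by
        have : ∫ t in x₀..x, E t * h t = ∫ t in x₀..x, (0 : ℝ) := by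
          refine intervalIntegral.integral_congr_ae ?_
          have hne : ∀ᵐ t : ℝ, t ≠ x₀ := by simp [ae_iff, measure_singleton]
          filter_upwards [hne] with t ht hm
          rw [uIoc_of_ge hx.le] at hm
          have h1 := hh t
          rw [hNz t (lt_of_le_of_ne hm.2 ht), zero_mul] at h1
          rw [abs_nonpos_iff.1 h1, mul_zero]
        simpa using this
      rw [this, mul_zero, abs_zero]
      positivity
  have hEi : ∀ x, |(E x)⁻¹| ≤ 1 := fun x => by
    rw [abs_of_pos (inv_pos.2 (E0 x))]
    refine inv_le_one_of_one_le₀ ?_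
    rcases le_or_gt x₀ x with hx | hx
    · refine Real.one_le_exp (mul_nonneg zero_le_two ?_)
      exact intervalIntegral.integral_nonneg hx fun t _ => hN0 t
    · exact (Eone x hx.le).ge
  -- one component of the Picard operator
  have comp : ∀ (p q : ℝ → ℝ), LocallyIntegrable p → LocallyIntegrable q →
      (∀ t, |p t| + |q t| ≤ N t) → ∀ w₀ : ℝ, ∃ T : (ℝ →ᵇ ℝ) × (ℝ →ᵇ ℝ) → (ℝ →ᵇ ℝ),
      (∀ y x, T y x = (E x)⁻¹ * (w₀ + ∫ t in x₀..x, E t * (p t * y.1 t + q t * y.2 t))) ∧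
      ∀ y y', dist (T y) (T y') ≤ 1 / 2 * dist y y' := by
    intro p q ip iq hpq w₀
    have hb : ∀ y : (ℝ →ᵇ ℝ) × (ℝ →ᵇ ℝ), ∀ t, |p t * y.1 t + q t * y.2 t| ≤ N t * ‖y‖ := by
      intro y t
      have h1 : |y.1 t| ≤ ‖y‖ := (y.1.norm_coe_le_norm t).trans (norm_fst_le y)
      have h2 : |y.2 t| ≤ ‖y‖ := (y.2.norm_coe_le_norm t).trans (norm_snd_le y)
      calc |p t * y.1 t + q t * y.2 t| ≤ |p t| * |y.1 t| + |q t| * |y.2 t| := by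
            rw [← abs_mul, ← abs_mul]; exact abs_add_le _ _
        _ ≤ |p t| * ‖y‖ + |q t| * ‖y‖ := by gcongr
        _ ≤ N t * ‖y‖ := by rw [← add_mul]; gcongr; exact hpq t
    have hi : ∀ y : (ℝ →ᵇ ℝ) × (ℝ →ᵇ ℝ), ∀ a b,
        IntervalIntegrable (fun t => E t * (p t * y.1 t + q t * y.2 t)) volume a b := by
      intro y a b
      exact (((ii ip a b).mul_continuousOn y.1.continuous.continuousOn).add
        ((ii iq a b).mul_continuousOn y.2.continuous.continuousOn)).continuousOn_mul
          Ec.continuousOn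
    have hc : ∀ y : (ℝ →ᵇ ℝ) × (ℝ →ᵇ ℝ), Continuous fun x =>
        (E x)⁻¹ * (w₀ + ∫ t in x₀..x, E t * (p t * y.1 t + q t * y.2 t)) := fun y =>
      (Ec.inv₀ fun x => (E0 x).ne').mul
        (continuous_const.add (intervalIntegral.continuous_primitive (hi y) x₀))
    refine ⟨fun y => BoundedContinuousFunction.ofNormedAddCommGroup _ (hc y) (|w₀| + ‖y‖ / 2)
      fun x => ?_, fun y x => rfl, fun y y' => ?_⟩
    · rw [mul_add, Real.norm_eq_abs]
      refine (abs_add_le _ _).trans (add_le_add ?_ (est _ _ (norm_nonneg y) (hb y) x))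
      rw [abs_mul]
      exact mul_le_of_le_one_left (abs_nonneg _) (hEi x)
    · rw [BoundedContinuousFunction.dist_le (by positivity)]
      intro x
      rw [Real.dist_eq]
      change |(E x)⁻¹ * (w₀ + ∫ t in x₀..x, E t * (p t * y.1 t + q t * y.2 t))
        - (E x)⁻¹ * (w₀ + ∫ t in x₀..x, E t * (p t * y'.1 t + q t * y'.2 t))| ≤ _
      rw [← mul_sub, add_sub_add_left_eq_sub, ← intervalIntegral.integral_sub (hi y _ _)
        (hi y' _ _), dist_eq_norm]
      have := est (fun t => p t * (y - y').1 t + q t * (y - y').2 t) _ (norm_nonneg _)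
        (hb (y - y')) x
      rw [show 1 / 2 * ‖y - y'‖ = ‖y - y'‖ / 2 by ring]
      refine le_of_eq_of_le ?_ this
      congr 3
      ext t
      simp only [Prod.fst_sub, Prod.snd_sub, BoundedContinuousFunction.coe_sub, Pi.sub_apply]
      ring
  obtain ⟨T₁, h1, d1⟩ := comp m₁₁ m₁₂ i₁₁ i₁₂ (fun t => by
    simp only [hN]; linarith [abs_nonneg (m₂₁ t), abs_nonneg (m₂₂ t)]) u₀
  obtain ⟨T₂, h2, d2⟩ := comp m₂₁ m₂₂ i₂₁ i₂₂ (fun t => by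
    simp only [hN]; linarith [abs_nonneg (m₁₁ t), abs_nonneg (m₁₂ t)]) v₀
  have hT : ContractingWith (1 / 2) (fun y => (T₁ y, T₂ y)) := by
    refine ⟨by norm_num, LipschitzWith.of_dist_le_mul fun y y' => ?_⟩
    rw [Prod.dist_eq]
    have h := max_le (d1 y y') (d2 y y')
    simpa using h
  obtain ⟨y, hy⟩ : ∃ y, (T₁ y, T₂ y) = y := ⟨_, hT.fixedPoint_isFixedPt⟩
  have e1 : ∀ x, E x * y.1 x = u₀ + ∫ t in x₀..x, E t * (m₁₁ t * y.1 t + m₁₂ t * y.2 t) := by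
    intro x
    have := h1 y x
    rw [show T₁ y = y.1 from (Prod.ext_iff.1 hy).1] at this
    rw [this, mul_inv_cancel_left₀ (E0 x).ne']
  have e2 : ∀ x, E x * y.2 x = v₀ + ∫ t in x₀..x, E t * (m₂₁ t * y.1 t + m₂₂ t * y.2 t) := by
    intro x
    have := h2 y x
    rw [show T₂ y = y.2 from (Prod.ext_iff.1 hy).2] at this
    rw [this, mul_inv_cancel_left₀ (E0 x).ne']
  refine ⟨fun x => E x * y.1 x, fun x => E x * y.2 x, Ec.mul y.1.continuous,
    Ec.mul y.2.continuous, fun x => ?_, fun x => ?_⟩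
  · refine (e1 x).trans ?_
    congr 2; ext t; ring
  · refine (e2 x).trans ?_
    congr 2; ext t; ring

/-- A linear system on a half-line with locally integrable coefficients has a global solution: the
coefficients are set to zero to the left of the initial point. -/
theorem exists_linear_system {m₁₁ m₁₂ m₂₁ m₂₂ : ℝ → ℝ} (x₀ u₀ v₀ : ℝ)
    (i₁₁ : ∀ x, x₀ ≤ x → IntervalIntegrable m₁₁ volume x₀ x)
    (i₁₂ : ∀ x, x₀ ≤ x → IntervalIntegrable m₁₂ volume x₀ x)
    (i₂₁ : ∀ x, x₀ ≤ x → IntervalIntegrable m₂₁ volume x₀ x)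
    (i₂₂ : ∀ x, x₀ ≤ x → IntervalIntegrable m₂₂ volume x₀ x) :
    ∃ u v : ℝ → ℝ, Continuous u ∧ Continuous v ∧ u x₀ = u₀ ∧ v x₀ = v₀ ∧
      ∀ x, x₀ ≤ x → HasACDeriv u (fun t => m₁₁ t * u t + m₁₂ t * v t) x₀ x ∧
        HasACDeriv v (fun t => m₂₁ t * u t + m₂₂ t * v t) x₀ x := by
  have ind : ∀ {m : ℝ → ℝ}, (∀ x, x₀ ≤ x → IntervalIntegrable m volume x₀ x) →
      LocallyIntegrable ((Ici x₀).indicator m) := by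
    intro m hm
    rw [locallyIntegrable_iff]
    intro K hK
    rw [IntegrableOn, integrable_indicator_iff measurableSet_Ici, IntegrableOn,
      Measure.restrict_restrict measurableSet_Ici]
    obtain ⟨M, hM⟩ := hK.bddAbove
    have h1 := hm (max M x₀) (le_max_right _ _)
    rw [intervalIntegrable_iff_integrableOn_Icc_of_le (le_max_right _ _)] at h1
    exact h1.mono_set fun x hx => ⟨hx.1, (hM hx.2).trans (le_max_left _ _)⟩
  obtain ⟨u, v, uc, vc, hu, hv⟩ := exists_linear_system_of_locallyIntegrable x₀ u₀ v₀ (ind i₁₁)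
    (ind i₁₂) (ind i₂₁) (ind i₂₂) (fun x hx => by simp [hx])
  have ii : ∀ {m w : ℝ → ℝ}, (∀ x, x₀ ≤ x → IntervalIntegrable m volume x₀ x) → Continuous w → ∀ x, x₀ ≤ x →
      IntervalIntegrable (fun t => m t * w t) volume x₀ x := by
    intro m w hm hw x hx
    exact (hm x hx).mul_continuousOn hw.continuousOn
  have key : ∀ {p q w : ℝ → ℝ} {w₀ : ℝ}, (∀ x, x₀ ≤ x → IntervalIntegrable p volume x₀ x) →
      (∀ x, x₀ ≤ x → IntervalIntegrable q volume x₀ x) →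
      (∀ x, w x = w₀ + ∫ t in x₀..x, ((Ici x₀).indicator p t * u t
        + (Ici x₀).indicator q t * v t)) → ∀ x, x₀ ≤ x →
      HasACDeriv w (fun t => p t * u t + q t * v t) x₀ x := by
    intro p q w w₀ hp hq hw x hx
    refine HasACDeriv.of_eq_integral ((ii hp uc x hx).add (ii hq vc x hx)) fun y hy => ?_
    rw [uIcc_of_le hx] at hy
    rw [hw y, hw x₀, intervalIntegral.integral_same, add_zero]
    congr 1
    refine intervalIntegral.integral_congr fun t ht => ?_
    rw [uIcc_of_le hy.1] at ht
    simp only [indicator_of_mem (mem_Ici.2 ht.1)]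
  refine ⟨u, v, uc, vc, by simp [hu x₀], by simp [hv x₀], fun x hx =>
    ⟨key i₁₁ i₁₂ hu x hx, key i₂₁ i₂₂ hv x hx⟩⟩

end

section

/-! ### The constraint equations along one null hypersurface -/

/-- The first-order system satisfied by the derivatives `b' = p` and `c' = w - θ` when the Ricci
scalar is `e^{-ka} φ` and the Weyl scalar is the distribution `∂(e^{-ka} θ)`, where `α = a'`. -/
structure IsRiccati (k : ℝ) (α φ θ : ℝ → ℝ) (b c p w : ℝ → ℝ) (x₀ x : ℝ) : Prop where
  b_deriv : HasACDeriv b p x₀ x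
  c_deriv : HasACDeriv c (fun t => w t - θ t) x₀ x
  p_deriv : HasACDeriv p
    (fun t => 2 * α t * p t - φ t - p t ^ 2 - (w t - θ t) ^ 2) x₀ x
  w_deriv : HasACDeriv w
    (fun t => k * α t * θ t + 2 * (α t - p t) * (w t - θ t)) x₀ x

/-- The linear equation `A'' = 2 α A' - (φ + e^{ka} ∂(e^{-ka} θ)) A`, as a first-order system for
`A` and `z = A' + θ A`. -/
structure IsJacobi (k : ℝ) (α φ θ : ℝ → ℝ) (A z : ℝ → ℝ) (x₀ x : ℝ) : Prop where
  A_deriv : HasACDeriv A (fun t => z t - θ t * A t) x₀ x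
  z_deriv : HasACDeriv z (fun t => 2 * α t * (z t - θ t * A t) - φ t * A t
    + k * α t * θ t * A t + θ t * (z t - θ t * A t)) x₀ x

theorem IsRiccati.neg {k x₀ x : ℝ} {α φ θ b c p w : ℝ → ℝ}
    (h : IsRiccati k α φ θ b c p w x₀ x) :
    IsRiccati k α φ (fun t => - θ t) b (fun t => - c t) p (fun t => - w t) x₀ x where
  b_deriv := h.b_deriv
  c_deriv := h.c_deriv.neg.congr_deriv (Eventually.of_forall fun t _ => by ring)
  p_deriv := h.p_deriv.congr_deriv (Eventually.of_forall fun t _ => by ring)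
  w_deriv := h.w_deriv.neg.congr_deriv (Eventually.of_forall fun t _ => by ring)

/-- The Riccati system becomes linear in terms of `A = e^{b + c}`. -/
theorem IsRiccati.isJacobi {k x₀ x : ℝ} {α φ θ b c p w : ℝ → ℝ}
    (h : IsRiccati k α φ θ b c p w x₀ x) :
    IsJacobi k α φ θ (fun t => Real.exp (b t + c t))
      (fun t => Real.exp (b t + c t) * (p t + w t)) x₀ x where
  A_deriv := (h.b_deriv.add h.c_deriv).exp.congr_deriv (Eventually.of_forall fun t _ => by ring)
  z_deriv := ((h.b_deriv.add h.c_deriv).exp.mul (h.p_deriv.add h.w_deriv)).congr_deriv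
    (Eventually.of_forall fun t _ => by ring)

/-- Conversely, two positive Jacobi fields for opposite Weyl coefficients `θ`, `- θ` give a solution
of the Riccati system. -/
theorem IsJacobi.isRiccati {k x₀ x : ℝ} {α φ θ A z B y : ℝ → ℝ}
    (hA : IsJacobi k α φ θ A z x₀ x) (hB : IsJacobi k α φ (fun t => - θ t) B y x₀ x)
    (pA : ∀ t ∈ uIcc x₀ x, 0 < A t) (pB : ∀ t ∈ uIcc x₀ x, 0 < B t) :
    IsRiccati k α φ θ (fun t => (Real.log (A t) + Real.log (B t)) / 2)
      (fun t => (Real.log (A t) - Real.log (B t)) / 2)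
      (fun t => (z t / A t + y t / B t) / 2) (fun t => (z t / A t - y t / B t) / 2) x₀ x := by
  have lA := hA.A_deriv.log pA
  have lB := hB.A_deriv.log pB
  have dA := hA.z_deriv.div hA.A_deriv pA
  have dB := hB.z_deriv.div hB.A_deriv pB
  constructor
  · have := (lA.add lB).const_mul (1 / 2)
    refine (this.congr fun t _ => by ring).congr_deriv (Eventually.of_forall fun t ht => ?_)
    have h1 := (pA t ht).ne'; have h2 := (pB t ht).ne'
    field_simp; ring
  · have := (lA.sub lB).const_mul (1 / 2)
    refine (this.congr fun t _ => by ring).congr_deriv (Eventually.of_forall fun t ht => ?_)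
    have h1 := (pA t ht).ne'; have h2 := (pB t ht).ne'
    field_simp; ring
  · have := (dA.add dB).const_mul (1 / 2)
    refine (this.congr fun t _ => by ring).congr_deriv (Eventually.of_forall fun t ht => ?_)
    have h1 := (pA t ht).ne'; have h2 := (pB t ht).ne'
    field_simp; ring
  · have := (dA.sub dB).const_mul (1 / 2)
    refine (this.congr fun t _ => by ring).congr_deriv (Eventually.of_forall fun t ht => ?_)
    have h1 := (pA t ht).ne'; have h2 := (pB t ht).ne'
    field_simp; ring

theorem IsJacobi.mono {k x₀ x x' : ℝ} {α φ θ A z : ℝ → ℝ} (h : IsJacobi k α φ θ A z x₀ x)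
    (h0 : x₀ ≤ x') (h1 : x' ≤ x) : IsJacobi k α φ θ A z x₀ x' :=
  have hs : uIcc x₀ x' ⊆ uIcc x₀ x := by
    rw [uIcc_of_le h0, uIcc_of_le (h0.trans h1)]; exact Icc_subset_Icc_right h1
  ⟨h.A_deriv.mono hs, h.z_deriv.mono hs⟩

/-- The Wronskian of two Jacobi fields. -/
theorem IsJacobi.wronskian {k x₀ x : ℝ} {α φ₁ φ₂ θ A₁ z₁ A₂ z₂ : ℝ → ℝ}
    (h₁ : IsJacobi k α φ₁ θ A₁ z₁ x₀ x) (h₂ : IsJacobi k α φ₂ θ A₂ z₂ x₀ x) :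
    HasACDeriv (fun t => z₂ t * A₁ t - z₁ t * A₂ t)
      (fun t => 2 * α t * (z₂ t * A₁ t - z₁ t * A₂ t) - (φ₂ t - φ₁ t) * (A₁ t * A₂ t)) x₀ x :=
  ((h₂.z_deriv.mul h₁.A_deriv).sub (h₁.z_deriv.mul h₂.A_deriv)).congr_deriv
    (Eventually.of_forall fun t _ => by ring)

/-- Two Jacobi fields with the same initial values agree as long as one of them is positive. -/
theorem IsJacobi.unique {k x₀ x : ℝ} {α φ θ A₁ z₁ A₂ z₂ : ℝ → ℝ} (hx : x₀ ≤ x)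
    (h₁ : IsJacobi k α φ θ A₁ z₁ x₀ x) (h₂ : IsJacobi k α φ θ A₂ z₂ x₀ x)
    (hα : IntervalIntegrable α volume x₀ x) (p₁ : ∀ t ∈ Icc x₀ x, 0 < A₁ t)
    (hA : A₁ x₀ = A₂ x₀) (hz : z₁ x₀ = z₂ x₀) : A₁ x = A₂ x := by
  have hW : ∀ t ∈ Icc x₀ x, z₂ t * A₁ t - z₁ t * A₂ t = 0 := by
    intro t ht
    have key := HasACDeriv.zero_of_linear (m := fun t => 2 * α t)
      ((h₁.mono ht.1 ht.2).wronskian (h₂.mono ht.1 ht.2)) ht.1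
    refine key ?_ (by rw [hA, hz]; ring) (Eventually.of_forall fun s _ => by ring)
    refine (hα.const_mul 2).mono_set ?_
    rw [uIcc_of_le ht.1, uIcc_of_le hx]; exact Icc_subset_Icc_right ht.2
  have hd := h₂.A_deriv.div h₁.A_deriv (by rwa [uIcc_of_le hx])
  have := hd.eq_of_deriv_zero (Eventually.of_forall fun t ht => by
    rw [uIcc_of_le hx] at ht
    rw [div_eq_zero_iff]; left
    have := hW t ht
    linear_combination this)
  have h1 := (p₁ x ⟨hx, le_rfl⟩).ne'
  have h2 := (p₁ x₀ ⟨le_rfl, hx⟩).ne'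
  rw [← hA, div_self h2, div_eq_one_iff_eq h1] at this
  exact this.symm

/-- Comparison of Jacobi fields, as long as the larger one is positive. -/
theorem IsJacobi.le_of_pos {k x₀ x : ℝ} {α φ₁ φ₂ θ A₁ z₁ A₂ z₂ : ℝ → ℝ} (hx : x₀ ≤ x)
    (h₁ : IsJacobi k α φ₁ θ A₁ z₁ x₀ x) (h₂ : IsJacobi k α φ₂ θ A₂ z₂ x₀ x)
    (hα : IntervalIntegrable α volume x₀ x) (p₁ : ∀ t ∈ Icc x₀ x, 0 < A₁ t)
    (p₂ : ∀ t ∈ Icc x₀ x, 0 < A₂ t) (hφ : ∀ᵐ t : ℝ, t ∈ Icc x₀ x → φ₁ t ≤ φ₂ t)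
    (hA : A₁ x₀ = A₂ x₀) (hz : z₂ x₀ ≤ z₁ x₀) : A₂ x ≤ A₁ x := by
  have hW : ∀ t ∈ Icc x₀ x, z₂ t * A₁ t - z₁ t * A₂ t ≤ 0 := by
    intro t ht
    have key := HasACDeriv.nonpos_of_linear (m := fun t => 2 * α t)
      (n := fun t => (φ₂ t - φ₁ t) * (A₁ t * A₂ t))
      ((h₁.mono ht.1 ht.2).wronskian (h₂.mono ht.1 ht.2)) ht.1
    refine key ?_ ?_ (Eventually.of_forall fun s _ => by ring) ?_
    · refine (hα.const_mul 2).mono_set ?_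
      rw [uIcc_of_le ht.1, uIcc_of_le hx]; exact Icc_subset_Icc_right ht.2
    · rw [hA, ← sub_mul]
      exact mul_nonpos_of_nonpos_of_nonneg (sub_nonpos.2 hz) (p₂ x₀ ⟨le_rfl, hx⟩).le
    · filter_upwards [hφ] with s hs hm
      have hm' : s ∈ Icc x₀ x := ⟨hm.1, hm.2.trans ht.2⟩
      exact mul_nonneg (sub_nonneg.2 (hs hm')) (mul_pos (p₁ s hm') (p₂ s hm')).le
  have hd := h₂.A_deriv.div h₁.A_deriv (by rwa [uIcc_of_le hx])
  have := hd.antitone_of_nonpos hx (Eventually.of_forall fun t ht =>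
    div_nonpos_of_nonpos_of_nonneg (by linarith [hW t ht]) (sq_nonneg _))
  rw [← hA, div_self (p₁ x₀ ⟨le_rfl, hx⟩).ne', div_le_one (p₁ x ⟨hx, le_rfl⟩)] at this
  exact this

/-- Comparison of Jacobi fields: raising the curvature and lowering the initial slope makes the
field smaller, so that it vanishes earlier. -/
theorem IsJacobi.comparison {k x₀ x : ℝ} {α φ₁ φ₂ θ A₁ z₁ A₂ z₂ : ℝ → ℝ} (hx : x₀ ≤ x)
    (h₁ : IsJacobi k α φ₁ θ A₁ z₁ x₀ x) (h₂ : IsJacobi k α φ₂ θ A₂ z₂ x₀ x)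
    (hα : IntervalIntegrable α volume x₀ x)
    (p₂ : ∀ t ∈ Icc x₀ x, 0 < A₂ t) (hφ : ∀ᵐ t : ℝ, t ∈ Icc x₀ x → φ₁ t ≤ φ₂ t)
    (hA : A₁ x₀ = A₂ x₀) (hz : z₂ x₀ ≤ z₁ x₀) :
    ∀ t ∈ Icc x₀ x, A₂ t ≤ A₁ t := by
  have sub : ∀ t ∈ Icc x₀ x, (∀ s ∈ Icc x₀ t, 0 < A₁ s) → A₂ t ≤ A₁ t := by
    intro t ht hp
    refine (h₁.mono ht.1 ht.2).le_of_pos ht.1 (h₂.mono ht.1 ht.2) ?_ hp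
      (fun s hs => p₂ s ⟨hs.1, hs.2.trans ht.2⟩) ?_ hA hz
    · refine hα.mono_set ?_
      rw [uIcc_of_le ht.1, uIcc_of_le hx]; exact Icc_subset_Icc_right ht.2
    · filter_upwards [hφ] with s hs hm using hs ⟨hm.1, hm.2.trans ht.2⟩
  have hc₁ := h₁.A_deriv.continuousOn
  have hc₂ := h₂.A_deriv.continuousOn
  rw [uIcc_of_le hx] at hc₁ hc₂
  suffices hpos : ∀ t ∈ Icc x₀ x, 0 < A₁ t from
    fun t ht => sub t ht fun s hs => hpos s ⟨hs.1, hs.2.trans ht.2⟩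
  by_contra hcon
  push Not at hcon
  -- the first point at which the larger field fails to be positive
  obtain ⟨t₁, ht₁, hn⟩ := hcon
  set Z : Set ℝ := Icc x₀ x ∩ A₁ ⁻¹' Iic 0 with hZ
  have hZc : IsCompact Z :=
    isCompact_Icc.of_isClosed_subset (hc₁.preimage_isClosed_of_isClosed isClosed_Icc isClosed_Iic)
      inter_subset_left
  obtain ⟨τ, hτ, hmin⟩ := hZc.exists_isLeast ⟨t₁, ht₁, hn⟩
  have h0 : 0 < A₁ x₀ := hA ▸ p₂ x₀ ⟨le_rfl, hx⟩
  have hlt : x₀ < τ := lt_of_le_of_ne hτ.1.1 fun h => absurd hτ.2 (by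
    rw [← h]; simpa using h0)
  have hle : ∀ t ∈ Ico x₀ τ, A₂ t ≤ A₁ t := by
    intro t ht
    refine sub t ⟨ht.1, ht.2.le.trans hτ.1.2⟩ fun s hs => ?_
    by_contra hs'
    exact absurd (hmin ⟨⟨hs.1, (hs.2.trans ht.2.le).trans hτ.1.2⟩, not_lt.1 hs'⟩)
      (not_le.2 (hs.2.trans_lt ht.2))
  have hτl : A₂ τ ≤ A₁ τ := by
    have hcl : τ ∈ closure (Ico x₀ τ) := by rw [closure_Ico hlt.ne]; exact ⟨hlt.le, le_rfl⟩
    have hsub : Icc x₀ τ ⊆ Icc x₀ x := Icc_subset_Icc_right hτ.1.2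
    refine ContinuousWithinAt.closure_le hcl
      ((hc₂ τ hτ.1).mono (Ico_subset_Icc_self.trans hsub))
      ((hc₁ τ hτ.1).mono (Ico_subset_Icc_self.trans hsub)) hle
  have := p₂ τ hτ.1
  have h2 : A₁ τ ≤ 0 := hτ.2
  linarith

end

section

/-! ### Newman–Penrose data in the sense of distributions -/

namespace NullData

/-- The Ricci scalar rescaled to the parameter with respect to which `a' = α`. -/
def ricciCoeff (D : NullData) (k : ℝ) (t : ℝ) : ℝ := Real.exp (k * D.a t) * D.Φ t

/-- The rescaled potential of the Weyl scalar. -/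
def weylCoeff (D : NullData) (k : ℝ) (t : ℝ) : ℝ := Real.exp (k * D.a t) * D.Ψ₁ t

namespace IsWeaklyRegular

variable {D : NullData} {x₀ x : ℝ}

theorem a_deriv (h : D.IsWeaklyRegular x₀) (hx : x₀ ≤ x) :
    HasACDeriv D.a (deriv D.a) x₀ x := .of_ac (h.a_ac x hx)

theorem a_cont (h : D.IsWeaklyRegular x₀) (hx : x₀ ≤ x) : ContinuousOn D.a (uIcc x₀ x) :=
  (h.a_ac x hx).continuousOn

theorem integrable_of_weighted (h : D.IsWeaklyRegular x₀) (hx : x₀ ≤ x) {g : ℝ → ℝ}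
    (hg : IntegrableOn (fun t => g t * Real.exp (D.a t)) (Ici x₀)) (k : ℝ) :
    IntervalIntegrable (fun t => Real.exp (k * D.a t) * g t) volume x₀ x := by
  have h1 : IntervalIntegrable (fun t => g t * Real.exp (D.a t)) volume x₀ x := by
    rw [intervalIntegrable_iff_integrableOn_Icc_of_le hx]
    exact hg.mono_set Icc_subset_Ici_self
  have h2 : ContinuousOn (fun t => Real.exp ((k - 1) * D.a t)) (uIcc x₀ x) :=
    Real.continuous_exp.comp_continuousOn (continuousOn_const.mul (h.a_cont hx))
  refine (h1.continuousOn_mul h2).congr fun t _ => ?_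
  have : Real.exp (k * D.a t) = Real.exp ((k - 1) * D.a t) * Real.exp (D.a t) := by
    rw [← Real.exp_add]; ring_nf
  simp only [this]; ring

theorem ricciCoeff_int (h : D.IsWeaklyRegular x₀) (hx : x₀ ≤ x) (k : ℝ) :
    IntervalIntegrable (D.ricciCoeff k) volume x₀ x := h.integrable_of_weighted hx h.Φ_int k

theorem weylCoeff_sq_int (h : D.IsWeaklyRegular x₀) (hx : x₀ ≤ x) (k : ℝ) :
    IntervalIntegrable (fun t => D.weylCoeff k t ^ 2) volume x₀ x := by
  refine (h.integrable_of_weighted hx h.Ψ_int (2 * k)).congr fun t _ => ?_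
  have : Real.exp (2 * k * D.a t) = Real.exp (k * D.a t) ^ 2 := by
    rw [← Real.exp_nat_mul]; push_cast; ring_nf
  simp only [weylCoeff, this]; ring

theorem weylCoeff_int (h : D.IsWeaklyRegular x₀) (hx : x₀ ≤ x) (k : ℝ) :
    IntervalIntegrable (D.weylCoeff k) volume x₀ x := by
  have h1 := (h.weylCoeff_sq_int hx k).add (intervalIntegrable_const (c := (1 : ℝ)))
  rw [intervalIntegrable_iff_integrableOn_Icc_of_le hx] at h1 ⊢
  refine Integrable.mono' h1 ?_ (Eventually.of_forall fun t => ?_)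
  · refine AEStronglyMeasurable.mul ?_ (h.Ψ_meas.mono_measure
      (Measure.restrict_mono Icc_subset_Ici_self le_rfl))
    have := Real.continuous_exp.comp_continuousOn ((continuousOn_const (c := k)).mul (h.a_cont hx))
    rw [uIcc_of_le hx] at this
    exact this.aestronglyMeasurable measurableSet_Icc
  · rw [Real.norm_eq_abs, abs_le]
    constructor <;> nlinarith [sq_nonneg (D.weylCoeff k t - 1), sq_nonneg (D.weylCoeff k t + 1)]

theorem deriv_mul_weylCoeff_int (h : D.IsWeaklyRegular x₀) (hx : x₀ ≤ x) (k : ℝ) :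
    IntervalIntegrable (fun t => deriv D.a t * D.weylCoeff k t) volume x₀ x := by
  have h1 : IntervalIntegrable (fun t => deriv D.a t * D.Ψ₁ t) volume x₀ x := by
    rw [intervalIntegrable_iff_integrableOn_Icc_of_le hx]
    exact h.product_int.integrableOn_compact_subset Icc_subset_Ici_self isCompact_Icc
  have h2 : ContinuousOn (fun t => Real.exp (k * D.a t)) (uIcc x₀ x) :=
    Real.continuous_exp.comp_continuousOn (continuousOn_const.mul (h.a_cont hx))
  refine (h1.continuousOn_mul h2).congr fun t _ => ?_
  simp only [weylCoeff]; ring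

end IsWeaklyRegular

end NullData

theorem integral_Ici_eq_intervalIntegral {F : ℝ → ℝ} {x₀ x₁ : ℝ} (hx : x₀ ≤ x₁)
    (h : ∀ x, x₁ < x → F x = 0) : ∫ x in Ici x₀, F x = ∫ x in x₀..x₁, F x := by
  rw [intervalIntegral.integral_of_le hx, integral_Ici_eq_integral_Ioi,
    setIntegral_eq_of_subset_of_forall_sdiff_eq_zero measurableSet_Ioi
      (Ioc_subset_Ioi_self : Ioc x₀ x₁ ⊆ Ioi x₀)]
  intro x hx
  exact h x (by by_contra hn; exact hx.2 ⟨hx.1, not_lt.1 hn⟩)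

theorem ContDiff.hasACDeriv {φ : ℝ → ℝ} (h : ContDiff ℝ ∞ φ) (a b : ℝ) :
    HasACDeriv φ (deriv φ) a b :=
  .of_hasDerivAt (fun t _ => (h.differentiable (by simp) t).hasDerivAt)
    (h.continuous_deriv (by simp)).continuousOn

/-- Prescribed scalars in the sense of distributions amount to the Riccati system. The test
functions need not vanish at `x₀`, so the initial values `β`, `γ` of the slopes are part of the
conclusion. -/
theorem HasNPData.exists_isRiccati {k x₀ x₁ β γ : ℝ} {I : Set ℝ} {D : NullData} {b c : ℝ → ℝ}
    (hD : D.IsWeaklyRegular x₀) (h : HasNPData k x₀ I D b c β γ) (h01 : x₀ < x₁)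
    (hI : Icc x₀ x₁ ⊆ I) :
    ∃ p w : ℝ → ℝ, IsRiccati k (deriv D.a) (D.ricciCoeff k) (D.weylCoeff k) b c p w x₀ x₁ ∧
      p x₀ = β ∧ w x₀ = γ := by
  have hx := h01.le
  have m1 : x₁ ∈ I := hI ⟨hx, le_rfl⟩
  have hb := HasACDeriv.of_ac (h.b_ac x₁ m1)
  have hc := HasACDeriv.of_ac (h.c_ac x₁ m1)
  have ha := hD.a_deriv hx
  have hE : HasACDeriv (fun t => Real.exp (k * D.a t))
      (fun t => Real.exp (k * D.a t) * (k * deriv D.a t)) x₀ x₁ := (ha.const_mul k).exp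
  have hE' : ContinuousOn (fun t => Real.exp (-k * D.a t)) (uIcc x₀ x₁) :=
    Real.continuous_exp.comp_continuousOn (continuousOn_const.mul ha.continuousOn)
  -- integrability of the products of first derivatives
  obtain ⟨C, hC⟩ := h.db_bound x₁ m1
  have bmul : ∀ g : ℝ → ℝ, IntervalIntegrable g volume x₀ x₁ →
      IntervalIntegrable (fun t => g t * deriv b t) volume x₀ x₁ := by
    intro g hg
    rw [intervalIntegrable_iff_integrableOn_Icc_of_le hx] at hg ⊢
    refine Integrable.mul_bdd (c := C) hg (measurable_deriv b).aestronglyMeasurable ?_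
    filter_upwards [hC] with t ht using ht
  have i_c2 : IntervalIntegrable (fun t => deriv c t ^ 2) volume x₀ x₁ := by
    rw [intervalIntegrable_iff_integrableOn_Icc_of_le hx]; exact h.dc_sq x₁ m1
  have i_ac : IntervalIntegrable (fun t => deriv D.a t * deriv c t) volume x₀ x₁ := by
    rw [intervalIntegrable_iff_integrableOn_Icc_of_le hx]; exact h.product x₁ m1
  have i_ab := bmul _ ha.intervalIntegrable
  have i_b2 := bmul _ hb.intervalIntegrable
  have i_cb := bmul _ hc.intervalIntegrable
  have i_Φ : IntervalIntegrable D.Φ volume x₀ x₁ := by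
    refine (hD.ricciCoeff_int hx 0).congr fun t _ => ?_
    simp [NullData.ricciCoeff]
  have i_Ψ : IntervalIntegrable D.Ψ₁ volume x₀ x₁ := by
    refine (hD.weylCoeff_int hx 0).congr fun t _ => ?_
    simp [NullData.weylCoeff]
  -- in the sense of distributions, `Q` and `R` are the derivatives of `exp (- k a) b'` and of
  -- `exp (- k a) c' + Ψ₁`
  set Q : ℝ → ℝ := fun t => Real.exp (-k * D.a t) * (-k * (deriv D.a t * deriv b t)
    + (2 * (deriv D.a t * deriv b t) - deriv b t * deriv b t - deriv c t ^ 2)) - D.Φ t with hQ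
  set R : ℝ → ℝ := fun t => Real.exp (-k * D.a t) * (-k * (deriv D.a t * deriv c t)
    + 2 * (deriv D.a t * deriv c t - deriv c t * deriv b t)) with hR
  have iQ : IntervalIntegrable Q volume x₀ x₁ :=
    (IntervalIntegrable.continuousOn_mul ((i_ab.const_mul (-k)).add
      (((i_ab.const_mul 2).sub i_b2).sub i_c2)) hE').sub i_Φ
  have iR : IntervalIntegrable R volume x₀ x₁ :=
    IntervalIntegrable.continuousOn_mul ((i_ac.const_mul (-k)).add
      ((i_ac.sub i_cb).const_mul 2)) hE'
  have iEb : IntervalIntegrable (fun t => Real.exp (-k * D.a t) * deriv b t) volume x₀ x₁ :=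
    hb.intervalIntegrable.continuousOn_mul hE'
  have iW : IntervalIntegrable (fun t => Real.exp (-k * D.a t) * deriv c t + D.Ψ₁ t) volume x₀ x₁ :=
    (hc.intervalIntegrable.continuousOn_mul hE').add i_Ψ
  have test : ∀ φ, IsTestOn x₀ (Ico x₀ x₁) φ → IsTestOn x₀ I φ ∧ (∀ x, x₁ < x → φ x = 0) ∧
      (∀ x, x₁ < x → deriv φ x = 0) := by
    intro φ hφ
    have z : ∀ x, x₁ < x → x ∉ tsupport φ := fun x hx' hm =>
      absurd (hφ.supp ⟨hm, (h01.trans hx').le⟩).2 (not_lt.2 hx'.le)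
    exact ⟨⟨hφ.smooth, hφ.compact, hφ.supp.trans (Ico_subset_Icc_self.trans hI)⟩,
      fun x hx' => image_eq_zero_of_notMem_tsupport (z x hx'),
      fun x hx' => image_eq_zero_of_notMem_tsupport fun hm => z x hx' (tsupport_deriv_subset hm)⟩
  have e1 : ∀ᵐ t : ℝ, t ∈ Ioo x₀ x₁ →
      Real.exp (-k * D.a t) * deriv b t = β + ∫ s in x₀..t, Q s := by
    refine ae_eq_integral_of_weak_half h01 ((intervalIntegrable_iff_integrableOn_Icc_of_le hx).1 iEb)
      ((intervalIntegrable_iff_integrableOn_Icc_of_le hx).1 iQ) fun φ hφ => ?_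
    obtain ⟨t1, t2, t3⟩ := test φ hφ
    have e := h.ricci φ t1
    have hφc : ContinuousOn φ (uIcc x₀ x₁) := hφ.smooth.continuous.continuousOn
    have hφd : ContinuousOn (deriv φ) (uIcc x₀ x₁) :=
      (hφ.smooth.continuous_deriv (by simp)).continuousOn
    rw [integral_Ici_eq_intervalIntegral hx (fun x hx' => by rw [t2 x hx', t3 x hx']; ring),
      integral_Ici_eq_intervalIntegral hx (fun x hx' => by rw [t2 x hx']; ring)] at e
    rw [integral_Ici_eq_intervalIntegral hx (fun x hx' => by rw [t2 x hx', t3 x hx']; ring)]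
    have i1 := (iEb.mul_continuousOn hφd).add (iQ.mul_continuousOn hφc)
    have i2 := i_Φ.mul_continuousOn hφc
    have e3 := intervalIntegral.integral_add i1 i2
    have e4 : ∀ t, Real.exp (-k * D.a t) * deriv b t * deriv φ t + Q t * φ t + D.Φ t * φ t
        = Real.exp (-k * D.a t) * (deriv b t * deriv φ t - k * deriv D.a t * deriv b t * φ t
          + (2 * deriv D.a t * deriv b t - deriv b t ^ 2 - deriv c t ^ 2) * φ t) := by
      intro t; simp only [hQ]; ring
    simp only [e4] at e3
    linarith
  -- only `exp (- k a) c' + Ψ₁` is absolutely continuous, not `c'` by itself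
  have e2 : ∀ᵐ t : ℝ, t ∈ Ioo x₀ x₁ →
      Real.exp (-k * D.a t) * deriv c t + D.Ψ₁ t = γ + ∫ s in x₀..t, R s := by
    refine ae_eq_integral_of_weak_half h01 ((intervalIntegrable_iff_integrableOn_Icc_of_le hx).1 iW)
      ((intervalIntegrable_iff_integrableOn_Icc_of_le hx).1 iR) fun φ hφ => ?_
    obtain ⟨t1, t2, t3⟩ := test φ hφ
    have e := h.weyl φ t1
    have hφc : ContinuousOn φ (uIcc x₀ x₁) := hφ.smooth.continuous.continuousOn
    have hφd : ContinuousOn (deriv φ) (uIcc x₀ x₁) :=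
      (hφ.smooth.continuous_deriv (by simp)).continuousOn
    rw [integral_Ici_eq_intervalIntegral hx (fun x hx' => by rw [t2 x hx', t3 x hx']; ring),
      integral_Ici_eq_intervalIntegral hx (fun x hx' => by rw [t3 x hx']; ring)] at e
    rw [integral_Ici_eq_intervalIntegral hx (fun x hx' => by rw [t2 x hx', t3 x hx']; ring)]
    have i1 := (iW.mul_continuousOn hφd).add (iR.mul_continuousOn hφc)
    have i2 := i_Ψ.mul_continuousOn hφd
    have e3 := intervalIntegral.integral_sub i1 i2
    have e4 : ∀ t, (Real.exp (-k * D.a t) * deriv c t + D.Ψ₁ t) * deriv φ t + R t * φ t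
        - D.Ψ₁ t * deriv φ t
        = Real.exp (-k * D.a t) * (deriv c t * deriv φ t - k * deriv D.a t * deriv c t * φ t
          + 2 * (deriv D.a t - deriv b t) * deriv c t * φ t) := by
      intro t; simp only [hR]; ring
    simp only [e4] at e3
    linarith
  have hP : HasACDeriv (fun x => β + ∫ t in x₀..x, Q t) (fun t => 0 + Q t) x₀ x₁ :=
    (HasACDeriv.const β).add (HasACDeriv.of_integral iQ left_mem_uIcc)
  have hW : HasACDeriv (fun x => γ + ∫ t in x₀..x, R t) (fun t => 0 + R t) x₀ x₁ :=
    (HasACDeriv.const γ).add (HasACDeriv.of_integral iR left_mem_uIcc)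
  have n0 : ∀ᵐ t : ℝ, t ≠ x₀ := by simp [ae_iff, measure_singleton]
  have n1 : ∀ᵐ t : ℝ, t ≠ x₁ := by simp [ae_iff, measure_singleton]
  -- the continuous representatives of the slopes
  have ep : ∀ᵐ t : ℝ, t ∈ uIcc x₀ x₁ →
      deriv b t = Real.exp (k * D.a t) * (β + ∫ s in x₀..t, Q s) := by
    filter_upwards [e1, n0, n1] with t ht h0 h1 hm
    rw [uIcc_of_le hx] at hm
    rw [← ht ⟨lt_of_le_of_ne hm.1 h0.symm, lt_of_le_of_ne hm.2 h1⟩, ← mul_assoc, ← Real.exp_add]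
    simp
  have ew : ∀ᵐ t : ℝ, t ∈ uIcc x₀ x₁ →
      deriv c t = Real.exp (k * D.a t) * (γ + ∫ s in x₀..t, R s) - D.weylCoeff k t := by
    filter_upwards [e2, n0, n1] with t ht h0 h1 hm
    rw [uIcc_of_le hx] at hm
    rw [← ht ⟨lt_of_le_of_ne hm.1 h0.symm, lt_of_le_of_ne hm.2 h1⟩, NullData.weylCoeff, mul_add,
      ← mul_assoc, ← Real.exp_add]
    simp
  refine ⟨fun t => Real.exp (k * D.a t) * (β + ∫ s in x₀..t, Q s),
    fun t => Real.exp (k * D.a t) * (γ + ∫ s in x₀..t, R s),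
    ⟨hb.congr_deriv ep, hc.congr_deriv ew, ?_, ?_⟩, by simp [hD.a_zero], by simp [hD.a_zero]⟩
  · refine (hE.mul hP).congr_deriv ?_
    filter_upwards [ep, ew] with t h1 h2 hm
    rw [← h2 hm, ← h1 hm, zero_add]
    have hX : Real.exp (k * D.a t) * Q t = -k * (deriv D.a t * deriv b t)
        + (2 * (deriv D.a t * deriv b t) - deriv b t * deriv b t - deriv c t ^ 2)
        - D.ricciCoeff k t := by
      simp only [hQ, NullData.ricciCoeff]
      rw [mul_sub, ← mul_assoc, ← Real.exp_add]
      simp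
    rw [hX]
    have := h1 hm
    linear_combination (-k * deriv D.a t) * this
  · refine (hE.mul hW).congr_deriv ?_
    filter_upwards [ep, ew] with t h1 h2 hm
    rw [zero_add]
    have hX : Real.exp (k * D.a t) * R t = -k * (deriv D.a t * deriv c t)
        + 2 * (deriv D.a t * deriv c t - deriv c t * deriv b t) := by
      simp only [hR]
      rw [← mul_assoc, ← Real.exp_add]
      simp
    rw [hX, ← h2 hm, ← h1 hm]
    have := h2 hm
    linear_combination (-k * deriv D.a t) * this

/-- The converse: solutions of the Riccati system have the prescribed Ricci and Weyl scalars. -/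
theorem hasNPData_of_isRiccati {k x₀ β γ : ℝ} {I : Set ℝ} {D : NullData} {b c p w : ℝ → ℝ}
    (hD : D.IsWeaklyRegular x₀) (hI₀ : x₀ ∈ I) (hI : ∀ x ∈ I, x₀ ≤ x ∧ ∃ x' ∈ I, x < x')
    (h : ∀ x ∈ I, IsRiccati k (deriv D.a) (D.ricciCoeff k) (D.weylCoeff k) b c p w x₀ x)
    (hp : p x₀ = β) (hw : w x₀ = γ) : HasNPData k x₀ I D b c β γ := by
  have test : ∀ φ, IsTestOn x₀ I φ → ∃ x₁ ∈ I, (∀ x, x₁ ≤ x → φ x = 0) ∧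
      (∀ x, x₁ ≤ x → deriv φ x = 0) := by
    intro φ hφ
    have hK : IsCompact (tsupport φ ∩ Ici x₀) := IsCompact.inter_right hφ.compact isClosed_Ici
    obtain ⟨x₁, h1, h2⟩ : ∃ x₁ ∈ I, ∀ x, x₁ ≤ x → x ∉ tsupport φ := by
      rcases (tsupport φ ∩ Ici x₀).eq_empty_or_nonempty with he | hne
      · exact ⟨x₀, hI₀, fun x hx hm => he.le ⟨hm, hx⟩⟩
      · obtain ⟨M, hM, hM'⟩ := hK.exists_isGreatest hne
        obtain ⟨x', hx', hlt⟩ := (hI M (hφ.supp hM)).2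
        refine ⟨x', hx', fun x hx hm => ?_⟩
        exact absurd (hM' ⟨hm, (hI x' hx').1.trans hx⟩) (not_le.2 (hlt.trans_le hx))
    exact ⟨x₁, h1, fun x hx => image_eq_zero_of_notMem_tsupport (h2 x hx),
      fun x hx => image_eq_zero_of_notMem_tsupport fun hm => h2 x hx (tsupport_deriv_subset hm)⟩
  constructor
  · exact fun x hx => (h x hx).b_deriv.ac
  · exact fun x hx => (h x hx).c_deriv.ac
  · intro x hx
    have hx0 := (hI x hx).1
    obtain ⟨C, hC⟩ := (h x hx).p_deriv.ac.exists_bound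
    refine ⟨C, ?_⟩
    rw [ae_restrict_iff' measurableSet_Icc]
    filter_upwards [(h x hx).b_deriv.deriv_eq] with t ht hm
    rw [← uIcc_of_le hx0] at hm
    rw [ht hm]
    exact hC t hm
  · intro x hx
    have hx0 := (hI x hx).1
    have hw := (h x hx).w_deriv.continuousOn
    rw [← intervalIntegrable_iff_integrableOn_Icc_of_le hx0]
    have i1 : IntervalIntegrable (fun t => w t ^ 2) volume x₀ x := (hw.pow 2).intervalIntegrable
    have i2 := (hD.weylCoeff_int hx0 k).continuousOn_mul hw
    have i3 := (i1.sub (i2.const_mul 2)).add (hD.weylCoeff_sq_int hx0 k)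
    refine i3.congr_ae ?_
    rw [EventuallyEq, ae_restrict_iff' measurableSet_uIoc]
    filter_upwards [(h x hx).c_deriv.deriv_eq] with t ht hm
    rw [ht (uIoc_subset_uIcc hm)]
    ring
  · intro x hx
    have hx0 := (hI x hx).1
    have hw := (h x hx).w_deriv.continuousOn
    rw [← intervalIntegrable_iff_integrableOn_Icc_of_le hx0]
    refine (((hD.a_deriv hx0).intervalIntegrable.mul_continuousOn hw).sub
      (hD.deriv_mul_weylCoeff_int hx0 k)).congr_ae ?_
    rw [EventuallyEq, ae_restrict_iff' measurableSet_uIoc]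
    filter_upwards [(h x hx).c_deriv.deriv_eq] with t ht hm
    rw [ht (uIoc_subset_uIcc hm)]
    ring
  · intro φ hφ
    obtain ⟨x₁, hx₁, z1, z2⟩ := test φ hφ
    have hx := (hI x₁ hx₁).1
    rw [integral_Ici_eq_intervalIntegral hx (fun x hx' => by rw [z1 x hx'.le, z2 x hx'.le]; ring),
      integral_Ici_eq_intervalIntegral hx (fun x hx' => by rw [z1 x hx'.le]; ring)]
    have hR := h x₁ hx₁
    have hd := (((hD.a_deriv hx).const_mul (-k)).exp.mul hR.p_deriv).mul
      (ContDiff.hasACDeriv hφ.smooth x₀ x₁)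
    have e := hd.integral_eq
    have iΦ : IntervalIntegrable (fun t => D.Φ t * φ t) volume x₀ x₁ := by
      refine IntervalIntegrable.mul_continuousOn ?_ hφ.smooth.continuous.continuousOn
      refine (hD.ricciCoeff_int hx 0).congr fun t _ => ?_
      simp [NullData.ricciCoeff]
    have e2 := intervalIntegral.integral_add hd.intervalIntegrable iΦ
    rw [e, z1 x₁ le_rfl, hD.a_zero, hp] at e2
    simp only [mul_zero, Real.exp_zero, one_mul, zero_sub] at e2
    rw [show ∀ u v : ℝ, β * φ x₀ + u = v ↔ u = -(β * φ x₀) + v from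
      fun u v => by constructor <;> intro h <;> linarith, ← e2]
    refine intervalIntegral.integral_congr_ae ?_
    filter_upwards [hR.b_deriv.deriv_eq, hR.c_deriv.deriv_eq] with t h1 h2 hm
    rw [h1 (uIoc_subset_uIcc hm), h2 (uIoc_subset_uIcc hm)]
    have hX : Real.exp (-k * D.a t) * D.ricciCoeff k t = D.Φ t := by
      rw [NullData.ricciCoeff, ← mul_assoc, ← Real.exp_add]; simp
    linear_combination φ t * hX
  · intro φ hφ
    obtain ⟨x₁, hx₁, z1, z2⟩ := test φ hφ
    have hx := (hI x₁ hx₁).1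
    rw [integral_Ici_eq_intervalIntegral hx (fun x hx' => by rw [z1 x hx'.le, z2 x hx'.le]; ring),
      integral_Ici_eq_intervalIntegral hx (fun x hx' => by rw [z2 x hx'.le]; ring)]
    have hR := h x₁ hx₁
    have hd := (((hD.a_deriv hx).const_mul (-k)).exp.mul hR.w_deriv).mul
      (ContDiff.hasACDeriv hφ.smooth x₀ x₁)
    have e := hd.integral_eq
    have iΨ : IntervalIntegrable (fun t => D.Ψ₁ t * deriv φ t) volume x₀ x₁ := by
      refine IntervalIntegrable.mul_continuousOn ?_
        (hφ.smooth.continuous_deriv (by simp)).continuousOn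
      refine (hD.weylCoeff_int hx 0).congr fun t _ => ?_
      simp [NullData.weylCoeff]
    have e2 := intervalIntegral.integral_sub hd.intervalIntegrable iΨ
    rw [e, z1 x₁ le_rfl, hD.a_zero, hw] at e2
    simp only [mul_zero, Real.exp_zero, one_mul, zero_sub] at e2
    rw [show ∀ u v : ℝ, γ * φ x₀ + u = -v ↔ u = -(γ * φ x₀) - v from
      fun u v => by constructor <;> intro h <;> linarith, ← e2]
    refine intervalIntegral.integral_congr_ae ?_
    filter_upwards [hR.b_deriv.deriv_eq, hR.c_deriv.deriv_eq] with t h1 h2 hm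
    rw [h1 (uIoc_subset_uIcc hm), h2 (uIoc_subset_uIcc hm)]
    have hX : Real.exp (-k * D.a t) * D.weylCoeff k t = D.Ψ₁ t := by
      rw [NullData.weylCoeff, ← mul_assoc, ← Real.exp_add]; simp
    linear_combination (-deriv φ t) * hX

end

section

/-! ### Future domains -/

/-- The past of `p` within the quadrant with vertex `(U₀, V₀)`. -/
def past (U₀ V₀ : ℝ) (p : ℝ × ℝ) : Set (ℝ × ℝ) := Icc U₀ p.1 ×ˢ Icc V₀ p.2

theorem isCompact_past (p : ℝ × ℝ) : IsCompact (past U₀ V₀ p) := isCompact_Icc.prod isCompact_Icc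

theorem measurableSet_past (p : ℝ × ℝ) : MeasurableSet (past U₀ V₀ p) :=
  measurableSet_Icc.prod measurableSet_Icc

theorem mem_past {p q : ℝ × ℝ} :
    q ∈ past U₀ V₀ p ↔ (U₀ ≤ q.1 ∧ q.1 ≤ p.1) ∧ V₀ ≤ q.2 ∧ q.2 ≤ p.2 := Iff.rfl

theorem past_mono {p q : ℝ × ℝ} (h₁ : q.1 ≤ p.1) (h₂ : q.2 ≤ p.2) :
    past U₀ V₀ q ⊆ past U₀ V₀ p := prod_mono (Icc_subset_Icc_right h₁) (Icc_subset_Icc_right h₂)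

theorem past_swap (p : ℝ × ℝ) : Prod.swap ⁻¹' past U₀ V₀ p = past V₀ U₀ p.swap := by
  ext q
  exact and_comm

namespace IsFutureDomain

variable {p q : ℝ × ℝ}

theorem swap (h : IsFutureDomain U₀ V₀ S) : IsFutureDomain V₀ U₀ (Prod.swap ⁻¹' S) where
  mem := h.mem
  subset := fun p hp => ⟨(h.subset hp).2, (h.subset hp).1⟩
  past := fun p hp q hq => h.past p.swap hp ⟨hq.2, hq.1⟩
  relOpen := by
    obtain ⟨O, hO, rfl⟩ := h.relOpen
    refine ⟨Prod.swap ⁻¹' O, hO.preimage continuous_swap, ?_⟩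
    ext q; simp [and_comm]

theorem le_fst (h : IsFutureDomain U₀ V₀ S) (hp : p ∈ S) : U₀ ≤ p.1 := (h.subset hp).1

theorem le_snd (h : IsFutureDomain U₀ V₀ S) (hp : p ∈ S) : V₀ ≤ p.2 := (h.subset hp).2

theorem past_subset (h : IsFutureDomain U₀ V₀ S) (hp : p ∈ S) : PlaneSymmetric.past U₀ V₀ p ⊆ S :=
  h.past p hp

theorem self_mem_past (h : IsFutureDomain U₀ V₀ S) (hp : p ∈ S) :
    p ∈ PlaneSymmetric.past U₀ V₀ p := ⟨⟨h.le_fst hp, le_rfl⟩, ⟨h.le_snd hp, le_rfl⟩⟩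

theorem exists_gt (h : IsFutureDomain U₀ V₀ S) (hp : p ∈ S) :
    ∃ p' ∈ S, p.1 < p'.1 ∧ p.2 < p'.2 := by
  obtain ⟨O, hO, rfl⟩ := h.relOpen
  obtain ⟨ε, hε, hb⟩ := Metric.isOpen_iff.1 hO p hp.1
  refine ⟨(p.1 + ε / 2, p.2 + ε / 2), ⟨hb ?_, ?_⟩, by simp; linarith, by simp; linarith⟩
  · rw [Metric.mem_ball, Prod.dist_eq, Real.dist_eq, Real.dist_eq]
    simp only [add_sub_cancel_left, max_self, abs_of_pos (half_pos hε)]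
    linarith
  · have h1 := hp.2.1; have h2 := hp.2.2
    simp only [mem_Ici] at h1 h2
    constructor
    · simp only [mem_Ici]; linarith
    · simp only [mem_Ici]; linarith

theorem past_mem_nhdsWithin (h : IsFutureDomain U₀ V₀ S) (h₁ : p.1 < q.1) (h₂ : p.2 < q.2) :
    PlaneSymmetric.past U₀ V₀ q ∈ 𝓝[S] p := by
  have : Iio q.1 ×ˢ Iio q.2 ∈ 𝓝 p := (isOpen_Iio.prod isOpen_Iio).mem_nhds ⟨h₁, h₂⟩
  filter_upwards [mem_nhdsWithin_of_mem_nhds this, self_mem_nhdsWithin] with r hr hS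
  exact ⟨⟨h.le_fst hS, hr.1.le⟩, ⟨h.le_snd hS, hr.2.le⟩⟩

theorem mem_fst (h : IsFutureDomain U₀ V₀ S) (hp : p ∈ S) : (p.1, V₀) ∈ S :=
  h.past p hp ⟨⟨(h.subset hp).1, le_rfl⟩, ⟨le_rfl, (h.subset hp).2⟩⟩

theorem mem_snd (h : IsFutureDomain U₀ V₀ S) (hp : p ∈ S) : (U₀, p.2) ∈ S :=
  h.past p hp ⟨⟨le_rfl, (h.subset hp).1⟩, ⟨(h.subset hp).2, le_rfl⟩⟩

theorem interior_eq (h : IsFutureDomain U₀ V₀ S) : interior S = S ∩ (Ioi U₀ ×ˢ Ioi V₀) := by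
  apply Subset.antisymm
  · refine subset_inter interior_subset ?_
    have := interior_mono h.subset
    rwa [interior_prod_eq, interior_Ici, interior_Ici] at this
  · obtain ⟨O, hO, rfl⟩ := h.relOpen
    have : O ∩ (Ioi U₀ ×ˢ Ioi V₀) ⊆ interior (O ∩ (Ici U₀ ×ˢ Ici V₀)) :=
      interior_maximal (inter_subset_inter_right _ (prod_mono Ioi_subset_Ici_self
        Ioi_subset_Ici_self)) (hO.inter (isOpen_Ioi.prod isOpen_Ioi))
    exact fun x hx => this ⟨hx.1.1, hx.2⟩

theorem measurableSet (h : IsFutureDomain U₀ V₀ S) : MeasurableSet S := by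
  obtain ⟨O, hO, rfl⟩ := h.relOpen
  exact hO.measurableSet.inter (measurableSet_Ici.prod measurableSet_Ici)

theorem exists_bound (h : IsFutureDomain U₀ V₀ S) {k : ℝ × ℝ → ℝ} (hk : ContinuousOn k S)
    (hp : p ∈ S) : ∃ M, 0 < M ∧ ∀ q ∈ PlaneSymmetric.past U₀ V₀ p, |k q| ≤ M := by
  obtain ⟨C, hC⟩ := (isCompact_past p).exists_bound_of_continuousOn (hk.mono (h.past_subset hp))
  exact ⟨|C| + 1, by positivity, fun q hq =>
    (hC q hq).trans ((le_abs_self C).trans (by linarith))⟩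

/-- A continuous function on the past of a point extends continuously to the plane. -/
theorem exists_extension (h : IsFutureDomain U₀ V₀ S) {k : ℝ × ℝ → ℝ} (hk : ContinuousOn k S)
    (hp : p ∈ S) : ∃ k' : ℝ × ℝ → ℝ, Continuous k' ∧ EqOn k k' (PlaneSymmetric.past U₀ V₀ p) ∧
      ∃ M, 0 < M ∧ ∀ q, |k' q| ≤ M := by
  set π : ℝ × ℝ → ℝ × ℝ := fun q =>
    (projIcc U₀ p.1 (h.le_fst hp) q.1, projIcc V₀ p.2 (h.le_snd hp) q.2) with hπ
  have hm : ∀ q, π q ∈ PlaneSymmetric.past U₀ V₀ p := fun q => ⟨Subtype.mem _, Subtype.mem _⟩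
  obtain ⟨M, hM, hb⟩ := h.exists_bound hk hp
  refine ⟨fun q => k (π q), ?_, ?_, M, hM, fun q => hb _ (hm q)⟩
  · refine hk.comp_continuous ?_ fun q => h.past_subset hp (hm q)
    exact (continuous_subtype_val.comp (continuous_projIcc.comp continuous_fst)).prodMk
      (continuous_subtype_val.comp (continuous_projIcc.comp continuous_snd))
  · intro q hq
    simp only [hπ, projIcc_of_mem _ hq.1, projIcc_of_mem _ hq.2]

theorem continuousOn_of_past (h : IsFutureDomain U₀ V₀ S) {k : ℝ × ℝ → ℝ}
    (hk : ∀ p ∈ S, ContinuousOn k (PlaneSymmetric.past U₀ V₀ p)) : ContinuousOn k S := by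
  intro p hp
  obtain ⟨p', hp', h1, h2⟩ := h.exists_gt hp
  have := hk p' hp' p ⟨⟨h.le_fst hp, h1.le⟩, ⟨h.le_snd hp, h2.le⟩⟩
  exact this.mono_of_mem_nhdsWithin (h.past_mem_nhdsWithin h1 h2)

theorem continuousOn_integral_snd (h : IsFutureDomain U₀ V₀ S) {k : ℝ × ℝ → ℝ}
    (hk : ContinuousOn k S) : ContinuousOn (fun p => ∫ y in V₀..p.2, k (p.1, y)) S := by
  refine h.continuousOn_of_past fun p hp => ?_
  obtain ⟨k', hk', he, -⟩ := h.exists_extension hk hp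
  have hc : Continuous fun q : ℝ × ℝ => ∫ y in V₀..q.2, k' (q.1, y) :=
    intervalIntegral.continuous_parametric_intervalIntegral_of_continuous
      (f := fun (q : ℝ × ℝ) y => k' (q.1, y)) (by
        unfold Function.uncurry; fun_prop) continuous_snd
  refine hc.continuousOn.congr fun q hq => ?_
  refine intervalIntegral.integral_congr fun y hy => ?_
  rw [uIcc_of_le hq.2.1] at hy
  exact he ⟨hq.1, ⟨hy.1, hy.2.trans hq.2.2⟩⟩

end IsFutureDomain

theorem setIntegral_past {f : ℝ × ℝ → ℝ} {p : ℝ × ℝ} (h₁ : U₀ ≤ p.1) (h₂ : V₀ ≤ p.2)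
    (hf : IntegrableOn f (past U₀ V₀ p)) :
    ∫ z in past U₀ V₀ p, f z = ∫ x in U₀..p.1, ∫ y in V₀..p.2, f (x, y) := by
  rw [past, Measure.volume_eq_prod, setIntegral_prod f hf, intervalIntegral.integral_of_le h₁,
    integral_Icc_eq_integral_Ioc]
  congr 1
  ext x
  rw [intervalIntegral.integral_of_le h₂, integral_Icc_eq_integral_Ioc]

theorem setIntegral_past_swap {f : ℝ × ℝ → ℝ} {p : ℝ × ℝ} :
    ∫ z in past V₀ U₀ p.swap, f z.swap = ∫ z in past U₀ V₀ p, f z := by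
  rw [← past_swap]
  have : MeasurePreserving (Prod.swap : ℝ × ℝ → ℝ × ℝ) volume volume :=
    Measure.measurePreserving_swap
  exact this.setIntegral_preimage_emb MeasurableEquiv.prodComm.measurableEmbedding f _

/-! ### The characteristic initial value problem as a Volterra equation -/

theorem integral_exp_weight_le {lam x : ℝ} (hl : 0 < lam) :
    ∫ s in U₀..x, Real.exp (lam * (s - U₀)) = (Real.exp (lam * (x - U₀)) - 1) / lam := by
  have hd : ∀ s ∈ uIcc U₀ x, HasDerivAt (fun s => Real.exp (lam * (s - U₀)) / lam)
      (Real.exp (lam * (s - U₀))) s := by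
    intro s _
    have := ((((hasDerivAt_id s).sub_const U₀).const_mul lam).exp).div_const lam
    refine this.congr_deriv ?_
    simp only [id]; field_simp
  rw [intervalIntegral.integral_eq_sub_of_hasDerivAt hd]
  · simp; ring
  · exact (by fun_prop : Continuous fun s => Real.exp (lam * (s - U₀))).intervalIntegrable _ _

/-- Gronwall's lemma for characteristic rectangles. -/
theorem eq_zero_of_le_integral {M : ℝ} {p : ℝ × ℝ} {g : ℝ × ℝ → ℝ}
    (h₁ : U₀ ≤ p.1) (h₂ : V₀ ≤ p.2) (hM : 0 ≤ M)
    (hg : ContinuousOn g (past U₀ V₀ p)) (h0 : ∀ q ∈ past U₀ V₀ p, 0 ≤ g q)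
    (hle : ∀ q ∈ past U₀ V₀ p, g q ≤ M * ∫ z in past U₀ V₀ q, g z) :
    ∀ q ∈ past U₀ V₀ p, g q = 0 := by
  set L := p.2 - V₀ with hL
  have hL0 : 0 ≤ L := sub_nonneg.2 h₂
  -- the weight is chosen so that `M L / lam ≤ 1 / 2`
  set lam := 2 * (M * L) + 1 with hlam
  have hl : 0 < lam := by positivity
  have hne : (past U₀ V₀ p).Nonempty := ⟨p, ⟨⟨h₁, le_rfl⟩, ⟨h₂, le_rfl⟩⟩⟩
  obtain ⟨q, hq, hmax⟩ := (isCompact_past p).exists_isMaxOn hne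
    (f := fun q => Real.exp (-(lam * (q.1 - U₀))) * g q)
    ((by fun_prop : Continuous fun q : ℝ × ℝ => Real.exp (-(lam * (q.1 - U₀)))).continuousOn.mul hg)
  set K := Real.exp (-(lam * (q.1 - U₀))) * g q with hK
  have hle' : ∀ z ∈ past U₀ V₀ p, g z ≤ K * Real.exp (lam * (z.1 - U₀)) := by
    intro z hz
    have : Real.exp (-(lam * (z.1 - U₀))) * g z ≤ K := hmax hz
    rw [Real.exp_neg, inv_mul_le_iff₀ (Real.exp_pos _)] at this
    linarith
  have hK0 : 0 ≤ K := mul_nonneg (Real.exp_pos _).le (h0 q hq)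
  have hsub : past U₀ V₀ q ⊆ past U₀ V₀ p := past_mono hq.1.2 hq.2.2
  have hi2 : IntegrableOn (fun z : ℝ × ℝ => K * Real.exp (lam * (z.1 - U₀))) (past U₀ V₀ q) :=
    (by fun_prop : Continuous fun z : ℝ × ℝ =>
      K * Real.exp (lam * (z.1 - U₀))).continuousOn.integrableOn_compact (isCompact_past q)
  have e1 : ∫ z in past U₀ V₀ q, g z ≤ ∫ z in past U₀ V₀ q, K * Real.exp (lam * (z.1 - U₀)) :=
    setIntegral_mono_on ((hg.mono hsub).integrableOn_compact (isCompact_past q)) hi2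
      (measurableSet_past q) fun z hz => hle' z (hsub hz)
  rw [setIntegral_past hq.1.1 hq.2.1 hi2] at e1
  simp only [intervalIntegral.integral_const, smul_eq_mul, intervalIntegral.integral_const_mul,
    integral_exp_weight_le hl] at e1
  have hqL : q.2 - V₀ ≤ L := by have := hq.2.2; linarith
  have hqL0 : 0 ≤ q.2 - V₀ := by have := hq.2.1; linarith
  have h3 := hle q hq
  have hE := Real.exp_pos (lam * (q.1 - U₀))
  have hE1 : 1 ≤ Real.exp (lam * (q.1 - U₀)) :=
    Real.one_le_exp (mul_nonneg hl.le (sub_nonneg.2 hq.1.1))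
  -- the maximum of the weighted function is at most half of itself
  have h4 : K ≤ K / 2 := by
    have h5 : g q ≤ M * (L * (K * (Real.exp (lam * (q.1 - U₀)) / lam))) := by
      refine h3.trans (mul_le_mul_of_nonneg_left ?_ hM)
      have e2 : ∫ z in past U₀ V₀ q, g z
          ≤ (q.2 - V₀) * (K * ((Real.exp (lam * (q.1 - U₀)) - 1) / lam)) :=
        e1.trans (le_of_eq (by ring))
      refine e2.trans (mul_le_mul hqL ?_ ?_ hL0)
      · gcongr; linarith
      · exact mul_nonneg hK0 (div_nonneg (by linarith) hl.le)
    have h6 : K ≤ Real.exp (-(lam * (q.1 - U₀)))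
        * (M * (L * (K * (Real.exp (lam * (q.1 - U₀)) / lam)))) :=
      mul_le_mul_of_nonneg_left h5 (Real.exp_pos _).le
    have h7 : Real.exp (-(lam * (q.1 - U₀)))
        * (M * (L * (K * (Real.exp (lam * (q.1 - U₀)) / lam)))) = K * (M * L / lam) := by
      rw [Real.exp_neg]; field_simp
    rw [h7] at h6
    refine h6.trans ?_
    have : M * L / lam ≤ 1 / 2 := by
      rw [div_le_div_iff₀ hl two_pos]; linarith
    calc K * (M * L / lam) ≤ K * (1 / 2) := mul_le_mul_of_nonneg_left this hK0
      _ = K / 2 := by ring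
  intro z hz
  have hKz : K = 0 := by linarith
  have := hle' z hz
  rw [hKz, zero_mul] at this
  exact le_antisymm this (h0 z hz)

/-- Uniqueness for the Volterra equation `w = h + ∫∫ q w`. -/
theorem volterra_unique {p : ℝ × ℝ} {q h w w' : ℝ × ℝ → ℝ} (h₁ : U₀ ≤ p.1) (h₂ : V₀ ≤ p.2)
    (hq : ContinuousOn q (past U₀ V₀ p)) (hw : ContinuousOn w (past U₀ V₀ p))
    (hw' : ContinuousOn w' (past U₀ V₀ p))
    (e : ∀ r ∈ past U₀ V₀ p, w r = h r + ∫ z in past U₀ V₀ r, q z * w z)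
    (e' : ∀ r ∈ past U₀ V₀ p, w' r = h r + ∫ z in past U₀ V₀ r, q z * w' z) :
    ∀ r ∈ past U₀ V₀ p, w r = w' r := by
  obtain ⟨M, hM⟩ := (isCompact_past p).exists_bound_of_continuousOn hq
  have hd : ContinuousOn (fun r => |w r - w' r|) (past U₀ V₀ p) := (hw.sub hw').abs
  have key := eq_zero_of_le_integral (M := |M|) h₁ h₂ (abs_nonneg M) hd (fun _ _ => abs_nonneg _) ?_
  · intro r hr
    have := key r hr
    rwa [abs_eq_zero, sub_eq_zero] at this
  intro r hr
  have hsub : past U₀ V₀ r ⊆ past U₀ V₀ p := past_mono hr.1.2 hr.2.2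
  have i1 : IntegrableOn (fun z => q z * w z) (past U₀ V₀ r) :=
    ((hq.mul hw).mono hsub).integrableOn_compact (isCompact_past r)
  have i2 : IntegrableOn (fun z => q z * w' z) (past U₀ V₀ r) :=
    ((hq.mul hw').mono hsub).integrableOn_compact (isCompact_past r)
  have i3 : IntegrableOn (fun z => |w z - w' z|) (past U₀ V₀ r) :=
    (hd.mono hsub).integrableOn_compact (isCompact_past r)
  rw [e r hr, e' r hr, add_sub_add_left_eq_sub, ← integral_sub i1 i2, ← integral_const_mul,
    ← Real.norm_eq_abs]
  refine norm_integral_le_of_norm_le (i3.const_mul _) ?_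
  rw [ae_restrict_iff' (measurableSet_past r)]
  refine Eventually.of_forall fun z hz => ?_
  rw [← mul_sub, norm_mul, Real.norm_eq_abs (w z - w' z)]
  exact mul_le_mul_of_nonneg_right ((hM z (hsub hz)).trans (le_abs_self M)) (abs_nonneg _)

open BoundedContinuousFunction in
/-- On a single rectangle, with bounded coefficient, the Volterra equation is solved by a
contraction in the supremum norm with an exponential weight. -/
theorem exists_volterra_rect {p : ℝ × ℝ} {q h : ℝ × ℝ → ℝ} {M H : ℝ} (h₁ : U₀ ≤ p.1)
    (h₂ : V₀ ≤ p.2) (hq : Continuous q) (hh : Continuous h) (hM : ∀ z, |q z| ≤ M)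
    (hH : ∀ z, |h z| ≤ H) :
    ∃ w : ℝ × ℝ → ℝ, Continuous w ∧
      ∀ r ∈ past U₀ V₀ p, w r = h r + ∫ z in past U₀ V₀ r, q z * w z := by
  have hM0 : 0 ≤ M := (abs_nonneg _).trans (hM 0)
  set L := p.2 - V₀ with hL
  have hL0 : 0 ≤ L := sub_nonneg.2 h₂
  -- the weight is chosen so that `M L / lam ≤ 1 / 2`
  set lam := 2 * (M * L) + 1 with hlam
  have hl : 0 < lam := by positivity
  set X : ℝ → ℝ := fun x => projIcc U₀ p.1 h₁ x with hX
  set Y : ℝ → ℝ := fun y => projIcc V₀ p.2 h₂ y with hY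
  have cX : Continuous X := continuous_subtype_val.comp continuous_projIcc
  have cY : Continuous Y := continuous_subtype_val.comp continuous_projIcc
  have mX : ∀ x, X x ∈ Icc U₀ p.1 := fun x => Subtype.mem _
  have mY : ∀ x, Y x ∈ Icc V₀ p.2 := fun x => Subtype.mem _
  set G : (ℝ × ℝ →ᵇ ℝ) → ℝ × ℝ → ℝ := fun u z => q z * (Real.exp (lam * (X z.1 - U₀)) * u z) with hG
  have cG : ∀ u, Continuous (G u) := fun u => by
    have := u.continuous
    fun_prop
  set J : (ℝ × ℝ →ᵇ ℝ) → ℝ × ℝ → ℝ := fun u z =>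
    ∫ x in U₀..X z.1, ∫ y in V₀..Y z.2, G u (x, y) with hJ
  have cJ : ∀ u, Continuous (J u) := fun u => by
    have c1 : Continuous fun z : ℝ × ℝ => ∫ y in V₀..Y z.2, G u (z.1, y) :=
      intervalIntegral.continuous_parametric_intervalIntegral_of_continuous
        (f := fun (z : ℝ × ℝ) y => G u (z.1, y))
        ((cG u).comp (g := G u) (f := fun w : (ℝ × ℝ) × ℝ => (w.1.1, w.2)) (by fun_prop)) (cY.comp continuous_snd)
    exact intervalIntegral.continuous_parametric_intervalIntegral_of_continuous
        (f := fun (z : ℝ × ℝ) x => ∫ y in V₀..Y z.2, G u (x, y))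
        (c1.comp (f := fun w : (ℝ × ℝ) × ℝ => (w.2, w.1.2)) (by fun_prop)) (cX.comp continuous_fst)
  -- the basic estimate
  have est : ∀ u z, Real.exp (-(lam * (X z.1 - U₀))) * |J u z| ≤ ‖u‖ / 2 := by
    intro u z
    have b1 : ∀ x ∈ Icc U₀ (X z.1), |∫ y in V₀..Y z.2, G u (x, y)|
        ≤ M * L * ‖u‖ * Real.exp (lam * (x - U₀)) := by
      intro x hx
      have hxp : x ∈ Icc U₀ p.1 := ⟨hx.1, hx.2.trans (mX z.1).2⟩
      have := intervalIntegral.norm_integral_le_of_norm_le_const (a := V₀) (b := Y z.2)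
        (f := fun y => G u (x, y)) (C := M * (Real.exp (lam * (x - U₀)) * ‖u‖)) fun y _ => by
          simp only [hG, hX, projIcc_of_mem _ hxp, norm_mul, Real.norm_eq_abs, Real.abs_exp]
          refine mul_le_mul (hM _) ?_ (by positivity) hM0
          exact mul_le_mul_of_nonneg_left (u.norm_coe_le_norm _) (Real.exp_pos _).le
      rw [Real.norm_eq_abs, abs_of_nonneg (sub_nonneg.2 (mY z.2).1)] at this
      refine this.trans ?_
      have hYL : Y z.2 - V₀ ≤ L := by have := (mY z.2).2; linarith
      calc M * (Real.exp (lam * (x - U₀)) * ‖u‖) * (Y z.2 - V₀)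
          ≤ M * (Real.exp (lam * (x - U₀)) * ‖u‖) * L := by gcongr
        _ = _ := by ring
    have b2 : |J u z| ≤ ∫ x in U₀..X z.1, M * L * ‖u‖ * Real.exp (lam * (x - U₀)) := by
      rw [← Real.norm_eq_abs]
      refine intervalIntegral.norm_integral_le_of_norm_le (mX z.1).1 ?_ ?_
      · exact Eventually.of_forall fun x hx => b1 x ⟨hx.1.le, hx.2⟩
      · exact (by fun_prop : Continuous fun x =>
          M * L * ‖u‖ * Real.exp (lam * (x - U₀))).intervalIntegrable _ _
    rw [intervalIntegral.integral_const_mul, integral_exp_weight_le hl] at b2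
    have hE := Real.exp_pos (lam * (X z.1 - U₀))
    rw [Real.exp_neg, inv_mul_le_iff₀ hE]
    refine b2.trans ?_
    have b3 : M * L / lam ≤ 1 / 2 := by
      rw [div_le_div_iff₀ hl two_pos]; linarith
    calc M * L * ‖u‖ * ((Real.exp (lam * (X z.1 - U₀)) - 1) / lam)
        = (M * L / lam) * (‖u‖ * (Real.exp (lam * (X z.1 - U₀)) - 1)) := by ring
      _ ≤ (M * L / lam) * (‖u‖ * Real.exp (lam * (X z.1 - U₀))) := by
        gcongr; linarith
      _ ≤ 1 / 2 * (‖u‖ * Real.exp (lam * (X z.1 - U₀))) := by gcongr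
      _ = _ := by ring
  have hE1 : ∀ z : ℝ × ℝ, Real.exp (-(lam * (X z.1 - U₀))) ≤ 1 := fun z =>
    Real.exp_le_one_iff.2 (neg_nonpos.2 (mul_nonneg hl.le (sub_nonneg.2 (mX z.1).1)))
  let T : (ℝ × ℝ →ᵇ ℝ) → (ℝ × ℝ →ᵇ ℝ) := fun u =>
    BoundedContinuousFunction.ofNormedAddCommGroup
      (fun z => Real.exp (-(lam * (X z.1 - U₀))) * (h z + J u z))
      ((by fun_prop : Continuous fun z : ℝ × ℝ => Real.exp (-(lam * (X z.1 - U₀)))).mul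
        (hh.add (cJ u))) (H + ‖u‖ / 2) fun z => by
          rw [norm_mul, Real.norm_eq_abs, Real.abs_exp, Real.norm_eq_abs]
          refine (mul_le_mul_of_nonneg_left (abs_add_le _ _) (Real.exp_pos _).le).trans ?_
          rw [mul_add]
          refine add_le_add ?_ (est u z)
          exact (mul_le_of_le_one_left (abs_nonneg _) (hE1 z)).trans (hH z)
  have hT : ContractingWith (1 / 2) T := by
    refine ⟨by norm_num, LipschitzWith.of_dist_le_mul fun u v => ?_⟩
    rw [BoundedContinuousFunction.dist_le (by positivity)]
    intro z
    rw [Real.dist_eq]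
    change |Real.exp (-(lam * (X z.1 - U₀))) * (h z + J u z)
      - Real.exp (-(lam * (X z.1 - U₀))) * (h z + J v z)| ≤ _
    rw [← mul_sub, add_sub_add_left_eq_sub, abs_mul, Real.abs_exp]
    have hJs : J u z - J v z = J (u - v) z := by
      have ci : ∀ u x, IntervalIntegrable (fun y => G u (x, y)) volume V₀ (Y z.2) := fun u x =>
        ((cG u).comp (by fun_prop : Continuous fun y : ℝ => (x, y))).intervalIntegrable _ _
      have co : ∀ u, IntervalIntegrable (fun x => ∫ y in V₀..Y z.2, G u (x, y)) volume U₀ (X z.1) :=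
        fun u => (intervalIntegral.continuous_parametric_intervalIntegral_of_continuous'
          (f := fun x y => G u (x, y)) (by exact cG u) V₀ (Y z.2)).intervalIntegrable _ _
      simp only [hJ]
      rw [← intervalIntegral.integral_sub (co u) (co v)]
      refine intervalIntegral.integral_congr fun x _ => ?_
      change (∫ y in V₀..Y z.2, G u (x, y)) - (∫ y in V₀..Y z.2, G v (x, y)) = _
      rw [← intervalIntegral.integral_sub (ci u x) (ci v x)]
      refine intervalIntegral.integral_congr fun y _ => ?_
      simp only [hG, BoundedContinuousFunction.coe_sub, Pi.sub_apply]
      ring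
    rw [hJs, dist_eq_norm]
    refine (est (u - v) z).trans (le_of_eq ?_)
    simp only [NNReal.coe_div, NNReal.coe_one, NNReal.coe_ofNat]
    ring
  obtain ⟨u, hu⟩ : ∃ u, T u = u := ⟨_, hT.fixedPoint_isFixedPt⟩
  have eu : ∀ z, u z = Real.exp (-(lam * (X z.1 - U₀))) * (h z + J u z) := fun z =>
    (DFunLike.congr_fun hu z).symm
  have cw : Continuous fun z : ℝ × ℝ => Real.exp (lam * (X z.1 - U₀)) * u z := by
    have := u.continuous
    fun_prop
  refine ⟨_, cw, fun r hr => ?_⟩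
  have i1 : IntegrableOn (fun z => q z * (Real.exp (lam * (X z.1 - U₀)) * u z)) (past U₀ V₀ r) :=
    (hq.mul cw).continuousOn.integrableOn_compact (isCompact_past r)
  have hr1 : r.1 ∈ Icc U₀ p.1 := hr.1
  have hr2 : r.2 ∈ Icc V₀ p.2 := hr.2
  have e1 : X r.1 = r.1 := by simp only [hX, projIcc_of_mem _ hr1]
  have e2 : Y r.2 = r.2 := by simp only [hY, projIcc_of_mem _ hr2]
  rw [setIntegral_past hr.1.1 hr.2.1 i1]
  have e3 := eu r
  rw [Real.exp_neg, eq_inv_mul_iff_mul_eq₀ (Real.exp_pos _).ne'] at e3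
  rw [e3]
  simp only [hJ, e1, e2]
  rfl

/-- The Volterra equation `w = h + ∫∫ q w` has a continuous solution on a future domain. -/
theorem IsFutureDomain.exists_volterra (hS : IsFutureDomain U₀ V₀ S) {q h : ℝ × ℝ → ℝ}
    (hq : ContinuousOn q S) (hh : ContinuousOn h S) :
    ∃ w : ℝ × ℝ → ℝ, ContinuousOn w S ∧
      ∀ p ∈ S, w p = h p + ∫ z in PlaneSymmetric.past U₀ V₀ p, q z * w z := by
  have rect : ∀ p : ℝ × ℝ, ∃ w : ℝ × ℝ → ℝ, p ∈ S → ContinuousOn w (PlaneSymmetric.past U₀ V₀ p) ∧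
      ∀ r ∈ PlaneSymmetric.past U₀ V₀ p, w r = h r + ∫ z in PlaneSymmetric.past U₀ V₀ r, q z * w z := by
    intro p
    by_cases hp : p ∈ S
    · obtain ⟨q', cq, eq, M, -, hM⟩ := hS.exists_extension hq hp
      obtain ⟨h', ch, eh, H, -, hH⟩ := hS.exists_extension hh hp
      obtain ⟨w, cw, ew⟩ := exists_volterra_rect (hS.le_fst hp) (hS.le_snd hp) cq ch hM hH
      refine ⟨w, fun _ => ⟨cw.continuousOn, fun r hr => ?_⟩⟩
      rw [ew r hr, eh hr]
      congr 1
      refine setIntegral_congr_fun (measurableSet_past r) fun z hz => ?_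
      simp only [eq (past_mono hr.1.2 hr.2.2 hz)]
    · exact ⟨0, fun h => absurd h hp⟩
  choose W hW using rect
  -- the solutions on different rectangles agree on the intersections
  have agree : ∀ p ∈ S, ∀ r ∈ PlaneSymmetric.past U₀ V₀ p, W r r = W p r := by
    intro p hp r hr
    have hrS := hS.past_subset hp hr
    have hsub : PlaneSymmetric.past U₀ V₀ r ⊆ PlaneSymmetric.past U₀ V₀ p := past_mono hr.1.2 hr.2.2
    exact volterra_unique (hS.le_fst hrS) (hS.le_snd hrS) (hq.mono (hS.past_subset hrS))
      (hW r hrS).1 ((hW p hp).1.mono hsub) (hW r hrS).2 (fun s hs => (hW p hp).2 s (hsub hs)) r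
      (hS.self_mem_past hrS)
  refine ⟨fun p => W p p, ?_, fun p hp => ?_⟩
  · exact hS.continuousOn_of_past fun p hp => (hW p hp).1.congr fun r hr => agree p hp r hr
  · simp only
    rw [(hW p hp).2 p (hS.self_mem_past hp)]
    congr 1
    refine setIntegral_congr_fun (measurableSet_past p) fun z hz => ?_
    simp only [agree p hp z hz]

end

section

/-! ### Integration over characteristic rectangles -/

/-- Functions on a future domain which, on the past of every point, are bounded by a product of
integrable functions of one null coordinate. In contrast with general integrable functions they
are integrable along every null line. -/
structure IsKernel (U₀ V₀ : ℝ) (S : Set (ℝ × ℝ)) (Q : ℝ × ℝ → ℝ) : Prop where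
  meas : Measurable (S.indicator Q)
  bound : ∀ p ∈ S, ∃ m n : ℝ → ℝ, IntegrableOn m (Icc U₀ p.1) ∧ IntegrableOn n (Icc V₀ p.2) ∧
    ∀ z ∈ past U₀ V₀ p, |Q z| ≤ m z.1 * n z.2

theorem IsFutureDomain.measurable_integral_slice (hS : IsFutureDomain U₀ V₀ S) {Q : ℝ × ℝ → ℝ}
    (h : Measurable (S.indicator Q)) :
    Measurable (S.indicator fun p => ∫ y in V₀..p.2, Q (p.1, y)) := by
  have hA : MeasurableSet {x : (ℝ × ℝ) × ℝ | V₀ < x.2 ∧ x.2 ≤ x.1.2} :=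
    (measurableSet_lt measurable_const measurable_snd).inter
      (measurableSet_le measurable_snd (measurable_snd.comp measurable_fst))
  have hF : Measurable ({x : (ℝ × ℝ) × ℝ | V₀ < x.2 ∧ x.2 ≤ x.1.2}.indicator
      fun x => S.indicator Q (x.1.1, x.2)) :=
    (h.comp ((measurable_fst.comp measurable_fst).prodMk measurable_snd)).indicator hA
  have := (hF.stronglyMeasurable.integral_prod_right' (ν := volume)).measurable.indicator
    hS.measurableSet
  convert this using 1
  ext p
  by_cases hp : p ∈ S
  · rw [indicator_of_mem hp, indicator_of_mem hp, intervalIntegral.integral_of_le (hS.le_snd hp),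
      ← integral_indicator measurableSet_Ioc]
    congr 1
    ext y
    by_cases hy : y ∈ Ioc V₀ p.2
    · have h1 : (p, y) ∈ {x : (ℝ × ℝ) × ℝ | V₀ < x.2 ∧ x.2 ≤ x.1.2} := hy
      have h2 := hS.le_fst hp
      rw [indicator_of_mem hy, indicator_of_mem h1, indicator_of_mem]
      exact hS.past_subset hp ⟨⟨h2, le_rfl⟩, ⟨hy.1.le, hy.2⟩⟩
    · have h1 : (p, y) ∉ {x : (ℝ × ℝ) × ℝ | V₀ < x.2 ∧ x.2 ≤ x.1.2} := hy
      rw [indicator_of_notMem hy, indicator_of_notMem h1]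
  · rw [indicator_of_notMem hp, indicator_of_notMem hp]

namespace IsKernel

variable {Q : ℝ × ℝ → ℝ} {p : ℝ × ℝ}

theorem swap (h : IsKernel U₀ V₀ S Q) :
    IsKernel V₀ U₀ (Prod.swap ⁻¹' S) (fun p => Q p.swap) where
  meas := h.meas.comp measurable_swap
  bound := fun p hp => by
    obtain ⟨m, n, hm, hn, hb⟩ := h.bound p.swap hp
    exact ⟨n, m, hn, hm, fun z hz => by
      rw [mul_comm]; exact hb z.swap ⟨hz.2, hz.1⟩⟩

theorem aestronglyMeasurable (h : IsKernel U₀ V₀ S Q) (hS : IsFutureDomain U₀ V₀ S)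
    (hp : p ∈ S) : AEStronglyMeasurable Q (volume.restrict (past U₀ V₀ p)) := by
  refine h.meas.aestronglyMeasurable.congr ?_
  filter_upwards [ae_restrict_mem (measurableSet_past p)] with z hz
  exact indicator_of_mem (hS.past_subset hp hz) Q

theorem integrableOn (h : IsKernel U₀ V₀ S Q) (hS : IsFutureDomain U₀ V₀ S)
    (hp : p ∈ S) : IntegrableOn Q (past U₀ V₀ p) := by
  obtain ⟨m, n, hm, hn, hb⟩ := h.bound p hp
  have : IntegrableOn (fun z : ℝ × ℝ => m z.1 * n z.2) (past U₀ V₀ p) := by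
    rw [past, IntegrableOn, Measure.volume_eq_prod, ← Measure.prod_restrict]
    exact hm.mul_prod hn
  refine Integrable.mono this (h.aestronglyMeasurable hS hp) ?_
  filter_upwards [ae_restrict_mem (measurableSet_past p)] with z hz
  rw [Real.norm_eq_abs]
  exact (hb z hz).trans (le_abs_self _)

theorem slice (h : IsKernel U₀ V₀ S Q) (hS : IsFutureDomain U₀ V₀ S) (hp : p ∈ S) :
    IntervalIntegrable (fun y => Q (p.1, y)) volume V₀ p.2 := by
  obtain ⟨m, n, hm, hn, hb⟩ := h.bound p hp
  rw [intervalIntegrable_iff_integrableOn_Icc_of_le (hS.le_snd hp)]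
  have h1 := hS.le_fst hp
  have hmem : ∀ y ∈ Icc V₀ p.2, (p.1, y) ∈ past U₀ V₀ p := fun y hy =>
    ⟨⟨h1, le_rfl⟩, hy⟩
  refine Integrable.mono (hn.const_mul (m p.1)) ?_ ?_
  · refine (h.meas.comp (measurable_prodMk_left (x := p.1))).aestronglyMeasurable.congr ?_
    filter_upwards [ae_restrict_mem measurableSet_Icc] with y hy
    exact indicator_of_mem (hS.past_subset hp (hmem y hy)) Q
  · filter_upwards [ae_restrict_mem measurableSet_Icc] with y hy
    rw [Real.norm_eq_abs]
    exact (hb _ (hmem y hy)).trans (le_abs_self _)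

theorem integral_slice (h : IsKernel U₀ V₀ S Q) (hS : IsFutureDomain U₀ V₀ S) (hp : p ∈ S) :
    IntervalIntegrable (fun x => ∫ y in V₀..p.2, Q (x, y)) volume U₀ p.1 := by
  rw [intervalIntegrable_iff_integrableOn_Icc_of_le (hS.le_fst hp)]
  have := h.integrableOn hS hp
  rw [past, IntegrableOn, Measure.volume_eq_prod, ← Measure.prod_restrict] at this
  refine this.integral_prod_left.congr (Eventually.of_forall fun x => ?_)
  simp only
  rw [intervalIntegral.integral_of_le (hS.le_snd hp), integral_Icc_eq_integral_Ioc]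

theorem measurable_integral_slice (h : IsKernel U₀ V₀ S Q) (hS : IsFutureDomain U₀ V₀ S) :
    Measurable (S.indicator fun p => ∫ y in V₀..p.2, Q (p.1, y)) :=
  hS.measurable_integral_slice h.meas

theorem hasACDeriv_integral (h : IsKernel U₀ V₀ S Q) (hS : IsFutureDomain U₀ V₀ S) (hp : p ∈ S) :
    HasACDeriv (fun x => ∫ z in past U₀ V₀ (x, p.2), Q z) (fun x => ∫ y in V₀..p.2, Q (x, y))
      U₀ p.1 := by
  have h1 := hS.le_fst hp
  have h2 := hS.le_snd hp
  have key : ∀ x ∈ Icc U₀ p.1, ∫ z in past U₀ V₀ (x, p.2), Q z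
      = ∫ x in U₀..x, ∫ y in V₀..p.2, Q (x, y) := fun x hx =>
    setIntegral_past (p := (x, p.2)) hx.1 h2
      (h.integrableOn hS (hS.past_subset hp ⟨⟨hx.1, hx.2⟩, ⟨h2, le_rfl⟩⟩))
  refine HasACDeriv.of_eq_integral (h.integral_slice hS hp) fun x hx => ?_
  rw [uIcc_of_le h1] at hx
  rw [key x hx, key U₀ ⟨le_rfl, h1⟩, intervalIntegral.integral_same, zero_add]

theorem continuousOn_integral (h : IsKernel U₀ V₀ S Q) (hS : IsFutureDomain U₀ V₀ S) :
    ContinuousOn (fun p => ∫ z in past U₀ V₀ p, Q z) S := by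
  refine hS.continuousOn_of_past fun p hp => ?_
  have hi := h.integrableOn hS hp
  have e : ∀ r ∈ past U₀ V₀ p, ∫ z in past U₀ V₀ r, Q z
      = ∫ z in past U₀ V₀ p, (past U₀ V₀ r).indicator Q z := by
    intro r hr
    rw [setIntegral_indicator (measurableSet_past r),
      inter_eq_self_of_subset_right (past_mono hr.1.2 hr.2.2)]
  refine ContinuousOn.congr ?_ e
  intro r hr
  have hn1 : ∀ᵐ z : ℝ × ℝ, z.1 ≠ r.1 := by
    have h0 : ∀ᵐ x : ℝ, x ≠ r.1 := by simp [ae_iff]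
    exact Measure.quasiMeasurePreserving_fst.ae h0
  have hn2 : ∀ᵐ z : ℝ × ℝ, z.2 ≠ r.2 := by
    have h0 : ∀ᵐ x : ℝ, x ≠ r.2 := by simp [ae_iff]
    exact Measure.quasiMeasurePreserving_snd.ae h0
  -- off the two null lines through `r`, the indicator of the past of `s` is constant for `s`
  -- near `r`
  refine continuousWithinAt_of_dominated (bound := fun z => |Q z|) ?_ ?_ hi.norm ?_
  · exact Eventually.of_forall fun s => hi.aestronglyMeasurable.indicator (measurableSet_past s)
  · refine Eventually.of_forall fun s => Eventually.of_forall fun z => ?_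
    exact norm_indicator_le_norm_self Q z
  · filter_upwards [ae_restrict_of_ae hn1, ae_restrict_of_ae hn2,
      ae_restrict_mem (measurableSet_past p)] with z hz1 hz2 hz
    refine ContinuousAt.continuousWithinAt ?_
    have hev : ∀ᶠ s : ℝ × ℝ in 𝓝 r, (z ∈ past U₀ V₀ s ↔ z ∈ past U₀ V₀ r) := by
      have a1 : ∀ᶠ s : ℝ × ℝ in 𝓝 r, (z.1 ≤ s.1 ↔ z.1 ≤ r.1) := by
        rcases lt_or_gt_of_ne hz1 with hlt | hlt
        · filter_upwards [continuous_fst.continuousAt.eventually (lt_mem_nhds hlt)] with s hs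
          exact ⟨fun _ => hlt.le, fun _ => le_of_lt hs⟩
        · filter_upwards [continuous_fst.continuousAt.eventually (gt_mem_nhds hlt)] with s hs
          exact ⟨fun hh => absurd hh (not_le.2 hs), fun hh => absurd hh (not_le.2 hlt)⟩
      have a2 : ∀ᶠ s : ℝ × ℝ in 𝓝 r, (z.2 ≤ s.2 ↔ z.2 ≤ r.2) := by
        rcases lt_or_gt_of_ne hz2 with hlt | hlt
        · filter_upwards [continuous_snd.continuousAt.eventually (lt_mem_nhds hlt)] with s hs
          exact ⟨fun _ => hlt.le, fun _ => le_of_lt hs⟩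
        · filter_upwards [continuous_snd.continuousAt.eventually (gt_mem_nhds hlt)] with s hs
          exact ⟨fun hh => absurd hh (not_le.2 hs), fun hh => absurd hh (not_le.2 hlt)⟩
      filter_upwards [a1, a2] with s h1 h2
      rw [mem_past, mem_past, h1, h2]
    refine (continuousAt_const (y := (past U₀ V₀ r).indicator Q z)).congr ?_
    filter_upwards [hev] with s hs
    by_cases hm : z ∈ past U₀ V₀ r
    · rw [indicator_of_mem hm, indicator_of_mem (hs.2 hm)]
    · rw [indicator_of_notMem hm, indicator_of_notMem (fun h => hm (hs.1 h))]

end IsKernel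

theorem IsFutureDomain.measurable_indicator (hS : IsFutureDomain U₀ V₀ S) {k : ℝ × ℝ → ℝ}
    (hk : ContinuousOn k S) : Measurable (S.indicator k) := by
  classical
  rw [← piecewise_eq_indicator]
  exact hk.measurable_piecewise continuousOn_const hS.measurableSet

theorem IsFutureDomain.isKernel_of_continuousOn (hS : IsFutureDomain U₀ V₀ S) {k : ℝ × ℝ → ℝ}
    (hk : ContinuousOn k S) : IsKernel U₀ V₀ S k where
  meas := hS.measurable_indicator hk
  bound := fun p hp => by
    obtain ⟨M, hM, hb⟩ := hS.exists_bound hk hp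
    exact ⟨fun _ => M, fun _ => 1, integrableOn_const (by simp), integrableOn_const (by simp),
      fun z hz => by simpa using hb z hz⟩

/-! ### Derivatives along null lines and weak derivatives -/

theorem hasDerivAt_dU {φ : ℝ × ℝ → ℝ} (hφ : ContDiff ℝ ∞ φ) (x y : ℝ) :
    HasDerivAt (fun x => φ (x, y)) (dU φ (x, y)) x := by
  have h1 : HasFDerivAt φ (fderiv ℝ φ (x, y)) (x, y) :=
    (hφ.differentiable (by simp)).differentiableAt.hasFDerivAt
  exact h1.comp_hasDerivAt x ((hasDerivAt_id x).prodMk (hasDerivAt_const x y))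

theorem hasDerivAt_dV {φ : ℝ × ℝ → ℝ} (hφ : ContDiff ℝ ∞ φ) (x y : ℝ) :
    HasDerivAt (fun y => φ (x, y)) (dV φ (x, y)) y := by
  have h1 : HasFDerivAt φ (fderiv ℝ φ (x, y)) (x, y) :=
    (hφ.differentiable (by simp)).differentiableAt.hasFDerivAt
  exact h1.comp_hasDerivAt y ((hasDerivAt_const y x).prodMk (hasDerivAt_id y))

theorem continuous_dU {φ : ℝ × ℝ → ℝ} (hφ : ContDiff ℝ ∞ φ) : Continuous (dU φ) :=
  (hφ.continuous_fderiv (by simp)).clm_apply continuous_const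

theorem continuous_dV {φ : ℝ × ℝ → ℝ} (hφ : ContDiff ℝ ∞ φ) : Continuous (dV φ) :=
  (hφ.continuous_fderiv (by simp)).clm_apply continuous_const

theorem dU_eq_zero {φ : ℝ × ℝ → ℝ} {p : ℝ × ℝ} (hp : p ∉ tsupport φ) : dU φ p = 0 := by
  have : fderiv ℝ φ p = 0 := by
    by_contra h
    exact hp (support_fderiv_subset ℝ h)
  rw [dU, this]; rfl

theorem dV_eq_zero {φ : ℝ × ℝ → ℝ} {p : ℝ × ℝ} (hp : p ∉ tsupport φ) : dV φ p = 0 := by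
  have : fderiv ℝ φ p = 0 := by
    by_contra h
    exact hp (support_fderiv_subset ℝ h)
  rw [dV, this]; rfl

theorem IsTest.swap {φ : ℝ × ℝ → ℝ} (h : IsTest S φ) :
    IsTest (Prod.swap ⁻¹' S) (fun p => φ p.swap) := by
  have e : (fun p : ℝ × ℝ => φ p.swap) = φ ∘ Homeomorph.prodComm ℝ ℝ := rfl
  refine ⟨h.smooth.comp (contDiff_snd.prodMk contDiff_fst), ?_, ?_⟩
  · rw [e]; exact h.compact.comp_homeomorph _
  · rw [e, tsupport_comp_eq_preimage]
    have := (Homeomorph.prodComm ℝ ℝ).preimage_interior S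
    intro z hz
    have hz' := h.supp hz
    have h2 : z ∈ (Homeomorph.prodComm ℝ ℝ) ⁻¹' interior S := hz'
    rw [this] at h2
    exact h2

theorem dU_swap {φ : ℝ × ℝ → ℝ} (hφ : ContDiff ℝ ∞ φ) (p : ℝ × ℝ) :
    dU (fun p => φ p.swap) p = dV φ p.swap := by
  have h2 : ContDiff ℝ ∞ (fun p : ℝ × ℝ => φ p.swap) :=
    hφ.comp (contDiff_snd.prodMk contDiff_fst)
  exact (hasDerivAt_dU h2 p.1 p.2).unique (hasDerivAt_dV hφ p.2 p.1)

theorem integral_swap (F : ℝ × ℝ → ℝ) : ∫ p : ℝ × ℝ, F p.swap = ∫ p, F p := by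
  have : MeasurePreserving (Prod.swap : ℝ × ℝ → ℝ × ℝ) volume volume :=
    Measure.measurePreserving_swap
  exact this.integral_comp MeasurableEquiv.prodComm.measurableEmbedding F

theorem IsFutureDomain.locallyIntegrableOn (hS : IsFutureDomain U₀ V₀ S) {g : ℝ × ℝ → ℝ}
    (hg : ∀ p ∈ S, IntegrableOn g (PlaneSymmetric.past U₀ V₀ p)) : LocallyIntegrableOn g S := by
  intro p hp
  obtain ⟨p', hp', h1, h2⟩ := hS.exists_gt hp
  exact ⟨_, hS.past_mem_nhdsWithin h1 h2, hg p' hp'⟩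

theorem integrable_mul_of_compact {K : Set (ℝ × ℝ)} (hK : IsCompact K) {g φ : ℝ × ℝ → ℝ}
    (hg : IntegrableOn g K) (hφ : Continuous φ) (h0 : ∀ p, p ∉ K → φ p = 0) :
    Integrable fun p => g p * φ p := by
  have h1 : IntegrableOn (fun p => g p * φ p) K := hg.mul_continuousOn hφ.continuousOn hK
  exact (integrableOn_iff_integrable_of_support_subset fun p hp => by
    by_contra hn
    exact hp (by simp [h0 p hn])).1 h1

namespace IsTest

variable {φ g : ℝ × ℝ → ℝ}

theorem integrable_mul (h : IsTest S φ) (hg : LocallyIntegrableOn g S) :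
    Integrable fun p => g p * φ p :=
  integrable_mul_of_compact h.compact
    (hg.integrableOn_compact_subset (h.supp.trans interior_subset) h.compact)
    h.smooth.continuous fun p hp => image_eq_zero_of_notMem_tsupport hp

theorem integrable_mul_dU (h : IsTest S φ) (hg : LocallyIntegrableOn g S) :
    Integrable fun p => g p * dU φ p :=
  integrable_mul_of_compact h.compact
    (hg.integrableOn_compact_subset (h.supp.trans interior_subset) h.compact)
    (continuous_dU h.smooth) fun p hp => dU_eq_zero hp

theorem integrable_mul_dV (h : IsTest S φ) (hg : LocallyIntegrableOn g S) :
    Integrable fun p => g p * dV φ p :=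
  integrable_mul_of_compact h.compact
    (hg.integrableOn_compact_subset (h.supp.trans interior_subset) h.compact)
    (continuous_dV h.smooth) fun p hp => dV_eq_zero hp

end IsTest

/-- Absolute continuity along the null lines `V = const` implies weak differentiability. -/
theorem IsFutureDomain.isWeakDU (hS : IsFutureDomain U₀ V₀ S) {f g : ℝ × ℝ → ℝ}
    (hf : LocallyIntegrableOn f S) (hg : LocallyIntegrableOn g S)
    (h : ∀ p ∈ S, HasACDeriv (fun x => f (x, p.2)) (fun x => g (x, p.2)) U₀ p.1) :
    IsWeakDU S f g := by
  intro φ hφ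
  have i1 := hφ.integrable_mul_dU hf
  have i2 := hφ.integrable_mul hg
  rw [eq_neg_iff_add_eq_zero, ← integral_add i1 i2]
  have i3 := i1.add i2
  rw [Measure.volume_eq_prod] at i3 ⊢
  refine (integral_prod_symm _ i3).trans ?_
  refine integral_eq_zero_of_ae (Eventually.of_forall fun y => ?_)
  simp only [Pi.zero_apply, Pi.add_apply]
  have hsub : tsupport φ ⊆ S := hφ.supp.trans interior_subset
  by_cases hne : ∃ x, (x, y) ∈ tsupport φ
  · have hc : IsCompact {x | (x, y) ∈ tsupport φ} := by
      have : IsCompact (Prod.fst '' (tsupport φ ∩ (Prod.snd ⁻¹' {y}))) :=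
        (IsCompact.inter_right hφ.compact (isClosed_singleton.preimage continuous_snd)).image
          continuous_fst
      convert this using 1
      ext x; constructor
      · exact fun hx => ⟨(x, y), ⟨hx, rfl⟩, rfl⟩
      · rintro ⟨⟨x', y'⟩, ⟨h1, h2⟩, rfl⟩
        simp only [mem_preimage, mem_singleton_iff] at h2
        subst h2; exact h1
    obtain ⟨x₁, hx₁, hmax⟩ := hc.exists_isMaxOn hne continuousOn_id
    obtain ⟨p', hp', l1, l2⟩ := hS.exists_gt (hsub hx₁)
    simp only at l1 l2
    have hU : U₀ ≤ x₁ := hS.le_fst (hsub hx₁)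
    have hV : V₀ ≤ y := hS.le_snd (hsub hx₁)
    have hm : (p'.1, y) ∈ S := hS.past_subset hp' ⟨⟨hU.trans l1.le, le_rfl⟩, ⟨hV, l2.le⟩⟩
    have hzero : ∀ x, x ∉ Ioo U₀ p'.1 → (x, y) ∉ tsupport φ := by
      intro x hx hx'
      have a1 : x ≤ x₁ := hmax hx'
      have a2 : (x, y) ∈ interior S := hφ.supp hx'
      rw [hS.interior_eq] at a2
      exact hx ⟨a2.2.1, a1.trans_lt l1⟩
    have h0 := h _ hm
    have h1 : HasACDeriv (fun x => φ (x, y)) (fun x => dU φ (x, y)) U₀ p'.1 :=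
      HasACDeriv.of_hasDerivAt (fun t _ => hasDerivAt_dU hφ.smooth t y)
        ((continuous_dU hφ.smooth).comp (by fun_prop)).continuousOn
    have h2 := (h0.mul h1).integral_eq
    rw [image_eq_zero_of_notMem_tsupport (hzero p'.1 (by simp)),
      image_eq_zero_of_notMem_tsupport (hzero U₀ (by simp))] at h2
    rw [mul_zero, mul_zero, sub_zero] at h2
    rw [integral_eq_intervalIntegral (hU.trans l1.le)]
    · rw [← h2]
      exact intervalIntegral.integral_congr fun x _ => by ring
    · intro x hx
      have := hzero x (fun hh => hx ⟨hh.1, hh.2.le⟩)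
      rw [dU_eq_zero this, image_eq_zero_of_notMem_tsupport this]; simp
  · push Not at hne
    refine integral_eq_zero_of_ae (Eventually.of_forall fun x => ?_)
    simp [dU_eq_zero (hne x), image_eq_zero_of_notMem_tsupport (hne x)]

theorem isWeakDV_of_swap {f g : ℝ × ℝ → ℝ}
    (h : IsWeakDU (Prod.swap ⁻¹' S) (fun p => f p.swap) (fun p => g p.swap)) :
    IsWeakDV S f g := by
  intro φ hφ
  have := h _ hφ.swap
  simp only [dU_swap hφ.smooth] at this
  rw [← integral_swap fun p => f p * dV φ p, ← integral_swap fun p => g p * φ p]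
  exact this

theorem isWeakDU_of_swap {f g : ℝ × ℝ → ℝ}
    (h : IsWeakDV (Prod.swap ⁻¹' S) (fun p => f p.swap) (fun p => g p.swap)) :
    IsWeakDU S f g := by
  intro φ hφ
  have := h _ hφ.swap
  have e : ∀ p : ℝ × ℝ, dV (fun p => φ p.swap) p = dU φ p.swap := fun p => by
    have h2 : ContDiff ℝ ∞ (fun p : ℝ × ℝ => φ p.swap) := hφ.swap.smooth
    exact (dU_swap h2 p.swap).symm
  simp only [e] at this
  rw [← integral_swap fun p => f p * dU φ p, ← integral_swap fun p => g p * φ p]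
  exact this

theorem locallyIntegrableOn_swap {g : ℝ × ℝ → ℝ} (hg : LocallyIntegrableOn g S) :
    LocallyIntegrableOn (fun p => g p.swap) (Prod.swap ⁻¹' S) := by
  have mp : MeasurePreserving (Prod.swap : ℝ × ℝ → ℝ × ℝ) volume volume :=
    Measure.measurePreserving_swap
  intro p hp
  obtain ⟨t, ht, hi⟩ := hg p.swap hp
  refine ⟨Prod.swap ⁻¹' t, ?_, ?_⟩
  · have : Tendsto (Prod.swap : ℝ × ℝ → ℝ × ℝ) (𝓝[Prod.swap ⁻¹' S] p) (𝓝[S] p.swap) :=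
      continuous_swap.continuousWithinAt.tendsto_nhdsWithin (fun x hx => hx)
    exact this ht
  · exact (mp.integrableOn_comp_preimage MeasurableEquiv.prodComm.measurableEmbedding).2 hi

/-- Absolute continuity along the null lines `U = const` implies weak differentiability. -/
theorem IsFutureDomain.isWeakDV (hS : IsFutureDomain U₀ V₀ S) {f g : ℝ × ℝ → ℝ}
    (hf : LocallyIntegrableOn f S) (hg : LocallyIntegrableOn g S)
    (h : ∀ p ∈ S, HasACDeriv (fun y => f (p.1, y)) (fun y => g (p.1, y)) V₀ p.2) :
    IsWeakDV S f g :=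
  isWeakDV_of_swap (hS.swap.isWeakDU (locallyIntegrableOn_swap hf) (locallyIntegrableOn_swap hg)
    fun p hp => h p.swap hp)

end

section

/-! ### Functions dominated along one null direction -/

/-- On the past of every point, `w` is bounded by a function of `U` alone that is integrable
together with its `r`-th power. -/
structure IsDominated (U₀ V₀ : ℝ) (S : Set (ℝ × ℝ)) (r : ℕ) (w : ℝ × ℝ → ℝ) : Prop where
  meas : Measurable (S.indicator w)
  bound : ∀ p ∈ S, ∃ m : ℝ → ℝ, IntegrableOn m (Icc U₀ p.1) ∧
    IntegrableOn (fun x => m x ^ r) (Icc U₀ p.1) ∧ ∀ z ∈ past U₀ V₀ p, |w z| ≤ m z.1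

theorem indicator_mul_eq (f g : ℝ × ℝ → ℝ) :
    S.indicator (fun p => f p * g p) = fun p => S.indicator f p * S.indicator g p := by
  ext p
  by_cases hp : p ∈ S
  · simp only [indicator_of_mem hp]
  · simp only [indicator_of_notMem hp, mul_zero]

theorem indicator_add_eq (f g : ℝ × ℝ → ℝ) :
    S.indicator (fun p => f p + g p) = fun p => S.indicator f p + S.indicator g p := by
  ext p
  by_cases hp : p ∈ S
  · simp only [indicator_of_mem hp]
  · simp only [indicator_of_notMem hp, add_zero]

theorem indicator_sub_eq (f g : ℝ × ℝ → ℝ) :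
    S.indicator (fun p => f p - g p) = fun p => S.indicator f p - S.indicator g p := by
  ext p
  by_cases hp : p ∈ S
  · simp only [indicator_of_mem hp]
  · simp only [indicator_of_notMem hp, sub_zero]

namespace IsDominated

variable {r : ℕ} {w : ℝ × ℝ → ℝ}

theorem isKernel (h : IsDominated U₀ V₀ S r w) : IsKernel U₀ V₀ S w where
  meas := h.meas
  bound := fun p hp => by
    obtain ⟨m, hm, -, hb⟩ := h.bound p hp
    exact ⟨m, fun _ => 1, hm, integrableOn_const (by simp), fun z hz => by simpa using hb z hz⟩

theorem isKernel_sq (h : IsDominated U₀ V₀ S 2 w) : IsKernel U₀ V₀ S (fun p => w p ^ 2) where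
  meas := by
    simp only [sq, indicator_mul_eq]; exact h.meas.mul h.meas
  bound := fun p hp => by
    obtain ⟨m, -, hm, hb⟩ := h.bound p hp
    refine ⟨_, fun _ => 1, hm, integrableOn_const (by simp), fun z hz => ?_⟩
    rw [abs_pow, mul_one]
    exact pow_le_pow_left₀ (abs_nonneg _) (hb z hz) 2

theorem mul_continuousOn (h : IsDominated U₀ V₀ S r w) (hS : IsFutureDomain U₀ V₀ S)
    {k : ℝ × ℝ → ℝ} (hk : ContinuousOn k S) : IsDominated U₀ V₀ S r (fun p => w p * k p) where
  meas := by rw [indicator_mul_eq]; exact h.meas.mul (hS.measurable_indicator hk)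
  bound := fun p hp => by
    obtain ⟨m, h1, h2, hb⟩ := h.bound p hp
    obtain ⟨M, hM, hM'⟩ := hS.exists_bound hk hp
    refine ⟨fun x => m x * M, h1.mul_const M, ?_, fun z hz => ?_⟩
    · simp only [mul_pow]; exact h2.mul_const _
    · rw [abs_mul]
      exact mul_le_mul (hb z hz) (hM' z hz) (abs_nonneg _) ((abs_nonneg _).trans (hb z hz))

theorem mul_swap {w' : ℝ × ℝ → ℝ} (h : IsDominated U₀ V₀ S r w)
    (h' : IsDominated V₀ U₀ (Prod.swap ⁻¹' S) r w') :
    IsKernel U₀ V₀ S (fun p => w p * w' p.swap) where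
  meas := by
    rw [indicator_mul_eq]
    exact h.meas.mul (h'.meas.comp measurable_swap)
  bound := fun p hp => by
    obtain ⟨m, hm, -, hb⟩ := h.bound p hp
    obtain ⟨n, hn, -, hb'⟩ := h'.bound p.swap hp
    refine ⟨m, n, hm, hn, fun z hz => ?_⟩
    rw [abs_mul]
    exact mul_le_mul (hb z hz) (hb' z.swap ⟨hz.2, hz.1⟩) (abs_nonneg _)
      ((abs_nonneg _).trans (hb z hz))

theorem sliceBoundU (h : IsDominated U₀ V₀ S r w) (hS : IsFutureDomain U₀ V₀ S) :
    SliceBoundU S r (S.indicator w) := by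
  intro U₁ U₂ V₁ V₂ hsub
  rcases lt_or_ge U₂ U₁ with hU | hU
  · exact ⟨0, fun V _ => by simp [Icc_eq_empty (not_le.2 hU)]⟩
  rcases lt_or_ge V₂ V₁ with hV | hV
  · exact ⟨0, fun V hV' => absurd (hV'.1.trans hV'.2) (not_le.2 hV)⟩
  have hp : (U₂, V₂) ∈ S := hsub ⟨⟨hU, le_rfl⟩, ⟨hV, le_rfl⟩⟩
  have hp' : (U₁, V₁) ∈ S := hsub ⟨⟨le_rfl, hU⟩, ⟨le_rfl, hV⟩⟩
  obtain ⟨m, -, hm, hb⟩ := h.bound _ hp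
  have hfin : ∫⁻ U in Icc U₀ U₂, ‖m U ^ r‖ₑ < ⊤ := hm.hasFiniteIntegral
  refine ⟨(∫⁻ U in Icc U₀ U₂, ‖m U ^ r‖ₑ).toNNReal, fun V hV' => ?_⟩
  rw [ENNReal.coe_toNNReal hfin.ne]
  have h1 : U₀ ≤ U₁ := hS.le_fst hp'
  have h2 : V₀ ≤ V := (hS.le_snd hp').trans hV'.1
  refine (lintegral_mono_set (Icc_subset_Icc_left h1)).trans ?_
  refine setLIntegral_mono_ae' measurableSet_Icc (Eventually.of_forall fun U hU' => ?_)
  have hz : (U, V) ∈ past U₀ V₀ (U₂, V₂) := ⟨hU', ⟨h2, hV'.2⟩⟩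
  rw [indicator_of_mem (hS.past_subset hp hz), enorm_pow, ENNReal.rpow_natCast]
  refine pow_le_pow_left' ?_ r
  rw [Real.enorm_eq_ofReal_abs, Real.enorm_eq_ofReal_abs]
  exact ENNReal.ofReal_le_ofReal ((hb _ hz).trans (le_abs_self _))

end IsDominated

theorem IsKernel.locallyIntegrableOn {Q : ℝ × ℝ → ℝ} (h : IsKernel U₀ V₀ S Q)
    (hS : IsFutureDomain U₀ V₀ S) : LocallyIntegrableOn Q S :=
  hS.locallyIntegrableOn fun _ hp => h.integrableOn hS hp

theorem IsKernel.add {Q Q' : ℝ × ℝ → ℝ} (h : IsKernel U₀ V₀ S Q) (h' : IsKernel U₀ V₀ S Q') :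
    IsKernel U₀ V₀ S (fun p => Q p + Q' p) where
  meas := by rw [indicator_add_eq]; exact h.meas.add h'.meas
  bound := fun p hp => by
    obtain ⟨m, n, hm, hn, hb⟩ := h.bound p hp
    obtain ⟨m', n', hm', hn', hb'⟩ := h'.bound p hp
    refine ⟨fun x => |m x| + |m' x|, fun x => |n x| + |n' x|, hm.abs.add hm'.abs,
      hn.abs.add hn'.abs, fun z hz => ?_⟩
    have h1 : m z.1 * n z.2 ≤ |m z.1| * |n z.2| := by rw [← abs_mul]; exact le_abs_self _
    have h2 : m' z.1 * n' z.2 ≤ |m' z.1| * |n' z.2| := by rw [← abs_mul]; exact le_abs_self _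
    have h3 := hb z hz
    have h4 := hb' z hz
    have h5 := abs_add_le (Q z) (Q' z)
    nlinarith [mul_nonneg (abs_nonneg (m z.1)) (abs_nonneg (n' z.2)),
      mul_nonneg (abs_nonneg (m' z.1)) (abs_nonneg (n z.2))]

theorem IsKernel.const_mul {Q : ℝ × ℝ → ℝ} (h : IsKernel U₀ V₀ S Q) (k : ℝ) :
    IsKernel U₀ V₀ S (fun p => k * Q p) where
  meas := by
    have : S.indicator (fun p => k * Q p) = fun p => k * S.indicator Q p := by
      ext p
      by_cases hp : p ∈ S
      · simp only [indicator_of_mem hp]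
      · simp only [indicator_of_notMem hp, mul_zero]
    rw [this]; exact h.meas.const_mul k
  bound := fun p hp => by
    obtain ⟨m, n, hm, hn, hb⟩ := h.bound p hp
    refine ⟨fun x => |k| * m x, n, hm.const_mul _, hn, fun z hz => ?_⟩
    rw [abs_mul, mul_assoc]
    exact mul_le_mul_of_nonneg_left (hb z hz) (abs_nonneg k)

namespace IsFutureDomain

variable {p : ℝ × ℝ}

theorem mem_line (hS : IsFutureDomain U₀ V₀ S) (hp : p ∈ S) {x : ℝ} (hx : x ∈ uIcc U₀ p.1) :
    (x, p.2) ∈ S := by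
  rw [uIcc_of_le (hS.le_fst hp)] at hx
  have h := hS.le_snd hp
  exact hS.past_subset hp ⟨hx, ⟨h, le_rfl⟩⟩

theorem mem_line' (hS : IsFutureDomain U₀ V₀ S) (hp : p ∈ S) {y : ℝ} (hy : y ∈ uIcc V₀ p.2) :
    (p.1, y) ∈ S := by
  rw [uIcc_of_le (hS.le_snd hp)] at hy
  have h := hS.le_fst hp
  exact hS.past_subset hp ⟨⟨h, le_rfl⟩, hy⟩

theorem continuousOn_comp_fst (hS : IsFutureDomain U₀ V₀ S)
    {k : ℝ → ℝ} (hk : ∀ p ∈ S, ContinuousOn k (uIcc U₀ p.1)) :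
    ContinuousOn (fun p : ℝ × ℝ => k p.1) S := by
  refine hS.continuousOn_of_past fun p hp => ?_
  refine (hk p hp).comp continuous_fst.continuousOn fun z hz => ?_
  rw [uIcc_of_le (hS.le_fst hp)]; exact hz.1

theorem continuousOn_comp_snd (hS : IsFutureDomain U₀ V₀ S)
    {k : ℝ → ℝ} (hk : ∀ p ∈ S, ContinuousOn k (uIcc V₀ p.2)) :
    ContinuousOn (fun p : ℝ × ℝ => k p.2) S := by
  refine hS.continuousOn_of_past fun p hp => ?_
  refine (hk p hp).comp continuous_snd.continuousOn fun z hz => ?_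
  rw [uIcc_of_le (hS.le_snd hp)]; exact hz.2

end IsFutureDomain

/-! ### The area function -/

/-- The area function `e^{2b} = f(U) + g(V) - 1` of a plane symmetric spacetime, with the first
two derivatives `f₁, f₂` of `f` and `g₁, g₂` of `g`. -/
structure Background (U₀ V₀ : ℝ) (S : Set (ℝ × ℝ)) where
  (f f₁ f₂ g g₁ g₂ : ℝ → ℝ)
  domain : IsFutureDomain U₀ V₀ S
  f_zero : f U₀ = 1
  g_zero : g V₀ = 1
  f_deriv : ∀ p ∈ S, HasACDeriv f f₁ U₀ p.1
  f₁_deriv : ∀ p ∈ S, HasACDeriv f₁ f₂ U₀ p.1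
  g_deriv : ∀ p ∈ S, HasACDeriv g g₁ V₀ p.2
  g₁_deriv : ∀ p ∈ S, HasACDeriv g₁ g₂ V₀ p.2
  pos : ∀ p ∈ S, 0 < f p.1 + g p.2 - 1

namespace Background

variable (B : Background U₀ V₀ S)

/-- The background with the two null directions exchanged. -/
def swap : Background V₀ U₀ (Prod.swap ⁻¹' S) where
  f := B.g
  f₁ := B.g₁
  f₂ := B.g₂
  g := B.f
  g₁ := B.f₁
  g₂ := B.f₂
  domain := B.domain.swap
  f_zero := B.g_zero
  g_zero := B.f_zero
  f_deriv := fun p hp => B.g_deriv p.swap hp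
  f₁_deriv := fun p hp => B.g₁_deriv p.swap hp
  g_deriv := fun p hp => B.f_deriv p.swap hp
  g₁_deriv := fun p hp => B.f₁_deriv p.swap hp
  pos := fun p hp => by have := B.pos p.swap hp; simp only [Prod.fst_swap, Prod.snd_swap] at this; linarith

/-- The area function `e^{2b}`. -/
def s (p : ℝ × ℝ) : ℝ := B.f p.1 + B.g p.2 - 1

/-- The area radius `e^b`. -/
def r (p : ℝ × ℝ) : ℝ := √(B.s p)

/-- The logarithm of the area radius. -/
def b (p : ℝ × ℝ) : ℝ := 1 / 2 * Real.log (B.s p)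

/-- The derivative `b_U`. -/
def bU (p : ℝ × ℝ) : ℝ := B.f₁ p.1 / (2 * B.s p)

/-- The derivative `b_V`. -/
def bV (p : ℝ × ℝ) : ℝ := B.g₁ p.2 / (2 * B.s p)

theorem s_swap (p : ℝ × ℝ) : B.swap.s p = B.s p.swap := by
  simp only [s, swap, Prod.fst_swap, Prod.snd_swap]; ring

theorem r_swap (p : ℝ × ℝ) : B.swap.r p = B.r p.swap := by rw [r, r, s_swap]

theorem b_swap (p : ℝ × ℝ) : B.swap.b p = B.b p.swap := by rw [b, b, s_swap]

theorem bU_swap (p : ℝ × ℝ) : B.swap.bU p = B.bV p.swap := by rw [bU, bV, s_swap]; rfl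

theorem bV_swap (p : ℝ × ℝ) : B.swap.bV p = B.bU p.swap := by rw [bU, bV, s_swap]; rfl

variable {p : ℝ × ℝ}

theorem s_pos (hp : p ∈ S) : 0 < B.s p := B.pos p hp

theorem r_pos (hp : p ∈ S) : 0 < B.r p := Real.sqrt_pos.2 (B.s_pos hp)

theorem r_sq (hp : p ∈ S) : B.r p ^ 2 = B.s p := Real.sq_sqrt (B.s_pos hp).le

theorem continuousOn_s : ContinuousOn B.s S :=
  ((B.domain.continuousOn_comp_fst fun p hp => (B.f_deriv p hp).continuousOn).add
    (B.domain.continuousOn_comp_snd fun p hp => (B.g_deriv p hp).continuousOn)).sub continuousOn_const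

theorem continuousOn_r : ContinuousOn B.r S := B.continuousOn_s.sqrt

theorem continuousOn_b : ContinuousOn B.b S :=
  (B.continuousOn_s.log fun _ hp => (B.s_pos hp).ne').const_mul _ |>.congr fun _ _ => rfl

theorem continuousOn_bU : ContinuousOn B.bU S :=
  (B.domain.continuousOn_comp_fst fun p hp => (B.f₁_deriv p hp).continuousOn).div
    (continuousOn_const.mul B.continuousOn_s) fun _ hp => (mul_pos two_pos (B.s_pos hp)).ne'

theorem continuousOn_bV : ContinuousOn B.bV S :=
  (B.domain.continuousOn_comp_snd fun p hp => (B.g₁_deriv p hp).continuousOn).div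
    (continuousOn_const.mul B.continuousOn_s) fun _ hp => (mul_pos two_pos (B.s_pos hp)).ne'

theorem s_deriv (hp : p ∈ S) : HasACDeriv (fun x => B.s (x, p.2)) B.f₁ U₀ p.1 := by
  have := (B.f_deriv p hp).add (HasACDeriv.const (B.g p.2 - 1))
  exact (this.congr fun t _ => by simp only [s]; ring).congr_deriv
    (Eventually.of_forall fun t _ => by simp)

theorem s_deriv' (hp : p ∈ S) : HasACDeriv (fun y => B.s (p.1, y)) B.g₁ V₀ p.2 := by
  have := (B.g_deriv p hp).add (HasACDeriv.const (B.f p.1 - 1))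
  exact (this.congr fun t _ => by simp only [s]; ring).congr_deriv
    (Eventually.of_forall fun t _ => by simp)

theorem b_deriv (hp : p ∈ S) : HasACDeriv (fun x => B.b (x, p.2)) (fun x => B.bU (x, p.2))
    U₀ p.1 := by
  refine ((B.s_deriv hp).log fun t ht => B.s_pos (B.domain.mem_line hp ht)).const_mul (1 / 2)
    |>.congr_deriv (Eventually.of_forall fun t ht => ?_)
  have := (B.s_pos (B.domain.mem_line hp ht)).ne'
  simp only [bU]; field_simp

theorem r_deriv (hp : p ∈ S) : HasACDeriv (fun x => B.r (x, p.2))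
    (fun x => B.bU (x, p.2) * B.r (x, p.2)) U₀ p.1 := by
  refine (B.s_deriv hp).sqrt (fun t ht => B.s_pos (B.domain.mem_line hp ht))
    |>.congr_deriv (Eventually.of_forall fun t ht => ?_)
  have h1 := B.r_pos (B.domain.mem_line hp ht)
  have h2 := B.r_sq (B.domain.mem_line hp ht)
  change 1 / (2 * B.r (t, p.2)) * _ = _
  simp only [bU, ← h2]
  field_simp

theorem r_deriv' (hp : p ∈ S) : HasACDeriv (fun y => B.r (p.1, y))
    (fun y => B.bV (p.1, y) * B.r (p.1, y)) V₀ p.2 := by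
  have := B.swap.r_deriv (p := p.swap) hp
  simpa only [r_swap, bU_swap, Prod.swap_prod_mk, Prod.fst_swap, Prod.snd_swap] using this

theorem bU_deriv (hp : p ∈ S) : HasACDeriv (fun x => B.bU (x, p.2))
    (fun x => B.f₂ x / (2 * B.s (x, p.2)) - 2 * B.bU (x, p.2) ^ 2) U₀ p.1 := by
  refine (B.f₁_deriv p hp).div ((B.s_deriv hp).const_mul 2)
    (fun t ht => mul_pos two_pos (B.s_pos (B.domain.mem_line hp ht)))
    |>.congr_deriv (Eventually.of_forall fun t ht => ?_)
  have := (B.s_pos (B.domain.mem_line hp ht)).ne'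
  simp only [bU]; field_simp

theorem bU_deriv' (hp : p ∈ S) : HasACDeriv (fun y => B.bU (p.1, y))
    (fun y => - (2 * B.bU (p.1, y) * B.bV (p.1, y))) V₀ p.2 := by
  refine (HasACDeriv.const (B.f₁ p.1)).div ((B.s_deriv' hp).const_mul 2)
    (fun t ht => mul_pos two_pos (B.s_pos (B.domain.mem_line' hp ht)))
    |>.congr_deriv (Eventually.of_forall fun t ht => ?_)
  have := (B.s_pos (B.domain.mem_line' hp ht)).ne'
  simp only [bU, bV]; field_simp; ring

end Background

end

section

/-! ### The wave equation on a given background -/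

namespace Background

variable (B : Background U₀ V₀ S) {p : ℝ × ℝ} {u v : ℝ → ℝ} {c : ℝ × ℝ → ℝ}

/-- The coefficient `b_U b_V = - r_{UV} / r` in the equation `w_{UV} = - b_U b_V w` satisfied by
`w = e^b c` when `c_{UV} + b_V c_U + b_U c_V = 0`. -/
def q (p : ℝ × ℝ) : ℝ := B.bU p * B.bV p

/-- The solution `c` of the wave equation `c_{UV} + b_V c_U + b_U c_V = 0` whose rescaling
`e^b c` is `u` on `V = V₀` and `v` on `U = U₀`, up to additive constants. -/
structure IsWave (u v : ℝ → ℝ) (c : ℝ × ℝ → ℝ) : Prop where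
  cont : ContinuousOn c S
  u_ac : ∀ p ∈ S, AbsolutelyContinuousOnInterval u U₀ p.1
  u_sq : ∀ p ∈ S, IntegrableOn (fun x => deriv u x ^ 2) (Icc U₀ p.1)
  v_ac : ∀ p ∈ S, AbsolutelyContinuousOnInterval v V₀ p.2
  v_sq : ∀ p ∈ S, IntegrableOn (fun x => deriv v x ^ 2) (Icc V₀ p.2)
  eq : ∀ p ∈ S, B.r p * c p = u p.1 + v p.2 - ∫ z in past U₀ V₀ p, B.q z * (B.r z * c z)

/-- The derivative `c_U` of a solution of the wave equation. -/
def slopeU (u : ℝ → ℝ) (c : ℝ × ℝ → ℝ) (p : ℝ × ℝ) : ℝ :=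
  (deriv u p.1 - ∫ y in V₀..p.2, B.q (p.1, y) * (B.r (p.1, y) * c (p.1, y))) / B.r p - B.bU p * c p

/-- The derivative `c_V` of a solution of the wave equation. -/
def slopeV (v : ℝ → ℝ) (c : ℝ × ℝ → ℝ) (p : ℝ × ℝ) : ℝ :=
  B.swap.slopeU v (fun p => c p.swap) p.swap

theorem q_swap (p : ℝ × ℝ) : B.swap.q p = B.q p.swap := by
  rw [q, q, bU_swap, bV_swap, mul_comm]

theorem continuousOn_q : ContinuousOn B.q S := B.continuousOn_bU.mul B.continuousOn_bV

theorem slopeV_swap (p : ℝ × ℝ) : B.swap.slopeV v (fun p => c p.swap) p = B.slopeU v c p.swap := by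
  simp only [slopeV, slopeU, q_swap, r_swap, bU_swap, bV_swap, Prod.swap_swap, Prod.swap_prod_mk,
    Prod.fst_swap, Prod.snd_swap]

theorem slopeU_swap (p : ℝ × ℝ) : B.swap.slopeU v (fun p => c p.swap) p = B.slopeV v c p.swap := by
  rw [slopeV, Prod.swap_swap]

namespace IsWave

variable {B}

theorem swap (h : B.IsWave u v c) : B.swap.IsWave v u (fun p => c p.swap) where
  cont := h.cont.comp continuous_swap.continuousOn fun _ hp => hp
  u_ac := fun p hp => h.v_ac p.swap hp
  u_sq := fun p hp => h.v_sq p.swap hp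
  v_ac := fun p hp => h.u_ac p.swap hp
  v_sq := fun p hp => h.u_sq p.swap hp
  eq := fun p hp => by
    simp only [r_swap, q_swap]
    have h1 := h.eq p.swap hp
    rw [h1, ← setIntegral_past_swap (U₀ := U₀) (V₀ := V₀) (p := p.swap), Prod.swap_swap]
    simp only [Prod.fst_swap, Prod.snd_swap]
    ring

theorem continuousOn_kernel (h : B.IsWave u v c) :
    ContinuousOn (fun p => B.q p * (B.r p * c p)) S :=
  B.continuousOn_q.mul (B.continuousOn_r.mul h.cont)

theorem mul_deriv (h : B.IsWave u v c) (hp : p ∈ S) :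
    HasACDeriv (fun x => B.r (x, p.2) * c (x, p.2)) (fun x => deriv u x
      - ∫ y in V₀..p.2, B.q (x, y) * (B.r (x, y) * c (x, y))) U₀ p.1 := by
  have h1 := (B.domain.isKernel_of_continuousOn h.continuousOn_kernel).hasACDeriv_integral
    B.domain hp
  have h2 := (((HasACDeriv.of_ac (h.u_ac p hp)).add (HasACDeriv.const (v p.2))).sub h1)
  refine (h2.congr fun t ht => ?_).congr_deriv (Eventually.of_forall fun t _ => by simp)
  exact (h.eq _ (B.domain.mem_line hp ht)).symm

theorem deriv_U (h : B.IsWave u v c) (hp : p ∈ S) :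
    HasACDeriv (fun x => c (x, p.2)) (fun x => B.slopeU u c (x, p.2)) U₀ p.1 := by
  have hr : ∀ t ∈ uIcc U₀ p.1, 0 < B.r (t, p.2) := fun t ht => B.r_pos (B.domain.mem_line hp ht)
  refine (((h.mul_deriv hp).div (B.r_deriv hp) hr).congr fun t ht => ?_).congr_deriv
    (Eventually.of_forall fun t ht => ?_)
  · have := (hr t ht).ne'
    field_simp
  · have := (hr t ht).ne'
    simp only [slopeU]
    field_simp

theorem deriv_V (h : B.IsWave u v c) (hp : p ∈ S) :
    HasACDeriv (fun y => c (p.1, y)) (fun y => B.slopeV v c (p.1, y)) V₀ p.2 :=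
  h.swap.deriv_U (p := p.swap) hp

/-- The derivative `c_U` is absolutely continuous in `V` for every `U`. -/
theorem slopeU_deriv (h : B.IsWave u v c) (hp : p ∈ S) :
    HasACDeriv (fun y => B.slopeU u c (p.1, y)) (fun y => - (B.bV (p.1, y) * B.slopeU u c (p.1, y)
      + B.bU (p.1, y) * B.slopeV v c (p.1, y))) V₀ p.2 := by
  have hr : ∀ t ∈ uIcc V₀ p.2, 0 < B.r (p.1, t) := fun t ht => B.r_pos (B.domain.mem_line' hp ht)
  have h0 := (B.domain.isKernel_of_continuousOn h.continuousOn_kernel).slice B.domain hp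
  have h1 := (HasACDeriv.const (deriv u p.1)).sub (HasACDeriv.of_integral h0 left_mem_uIcc)
  refine ((h1.div (B.r_deriv' hp) hr).sub ((B.bU_deriv' hp).mul (h.deriv_V hp))).congr_deriv
    (Eventually.of_forall fun t ht => ?_)
  have := (hr t ht).ne'
  simp only [slopeU, q]
  field_simp
  ring

theorem isDominated (h : B.IsWave u v c) : IsDominated U₀ V₀ S 2 (B.slopeU u c) where
  meas := by
    have m1 := (B.domain.isKernel_of_continuousOn h.continuousOn_kernel).measurable_integral_slice
      B.domain
    have m2 : Measurable (S.indicator fun p : ℝ × ℝ => deriv u p.1) :=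
      ((measurable_deriv u).comp measurable_fst).indicator B.domain.measurableSet
    have m3 := B.domain.measurable_indicator
      (B.continuousOn_r.inv₀ fun _ hp => (B.r_pos hp).ne')
    have m4 := B.domain.measurable_indicator (B.continuousOn_bU.mul h.cont)
    have e : B.slopeU u c = fun p => (deriv u p.1
      - ∫ y in V₀..p.2, B.q (p.1, y) * (B.r (p.1, y) * c (p.1, y))) * (B.r p)⁻¹
      - B.bU p * c p := by ext p; rw [slopeU, div_eq_mul_inv]
    rw [e, indicator_sub_eq, indicator_mul_eq, indicator_sub_eq]
    exact ((m2.sub m1).mul m3).sub m4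
  bound := fun p hp => by
    obtain ⟨M₁, p1, h1⟩ := B.domain.exists_bound (B.domain.continuousOn_integral_snd
      h.continuousOn_kernel) hp
    obtain ⟨M₂, p2, h2⟩ := B.domain.exists_bound
      (B.continuousOn_r.inv₀ fun _ hp => (B.r_pos hp).ne') hp
    obtain ⟨M₃, p3, h3⟩ := B.domain.exists_bound (B.continuousOn_bU.mul h.cont) hp
    have i1 : IntegrableOn (deriv u) (Icc U₀ p.1) :=
      (intervalIntegrable_iff_integrableOn_Icc_of_le (B.domain.le_fst hp)).1
        (HasACDeriv.of_ac (h.u_ac p hp)).intervalIntegrable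
    refine ⟨fun x => |deriv u x| * M₂ + (M₁ * M₂ + M₃), (i1.abs.mul_const _).add
      (integrableOn_const (by simp)), ?_, fun z hz => ?_⟩
    · have e : (fun x => (|deriv u x| * M₂ + (M₁ * M₂ + M₃)) ^ 2) = fun x =>
        deriv u x ^ 2 * M₂ ^ 2 + |deriv u x| * (2 * M₂ * (M₁ * M₂ + M₃)) + (M₁ * M₂ + M₃) ^ 2 := by
        ext x; rw [← sq_abs (deriv u x)]; ring
      rw [e]
      exact (((h.u_sq p hp).mul_const _).add (i1.abs.mul_const _)).add (integrableOn_const (by simp))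
    · have a1 := h1 z hz
      have a2 : |(B.r z)⁻¹| ≤ M₂ := h2 z hz
      have a3 : |B.bU z * c z| ≤ M₃ := h3 z hz
      rw [slopeU, div_eq_mul_inv]
      refine (abs_sub _ _).trans ?_
      rw [abs_mul]
      have a4 := (abs_sub (deriv u z.1)
        (∫ y in V₀..z.2, B.q (z.1, y) * (B.r (z.1, y) * c (z.1, y)))).trans
        (add_le_add le_rfl a1)
      have := mul_le_mul a4 a2 (abs_nonneg _) (by positivity)
      linarith

end IsWave
end Background

end

section

/-! ### Solutions in integrated form -/

/-- Metric coefficients and potential on a future domain that satisfy the wave equations for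
`b, c, ψ, a` in integrated form. -/
structure Solution (κ U₀ V₀ : ℝ) (S : Set (ℝ × ℝ)) extends Background U₀ V₀ S where
  (u v uψ vψ α β : ℝ → ℝ)
  (a c ψ : ℝ × ℝ → ℝ)
  wave_c : toBackground.IsWave u v c
  wave_ψ : toBackground.IsWave uψ vψ ψ
  α_ac : ∀ p ∈ S, AbsolutelyContinuousOnInterval α U₀ p.1
  β_ac : ∀ p ∈ S, AbsolutelyContinuousOnInterval β V₀ p.2
  a_eq : ∀ p ∈ S, a p = α p.1 + β p.2 + ∫ z in past U₀ V₀ p, (toBackground.q z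
    - toBackground.slopeU u c z * toBackground.slopeV v c z
    - κ * toBackground.slopeU uψ ψ z * toBackground.slopeV vψ ψ z)

namespace Solution

variable {κ : ℝ} (X : Solution κ U₀ V₀ S) {p : ℝ × ℝ}

/-- The derivative `c_U`. -/
def cU : ℝ × ℝ → ℝ := X.slopeU X.u X.c

/-- The derivative `c_V`. -/
def cV : ℝ × ℝ → ℝ := X.slopeV X.v X.c

/-- The derivative `ψ_U`. -/
def ψU : ℝ × ℝ → ℝ := X.slopeU X.uψ X.ψ

/-- The derivative `ψ_V`. -/
def ψV : ℝ × ℝ → ℝ := X.slopeV X.vψ X.ψ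

/-- The mixed derivative `a_{UV}`. -/
def aUV (z : ℝ × ℝ) : ℝ := X.q z - X.cU z * X.cV z - κ * X.ψU z * X.ψV z

/-- The derivative `a_U`. -/
def aU (p : ℝ × ℝ) : ℝ := deriv X.α p.1 + ∫ y in V₀..p.2, X.aUV (p.1, y)

/-- The solution with the two null directions exchanged. -/
def swap : Solution κ V₀ U₀ (Prod.swap ⁻¹' S) where
  toBackground := X.toBackground.swap
  u := X.v
  v := X.u
  uψ := X.vψ
  vψ := X.uψ
  α := X.β
  β := X.α
  a := fun p => X.a p.swap
  c := fun p => X.c p.swap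
  ψ := fun p => X.ψ p.swap
  wave_c := X.wave_c.swap
  wave_ψ := X.wave_ψ.swap
  α_ac := fun p hp => X.β_ac p.swap hp
  β_ac := fun p hp => X.α_ac p.swap hp
  a_eq := fun p hp => by
    simp only [Background.q_swap, Background.slopeU_swap, Background.slopeV_swap]
    rw [X.a_eq p.swap hp, ← setIntegral_past_swap (U₀ := U₀) (V₀ := V₀) (p := p.swap),
      Prod.swap_swap, add_comm (X.α _)]
    simp only [Prod.fst_swap, Prod.snd_swap]
    congr 2
    ext z
    ring

/-- The derivative `a_V`. -/
def aV (p : ℝ × ℝ) : ℝ := X.swap.aU p.swap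

theorem cU_swap (p : ℝ × ℝ) : X.swap.cU p = X.cV p.swap := X.slopeU_swap p

theorem ψU_swap (p : ℝ × ℝ) : X.swap.ψU p = X.ψV p.swap := X.slopeU_swap p

theorem ψV_swap (p : ℝ × ℝ) : X.swap.ψV p = X.ψU p.swap := X.slopeV_swap p

theorem cU_dominated : IsDominated U₀ V₀ S 2 X.cU := X.wave_c.isDominated

theorem ψU_dominated : IsDominated U₀ V₀ S 2 X.ψU := X.wave_ψ.isDominated

theorem cV_dominated : IsDominated V₀ U₀ (Prod.swap ⁻¹' S) 2 (fun p => X.cV p.swap) := by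
  have := X.swap.cU_dominated
  rwa [funext X.cU_swap] at this

theorem ψV_dominated : IsDominated V₀ U₀ (Prod.swap ⁻¹' S) 2 (fun p => X.ψV p.swap) := by
  have := X.swap.ψU_dominated
  rwa [funext X.ψU_swap] at this

theorem cU_mul_cV : IsKernel U₀ V₀ S (fun p => X.cU p * X.cV p) := by
  simpa only [Prod.swap_swap] using X.cU_dominated.mul_swap X.cV_dominated

theorem ψU_mul_ψV : IsKernel U₀ V₀ S (fun p => X.ψU p * X.ψV p) := by
  simpa only [Prod.swap_swap] using X.ψU_dominated.mul_swap X.ψV_dominated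

theorem isKernel_aUV : IsKernel U₀ V₀ S X.aUV := by
  have := ((X.domain.isKernel_of_continuousOn X.continuousOn_q).add
    (X.cU_mul_cV.const_mul (-1))).add (X.ψU_mul_ψV.const_mul (-κ))
  convert this using 1
  ext p; simp only [aUV]; ring

theorem continuousOn_a : ContinuousOn X.a S :=
  (((X.domain.continuousOn_comp_fst fun p hp =>
    (HasACDeriv.of_ac (X.α_ac p hp)).continuousOn).add (X.domain.continuousOn_comp_snd fun p hp =>
    (HasACDeriv.of_ac (X.β_ac p hp)).continuousOn)).add
    (X.isKernel_aUV.continuousOn_integral X.domain)).congr fun p hp => X.a_eq p hp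

theorem a_deriv (hp : p ∈ S) : HasACDeriv (fun x => X.a (x, p.2)) (fun x => X.aU (x, p.2))
    U₀ p.1 := by
  have h1 := X.isKernel_aUV.hasACDeriv_integral X.domain hp
  have h2 := (((HasACDeriv.of_ac (X.α_ac p hp)).add (HasACDeriv.const (X.β p.2))).add h1)
  refine (h2.congr fun t ht => ?_).congr_deriv (Eventually.of_forall fun t _ => by simp [aU])
  exact (X.a_eq _ (X.domain.mem_line hp ht)).symm

theorem aU_deriv (hp : p ∈ S) : HasACDeriv (fun y => X.aU (p.1, y)) (fun y => X.aUV (p.1, y))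
    V₀ p.2 := by
  have h0 := X.isKernel_aUV.slice X.domain hp
  exact ((HasACDeriv.const (deriv X.α p.1)).add (HasACDeriv.of_integral h0 left_mem_uIcc)).congr_deriv
    (Eventually.of_forall fun t ht => by simp)

theorem aU_dominated : IsDominated U₀ V₀ S 1 X.aU where
  meas := by
    have e : X.aU = fun p => deriv X.α p.1 + ∫ y in V₀..p.2, X.aUV (p.1, y) := rfl
    rw [e, indicator_add_eq]
    exact (((measurable_deriv X.α).comp measurable_fst).indicator X.domain.measurableSet).add
      (X.isKernel_aUV.measurable_integral_slice X.domain)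
  bound := fun p hp => by
    obtain ⟨m, n, hm, hn, hb⟩ := X.isKernel_aUV.bound p hp
    have i1 : IntegrableOn (deriv X.α) (Icc U₀ p.1) :=
      (intervalIntegrable_iff_integrableOn_Icc_of_le (X.domain.le_fst hp)).1
        (HasACDeriv.of_ac (X.α_ac p hp)).intervalIntegrable
    have i2 : IntegrableOn (fun x => |deriv X.α x| + |m x| * ∫ y in Icc V₀ p.2, |n y|)
      (Icc U₀ p.1) := i1.abs.add (hm.abs.mul_const _)
    refine ⟨_, i2, by simpa only [pow_one] using i2, fun z hz => ?_⟩
    refine (abs_add_le _ _).trans (add_le_add le_rfl ?_)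
    have hz2 : V₀ ≤ z.2 := hz.2.1
    rw [intervalIntegral.integral_of_le hz2, ← integral_Icc_eq_integral_Ioc]
    calc |∫ y in Icc V₀ z.2, X.aUV (z.1, y)| ≤ ∫ y in Icc V₀ z.2, |m z.1| * |n y| := by
          have hi : IntegrableOn (fun y => |m z.1| * |n y|) (Icc V₀ z.2) :=
            (hn.mono_set (Icc_subset_Icc_right hz.2.2)).abs.const_mul _
          have hle : ∀ᵐ y ∂(volume.restrict (Icc V₀ z.2)),
              ‖X.aUV (z.1, y)‖ ≤ |m z.1| * |n y| := by
            filter_upwards [ae_restrict_mem measurableSet_Icc] with y hy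
            have := hb (z.1, y) ⟨hz.1, ⟨hy.1, hy.2.trans hz.2.2⟩⟩
            rw [← abs_mul]
            exact this.trans (le_abs_self _)
          exact norm_integral_le_of_norm_le hi hle
      _ = |m z.1| * ∫ y in Icc V₀ z.2, |n y| := integral_const_mul _ _
      _ ≤ |m z.1| * ∫ y in Icc V₀ p.2, |n y| := by
          refine mul_le_mul_of_nonneg_left ?_ (abs_nonneg _)
          exact setIntegral_mono_set hn.abs (Eventually.of_forall fun y => abs_nonneg _)
            (Icc_subset_Icc_right hz.2.2).eventuallyLE

/-! ### Propagation of the constraints -/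

/-- The constraint equation in the direction of `U`, multiplied by the area function. -/
def constraint (p : ℝ × ℝ) : ℝ :=
  X.s p * (2 * X.aU p * X.bU p + X.bU p ^ 2 - X.cU p ^ 2 - κ * X.ψU p ^ 2) - X.f₂ p.1 / 2

/-- The wave equations propagate the constraint in the direction of `U` along the lines
`U = const`. -/
theorem constraint_eq (hp : p ∈ S) : X.constraint p = X.constraint (p.1, V₀) := by
  have h1 := X.s_deriv' hp
  have h2 := X.aU_deriv hp
  have h3 := X.bU_deriv' hp
  have h4 : HasACDeriv (fun y => X.cU (p.1, y)) (fun y => - (X.bV (p.1, y) * X.cU (p.1, y)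
      + X.bU (p.1, y) * X.cV (p.1, y))) V₀ p.2 := X.wave_c.slopeU_deriv hp
  have h5 : HasACDeriv (fun y => X.ψU (p.1, y)) (fun y => - (X.bV (p.1, y) * X.ψU (p.1, y)
      + X.bU (p.1, y) * X.ψV (p.1, y))) V₀ p.2 := X.wave_ψ.slopeU_deriv hp
  have h6 := (h1.mul ((((h2.const_mul 2).mul h3).add (h3.mul h3)).sub
    ((h4.mul h4).add ((h5.mul h5).const_mul κ)))).sub (HasACDeriv.const (X.f₂ p.1 / 2))
  have h7 := h6.eq_of_deriv_zero (Eventually.of_forall fun t ht => by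
    have hs := (X.s_pos (X.domain.mem_line' hp ht)).ne'
    have hg : X.g₁ t = 2 * X.s (p.1, t) * X.bV (p.1, t) := by
      simp only [Background.bV]; field_simp
    simp only [aUV, Background.q, hg]
    ring)
  simp only [constraint]
  linear_combination h7

/-- The constraint, imposed on the initial hypersurface, holds in integrated form along every null
line. -/
theorem constraint_U_of_axis (hN : ∀ᵐ U : ℝ, (U, V₀) ∈ S → X.constraint (U, V₀) = 0)
    (hp : p ∈ S) : HasACDeriv (fun x => X.bU (x, p.2)) (fun x => 2 * X.aU (x, p.2) * X.bU (x, p.2)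
      - X.bU (x, p.2) ^ 2 - X.cU (x, p.2) ^ 2 - κ * X.ψU (x, p.2) ^ 2) U₀ p.1 := by
  refine (X.bU_deriv hp).congr_deriv ?_
  filter_upwards [hN] with t hN ht
  have hm := X.domain.mem_line hp ht
  have h1 := X.constraint_eq hm
  rw [hN (X.domain.mem_fst hm)] at h1
  simp only [constraint] at h1
  have hs := (X.s_pos hm).ne'
  field_simp
  linear_combination (-2) * h1

end Solution

end

section

/-! ### The Einstein equations in the sense of distributions -/

theorem IsTest.eq_zero {φ : ℝ × ℝ → ℝ} (h : IsTest S φ) {p : ℝ × ℝ} (hp : p ∉ S) :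
    φ p = 0 ∧ dU φ p = 0 ∧ dV φ p = 0 := by
  have : p ∉ tsupport φ := fun hh => hp (interior_subset (h.supp hh))
  exact ⟨image_eq_zero_of_notMem_tsupport this, dU_eq_zero this, dV_eq_zero this⟩

theorem IsWeakDU.congr {f g g' : ℝ × ℝ → ℝ} (h : IsWeakDU S f g) (he : EqOn g' g S) :
    IsWeakDU S f g' := by
  intro φ hφ
  rw [h φ hφ]
  congr 2
  ext p
  by_cases hp : p ∈ S
  · rw [he hp]
  · rw [(hφ.eq_zero hp).1, mul_zero, mul_zero]

theorem IsWeakDV.congr {f g g' : ℝ × ℝ → ℝ} (h : IsWeakDV S f g) (he : EqOn g' g S) :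
    IsWeakDV S f g' := by
  intro φ hφ
  rw [h φ hφ]
  congr 2
  ext p
  by_cases hp : p ∈ S
  · rw [he hp]
  · rw [(hφ.eq_zero hp).1, mul_zero, mul_zero]

theorem IsWeakDU.integral_eq_zero {f g F φ : ℝ × ℝ → ℝ} (h : IsWeakDU S f g) (hφ : IsTest S φ)
    (hf : LocallyIntegrableOn f S) (hg : LocallyIntegrableOn g S)
    (hF : ∀ p ∈ S, F p = f p * dU φ p + g p * φ p) (h0 : ∀ p ∉ S, F p = 0) : ∫ p, F p = 0 := by
  have e : F = fun p => f p * dU φ p + g p * φ p := by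
    ext p
    by_cases hp : p ∈ S
    · exact hF p hp
    · rw [h0 p hp, (hφ.eq_zero hp).1, (hφ.eq_zero hp).2.1, mul_zero, mul_zero, add_zero]
  rw [e, integral_add (hφ.integrable_mul_dU hf) (hφ.integrable_mul hg), h φ hφ, neg_add_cancel]

theorem IsWeakDV.integral_eq_zero {f g F φ : ℝ × ℝ → ℝ} (h : IsWeakDV S f g) (hφ : IsTest S φ)
    (hf : LocallyIntegrableOn f S) (hg : LocallyIntegrableOn g S)
    (hF : ∀ p ∈ S, F p = - (f p * dV φ p + g p * φ p)) (h0 : ∀ p ∉ S, F p = 0) :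
    ∫ p, F p = 0 := by
  have e : F = fun p => - (f p * dV φ p + g p * φ p) := by
    ext p
    by_cases hp : p ∈ S
    · exact hF p hp
    · rw [h0 p hp, (hφ.eq_zero hp).1, (hφ.eq_zero hp).2.2, mul_zero, mul_zero, add_zero, neg_zero]
  rw [e, integral_neg, integral_add (hφ.integrable_mul_dV hf) (hφ.integrable_mul hg), h φ hφ,
    neg_add_cancel, neg_zero]

theorem IsFutureDomain.locallyIntegrableOn_of_continuousOn (hS : IsFutureDomain U₀ V₀ S)
    {k : ℝ × ℝ → ℝ} (hk : ContinuousOn k S) : LocallyIntegrableOn k S :=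
  (hS.isKernel_of_continuousOn hk).locallyIntegrableOn hS

theorem sliceBoundV_of_swap {r : ℝ} {w : ℝ × ℝ → ℝ}
    (h : SliceBoundU (Prod.swap ⁻¹' S) r (fun p => w p.swap)) : SliceBoundV S r w := by
  intro U₁ U₂ V₁ V₂ hsub
  exact h V₁ V₂ U₁ U₂ fun p hp => hsub ⟨hp.2, hp.1⟩

theorem measurable_of_swap {w : ℝ × ℝ → ℝ} (h : Measurable fun p : ℝ × ℝ => w p.swap) :
    Measurable w := by
  simpa [Function.comp_def] using h.comp measurable_swap

theorem IsFutureDomain.isWeakDU_indicator (hS : IsFutureDomain U₀ V₀ S) {f g : ℝ × ℝ → ℝ}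
    (hf : LocallyIntegrableOn f S) (hg : LocallyIntegrableOn g S)
    (h : ∀ p ∈ S, HasACDeriv (fun x => f (x, p.2)) (fun x => g (x, p.2)) U₀ p.1) :
    IsWeakDU S f (S.indicator g) :=
  (hS.isWeakDU hf hg h).congr fun _ hp => indicator_of_mem hp _

namespace Solution

variable {κ : ℝ} (X : Solution κ U₀ V₀ S) {p : ℝ × ℝ}

/-- The coefficients of the metric and the potential of a solution. -/
def fields : Fields := ⟨X.a, X.b, X.c, X.ψ⟩

/-- The derivatives of the coefficients of a solution, set equal to zero outside of the domain
so as to be measurable on the plane. -/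
def derivs : Derivs where
  aU := S.indicator X.aU
  aV := S.indicator X.aV
  bU := X.bU
  bV := X.bV
  cU := S.indicator X.cU
  cV := S.indicator X.cV
  ψU := S.indicator X.ψU
  ψV := S.indicator X.ψV

theorem indicator_swap (w w' : ℝ × ℝ → ℝ) (h : ∀ p, w' p = w p.swap) :
    (fun p : ℝ × ℝ => S.indicator w p.swap) = (Prod.swap ⁻¹' S).indicator w' := by
  ext p
  rw [funext h]
  rfl

theorem aU_swap (p : ℝ × ℝ) : X.swap.aU p = X.aV p.swap := by rw [aV, Prod.swap_swap]

theorem isWeakDU_a : IsWeakDU S X.a (S.indicator X.aU) :=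
  X.domain.isWeakDU_indicator (X.domain.locallyIntegrableOn_of_continuousOn X.continuousOn_a)
    (X.aU_dominated.isKernel.locallyIntegrableOn X.domain) fun _ hp => X.a_deriv hp

theorem isWeakDU_b : IsWeakDU S X.b X.bU :=
  X.domain.isWeakDU (X.domain.locallyIntegrableOn_of_continuousOn X.continuousOn_b)
    (X.domain.locallyIntegrableOn_of_continuousOn X.continuousOn_bU) fun _ hp => X.b_deriv hp

theorem isWeakDU_c : IsWeakDU S X.c (S.indicator X.cU) :=
  X.domain.isWeakDU_indicator (X.domain.locallyIntegrableOn_of_continuousOn X.wave_c.cont)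
    (X.cU_dominated.isKernel.locallyIntegrableOn X.domain) fun _ hp => X.wave_c.deriv_U hp

theorem isWeakDU_ψ : IsWeakDU S X.ψ (S.indicator X.ψU) :=
  X.domain.isWeakDU_indicator (X.domain.locallyIntegrableOn_of_continuousOn X.wave_ψ.cont)
    (X.ψU_dominated.isKernel.locallyIntegrableOn X.domain) fun _ hp => X.wave_ψ.deriv_U hp

theorem swap_b : X.swap.b = fun p => X.b p.swap := funext X.toBackground.b_swap

theorem swap_bU : X.swap.bU = fun p => X.bV p.swap := funext X.toBackground.bU_swap

theorem swap_bV : X.swap.bV = fun p => X.bU p.swap := funext X.toBackground.bV_swap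

theorem isRegular : IsRegular S X.fields X.derivs where
  a_cont := X.continuousOn_a
  b_cont := X.continuousOn_b
  c_cont := X.wave_c.cont
  ψ_cont := X.wave_ψ.cont
  aU_meas := X.aU_dominated.meas
  cU_meas := X.cU_dominated.meas
  ψU_meas := X.ψU_dominated.meas
  aV_meas := measurable_of_swap (by
    rw [derivs, indicator_swap X.aV _ X.aU_swap]; exact X.swap.aU_dominated.meas)
  cV_meas := measurable_of_swap (by
    rw [derivs, indicator_swap X.cV _ X.cU_swap]; exact X.swap.cU_dominated.meas)
  ψV_meas := measurable_of_swap (by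
    rw [derivs, indicator_swap X.ψV _ X.ψU_swap]; exact X.swap.ψU_dominated.meas)
  aU_weak := X.isWeakDU_a
  aV_weak := isWeakDV_of_swap (by
    rw [derivs, indicator_swap X.aV _ X.aU_swap]; exact X.swap.isWeakDU_a)
  bU_weak := X.isWeakDU_b
  bV_weak := isWeakDV_of_swap (by
    have := X.swap.isWeakDU_b; rwa [swap_b, swap_bU] at this)
  cU_weak := X.isWeakDU_c
  cV_weak := isWeakDV_of_swap (by
    rw [derivs, indicator_swap X.cV _ X.cU_swap]; exact X.swap.isWeakDU_c)
  ψU_weak := X.isWeakDU_ψ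
  ψV_weak := isWeakDV_of_swap (by
    rw [derivs, indicator_swap X.ψV _ X.ψU_swap]; exact X.swap.isWeakDU_ψ)
  aU_bound := by
    have h := X.aU_dominated.sliceBoundU X.domain
    rw [Nat.cast_one] at h; exact h
  aV_bound := sliceBoundV_of_swap (by
    rw [derivs, indicator_swap X.aV _ X.aU_swap]
    have h := X.swap.aU_dominated.sliceBoundU X.swap.domain
    rw [Nat.cast_one] at h; exact h)
  bU_cont := X.continuousOn_bU
  bV_cont := X.continuousOn_bV
  cU_bound := by
    have h := X.cU_dominated.sliceBoundU X.domain
    rw [Nat.cast_ofNat] at h; exact h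
  cV_bound := sliceBoundV_of_swap (by
    rw [derivs, indicator_swap X.cV _ X.cU_swap]
    have h := X.swap.cU_dominated.sliceBoundU X.swap.domain
    rw [Nat.cast_ofNat] at h; exact h)
  ψU_bound := by
    have h := X.ψU_dominated.sliceBoundU X.domain
    rw [Nat.cast_ofNat] at h; exact h
  ψV_bound := sliceBoundV_of_swap (by
    rw [derivs, indicator_swap X.ψV _ X.ψU_swap]
    have h := X.swap.ψU_dominated.sliceBoundU X.swap.domain
    rw [Nat.cast_ofNat] at h; exact h)

theorem isKernel_constraint : IsKernel U₀ V₀ S (fun p => 2 * X.aU p * X.bU p - X.bU p ^ 2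
    - X.cU p ^ 2 - κ * X.ψU p ^ 2) := by
  have h1 := (X.aU_dominated.mul_continuousOn X.domain X.continuousOn_bU).isKernel.const_mul 2
  have h2 := (X.domain.isKernel_of_continuousOn (X.continuousOn_bU.pow 2)).const_mul (-1)
  have h3 := X.cU_dominated.isKernel_sq.const_mul (-1)
  have h4 := X.ψU_dominated.isKernel_sq.const_mul (-κ)
  convert ((h1.add h2).add h3).add h4 using 1
  ext p; simp only [Pi.pow_apply]; ring

/-- An integrated solution whose constraints hold on the two initial hypersurfaces satisfies all
field equations in the sense of distributions. -/
theorem solvesEinstein (hU : ∀ᵐ U : ℝ, (U, V₀) ∈ S → X.constraint (U, V₀) = 0)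
    (hV : ∀ᵐ V : ℝ, (U₀, V) ∈ S → X.swap.constraint (V, U₀) = 0) :
    SolvesEinstein κ S X.derivs where
  potential := fun φ hφ => by
    have l1 := (X.ψU_dominated.mul_continuousOn X.domain X.continuousOn_bV).isKernel
    have l2 : IsKernel U₀ V₀ S (fun p => X.ψV p * X.bU p) := by
      have := X.ψV_dominated.mul_continuousOn X.swap.domain X.swap.continuousOn_bV
      rw [swap_bV] at this
      exact this.isKernel.swap
    have l3 := (l1.add l2).const_mul (-1)
    have l0 := X.ψU_dominated.isKernel
    refine (X.domain.isWeakDV (l0.locallyIntegrableOn X.domain) (l3.locallyIntegrableOn X.domain)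
      fun p hp => ?_).integral_eq_zero hφ (l0.locallyIntegrableOn X.domain)
        (l3.locallyIntegrableOn X.domain) (fun p hp => ?_) fun p hp => ?_
    · exact (X.wave_ψ.slopeU_deriv hp).congr_deriv (Eventually.of_forall fun t _ => by
        simp only [ψU, ψV]; ring)
    · simp only [derivs, indicator_of_mem hp]; ring
    · rw [(hφ.eq_zero hp).1, (hφ.eq_zero hp).2.2]; ring
  wave_c := fun φ hφ => by
    have l1 := (X.cU_dominated.mul_continuousOn X.domain X.continuousOn_bV).isKernel
    have l2 : IsKernel U₀ V₀ S (fun p => X.cV p * X.bU p) := by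
      have := X.cV_dominated.mul_continuousOn X.swap.domain X.swap.continuousOn_bV
      rw [swap_bV] at this
      exact this.isKernel.swap
    have l3 := (l1.add l2).const_mul (-1)
    have l0 := X.cU_dominated.isKernel
    refine (X.domain.isWeakDV (l0.locallyIntegrableOn X.domain) (l3.locallyIntegrableOn X.domain)
      fun p hp => ?_).integral_eq_zero hφ (l0.locallyIntegrableOn X.domain)
        (l3.locallyIntegrableOn X.domain) (fun p hp => ?_) fun p hp => ?_
    · exact (X.wave_c.slopeU_deriv hp).congr_deriv (Eventually.of_forall fun t _ => by
        simp only [cU, cV]; ring)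
    · simp only [derivs, indicator_of_mem hp]; ring
    · rw [(hφ.eq_zero hp).1, (hφ.eq_zero hp).2.2]; ring
  wave_b := fun φ hφ => by
    have l0 := X.domain.locallyIntegrableOn_of_continuousOn X.continuousOn_bU
    have l1 : LocallyIntegrableOn (fun p => - (2 * X.bU p * X.bV p)) S :=
      X.domain.locallyIntegrableOn_of_continuousOn
        ((continuousOn_const.mul X.continuousOn_bU).mul X.continuousOn_bV).neg
    refine (X.domain.isWeakDV l0 l1 fun p hp => X.bU_deriv' hp).integral_eq_zero hφ l0 l1
      (fun p hp => ?_) fun p hp => ?_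
    · simp only [derivs]; ring
    · rw [(hφ.eq_zero hp).1, (hφ.eq_zero hp).2.2]; ring
  constraint_U := fun φ hφ => by
    have l0 := X.domain.locallyIntegrableOn_of_continuousOn X.continuousOn_bU
    have l1 := X.isKernel_constraint.locallyIntegrableOn X.domain
    refine (X.domain.isWeakDU l0 l1 fun p hp => X.constraint_U_of_axis hU hp).integral_eq_zero hφ
      l0 l1 (fun p hp => ?_) fun p hp => ?_
    · simp only [derivs, indicator_of_mem hp]
    · rw [(hφ.eq_zero hp).1, (hφ.eq_zero hp).2.1]; ring
  constraint_V := fun φ hφ => by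
    have l0 := X.swap.domain.locallyIntegrableOn_of_continuousOn X.swap.continuousOn_bU
    have l1 := X.swap.isKernel_constraint.locallyIntegrableOn X.swap.domain
    rw [← integral_swap]
    refine (X.swap.domain.isWeakDU l0 l1 fun p hp =>
      X.swap.constraint_U_of_axis hV hp).integral_eq_zero hφ.swap l0 l1 (fun p hp => ?_)
      fun p hp => ?_
    · have hp' : p.swap ∈ S := hp
      simp only [derivs, indicator_of_mem hp', dU_swap hφ.smooth, swap_bU, aU_swap, cU_swap,
        ψU_swap]
    · have hp' : p.swap ∉ S := hp
      rw [(hφ.eq_zero hp').1, (hφ.eq_zero hp').2.2]; ring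
  wave_a := fun φ hφ => by
    have l0 := X.aU_dominated.isKernel.locallyIntegrableOn X.domain
    have l1 := X.isKernel_aUV.locallyIntegrableOn X.domain
    refine (X.domain.isWeakDV l0 l1 fun p hp => X.aU_deriv hp).integral_eq_zero hφ l0 l1
      (fun p hp => ?_) fun p hp => ?_
    · simp only [derivs, indicator_of_mem hp, aUV, Background.q]; ring
    · rw [(hφ.eq_zero hp).1, (hφ.eq_zero hp).2.2]; ring

end Solution

end

section

/-! ### From weak derivatives to null lines -/

/-- The lemma of du Bois-Reymond on a closed interval, with the weak derivative tested in the
interior. -/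
theorem sub_eq_integral_of_weak_Icc {x₀ x₁ : ℝ} {w g : ℝ → ℝ} (h01 : x₀ < x₁)
    (hw : ContinuousOn w (Icc x₀ x₁)) (hg : IntegrableOn g (Icc x₀ x₁))
    (H : ∀ χ : ℝ → ℝ, ContDiff ℝ ∞ χ → HasCompactSupport χ → tsupport χ ⊆ Ioo x₀ x₁ →
      ∫ x in x₀..x₁, w x * deriv χ x = - ∫ x in x₀..x₁, g x * χ x) :
    ∀ u ∈ Icc x₀ x₁, ∀ v ∈ Icc x₀ x₁, w v - w u = ∫ x in u..v, g x := by
  have key := sub_eq_integral_of_weak (hw.mono Ioo_subset_Icc_self)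
    (hg.mono_set Ioo_subset_Icc_self) fun χ h1 h2 h3 => by
      have e := H χ h1 h2 h3
      have hn : ∀ x, x ∉ Ioc x₀ x₁ → x ∉ Ioo x₀ x₁ := fun x hx hx' => hx ⟨hx'.1, hx'.2.le⟩
      rwa [integral_eq_intervalIntegral h01.le, integral_eq_intervalIntegral h01.le]
      · intro x hx
        rw [eq_zero_of_notMem_tsupport h3 (hn x hx), mul_zero]
      · intro x hx
        rw [deriv_eq_zero_of_notMem_tsupport h3 (hn x hx), mul_zero]
  have hgi : IntervalIntegrable g volume x₀ x₁ :=
    (intervalIntegrable_iff_integrableOn_Icc_of_le h01.le).2 hg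
  have hsub : ∀ u ∈ Icc x₀ x₁, IntervalIntegrable g volume x₀ u := fun u hu =>
    hgi.mono_set (by rw [uIcc_of_le hu.1, uIcc_of_le h01.le]; exact Icc_subset_Icc_right hu.2)
  have hc : ContinuousOn (fun x => w x - ∫ t in x₀..x, g t) (Icc x₀ x₁) := by
    refine hw.sub ?_
    have := (HasACDeriv.of_integral hgi left_mem_uIcc).continuousOn
    rwa [uIcc_of_le h01.le] at this
  obtain ⟨m, hm⟩ : (Ioo x₀ x₁).Nonempty := nonempty_Ioo.2 h01
  have hE : EqOn (fun x => w x - ∫ t in x₀..x, g t) (fun _ => w m - ∫ t in x₀..m, g t)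
      (Ioo x₀ x₁) := by
    intro x hx
    have h1 := key m hm x hx
    have h2 := intervalIntegral.integral_interval_sub_left (hsub x (Ioo_subset_Icc_self hx))
      (hsub m (Ioo_subset_Icc_self hm))
    simp only
    linarith
  have hE' := hE.of_subset_closure hc continuousOn_const Ioo_subset_Icc_self
    (by rw [closure_Ioo h01.ne])
  intro u hu v hv
  have h1 := hE' hu
  have h2 := hE' hv
  simp only at h1 h2
  rw [← intervalIntegral.integral_interval_sub_left (hsub v hv) (hsub u hu)]
  linarith

theorem integrableOn_past_iff {Q : ℝ × ℝ → ℝ} {p : ℝ × ℝ} : IntegrableOn Q (past U₀ V₀ p) ↔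
    Integrable Q ((volume.restrict (Icc U₀ p.1)).prod (volume.restrict (Icc V₀ p.2))) := by
  rw [past, IntegrableOn, Measure.volume_eq_prod, ← Measure.prod_restrict]

/-- Iterated integrals over subrectangles of a characteristic rectangle. -/
theorem integral_interval_swap {Q : ℝ × ℝ → ℝ} {p : ℝ × ℝ} {u v u' v' : ℝ}
    (h₁ : U₀ ≤ p.1) (h₂ : V₀ ≤ p.2) (hQ : IntegrableOn Q (past U₀ V₀ p))
    (hu : u ∈ Icc U₀ p.1) (hv : v ∈ Icc U₀ p.1) (hu' : u' ∈ Icc V₀ p.2) (hv' : v' ∈ Icc V₀ p.2) :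
    ∫ x in u..v, ∫ y in u'..v', Q (x, y) = ∫ y in u'..v', ∫ x in u..v, Q (x, y) := by
  refine intervalIntegral_intervalIntegral_swap (F := fun x y => Q (x, y)) (hQ.mono_set ?_)
  exact prod_mono ((uIoc_subset_uIcc).trans (uIcc_subset_Icc hu hv))
    ((uIoc_subset_uIcc).trans (uIcc_subset_Icc hu' hv'))

theorem intervalIntegrable_integral_snd {Q : ℝ × ℝ → ℝ} {p : ℝ × ℝ} {u' v' : ℝ}
    (h₂ : V₀ ≤ p.2) (hQ : IntegrableOn Q (past U₀ V₀ p))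
    (hu' : u' ∈ Icc V₀ p.2) (hv' : v' ∈ Icc V₀ p.2) :
    IntegrableOn (fun x => ∫ y in u'..v', Q (x, y)) (Icc U₀ p.1) := by
  have key : ∀ y ∈ Icc V₀ p.2, IntegrableOn (fun x => ∫ y in Ioc V₀ y, Q (x, y)) (Icc U₀ p.1) := by
    intro y hy
    have : IntegrableOn Q (past U₀ V₀ (p.1, y)) := hQ.mono_set (past_mono le_rfl hy.2)
    rw [integrableOn_past_iff] at this
    simp only [← integral_Icc_eq_integral_Ioc]
    exact this.integral_prod_left
  have hs : ∀ᵐ x ∂(volume.restrict (Icc U₀ p.1)), IntegrableOn (fun y => Q (x, y)) (Icc V₀ p.2) := by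
    rw [integrableOn_past_iff] at hQ
    exact hQ.prod_right_ae
  refine ((key v' hv').sub (key u' hu')).congr ?_
  filter_upwards [hs] with x hx
  have hi : ∀ y ∈ Icc V₀ p.2, IntervalIntegrable (fun y => Q (x, y)) volume V₀ y := fun y hy =>
    (intervalIntegrable_iff_integrableOn_Icc_of_le hy.1).2
      (hx.mono_set (Icc_subset_Icc_right hy.2))
  have := intervalIntegral.integral_interval_sub_left (hi v' hv') (hi u' hu')
  rw [intervalIntegral.integral_of_le hv'.1, intervalIntegral.integral_of_le hu'.1] at this
  exact this

theorem IntegrableOn.past_swap {Q : ℝ × ℝ → ℝ} {p : ℝ × ℝ} (hQ : IntegrableOn Q (past U₀ V₀ p)) :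
    IntegrableOn (fun z => Q z.swap) (past V₀ U₀ p.swap) := by
  have mp : MeasurePreserving (Prod.swap : ℝ × ℝ → ℝ × ℝ) volume volume :=
    Measure.measurePreserving_swap
  rw [← PlaneSymmetric.past_swap]
  exact (mp.integrableOn_comp_preimage MeasurableEquiv.prodComm.measurableEmbedding).2 hQ

theorem intervalIntegrable_integral_fst {Q : ℝ × ℝ → ℝ} {p : ℝ × ℝ} {u v : ℝ}
    (h₁ : U₀ ≤ p.1) (hQ : IntegrableOn Q (past U₀ V₀ p))
    (hu : u ∈ Icc U₀ p.1) (hv : v ∈ Icc U₀ p.1) :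
    IntegrableOn (fun y => ∫ x in u..v, Q (x, y)) (Icc V₀ p.2) :=
  intervalIntegrable_integral_snd (p := p.swap) (Q := fun z => Q z.swap) h₁
    (IntegrableOn.past_swap hQ) hu hv

theorem integrableOn_past_mul {Q : ℝ × ℝ → ℝ} {p : ℝ × ℝ} (hQ : IntegrableOn Q (past U₀ V₀ p))
    {k : ℝ × ℝ → ℝ} (hk : Continuous k) : IntegrableOn (fun z => Q z * k z) (past U₀ V₀ p) :=
  hQ.mul_continuousOn hk.continuousOn (isCompact_past p)

/-- Integrals of functions supported in the past of a point. -/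
theorem integral_eq_setIntegral_past {F : ℝ × ℝ → ℝ} {p : ℝ × ℝ}
    (h0 : ∀ z, z ∉ past U₀ V₀ p → F z = 0) : ∫ z, F z = ∫ z in past U₀ V₀ p, F z :=
  (setIntegral_eq_integral_of_forall_compl_eq_zero h0).symm

/-- If `∂_U (η P) = ζ Q` weakly after integration over `V`, then this holds for differences of
`P` along the null direction `U`. -/
theorem IsFutureDomain.integral_sub_eq_of_weak (hS : IsFutureDomain U₀ V₀ S) {p : ℝ × ℝ}
    (hp : p ∈ S) (h₁ : U₀ < p.1) {P Q : ℝ × ℝ → ℝ} (hP : ContinuousOn P S)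
    (hQ : IntegrableOn Q (PlaneSymmetric.past U₀ V₀ p)) {η ζ : ℝ → ℝ} (cη : Continuous η)
    (cζ : Continuous ζ) (hη : ∀ y, y ∉ Icc V₀ p.2 → η y = 0) (hζ : ∀ y, y ∉ Icc V₀ p.2 → ζ y = 0)
    (H : ∀ χ : ℝ → ℝ, ContDiff ℝ ∞ χ → HasCompactSupport χ → tsupport χ ⊆ Ioo U₀ p.1 →
      ∫ z : ℝ × ℝ, P z * (deriv χ z.1 * η z.2) = - ∫ z : ℝ × ℝ, Q z * (χ z.1 * ζ z.2)) :
    ∀ u ∈ Icc U₀ p.1, ∀ v ∈ Icc U₀ p.1,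
      ∫ y in V₀..p.2, (P (v, y) - P (u, y)) * η y
        = ∫ y in V₀..p.2, (∫ x in u..v, Q (x, y)) * ζ y := by
  have h₂ := hS.le_snd hp
  obtain ⟨P', cP, eP, -⟩ := hS.exists_extension hP hp
  have iP : IntegrableOn P (PlaneSymmetric.past U₀ V₀ p) :=
    (hP.mono (hS.past_subset hp)).integrableOn_compact (isCompact_past p)
  have iQ : IntegrableOn (fun z => Q z * ζ z.2) (PlaneSymmetric.past U₀ V₀ p) :=
    integrableOn_past_mul hQ (cζ.comp continuous_snd)
  have hs : V₀ ∈ Icc V₀ p.2 := ⟨le_rfl, h₂⟩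
  have hs' : p.2 ∈ Icc V₀ p.2 := ⟨h₂, le_rfl⟩
  have cw : Continuous fun x => ∫ y in V₀..p.2, P' (x, y) * η y :=
    intervalIntegral.continuous_parametric_intervalIntegral_of_continuous'
      (f := fun x y => P' (x, y) * η y) (by unfold Function.uncurry; fun_prop) _ _
  have ew : ∀ x ∈ Icc U₀ p.1, ∫ y in V₀..p.2, P (x, y) * η y = ∫ y in V₀..p.2, P' (x, y) * η y := by
    intro x hx
    refine intervalIntegral.integral_congr fun y hy => ?_
    rw [uIcc_of_le h₂] at hy
    simp only [eP (show (x, y) ∈ PlaneSymmetric.past U₀ V₀ p from ⟨hx, hy⟩)]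
  have key := sub_eq_integral_of_weak_Icc (w := fun x => ∫ y in V₀..p.2, P (x, y) * η y)
    (g := fun x => ∫ y in V₀..p.2, Q (x, y) * ζ y) h₁
    (cw.continuousOn.congr ew)
    (intervalIntegrable_integral_snd h₂ iQ hs hs') fun χ h1 h2 h3 => by
      have e := H χ h1 h2 h3
      have hn : ∀ x, x ∉ Icc U₀ p.1 → x ∉ Ioo U₀ p.1 := fun x hx hx' =>
        hx (Ioo_subset_Icc_self hx')
      rw [integral_eq_setIntegral_past (U₀ := U₀) (V₀ := V₀) (p := p),
        integral_eq_setIntegral_past (U₀ := U₀) (V₀ := V₀) (p := p),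
        setIntegral_past h₁.le h₂, setIntegral_past h₁.le h₂] at e
      · refine Eq.trans ?_ (e.trans ?_)
        · refine intervalIntegral.integral_congr fun x _ => ?_
          simp only
          rw [← intervalIntegral.integral_mul_const]
          exact intervalIntegral.integral_congr fun y _ => by ring
        · congr 1
          refine intervalIntegral.integral_congr fun x _ => ?_
          simp only
          rw [← intervalIntegral.integral_mul_const]
          exact intervalIntegral.integral_congr fun y _ => by ring
      · exact integrableOn_past_mul hQ
          ((h1.continuous.comp continuous_fst).mul (cζ.comp continuous_snd))
      · exact integrableOn_past_mul iP
          (((h1.continuous_deriv (by simp)).comp continuous_fst).mul (cη.comp continuous_snd))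
      · intro z hz
        by_cases h : z.1 ∈ Icc U₀ p.1
        · rw [hζ z.2 fun h' => hz ⟨h, h'⟩]; simp
        · rw [eq_zero_of_notMem_tsupport h3 (hn _ h)]; simp
      · intro z hz
        by_cases h : z.1 ∈ Icc U₀ p.1
        · rw [hη z.2 fun h' => hz ⟨h, h'⟩]; simp
        · rw [deriv_eq_zero_of_notMem_tsupport h3 (hn _ h)]; simp
  intro u hu v hv
  have hk := key u hu v hv
  rw [integral_interval_swap h₁.le h₂ iQ hu hv hs hs'] at hk
  simp only [ew u hu, ew v hv] at hk
  have ci : ∀ x, IntervalIntegrable (fun y => P' (x, y) * η y) volume V₀ p.2 := fun x =>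
    Continuous.intervalIntegrable (by fun_prop) _ _
  rw [← intervalIntegral.integral_sub (ci v) (ci u)] at hk
  refine Eq.trans ?_ (hk.trans ?_)
  · refine intervalIntegral.integral_congr fun y hy => ?_
    rw [uIcc_of_le h₂] at hy
    simp only [eP (show (v, y) ∈ PlaneSymmetric.past U₀ V₀ p from ⟨hv, hy⟩),
      eP (show (u, y) ∈ PlaneSymmetric.past U₀ V₀ p from ⟨hu, hy⟩)]
    ring
  · refine intervalIntegral.integral_congr fun y _ => ?_
    rw [intervalIntegral.integral_mul_const]

/-- A function with integrable weak mixed derivative is the sum of functions of one variable and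
of the integral of the mixed derivative. -/
theorem IsFutureDomain.corner_of_weak (hS : IsFutureDomain U₀ V₀ S) {p : ℝ × ℝ}
    (hp : p ∈ S) (h₁ : U₀ < p.1) (h₂ : V₀ < p.2) {P Q : ℝ × ℝ → ℝ} (hP : ContinuousOn P S)
    (hQ : IntegrableOn Q (PlaneSymmetric.past U₀ V₀ p))
    (H : ∀ χ η : ℝ → ℝ, ContDiff ℝ ∞ χ → HasCompactSupport χ → tsupport χ ⊆ Ioo U₀ p.1 →
      ContDiff ℝ ∞ η → HasCompactSupport η → tsupport η ⊆ Ioo V₀ p.2 →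
      ∫ z : ℝ × ℝ, P z * (deriv χ z.1 * deriv η z.2) = ∫ z : ℝ × ℝ, Q z * (χ z.1 * η z.2)) :
    ∀ r ∈ PlaneSymmetric.past U₀ V₀ p, P r = P (r.1, V₀) + P (U₀, r.2) - P (U₀, V₀)
      + ∫ z in PlaneSymmetric.past U₀ V₀ r, Q z := by
  intro r hr
  have hs : U₀ ∈ Icc U₀ p.1 := ⟨le_rfl, h₁.le⟩
  have hs' : V₀ ∈ Icc V₀ p.2 := ⟨le_rfl, h₂.le⟩
  have hl : ∀ x ∈ Icc U₀ p.1, ContinuousOn (fun y => P (x, y)) (Icc V₀ p.2) := fun x hx =>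
    (hP.mono (hS.past_subset hp)).comp (by fun_prop) fun y hy => ⟨hx, hy⟩
  have key := sub_eq_integral_of_weak_Icc (w := fun y => P (r.1, y) - P (U₀, y))
    (g := fun y => ∫ x in U₀..r.1, Q (x, y)) h₂ ((hl _ hr.1).sub (hl _ hs))
    (intervalIntegrable_integral_fst h₁.le hQ hs hr.1) fun η h1 h2 h3 => by
      have hn : ∀ y, y ∉ Icc V₀ p.2 → y ∉ Ioo V₀ p.2 := fun x hx hx' =>
        hx (Ioo_subset_Icc_self hx')
      have e := hS.integral_sub_eq_of_weak hp h₁ hP hQ (η := deriv η) (ζ := fun y => - η y)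
        (h1.continuous_deriv (by simp)) h1.continuous.neg
        (fun y hy => deriv_eq_zero_of_notMem_tsupport h3 (hn y hy))
        (fun y hy => by rw [eq_zero_of_notMem_tsupport h3 (hn y hy), neg_zero])
        (fun χ k1 k2 k3 => by
          rw [H χ η k1 k2 k3 h1 h2 h3, ← integral_neg]
          congr 1; ext z; ring) U₀ hs r.1 hr.1
      rw [e, ← intervalIntegral.integral_neg]
      exact intervalIntegral.integral_congr fun y _ => by ring
  have hk := key V₀ hs' r.2 hr.2
  have hQr : IntegrableOn Q (PlaneSymmetric.past U₀ V₀ r) := hQ.mono_set (past_mono hr.1.2 hr.2.2)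
  rw [setIntegral_past hr.1.1 hr.2.1 hQr, integral_interval_swap h₁.le h₂.le hQ hs hr.1 hs' hr.2,
    ← hk]
  simp only [Prod.mk.eta]
  ring

theorem integral_zero_of_weights {w : ℝ → ℝ} {y₀ y₁ : ℝ} (h : y₀ < y₁)
    (hw : ContinuousOn w (Icc y₀ y₁))
    (H : ∀ η : ℝ → ℝ, ContDiff ℝ ∞ η → HasCompactSupport η → tsupport η ⊆ Ioo y₀ y₁ →
      ∫ y in y₀..y₁, w y * η y = 0) : ∀ y ∈ Icc y₀ y₁, w y = 0 := by
  have h1 : ∀ᵐ y : ℝ, y ∈ Ioo y₀ y₁ → w y = 0 := by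
    refine isOpen_Ioo.ae_eq_zero_of_integral_contDiff_smul_eq_zero
      ((hw.mono Ioo_subset_Icc_self).locallyIntegrableOn measurableSet_Ioo) fun η k1 k2 k3 => ?_
    rw [← H η k1 k2 k3, integral_eq_intervalIntegral h.le]
    · exact intervalIntegral.integral_congr fun y _ => by simp [mul_comm]
    · intro y hy
      rw [eq_zero_of_notMem_tsupport k3 fun h => hy (Ioo_subset_Ioc_self h), zero_smul]
  have h2 : EqOn w (fun _ => 0) (Ioo y₀ y₁) :=
    Measure.eqOn_open_of_ae_eq ((ae_restrict_iff' measurableSet_Ioo).2 h1) isOpen_Ioo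
      (hw.mono Ioo_subset_Icc_self) continuousOn_const
  exact h2.of_subset_closure hw continuousOn_const Ioo_subset_Icc_self (by rw [closure_Ioo h.ne])

/-- A product test function. -/
theorem IsFutureDomain.isTest_mul (hS : IsFutureDomain U₀ V₀ S) {p : ℝ × ℝ} (hp : p ∈ S)
    {χ η : ℝ → ℝ} (k1 : ContDiff ℝ ∞ χ) (k2 : HasCompactSupport χ) (k3 : tsupport χ ⊆ Ioo U₀ p.1)
    (h1 : ContDiff ℝ ∞ η) (h2 : HasCompactSupport η) (h3 : tsupport η ⊆ Ioo V₀ p.2) :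
    IsTest S (fun z => χ z.1 * η z.2) := by
  have hsub : tsupport (fun z : ℝ × ℝ => χ z.1 * η z.2) ⊆ tsupport χ ×ˢ tsupport η := by
    refine closure_minimal ?_ ((isClosed_tsupport χ).prod (isClosed_tsupport η))
    intro z hz
    exact ⟨subset_tsupport _ (left_ne_zero_of_mul hz), subset_tsupport _ (right_ne_zero_of_mul hz)⟩
  refine ⟨(k1.comp contDiff_fst).mul (h1.comp contDiff_snd),
    IsCompact.of_isClosed_subset (k2.prod h2) (isClosed_tsupport _) hsub, hsub.trans ?_⟩
  rw [hS.interior_eq]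
  intro z hz
  have a1 := k3 hz.1
  have a2 := h3 hz.2
  exact ⟨hS.past_subset hp ⟨⟨a1.1.le, a1.2.le⟩, ⟨a2.1.le, a2.2.le⟩⟩, a1.1, a2.1⟩

theorem dU_mul {χ η : ℝ → ℝ} (k1 : ContDiff ℝ ∞ χ) (h1 : ContDiff ℝ ∞ η) (z : ℝ × ℝ) :
    dU (fun z => χ z.1 * η z.2) z = deriv χ z.1 * η z.2 :=
  (hasDerivAt_dU ((k1.comp contDiff_fst).mul (h1.comp contDiff_snd)) z.1 z.2).unique
    (show HasDerivAt (fun x => χ x * η z.2) (deriv χ z.1 * η z.2) z.1 from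
      (k1.differentiable (by simp) z.1).hasDerivAt.mul_const _)

theorem dV_mul {χ η : ℝ → ℝ} (k1 : ContDiff ℝ ∞ χ) (h1 : ContDiff ℝ ∞ η) (z : ℝ × ℝ) :
    dV (fun z => χ z.1 * η z.2) z = χ z.1 * deriv η z.2 :=
  (hasDerivAt_dV ((k1.comp contDiff_fst).mul (h1.comp contDiff_snd)) z.1 z.2).unique
    (show HasDerivAt (fun y => χ z.1 * η y) (χ z.1 * deriv η z.2) z.2 from
      (h1.differentiable (by simp) z.2).hasDerivAt.const_mul _)

/-- Continuous weak derivatives are derivatives along the null lines, up to the initial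
hypersurfaces. -/
theorem IsFutureDomain.hasACDeriv_of_isWeakDU (hS : IsFutureDomain U₀ V₀ S) {P R : ℝ × ℝ → ℝ}
    (hP : ContinuousOn P S) (hR : ContinuousOn R S) (h : IsWeakDU S P R) {r : ℝ × ℝ}
    (hr : r ∈ S) : HasACDeriv (fun x => P (x, r.2)) (fun x => R (x, r.2)) U₀ r.1 := by
  obtain ⟨p, hp, l1, l2⟩ := hS.exists_gt hr
  have g1 := hS.le_fst hr
  have g2 := hS.le_snd hr
  have h₁ : U₀ < p.1 := g1.trans_lt l1
  have h₂ : V₀ < p.2 := g2.trans_lt l2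
  have hl : ∀ y ∈ Icc V₀ p.2, ContinuousOn (fun x => R (x, y)) (Icc U₀ p.1) := fun y hy =>
    (hR.mono (hS.past_subset hp)).comp (by fun_prop) fun x hx => ⟨hx, hy⟩
  have hl' : ∀ x ∈ Icc U₀ p.1, ContinuousOn (fun y => P (x, y)) (Icc V₀ p.2) := fun x hx =>
    (hP.mono (hS.past_subset hp)).comp (by fun_prop) fun y hy => ⟨hx, hy⟩
  have hs : U₀ ∈ Icc U₀ p.1 := ⟨le_rfl, h₁.le⟩
  have iR : IntegrableOn R (PlaneSymmetric.past U₀ V₀ p) :=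
    (hR.mono (hS.past_subset hp)).integrableOn_compact (isCompact_past p)
  obtain ⟨R', cR, eR, -⟩ := hS.exists_extension hR hp
  have hi : IntervalIntegrable (fun x => R (x, r.2)) volume U₀ r.1 := by
    refine ContinuousOn.intervalIntegrable ?_
    rw [uIcc_of_le g1]
    exact (hl r.2 ⟨g2, l2.le⟩).mono (Icc_subset_Icc_right l1.le)
  refine HasACDeriv.of_eq_integral hi fun x hx => ?_
  rw [uIcc_of_le g1] at hx
  have hx' : x ∈ Icc U₀ p.1 := ⟨hx.1, hx.2.trans l1.le⟩
  have cI : Continuous fun y => ∫ x in U₀..x, R' (x, y) :=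
    intervalIntegral.continuous_parametric_intervalIntegral_of_continuous'
      (f := fun y x => R' (x, y)) (by unfold Function.uncurry; fun_prop) _ _
  have eI : ∀ y ∈ Icc V₀ p.2, ∫ x in U₀..x, R (x, y) = ∫ x in U₀..x, R' (x, y) := by
    intro y hy
    refine intervalIntegral.integral_congr fun t ht => ?_
    rw [uIcc_of_le hx.1] at ht
    exact eR ⟨⟨ht.1, ht.2.trans hx'.2⟩, hy⟩
  have hc : ContinuousOn (fun y => P (x, y) - P (U₀, y) - ∫ x in U₀..x, R (x, y)) (Icc V₀ p.2) :=
    ((hl' x hx').sub (hl' U₀ hs)).sub (cI.continuousOn.congr eI)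
  have := integral_zero_of_weights h₂ hc (fun η h1 h2 h3 => ?_) r.2 ⟨g2, l2.le⟩
  · linarith
  have hn : ∀ y, y ∉ Icc V₀ p.2 → η y = 0 := fun y hy =>
    eq_zero_of_notMem_tsupport h3 fun hx' => hy (Ioo_subset_Icc_self hx')
  have e := hS.integral_sub_eq_of_weak hp h₁ hP iR (η := η) (ζ := η) h1.continuous h1.continuous
    hn hn (fun χ k1 k2 k3 => by
      have := h _ (hS.isTest_mul hp k1 k2 k3 h1 h2 h3)
      simpa only [dU_mul k1 h1] using this) U₀ hs x hx'
  rw [← sub_eq_zero, ← intervalIntegral.integral_sub] at e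
  · rw [← e]
    exact intervalIntegral.integral_congr fun y _ => by ring
  · refine ContinuousOn.intervalIntegrable ?_
    rw [uIcc_of_le h₂.le]
    exact ((hl' x hx').sub (hl' U₀ hs)).mul h1.continuous.continuousOn
  · refine ContinuousOn.intervalIntegrable ?_
    rw [uIcc_of_le h₂.le]
    exact (cI.continuousOn.congr eI).mul h1.continuous.continuousOn

theorem IsFutureDomain.hasACDeriv_of_isWeakDV (hS : IsFutureDomain U₀ V₀ S) {P R : ℝ × ℝ → ℝ}
    (hP : ContinuousOn P S) (hR : ContinuousOn R S) (h : IsWeakDV S P R) {r : ℝ × ℝ}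
    (hr : r ∈ S) : HasACDeriv (fun y => P (r.1, y)) (fun y => R (r.1, y)) V₀ r.2 :=
  hS.swap.hasACDeriv_of_isWeakDU (P := fun z => P z.swap) (R := fun z => R z.swap) (r := r.swap)
    (hP.comp continuous_swap.continuousOn fun _ h => h)
    (hR.comp continuous_swap.continuousOn fun _ h => h) (isWeakDU_of_swap h) hr

end

section

/-! ### Weak solutions are solutions in integrated form -/

theorem ae_zero_of_weights {w : ℝ → ℝ} {y₀ y₁ : ℝ} (h : y₀ < y₁)
    (hw : IntegrableOn w (Icc y₀ y₁))
    (H : ∀ η : ℝ → ℝ, ContDiff ℝ ∞ η → HasCompactSupport η → tsupport η ⊆ Ioo y₀ y₁ →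
      ∫ y in y₀..y₁, w y * η y = 0) : ∀ᵐ y ∂(volume.restrict (Icc y₀ y₁)), w y = 0 := by
  have h1 : ∀ᵐ y : ℝ, y ∈ Ioo y₀ y₁ → w y = 0 := by
    refine isOpen_Ioo.ae_eq_zero_of_integral_contDiff_smul_eq_zero
      (hw.mono_set Ioo_subset_Icc_self).locallyIntegrableOn fun η k1 k2 k3 => ?_
    rw [← H η k1 k2 k3, integral_eq_intervalIntegral h.le]
    · exact intervalIntegral.integral_congr fun y _ => by simp [mul_comm]
    · intro y hy
      rw [eq_zero_of_notMem_tsupport k3 fun h => hy (Ioo_subset_Ioc_self h), zero_smul]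
  rw [restrict_Ioo_eq_restrict_Icc.symm]
  exact (ae_restrict_iff' measurableSet_Ioo).2 h1

/-- A continuous function with integrable weak derivative is absolutely continuous on almost every
null line. -/
theorem IsFutureDomain.ae_slice_of_isWeakDU (hS : IsFutureDomain U₀ V₀ S) {p : ℝ × ℝ}
    (hp : p ∈ S) (h₁ : U₀ < p.1) (h₂ : V₀ < p.2) {P R : ℝ × ℝ → ℝ} (hP : ContinuousOn P S)
    (hR : IntegrableOn R (PlaneSymmetric.past U₀ V₀ p)) (h : IsWeakDU S P R) :
    ∀ᵐ y ∂(volume.restrict (Icc V₀ p.2)),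
      HasACDeriv (fun x => P (x, y)) (fun x => R (x, y)) U₀ p.1 := by
  have hs : U₀ ∈ Icc U₀ p.1 := ⟨le_rfl, h₁.le⟩
  have hl : ∀ x ∈ Icc U₀ p.1, ContinuousOn (fun y => P (x, y)) (Icc V₀ p.2) := fun x hx =>
    (hP.mono (hS.past_subset hp)).comp (by fun_prop) fun y hy => ⟨hx, hy⟩
  have hl' : ∀ y ∈ Icc V₀ p.2, ContinuousOn (fun x => P (x, y)) (Icc U₀ p.1) := fun y hy =>
    (hP.mono (hS.past_subset hp)).comp (by fun_prop) fun x hx => ⟨hx, hy⟩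
  -- the integrated identity for a fixed endpoint `u` and almost every `y`
  have step : ∀ u ∈ Icc U₀ p.1, ∀ᵐ y ∂(volume.restrict (Icc V₀ p.2)),
      P (u, y) - P (U₀, y) - ∫ x in U₀..u, R (x, y) = 0 := by
    intro u hu
    have i1 : IntegrableOn (fun y => P (u, y) - P (U₀, y)) (Icc V₀ p.2) :=
      ((hl u hu).sub (hl U₀ hs)).integrableOn_Icc
    have i2 := intervalIntegrable_integral_fst h₁.le hR hs hu
    refine ae_zero_of_weights h₂ (i1.sub i2) fun η k1 k2 k3 => ?_
    have hn : ∀ y, y ∉ Icc V₀ p.2 → η y = 0 := fun y hy =>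
      eq_zero_of_notMem_tsupport k3 fun hx' => hy (Ioo_subset_Icc_self hx')
    have e := hS.integral_sub_eq_of_weak hp h₁ hP hR (η := η) (ζ := η) k1.continuous k1.continuous
      hn hn (fun χ l1 l2 l3 => by
        have := h _ (hS.isTest_mul hp l1 l2 l3 k1 k2 k3)
        simpa only [dU_mul l1 k1] using this) U₀ hs u hu
    have cη : ContinuousOn η (uIcc V₀ p.2) := k1.continuous.continuousOn
    rw [← sub_eq_zero, ← intervalIntegral.integral_sub
      (((intervalIntegrable_iff_integrableOn_Icc_of_le h₂.le).2 i1).mul_continuousOn cη)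
      (((intervalIntegrable_iff_integrableOn_Icc_of_le h₂.le).2 i2).mul_continuousOn cη)] at e
    rw [← e]
    exact intervalIntegral.integral_congr fun y _ => by ring
  set π : ℝ → ℝ := fun t => projIcc U₀ p.1 h₁.le t with hπ
  have mπ : ∀ t, π t ∈ Icc U₀ p.1 := fun t => Subtype.mem _
  have cπ : Continuous π := continuous_subtype_val.comp continuous_projIcc
  have hint : ∀ᵐ y ∂(volume.restrict (Icc V₀ p.2)),
      IntegrableOn (fun x => R (x, y)) (Icc U₀ p.1) :=
    (integrableOn_past_iff.1 hR).prod_left_ae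
  -- one null set serves all rational endpoints, and continuity in the endpoint gives the rest
  have hall : ∀ᵐ y ∂(volume.restrict (Icc V₀ p.2)), ∀ q : ℚ,
      P (π q, y) - P (U₀, y) - ∫ x in U₀..π q, R (x, y) = 0 :=
    ae_all_iff.2 fun q => step _ (mπ q)
  filter_upwards [hint, hall, ae_restrict_mem measurableSet_Icc] with y hy hq hmem
  have hi : IntervalIntegrable (fun x => R (x, y)) volume U₀ p.1 :=
    (intervalIntegrable_iff_integrableOn_Icc_of_le h₁.le).2 hy
  have hc : Continuous fun t : ℝ => P (π t, y) - P (U₀, y) - ∫ x in U₀..π t, R (x, y) := by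
    refine (((hl' y hmem).comp_continuous cπ mπ).sub continuous_const).sub ?_
    have := (HasACDeriv.of_integral hi left_mem_uIcc).continuousOn
    rw [uIcc_of_le h₁.le] at this
    exact this.comp_continuous cπ mπ
  have h0 := (Rat.denseRange_cast (𝕜 := ℝ)).equalizer hc (continuous_const (y := (0 : ℝ)))
    (funext hq)
  refine HasACDeriv.of_eq_integral hi fun x hx => ?_
  rw [uIcc_of_le h₁.le] at hx
  have := congrFun h0 x
  simp only [hπ, projIcc_of_mem h₁.le hx] at this
  linarith

/-- If the mixed derivative of `P` is integrable, then `P` is absolutely continuous on every null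
line, and its weak derivative is almost everywhere the integral of the mixed derivative. -/
theorem IsFutureDomain.slice_of_corner (hS : IsFutureDomain U₀ V₀ S) {p : ℝ × ℝ}
    (hp : p ∈ S) (h₁ : U₀ < p.1) (h₂ : V₀ < p.2) {P R Q : ℝ × ℝ → ℝ} (hP : ContinuousOn P S)
    (mR : Measurable R) (hR : IntegrableOn R (PlaneSymmetric.past U₀ V₀ p))
    (mQ : Measurable (S.indicator Q)) (hQ : IntegrableOn Q (PlaneSymmetric.past U₀ V₀ p))
    (h : IsWeakDU S P R)
    (hc : ∀ r ∈ PlaneSymmetric.past U₀ V₀ p, P r = P (r.1, V₀) + P (U₀, r.2) - P (U₀, V₀)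
      + ∫ z in PlaneSymmetric.past U₀ V₀ r, Q z) :
    (∀ y ∈ Icc V₀ p.2, HasACDeriv (fun x => P (x, y))
      (fun x => deriv (fun x => P (x, V₀)) x + ∫ t in V₀..y, Q (x, t)) U₀ p.1) ∧
    ∀ᵐ z ∂(volume.restrict (PlaneSymmetric.past U₀ V₀ p)),
      R z = deriv (fun x => P (x, V₀)) z.1 + ∫ t in V₀..z.2, Q (z.1, t) := by
  have hs' : V₀ ∈ Icc V₀ p.2 := ⟨le_rfl, h₂.le⟩
  have iQ : ∀ y ∈ Icc V₀ p.2, IntervalIntegrable (fun x => ∫ t in V₀..y, Q (x, t)) volume U₀ p.1 :=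
    fun y hy => (intervalIntegrable_iff_integrableOn_Icc_of_le h₁.le).2
      (intervalIntegrable_integral_snd h₂.le hQ hs' hy)
  have dQ : ∀ y ∈ Icc V₀ p.2, HasACDeriv (fun x => P (x, y) - P (x, V₀))
      (fun x => ∫ t in V₀..y, Q (x, t)) U₀ p.1 := by
    intro y hy
    refine HasACDeriv.of_eq_integral (iQ y hy) fun x hx => ?_
    rw [uIcc_of_le h₁.le] at hx
    have hm : (x, y) ∈ PlaneSymmetric.past U₀ V₀ p := ⟨hx, hy⟩
    have := hc _ hm
    rw [setIntegral_past (p := (x, y)) hx.1 hy.1 (hQ.mono_set (past_mono hx.2 hy.2))] at this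
    simp only at this
    linarith
  have hae := hS.ae_slice_of_isWeakDU hp h₁ h₂ hP hR h
  have hne : NeBot (ae (volume.restrict (Icc V₀ p.2))) := by
    rw [ae_neBot, Ne, Measure.restrict_eq_zero]
    simp [h₂]
  -- a single good line transfers absolute continuity to `V = V₀`, hence to every line
  obtain ⟨y₁, hy₁, hm₁⟩ := (hae.and (ae_restrict_mem measurableSet_Icc)).exists
  have hax : HasACDeriv (fun x => P (x, V₀)) (deriv fun x => P (x, V₀)) U₀ p.1 := by
    have := hy₁.sub (dQ y₁ hm₁)
    exact HasACDeriv.of_ac (this.congr fun x _ => by ring).ac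
  have hall : ∀ y ∈ Icc V₀ p.2, HasACDeriv (fun x => P (x, y))
      (fun x => deriv (fun x => P (x, V₀)) x + ∫ t in V₀..y, Q (x, t)) U₀ p.1 := fun y hy =>
    (hax.add (dQ y hy)).congr fun x _ => by ring
  refine ⟨hall, ?_⟩
  have key : ∀ᵐ y ∂(volume.restrict (Icc V₀ p.2)), ∀ᵐ x ∂(volume.restrict (Icc U₀ p.1)),
      R (x, y) = deriv (fun x => P (x, V₀)) x
        + S.indicator (fun z => ∫ t in V₀..z.2, Q (z.1, t)) (x, y) := by
    filter_upwards [hae, ae_restrict_mem measurableSet_Icc] with y hy hm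
    rw [ae_restrict_iff' measurableSet_Icc]
    filter_upwards [hy.deriv_eq, (hall y hm).deriv_eq] with x e1 e2 hx
    have hmem : (x, y) ∈ S := hS.past_subset hp ⟨hx, hm⟩
    rw [uIcc_of_le h₁.le] at e1 e2
    rw [← e1 hx, e2 hx, indicator_of_mem hmem]
  have hmeas : MeasurableSet {z : ℝ × ℝ | R (z.1, z.2) = deriv (fun x => P (x, V₀)) z.1
        + S.indicator (fun z => ∫ t in V₀..z.2, Q (z.1, t)) (z.1, z.2)} :=
    measurableSet_eq_fun mR (((measurable_deriv _).comp measurable_fst).add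
      (hS.measurable_integral_slice mQ))
  rw [← Measure.ae_ae_comm (p := fun x y => R (x, y) = deriv (fun x => P (x, V₀)) x
        + S.indicator (fun z => ∫ t in V₀..z.2, Q (z.1, t)) (x, y)) hmeas,
    ← Measure.ae_prod_iff_ae_ae (p := fun z : ℝ × ℝ => R (z.1, z.2) = deriv (fun x => P (x, V₀)) z.1
        + S.indicator (fun z => ∫ t in V₀..z.2, Q (z.1, t)) (z.1, z.2)) hmeas,
    Measure.prod_restrict, ← Measure.volume_eq_prod] at key
  filter_upwards [key, ae_restrict_mem (measurableSet_past p)] with z hz hm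
  rwa [indicator_of_mem (hS.past_subset hp hm)] at hz

theorem ae_ae_of_ae_past {p : ℝ × ℝ} {A : ℝ × ℝ → Prop}
    (h : ∀ᵐ z ∂(volume.restrict (past U₀ V₀ p)), A z) :
    ∀ᵐ x ∂(volume.restrict (Icc U₀ p.1)), ∀ᵐ y ∂(volume.restrict (Icc V₀ p.2)), A (x, y) := by
  rw [past, Measure.volume_eq_prod, ← Measure.prod_restrict] at h
  exact Measure.ae_ae_of_ae_prod h

theorem ae_past_swap {p : ℝ × ℝ} {A : ℝ × ℝ → Prop}
    (h : ∀ᵐ z ∂(volume.restrict (past U₀ V₀ p)), A z) :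
    ∀ᵐ z ∂(volume.restrict (past V₀ U₀ p.swap)), A z.swap := by
  have mp : MeasurePreserving (Prod.swap : ℝ × ℝ → ℝ × ℝ) volume volume :=
    Measure.measurePreserving_swap
  rw [← past_swap]
  exact (mp.restrict_preimage_emb MeasurableEquiv.prodComm.measurableEmbedding
    _).quasiMeasurePreserving.ae h

theorem SliceBoundU.integrableOn_pow {n : ℕ} {w : ℝ × ℝ → ℝ} (h : SliceBoundU S n w)
    (mw : Measurable w) {p : ℝ × ℝ} (hp : past U₀ V₀ p ⊆ S) :
    IntegrableOn (fun z => w z ^ n) (past U₀ V₀ p) ∧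
    ∀ y ∈ Icc V₀ p.2, IntegrableOn (fun x => w (x, y) ^ n) (Icc U₀ p.1) := by
  obtain ⟨C, hC⟩ := h U₀ p.1 V₀ p.2 hp
  simp only [ENNReal.rpow_natCast] at hC
  constructor
  · refine ⟨(mw.pow_const n).aestronglyMeasurable, ?_⟩
    rw [past, HasFiniteIntegral, Measure.volume_eq_prod, ← Measure.prod_restrict,
      lintegral_prod_symm' _ (mw.pow_const n).enorm]
    simp only [enorm_pow]
    calc ∫⁻ y in Icc V₀ p.2, ∫⁻ x in Icc U₀ p.1, ‖w (x, y)‖ₑ ^ n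
        ≤ ∫⁻ _ in Icc V₀ p.2, (C : ℝ≥0∞) := setLIntegral_mono measurable_const hC
      _ < ⊤ := by
          rw [setLIntegral_const]
          exact ENNReal.mul_lt_top ENNReal.coe_lt_top (by simp)
  · intro y hy
    refine ⟨((mw.comp measurable_prodMk_right).pow_const n).aestronglyMeasurable, ?_⟩
    rw [HasFiniteIntegral]
    simp only [enorm_pow]
    exact (hC y hy).trans_lt ENNReal.coe_lt_top

theorem integrableOn_of_sq {X : Type*} [MeasurableSpace X] {μ : Measure X} {s : Set X}
    {w : X → ℝ} (hs : μ s ≠ ⊤)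
    (mw : Measurable w) (h : IntegrableOn (fun z => w z ^ 2) s μ) : IntegrableOn w s μ := by
  have h1 : IntegrableOn (fun _ => (1 : ℝ)) s μ := integrableOn_const hs
  refine Integrable.mono (h1.add h) mw.aestronglyMeasurable (Eventually.of_forall fun z => ?_)
  rw [Real.norm_eq_abs, Real.norm_eq_abs, Pi.add_apply]
  refine le_trans ?_ (le_abs_self _)
  nlinarith [sq_nonneg (|w z| - 1), sq_abs (w z), abs_nonneg (w z)]

end

section

namespace Background

variable (B : Background U₀ V₀ S)

/-- Weak solutions of the wave equation with square integrable derivatives, tested against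
products. -/
structure IsWeakWave (c cU cV : ℝ × ℝ → ℝ) : Prop where
  cont : ContinuousOn c S
  measU : Measurable cU
  measV : Measurable cV
  weakU : IsWeakDU S c cU
  weakV : IsWeakDV S c cV
  boundU : SliceBoundU S 2 cU
  boundV : SliceBoundV S 2 cV
  wave : ∀ p ∈ S, ∀ χ η : ℝ → ℝ, ContDiff ℝ ∞ χ → HasCompactSupport χ → tsupport χ ⊆ Ioo U₀ p.1 →
      ContDiff ℝ ∞ η → HasCompactSupport η → tsupport η ⊆ Ioo V₀ p.2 →
      ∫ z : ℝ × ℝ, c z * (deriv χ z.1 * deriv η z.2)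
        = ∫ z : ℝ × ℝ, - (B.bV z * cU z + B.bU z * cV z) * (χ z.1 * η z.2)

namespace IsWeakWave

variable {B} {c cU cV : ℝ × ℝ → ℝ} {p : ℝ × ℝ}

theorem swap (h : B.IsWeakWave c cU cV) :
    B.swap.IsWeakWave (fun z => c z.swap) (fun z => cV z.swap) (fun z => cU z.swap) where
  cont := h.cont.comp continuous_swap.continuousOn fun _ hp => hp
  measU := h.measV.comp measurable_swap
  measV := h.measU.comp measurable_swap
  weakU := isWeakDU_of_swap h.weakV
  weakV := isWeakDV_of_swap h.weakU
  boundU := fun U₁ U₂ V₁ V₂ hsub => h.boundV V₁ V₂ U₁ U₂ fun p hp =>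
    hsub (show p.swap ∈ _ from ⟨hp.2, hp.1⟩)
  boundV := fun U₁ U₂ V₁ V₂ hsub => h.boundU V₁ V₂ U₁ U₂ fun p hp =>
    hsub (show p.swap ∈ _ from ⟨hp.2, hp.1⟩)
  wave := fun p hp χ η k1 k2 k3 h1 h2 h3 => by
    have := h.wave p.swap hp η χ h1 h2 h3 k1 k2 k3
    rw [← integral_swap] at this
    refine Eq.trans ?_ (this.trans ?_)
    · congr 1; ext z; simp only [Prod.fst_swap, Prod.snd_swap]; ring
    · rw [← integral_swap]
      congr 1; ext z
      simp only [bU_swap, bV_swap, Prod.fst_swap, Prod.snd_swap]; ring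

theorem integrable_sqU (h : B.IsWeakWave c cU cV) (hp : p ∈ S) :
    IntegrableOn (fun z => cU z ^ 2) (past U₀ V₀ p) ∧
    ∀ y ∈ Icc V₀ p.2, IntegrableOn (fun x => cU (x, y) ^ 2) (Icc U₀ p.1) :=
  SliceBoundU.integrableOn_pow (n := 2) (by exact_mod_cast h.boundU) h.measU
    (B.domain.past_subset hp)

theorem integrableU (h : B.IsWeakWave c cU cV) (hp : p ∈ S) : IntegrableOn cU (past U₀ V₀ p) :=
  integrableOn_of_sq (isCompact_past p).measure_lt_top.ne h.measU (h.integrable_sqU hp).1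

theorem integrableV (h : B.IsWeakWave c cU cV) (hp : p ∈ S) : IntegrableOn cV (past U₀ V₀ p) :=
  IntegrableOn.past_swap (h.swap.integrableU (p := p.swap) hp)

theorem integrable_source (h : B.IsWeakWave c cU cV) (hp : p ∈ S) :
    IntegrableOn (fun z => - (B.bV z * cU z + B.bU z * cV z)) (past U₀ V₀ p) :=
  (((h.integrableU hp).continuousOn_mul (B.continuousOn_bV.mono (B.domain.past_subset hp))
    (isCompact_past p)).add ((h.integrableV hp).continuousOn_mul
    (B.continuousOn_bU.mono (B.domain.past_subset hp)) (isCompact_past p))).neg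

theorem measurable_source (h : B.IsWeakWave c cU cV) :
    Measurable (S.indicator fun z => - (B.bV z * cU z + B.bU z * cV z)) := by
  have e : (S.indicator fun z => - (B.bV z * cU z + B.bU z * cV z))
      = fun z => - (S.indicator B.bV z * cU z + S.indicator B.bU z * cV z) := by
    ext z
    by_cases hz : z ∈ S
    · simp only [indicator_of_mem hz]
    · simp only [indicator_of_notMem hz]; ring
  rw [e]
  exact (((B.domain.measurable_indicator B.continuousOn_bV).mul h.measU).add
    ((B.domain.measurable_indicator B.continuousOn_bU).mul h.measV)).neg

/-- The rescaled field `w = e^b c` on the initial hypersurface `V = V₀`, and the integrated wave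
equation `w_{UV} = - b_U b_V w`. -/
theorem rescaled (h : B.IsWeakWave c cU cV) (hp : p ∈ S) (h₁ : U₀ < p.1) (h₂ : V₀ < p.2) :
    AbsolutelyContinuousOnInterval (fun x => B.r (x, V₀) * c (x, V₀)) U₀ p.1 ∧
    IntegrableOn (fun x => deriv (fun x => B.r (x, V₀) * c (x, V₀)) x ^ 2) (Icc U₀ p.1) ∧
    (B.r p * c p = B.r (p.1, V₀) * c (p.1, V₀) + (B.r (U₀, p.2) * c (U₀, p.2)
      - B.r (U₀, V₀) * c (U₀, V₀)) - ∫ z in past U₀ V₀ p, B.q z * (B.r z * c z)) ∧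
    ∀ᵐ z ∂(volume.restrict (past U₀ V₀ p)),
      cU z = B.slopeU (fun x => B.r (x, V₀) * c (x, V₀)) c z := by
  set Q : ℝ × ℝ → ℝ := fun z => - (B.bV z * cU z + B.bU z * cV z) with hQdef
  have hQ : IntegrableOn Q (past U₀ V₀ p) := h.integrable_source hp
  have hsub := B.domain.past_subset hp
  have hs' : V₀ ∈ Icc V₀ p.2 := ⟨le_rfl, h₂.le⟩
  have corner := B.domain.corner_of_weak hp h₁ h₂ h.cont hQ (h.wave p hp)
  obtain ⟨sl, hcU⟩ := B.domain.slice_of_corner hp h₁ h₂ h.cont h.measU (h.integrableU hp)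
    h.measurable_source hQ h.weakU corner
  have slV : ∀ᵐ x ∂(volume.restrict (Icc U₀ p.1)),
      HasACDeriv (fun y => c (x, y)) (fun y => cV (x, y)) V₀ p.2 :=
    B.domain.swap.ae_slice_of_isWeakDU (p := p.swap) hp h₂ h₁ h.swap.cont
      (h.swap.integrableU (p := p.swap) hp) h.swap.weakU
  set e₀ := deriv fun x => c (x, V₀) with he₀
  set E : ℝ × ℝ → ℝ := fun z => e₀ z.1 + ∫ t in V₀..z.2, Q (z.1, t) with hE
  set W : ℝ × ℝ → ℝ := fun z => B.r z * (E z + B.bU z * c z) with hW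
  have kcont : ContinuousOn (fun z => B.q z * (B.r z * c z)) S :=
    B.continuousOn_q.mul (B.continuousOn_r.mul h.cont)
  have kker := B.domain.isKernel_of_continuousOn kcont
  -- along almost every line `U = const` the derivative of `w_U` is `- b_U b_V w`
  have hWV : ∀ᵐ x ∂(volume.restrict (Icc U₀ p.1)), ∀ v ∈ Icc V₀ p.2,
      W (x, v) = W (x, V₀) - ∫ y in V₀..v, B.q (x, y) * (B.r (x, y) * c (x, y)) := by
    filter_upwards [slV, ae_ae_of_ae_past hcU, (integrableOn_past_iff.1 hQ).prod_right_ae,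
      ae_restrict_mem measurableSet_Icc] with x hx1 hx2 hx3 hx v hv
    have hm : (x, p.2) ∈ S := hsub ⟨hx, ⟨h₂.le, le_rfl⟩⟩
    have hi : IntervalIntegrable (fun y => Q (x, y)) volume V₀ p.2 :=
      (intervalIntegrable_iff_integrableOn_Icc_of_le h₂.le).2 hx3
    have dE : HasACDeriv (fun y => E (x, y)) (fun y => Q (x, y)) V₀ p.2 :=
      ((HasACDeriv.const (e₀ x)).add (HasACDeriv.of_integral hi left_mem_uIcc)).congr_deriv
        (Eventually.of_forall fun t ht => by simp)
    have dW := (B.r_deriv' hm).mul (dE.add ((B.bU_deriv' hm).mul hx1))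
    have dW' : HasACDeriv (fun y => W (x, y))
        (fun y => - (B.q (x, y) * (B.r (x, y) * c (x, y)))) V₀ p.2 := by
      refine dW.congr_deriv ?_
      rw [ae_restrict_iff' measurableSet_Icc] at hx2
      filter_upwards [hx2] with y hy hmem
      rw [uIcc_of_le h₂.le] at hmem
      have e1 : cU (x, y) = E (x, y) := hy hmem
      simp only [hQdef, e1, q]
      ring
    have := (dW'.mono (c := V₀) (d := v) (by
      rw [uIcc_of_le hv.1, uIcc_of_le h₂.le]; exact Icc_subset_Icc_right hv.2)).integral_eq
    rw [intervalIntegral.integral_neg] at this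
    linarith
  -- the derivative of `w` along the lines `V = const` is `W`
  have dw : ∀ y ∈ Icc V₀ p.2, HasACDeriv (fun x => B.r (x, y) * c (x, y)) (fun x => W (x, y))
      U₀ p.1 := by
    intro y hy
    have hm : (p.1, y) ∈ S := hsub ⟨⟨h₁.le, le_rfl⟩, hy⟩
    refine ((B.r_deriv hm).mul (sl y hy)).congr_deriv (Eventually.of_forall fun x _ => ?_)
    simp only [hW, hE]; ring
  have hW₀ : ∀ᵐ x ∂(volume.restrict (Icc U₀ p.1)),
      deriv (fun x => B.r (x, V₀) * c (x, V₀)) x = W (x, V₀) := by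
    rw [ae_restrict_iff' measurableSet_Icc, ← uIcc_of_le h₁.le]
    exact (dw V₀ hs').deriv_eq
  refine ⟨(dw V₀ hs').ac, ?_, ?_, ?_⟩
  · -- square integrability, by comparison with another line
    have hne : NeBot (ae (volume.restrict (Icc V₀ p.2))) := by
      rw [ae_neBot, Ne, Measure.restrict_eq_zero]
      simp [h₂]
    have hcU' : ∀ᵐ y ∂(volume.restrict (Icc V₀ p.2)), ∀ᵐ x ∂(volume.restrict (Icc U₀ p.1)),
        cU (x, y) = E (x, y) := by
      have := ae_ae_of_ae_past (p := p.swap) (ae_past_swap hcU)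
      exact this
    obtain ⟨y, hy, hmem⟩ := (hcU'.and (ae_restrict_mem measurableSet_Icc)).exists
    have hl : ∀ {k : ℝ × ℝ → ℝ}, ContinuousOn k S → ContinuousOn (fun x => k (x, y)) (Icc U₀ p.1) :=
      fun hk => (hk.mono hsub).comp (by fun_prop) fun x hx => ⟨hx, hmem⟩
    have c1 := hl B.continuousOn_r
    have c2 := hl ((B.continuousOn_r.mul (B.continuousOn_bU.mul h.cont)).add
      (B.domain.continuousOn_integral_snd kcont))
    have i2 := (h.integrable_sqU hp).2 y hmem
    have i1 : IntegrableOn (fun x => cU (x, y)) (Icc U₀ p.1) :=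
      integrableOn_of_sq (by simp) (h.measU.comp measurable_prodMk_right) i2
    have i3 := ((i2.continuousOn_mul (c1.pow 2) isCompact_Icc).add (i1.continuousOn_mul
      ((continuousOn_const (c := (2 : ℝ))).mul (c1.mul c2)) isCompact_Icc)).add
      (c2.pow 2).integrableOn_Icc
    refine i3.congr ?_
    filter_upwards [hW₀, hWV, hy] with x e1 e2 e3
    have e2 := e2 y hmem
    simp only [Pi.add_apply, Pi.pow_apply, Pi.mul_apply]
    rw [e1, show W (x, V₀) = W (x, y) + ∫ t in V₀..y, B.q (x, t) * (B.r (x, t) * c (x, t)) by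
      linarith]
    simp only [hW, ← e3]
    ring
  · have i1 := (dw p.2 ⟨h₂.le, le_rfl⟩).integral_eq
    have i2 := (dw V₀ hs').integral_eq
    rw [setIntegral_past h₁.le h₂.le (kker.integrableOn B.domain hp)]
    have hk := kker.integral_slice B.domain hp
    have : ∫ x in U₀..p.1, W (x, p.2) = (∫ x in U₀..p.1, W (x, V₀))
        - ∫ x in U₀..p.1, ∫ y in V₀..p.2, B.q (x, y) * (B.r (x, y) * c (x, y)) := by
      rw [← intervalIntegral.integral_sub (dw V₀ hs').intervalIntegrable hk]
      refine intervalIntegral.integral_congr_ae ?_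
      rw [ae_restrict_iff' measurableSet_Icc] at hWV
      filter_upwards [hWV] with x hx hmem
      rw [uIoc_of_le h₁.le] at hmem
      exact hx (Ioc_subset_Icc_self hmem) p.2 ⟨h₂.le, le_rfl⟩
    simp only [Prod.mk.eta] at i1
    linarith
  · have hA : ∀ᵐ z ∂(volume.restrict (past U₀ V₀ p)), ∀ v ∈ Icc V₀ p.2,
        deriv (fun x => B.r (x, V₀) * c (x, V₀)) z.1 = W (z.1, V₀) ∧
        W (z.1, v) = W (z.1, V₀)
          - ∫ y in V₀..v, B.q (z.1, y) * (B.r (z.1, y) * c (z.1, y)) := by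
      rw [past, Measure.volume_eq_prod, ← Measure.prod_restrict]
      refine Measure.quasiMeasurePreserving_fst.ae (p := fun x => ∀ v ∈ Icc V₀ p.2,
        deriv (fun x => B.r (x, V₀) * c (x, V₀)) x = W (x, V₀) ∧
        W (x, v) = W (x, V₀) - ∫ y in V₀..v, B.q (x, y) * (B.r (x, y) * c (x, y))) ?_
      filter_upwards [hW₀, hWV] with x e1 e2 v hv using ⟨e1, e2 v hv⟩
    filter_upwards [hA, hcU, ae_restrict_mem (measurableSet_past p)] with z hz1 hz2 hz
    obtain ⟨e1, e2⟩ := hz1 z.2 hz.2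
    have hr := (B.r_pos (hsub hz)).ne'
    rw [slopeU, e1, ← e2]
    simp only [hW, Prod.mk.eta]
    rw [hz2]
    field_simp
    simp only [hE]
    ring

theorem isWave (h : B.IsWeakWave c cU cV) :
    B.IsWave (fun x => B.r (x, V₀) * c (x, V₀))
      (fun y => B.r (U₀, y) * c (U₀, y) - B.r (U₀, V₀) * c (U₀, V₀)) c where
  cont := h.cont
  u_ac := fun p hp => by
    obtain ⟨p', hp', l1, l2⟩ := B.domain.exists_gt hp
    have g1 := B.domain.le_fst hp
    have g2 := B.domain.le_snd hp
    have := (h.rescaled hp' (g1.trans_lt l1) (g2.trans_lt l2)).1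
    exact ((HasACDeriv.of_ac this).mono (by
      rw [uIcc_of_le g1, uIcc_of_le (g1.trans l1.le)]; exact Icc_subset_Icc_right l1.le)).ac
  u_sq := fun p hp => by
    obtain ⟨p', hp', l1, l2⟩ := B.domain.exists_gt hp
    have g1 := B.domain.le_fst hp
    have g2 := B.domain.le_snd hp
    exact (h.rescaled hp' (g1.trans_lt l1) (g2.trans_lt l2)).2.1.mono_set
      (Icc_subset_Icc_right l1.le)
  v_ac := fun p hp => by
    obtain ⟨p', hp', l1, l2⟩ := B.domain.exists_gt hp
    have g1 := B.domain.le_fst hp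
    have g2 := B.domain.le_snd hp
    have := (h.swap.rescaled (p := p'.swap) hp' (g2.trans_lt l2) (g1.trans_lt l1)).1
    simp only [r_swap, Prod.swap_prod_mk, Prod.fst_swap] at this
    exact (((HasACDeriv.of_ac this).sub (HasACDeriv.const _)).mono (by
      rw [uIcc_of_le g2, uIcc_of_le (g2.trans l2.le)]; exact Icc_subset_Icc_right l2.le)).ac
  v_sq := fun p hp => by
    obtain ⟨p', hp', l1, l2⟩ := B.domain.exists_gt hp
    have g1 := B.domain.le_fst hp
    have g2 := B.domain.le_snd hp
    have := (h.swap.rescaled (p := p'.swap) hp' (g2.trans_lt l2) (g1.trans_lt l1)).2.1.mono_set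
      (Icc_subset_Icc_right l2.le)
    simpa only [r_swap, Prod.swap_prod_mk, deriv_sub_const] using this
  eq := fun p hp => by
    have g1 := B.domain.le_fst hp
    have g2 := B.domain.le_snd hp
    rcases g1.eq_or_lt with e1 | l1
    · have : volume (past U₀ V₀ p) = 0 := by
        rw [past, ← e1, Icc_self, Measure.volume_eq_prod, Measure.prod_prod]; simp
      rw [setIntegral_measure_zero _ this, ← Prod.mk.eta (p := p), ← e1]
      simp
    rcases g2.eq_or_lt with e2 | l2
    · have : volume (past U₀ V₀ p) = 0 := by
        rw [past, ← e2, Icc_self, Measure.volume_eq_prod, Measure.prod_prod]; simp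
      rw [setIntegral_measure_zero _ this, ← Prod.mk.eta (p := p), ← e2]
      simp
    exact (h.rescaled hp l1 l2).2.2.1

end IsWeakWave
end Background

end

section

/-! ### The geometry of an initial hypersurface -/

/-- The global solution of the linear equations for `A = e^{b + c}` and `B = e^{b - c}` on an
initial hypersurface with data `D`, where `z = A' + θ A` and `y = B' - θ B` with
`θ = e^{ka} Ψ₁`. -/
structure Axis (k x₀ β γ : ℝ) (D : NullData) where
  (A z B y : ℝ → ℝ)
  regular : D.IsWeaklyRegular x₀
  jacobi_A : ∀ x, x₀ ≤ x → IsJacobi k (deriv D.a) (D.ricciCoeff k) (D.weylCoeff k) A z x₀ x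
  jacobi_B : ∀ x, x₀ ≤ x →
    IsJacobi k (deriv D.a) (D.ricciCoeff k) (fun t => - D.weylCoeff k t) B y x₀ x
  A_zero : A x₀ = 1
  B_zero : B x₀ = 1
  z_zero : z x₀ = β + γ
  y_zero : y x₀ = β - γ

/-- The Jacobi equation as a linear system for `(A, z)`. Its coefficients contain `α θ` and `θ ^ 2`;
local integrability of the former is the assumption on the product `a_U Ψ₀⁽¹⁾`. -/
theorem exists_isJacobi {k x₀ z₀ : ℝ} {α φ θ : ℝ → ℝ}
    (hα : ∀ x, x₀ ≤ x → IntervalIntegrable α volume x₀ x)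
    (hφ : ∀ x, x₀ ≤ x → IntervalIntegrable φ volume x₀ x)
    (hθ : ∀ x, x₀ ≤ x → IntervalIntegrable θ volume x₀ x)
    (hθ2 : ∀ x, x₀ ≤ x → IntervalIntegrable (fun t => θ t ^ 2) volume x₀ x)
    (hαθ : ∀ x, x₀ ≤ x → IntervalIntegrable (fun t => α t * θ t) volume x₀ x) :
    ∃ A z : ℝ → ℝ, A x₀ = 1 ∧ z x₀ = z₀ ∧ ∀ x, x₀ ≤ x → IsJacobi k α φ θ A z x₀ x := by
  obtain ⟨A, z, -, -, hA, hz, h⟩ := exists_linear_system x₀ 1 z₀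
    (m₁₁ := fun t => - θ t) (m₁₂ := fun _ => 1)
    (m₂₁ := fun t => (k - 2) * (α t * θ t) - φ t - θ t ^ 2) (m₂₂ := fun t => 2 * α t + θ t)
    (fun x hx => (hθ x hx).neg) (fun x hx => intervalIntegrable_const)
    (fun x hx => (((hαθ x hx).const_mul _).sub (hφ x hx)).sub (hθ2 x hx))
    (fun x hx => ((hα x hx).const_mul _).add (hθ x hx))
  refine ⟨A, z, hA, hz, fun x hx => ⟨(h x hx).1.congr_deriv (Eventually.of_forall fun t _ => by ring),
    (h x hx).2.congr_deriv (Eventually.of_forall fun t _ => by ring)⟩⟩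

/-- The pair of Jacobi fields exists globally; only their positivity can fail. -/
theorem exists_axis {x₀ : ℝ} {D : NullData} (hD : D.IsWeaklyRegular x₀) (k β γ : ℝ) :
    Nonempty (Axis k x₀ β γ D) := by
  have h1 := fun x (hx : x₀ ≤ x) => (hD.a_deriv hx).intervalIntegrable
  have h2 := fun x (hx : x₀ ≤ x) => hD.ricciCoeff_int hx k
  have h3 := fun x (hx : x₀ ≤ x) => hD.weylCoeff_int hx k
  have h4 := fun x (hx : x₀ ≤ x) => hD.weylCoeff_sq_int hx k
  have h5 := fun x (hx : x₀ ≤ x) => hD.deriv_mul_weylCoeff_int hx k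
  obtain ⟨A, z, a1, a2, a3⟩ := exists_isJacobi (k := k) (z₀ := β + γ) h1 h2 h3 h4 h5
  obtain ⟨B, y, b1, b2, b3⟩ := exists_isJacobi (k := k) (z₀ := β - γ)
    (θ := fun t => - D.weylCoeff k t) h1 h2
    (fun x hx => (h3 x hx).neg) (fun x hx => by simpa only [neg_sq] using h4 x hx)
    (fun x hx => by simpa only [mul_neg, Pi.neg_def] using (h5 x hx).neg)
  exact ⟨⟨A, z, B, y, hD, a3, b3, a1, b1, a2, b2⟩⟩

/-- The potential on the initial hypersurface, determined by the constraint `κ ψ'² = e^{ka} Φ`. -/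
def NullData.potential (D : NullData) (k κ x₀ x : ℝ) : ℝ :=
  ∫ t in x₀..x, √(D.ricciCoeff k t / κ)

namespace NullData.IsWeaklyRegular

variable {x₀ x : ℝ} {D : NullData}

theorem ricciCoeff_nonneg (hD : D.IsWeaklyRegular x₀) (k : ℝ) : ∀ᵐ t : ℝ, x₀ ≤ t → 0 ≤ D.ricciCoeff k t := by
  have := (ae_restrict_iff' measurableSet_Ici).1 hD.Φ_nonneg
  filter_upwards [this] with t ht h
  exact mul_nonneg (Real.exp_pos _).le (ht h)

theorem potential_sq (hD : D.IsWeaklyRegular x₀) (k : ℝ) {κ : ℝ} (hκ : 0 < κ) : ∀ᵐ t : ℝ, x₀ ≤ t →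
    √(D.ricciCoeff k t / κ) ^ 2 = D.ricciCoeff k t / κ := by
  filter_upwards [hD.ricciCoeff_nonneg k] with t ht h
  exact Real.sq_sqrt (div_nonneg (ht h) hκ.le)

theorem potential_int (hD : D.IsWeaklyRegular x₀) (k : ℝ) {κ : ℝ} (hκ : 0 < κ) (hx : x₀ ≤ x) :
    IntervalIntegrable (fun t => √(D.ricciCoeff k t / κ)) volume x₀ x := by
  have h1 := (hD.ricciCoeff_int hx k).div_const κ
  rw [intervalIntegrable_iff_integrableOn_Ioc_of_le hx] at h1 ⊢
  have h2 : IntegrableOn (fun _ => (1 : ℝ)) (Ioc x₀ x) := integrableOn_const (by simp)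
  refine Integrable.mono (h2.add h1.abs)
    (Real.continuous_sqrt.comp_aestronglyMeasurable h1.aestronglyMeasurable)
    (Eventually.of_forall fun t => ?_)
  rw [Real.norm_eq_abs, Real.norm_eq_abs, abs_of_nonneg (Real.sqrt_nonneg _), Pi.add_apply]
  refine le_trans ?_ (le_abs_self _)
  have h3 : √(D.ricciCoeff k t / κ) ≤ √|D.ricciCoeff k t / κ| :=
    Real.sqrt_le_sqrt (le_abs_self _)
  nlinarith [Real.sq_sqrt (abs_nonneg (D.ricciCoeff k t / κ)),
    sq_nonneg (√|D.ricciCoeff k t / κ| - 1), Real.sqrt_nonneg |D.ricciCoeff k t / κ|]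

theorem potential_deriv (hD : D.IsWeaklyRegular x₀) (k : ℝ) {κ : ℝ} (hκ : 0 < κ) (hx : x₀ ≤ x) :
    HasACDeriv (D.potential k κ x₀) (fun t => √(D.ricciCoeff k t / κ)) x₀ x :=
  HasACDeriv.of_integral (hD.potential_int k hκ hx) left_mem_uIcc

end NullData.IsWeaklyRegular

namespace Axis

variable {k x₀ β γ : ℝ} {D : NullData} (J : Axis k x₀ β γ D)

/-- The area function `e^{2b}` on the initial hypersurface. -/
def f (x : ℝ) : ℝ := J.A x * J.B x

/-- The derivative of the area function. -/
def f₁ (x : ℝ) : ℝ := J.z x * J.B x + J.A x * J.y x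

/-- The second derivative of the area function. -/
def f₂ (x : ℝ) : ℝ := 2 * deriv D.a x * J.f₁ x - 2 * D.ricciCoeff k x * J.f x
  + 2 * ((J.z x - D.weylCoeff k x * J.A x) * (J.y x + D.weylCoeff k x * J.B x))

/-- The coefficient `c` on the initial hypersurface. -/
def c (x : ℝ) : ℝ := (Real.log (J.A x) - Real.log (J.B x)) / 2

/-- The part of the initial hypersurface on which the metric is not degenerate. -/
def domain : Set ℝ := {x | x₀ ≤ x ∧ ∀ t ∈ Icc x₀ x, 0 < J.A t ∧ 0 < J.B t}

theorem f_zero : J.f x₀ = 1 := by rw [f, J.A_zero, J.B_zero, one_mul]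

theorem f₁_zero : J.f₁ x₀ = 2 * β := by
  rw [f₁, J.A_zero, J.B_zero, J.z_zero, J.y_zero]; ring

variable {x : ℝ}

theorem f_deriv (hx : x₀ ≤ x) : HasACDeriv J.f J.f₁ x₀ x :=
  ((J.jacobi_A x hx).A_deriv.mul (J.jacobi_B x hx).A_deriv).congr_deriv
    (Eventually.of_forall fun t _ => by simp only [f₁]; ring)

theorem f₁_deriv (hx : x₀ ≤ x) : HasACDeriv J.f₁ J.f₂ x₀ x :=
  (((J.jacobi_A x hx).z_deriv.mul (J.jacobi_B x hx).A_deriv).add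
    ((J.jacobi_A x hx).A_deriv.mul (J.jacobi_B x hx).z_deriv)).congr_deriv
    (Eventually.of_forall fun t _ => by simp only [f₂, f₁, f]; ring)

theorem mem_domain_of_le {x' : ℝ} (h : x ∈ J.domain) (h0 : x₀ ≤ x') (h1 : x' ≤ x) :
    x' ∈ J.domain :=
  ⟨h0, fun t ht => h.2 t ⟨ht.1, ht.2.trans h1⟩⟩

theorem c_deriv (h : x ∈ J.domain) : HasACDeriv J.c (fun t =>
    ((J.z t - D.weylCoeff k t * J.A t) / J.A t
      - (J.y t + D.weylCoeff k t * J.B t) / J.B t) / 2) x₀ x := by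
  have h0 := uIcc_of_le h.1
  have lA := (J.jacobi_A x h.1).A_deriv.log fun t ht => (h.2 t (by rwa [h0] at ht)).1
  have lB := (J.jacobi_B x h.1).A_deriv.log fun t ht => (h.2 t (by rwa [h0] at ht)).2
  refine (((lA.sub lB).const_mul (1 / 2)).congr fun t _ => by simp only [c]; ring).congr_deriv
    (Eventually.of_forall fun t _ => by ring)

theorem f_pos (h : x ∈ J.domain) : 0 < J.f x := by
  obtain ⟨h1, h2⟩ := h.2 x ⟨h.1, le_rfl⟩
  exact mul_pos h1 h2

theorem isRiccati (h : x ∈ J.domain) : IsRiccati k (deriv D.a) (D.ricciCoeff k) (D.weylCoeff k)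
    (fun t => (Real.log (J.A t) + Real.log (J.B t)) / 2) J.c
    (fun t => (J.z t / J.A t + J.y t / J.B t) / 2) (fun t => (J.z t / J.A t - J.y t / J.B t) / 2)
    x₀ x :=
  (J.jacobi_A x h.1).isRiccati (J.jacobi_B x h.1)
    (fun t ht => (h.2 t (by rwa [uIcc_of_le h.1] at ht)).1)
    (fun t ht => (h.2 t (by rwa [uIcc_of_le h.1] at ht)).2)

/-- Solutions of the constraints on an initial hypersurface are unique. -/
theorem eq_of_hasNPData {I : Set ℝ} {b c : ℝ → ℝ} (h : HasNPData k x₀ I D b c β γ)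
    (hb : b x₀ = 0) (hc : c x₀ = 0) (h0 : x₀ ≤ x) (hI : Icc x₀ x ⊆ I) :
    J.A x = Real.exp (b x + c x) ∧ J.B x = Real.exp (b x - c x) := by
  rcases h0.eq_or_lt with rfl | h01
  · rw [J.A_zero, J.B_zero, hb, hc]; simp
  obtain ⟨p, w, hR, hp, hw⟩ := h.exists_isRiccati J.regular h01 hI
  have hα := (J.regular.a_deriv h0).intervalIntegrable
  constructor
  · refine (IsJacobi.unique h0 hR.isJacobi (J.jacobi_A x h0) hα (fun t _ => Real.exp_pos _)
      ?_ ?_).symm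
    · rw [J.A_zero, hb, hc]; simp
    · rw [J.z_zero, hb, hc, hp, hw]; simp
  · have := (IsJacobi.unique h0 hR.neg.isJacobi (J.jacobi_B x h0) hα (fun t _ => Real.exp_pos _)
      ?_ ?_).symm
    · rw [this, sub_eq_add_neg]
    · rw [J.B_zero, hb, hc]; simp
    · rw [J.y_zero, hb, hc, hp, hw]; simp; ring

/-- Metric data with the prescribed scalars exist only inside `J.domain`, and there they are given
by the Jacobi fields. -/
theorem mem_domain_of_hasNPData {I : Set ℝ} {b c : ℝ → ℝ} (h : HasNPData k x₀ I D b c β γ)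
    (hb : b x₀ = 0) (hc : c x₀ = 0) (h0 : x₀ ≤ x) (hI : Icc x₀ x ⊆ I) :
    x ∈ J.domain ∧ J.f x = Real.exp (2 * b x) ∧ J.c x = c x := by
  refine ⟨⟨h0, fun t ht => ?_⟩, ?_, ?_⟩
  · obtain ⟨h1, h2⟩ := J.eq_of_hasNPData h hb hc ht.1 ((Icc_subset_Icc_right ht.2).trans hI)
    rw [h1, h2]
    exact ⟨Real.exp_pos _, Real.exp_pos _⟩
  · obtain ⟨h1, h2⟩ := J.eq_of_hasNPData h hb hc h0 hI
    rw [f, h1, h2, ← Real.exp_add]; congr 1; ring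
  · obtain ⟨h1, h2⟩ := J.eq_of_hasNPData h hb hc h0 hI
    rw [Axis.c, h1, h2, Real.log_exp, Real.log_exp]; ring

/-- The domain is open to the right. -/
theorem exists_gt_mem_domain (h : x ∈ J.domain) : ∃ x' ∈ J.domain, x < x' := by
  have cA : ContinuousOn J.A (Icc x₀ (x + 1)) := by
    have := (J.jacobi_A (x + 1) (h.1.trans (by linarith))).A_deriv.continuousOn
    rwa [uIcc_of_le (h.1.trans (by linarith))] at this
  have cB : ContinuousOn J.B (Icc x₀ (x + 1)) := by
    have := (J.jacobi_B (x + 1) (h.1.trans (by linarith))).A_deriv.continuousOn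
    rwa [uIcc_of_le (h.1.trans (by linarith))] at this
  have hx : x ∈ Icc x₀ (x + 1) := ⟨h.1, by linarith⟩
  obtain ⟨pA, pB⟩ := h.2 x ⟨h.1, le_rfl⟩
  have e1 := (cA x hx).eventually (lt_mem_nhds pA)
  have e2 := (cB x hx).eventually (lt_mem_nhds pB)
  have hsub : 𝓝[Ico x (x + 1)] x ≤ 𝓝[Icc x₀ (x + 1)] x :=
    nhdsWithin_mono _ fun t ht => ⟨h.1.trans ht.1, ht.2.le⟩
  have e3 := hsub (e1.and e2)
  rw [nhdsWithin_Ico_eq_nhdsGE (by linarith)] at e3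
  obtain ⟨u, hu, hu'⟩ := mem_nhdsGE_iff_exists_Ico_subset.1 e3
  have hu1 : x < u := hu
  refine ⟨(x + u) / 2, ⟨h.1.trans (by linarith), fun t ht => ?_⟩, by linarith⟩
  rcases le_or_gt t x with ht' | ht'
  · exact h.2 t ⟨ht.1, ht'⟩
  · exact hu' ⟨ht'.le, by linarith [ht.2]⟩

end Axis

end

section

/-! ### The solution with given data -/

theorem ae_of_forall_uIcc {x₀ : ℝ} {I : Set ℝ} {A : ℝ → Prop} (h0 : ∀ x ∈ I, x₀ ≤ x)
    (hlt : ∀ x ∈ I, ∃ x' ∈ I, x < x') (hI : ∀ x ∈ I, Icc x₀ x ⊆ I)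
    (h : ∀ x ∈ I, ∀ᵐ t : ℝ, t ∈ uIcc x₀ x → A t) : ∀ᵐ t : ℝ, t ∈ I → A t := by
  have hq : ∀ᵐ t : ℝ, ∀ q : ℚ, (q : ℝ) ∈ I → t ∈ uIcc x₀ (q : ℝ) → A t := by
    refine ae_all_iff.2 fun q => ?_
    by_cases hq : (q : ℝ) ∈ I
    · filter_upwards [h _ hq] with t ht _ using ht
    · exact Eventually.of_forall fun t hh => absurd hh hq
  filter_upwards [hq] with t ht hm
  obtain ⟨x', hx', hlt'⟩ := hlt t hm
  obtain ⟨q, hq1, hq2⟩ := exists_rat_btwn hlt'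
  have g0 := h0 t hm
  refine ht q (hI x' hx' ⟨g0.trans hq1.le, hq2.le⟩) ?_
  rw [uIcc_of_le (g0.trans hq1.le)]
  exact ⟨g0, hq1.le⟩

theorem IsFutureDomain.ae_fst (hS : IsFutureDomain U₀ V₀ S) {A : ℝ → Prop}
    (h : ∀ x, (x, V₀) ∈ S → ∀ᵐ t : ℝ, t ∈ uIcc U₀ x → A t) : ∀ᵐ t : ℝ, (t, V₀) ∈ S → A t := by
  refine ae_of_forall_uIcc (x₀ := U₀) (I := {x | (x, V₀) ∈ S}) (fun x hx => hS.le_fst hx)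
    (fun x hx => ?_) (fun x hx t ht => ?_) h
  · obtain ⟨p', hp', l1, -⟩ := hS.exists_gt hx
    exact ⟨p'.1, hS.mem_fst hp', l1⟩
  · exact hS.past_subset hx ⟨ht, le_rfl, le_rfl⟩

theorem integrableOn_sq_affine {k₁ k₂ m : ℝ → ℝ} {a b : ℝ} (c1 : ContinuousOn k₁ (Icc a b))
    (c2 : ContinuousOn k₂ (Icc a b)) (i1 : IntegrableOn m (Icc a b))
    (i2 : IntegrableOn (fun x => m x ^ 2) (Icc a b)) :
    IntegrableOn (fun x => (k₁ x * m x + k₂ x) ^ 2) (Icc a b) := by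
  have i3 := ((i2.continuousOn_mul (c1.pow 2) isCompact_Icc).add (i1.continuousOn_mul
    ((continuousOn_const (c := (2 : ℝ))).mul (c1.mul c2)) isCompact_Icc)).add
    (c2.pow 2).integrableOn_Icc
  refine i3.congr (Eventually.of_forall fun x => ?_)
  simp only [Pi.add_apply, Pi.pow_apply, Pi.mul_apply]
  ring

namespace Axis

variable {k x₀ x β γ : ℝ} {D : NullData} (J : Axis k x₀ β γ D)

/-- The function `e^b m` on an initial hypersurface has a square integrable derivative if `m`
does. -/
theorem rescaled_data {m m' : ℝ → ℝ} (hx : x ∈ J.domain) (hm : HasACDeriv m m' x₀ x)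
    (hm2 : IntegrableOn (fun t => m' t ^ 2) (Icc x₀ x)) :
    AbsolutelyContinuousOnInterval (fun t => √(J.f t) * m t) x₀ x ∧
    IntegrableOn (fun t => deriv (fun t => √(J.f t) * m t) t ^ 2) (Icc x₀ x) := by
  have h0 := uIcc_of_le hx.1
  have hpos : ∀ t ∈ uIcc x₀ x, 0 < J.f t := fun t ht => by
    rw [h0] at ht
    exact J.f_pos (J.mem_domain_of_le hx ht.1 ht.2)
  have d := ((J.f_deriv hx.1).sqrt hpos).mul hm
  refine ⟨d.ac, ?_⟩
  have cf := (J.f_deriv hx.1).continuousOn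
  have cf1 := (J.f₁_deriv hx.1).continuousOn
  have cm := hm.continuousOn
  rw [h0] at cf cf1 cm hpos
  have im : IntegrableOn m' (Icc x₀ x) :=
    (intervalIntegrable_iff_integrableOn_Icc_of_le hx.1).1 hm.intervalIntegrable
  have hsq : ∀ t ∈ Icc x₀ x, 2 * √(J.f t) ≠ 0 := fun t ht =>
    (mul_pos two_pos (Real.sqrt_pos.2 (hpos t ht))).ne'
  refine (integrableOn_sq_affine (k₁ := fun t => √(J.f t))
    (k₂ := fun t => 1 / (2 * √(J.f t)) * J.f₁ t * m t) cf.sqrt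
    (((continuousOn_const.div (continuousOn_const.mul cf.sqrt) hsq).mul cf1).mul cm) im hm2).congr ?_
  have := d.deriv_eq
  rw [h0, ← ae_restrict_iff' measurableSet_Icc] at this
  filter_upwards [this] with t ht
  rw [ht]; ring

theorem c_data (hx : x ∈ J.domain) :
    AbsolutelyContinuousOnInterval (fun t => √(J.f t) * J.c t) x₀ x ∧
    IntegrableOn (fun t => deriv (fun t => √(J.f t) * J.c t) t ^ 2) (Icc x₀ x) := by
  have h0 := uIcc_of_le hx.1
  have hR := J.isRiccati hx
  refine J.rescaled_data hx hR.c_deriv ?_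
  have cw := hR.w_deriv.continuousOn
  rw [h0] at cw
  have i1 := (intervalIntegrable_iff_integrableOn_Icc_of_le hx.1).1 (J.regular.weylCoeff_int hx.1 k)
  have i2 := (intervalIntegrable_iff_integrableOn_Icc_of_le hx.1).1
    (J.regular.weylCoeff_sq_int hx.1 k)
  refine (integrableOn_sq_affine (k₁ := fun _ => -1) continuousOn_const cw i1 i2).congr
    (Eventually.of_forall fun t => by ring)

theorem potential_data {κ : ℝ} (hκ : 0 < κ) (hx : x ∈ J.domain) :
    AbsolutelyContinuousOnInterval (fun t => √(J.f t) * D.potential k κ x₀ t) x₀ x ∧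
    IntegrableOn (fun t => deriv (fun t => √(J.f t) * D.potential k κ x₀ t) t ^ 2) (Icc x₀ x) := by
  refine J.rescaled_data hx (J.regular.potential_deriv k hκ hx.1) ?_
  have i1 := (intervalIntegrable_iff_integrableOn_Icc_of_le hx.1).1
    ((J.regular.ricciCoeff_int hx.1 k).div_const κ)
  refine i1.congr ?_
  rw [EventuallyEq, ae_restrict_iff' measurableSet_Icc]
  filter_upwards [J.regular.potential_sq k hκ] with t ht hm
  exact (ht hm.1).symm

theorem c_zero : J.c x₀ = 0 := by rw [c, J.A_zero, J.B_zero]; simp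

end Axis

theorem potential_zero (D : NullData) (k κ x₀ : ℝ) : D.potential k κ x₀ x₀ = 0 :=
  intervalIntegral.integral_same

variable {k₁ k₂ β₁ γ₁ β₂ γ₂ κ : ℝ} {D₁ D₂ : NullData} (J₁ : Axis k₁ U₀ β₁ γ₁ D₁)
  (J₂ : Axis k₂ V₀ β₂ γ₂ D₂)

/-- The solution `X` on `S` has the initial data of `J₁` and `J₂`. -/
structure IsCanonical (X : Solution κ U₀ V₀ S) : Prop where
  f_eq : X.f = J₁.f
  f₁_eq : X.f₁ = J₁.f₁
  f₂_eq : X.f₂ = J₁.f₂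
  g_eq : X.g = J₂.f
  g₁_eq : X.g₁ = J₂.f₁
  g₂_eq : X.g₂ = J₂.f₂
  u_eq : X.u = fun x => √(J₁.f x) * J₁.c x
  v_eq : X.v = fun y => √(J₂.f y) * J₂.c y
  uψ_eq : X.uψ = fun x => √(J₁.f x) * D₁.potential k₁ κ U₀ x
  vψ_eq : X.vψ = fun y => √(J₂.f y) * D₂.potential k₂ κ V₀ y
  α_eq : X.α = D₁.a
  β_eq : X.β = D₂.a
  mem : ∀ p ∈ S, p.1 ∈ J₁.domain ∧ p.2 ∈ J₂.domain

/-- The background determined by the data, on a domain on which the area does not vanish. -/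
def background (hS : IsFutureDomain U₀ V₀ S)
    (h : ∀ p ∈ S, p.1 ∈ J₁.domain ∧ p.2 ∈ J₂.domain ∧ 0 < J₁.f p.1 + J₂.f p.2 - 1) :
    Background U₀ V₀ S where
  f := J₁.f
  f₁ := J₁.f₁
  f₂ := J₁.f₂
  g := J₂.f
  g₁ := J₂.f₁
  g₂ := J₂.f₂
  domain := hS
  f_zero := J₁.f_zero
  g_zero := J₂.f_zero
  f_deriv := fun p hp => J₁.f_deriv (h p hp).1.1
  f₁_deriv := fun p hp => J₁.f₁_deriv (h p hp).1.1
  g_deriv := fun p hp => J₂.f_deriv (h p hp).2.1.1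
  g₁_deriv := fun p hp => J₂.f₁_deriv (h p hp).2.1.1
  pos := fun p hp => (h p hp).2.2

theorem Background.exists_isWave (B : Background U₀ V₀ S) {u v : ℝ → ℝ}
    (hu : ∀ p ∈ S, AbsolutelyContinuousOnInterval u U₀ p.1 ∧
      IntegrableOn (fun t => deriv u t ^ 2) (Icc U₀ p.1))
    (hv : ∀ p ∈ S, AbsolutelyContinuousOnInterval v V₀ p.2 ∧
      IntegrableOn (fun t => deriv v t ^ 2) (Icc V₀ p.2)) : ∃ c, B.IsWave u v c := by
  obtain ⟨w, cw, hw⟩ := B.domain.exists_volterra (q := fun z => - B.q z)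
    (h := fun p => u p.1 + v p.2) B.continuousOn_q.neg
    ((B.domain.continuousOn_comp_fst fun p hp => (HasACDeriv.of_ac (hu p hp).1).continuousOn).add
    (B.domain.continuousOn_comp_snd fun p hp => (HasACDeriv.of_ac (hv p hp).1).continuousOn))
  have hrw : ∀ p ∈ S, B.r p * (w p / B.r p) = w p := fun p hp =>
    mul_div_cancel₀ _ (B.r_pos hp).ne'
  refine ⟨fun p => w p / B.r p, cw.div B.continuousOn_r fun p hp => (B.r_pos hp).ne',
    fun p hp => (hu p hp).1, fun p hp => (hu p hp).2, fun p hp => (hv p hp).1,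
    fun p hp => (hv p hp).2, fun p hp => ?_⟩
  rw [hrw p hp, hw p hp, sub_eq_add_neg, ← integral_neg]
  congr 1
  refine setIntegral_congr_fun (measurableSet_past p) fun z hz => ?_
  simp only [hrw z (B.domain.past_subset hp hz), neg_mul]

/-- A solution with the given data exists on every future domain over which the data exist and on
which the area function is positive. -/
theorem exists_isCanonical (hκ : 0 < κ) (hS : IsFutureDomain U₀ V₀ S)
    (h : ∀ p ∈ S, p.1 ∈ J₁.domain ∧ p.2 ∈ J₂.domain ∧ 0 < J₁.f p.1 + J₂.f p.2 - 1) :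
    ∃ X : Solution κ U₀ V₀ S, IsCanonical J₁ J₂ X := by
  obtain ⟨c, hc⟩ := (background J₁ J₂ hS h).exists_isWave
    (fun p hp => J₁.c_data (h p hp).1) (fun p hp => J₂.c_data (h p hp).2.1)
  obtain ⟨ψ, hψ⟩ := (background J₁ J₂ hS h).exists_isWave
    (fun p hp => J₁.potential_data hκ (h p hp).1) (fun p hp => J₂.potential_data hκ (h p hp).2.1)
  exact ⟨{ toBackground := background J₁ J₂ hS h
           u := _, v := _, uψ := _, vψ := _
           α := D₁.a, β := D₂.a
           a := fun p => D₁.a p.1 + D₂.a p.2 + ∫ z in past U₀ V₀ p, _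
           c := c, ψ := ψ
           wave_c := hc
           wave_ψ := hψ
           α_ac := fun p hp => J₁.regular.a_ac _ (h p hp).1.1
           β_ac := fun p hp => J₂.regular.a_ac _ (h p hp).2.1.1
           a_eq := fun p hp => rfl },
    ⟨rfl, rfl, rfl, rfl, rfl, rfl, rfl, rfl, rfl, rfl, rfl, rfl,
      fun p hp => ⟨(h p hp).1, (h p hp).2.1⟩⟩⟩

theorem integral_past_axis (Q : ℝ × ℝ → ℝ) (x : ℝ) : ∫ z in past U₀ V₀ (x, V₀), Q z = 0 := by
  have : volume (past U₀ V₀ (x, V₀)) = 0 := by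
    rw [past, Icc_self, Measure.volume_eq_prod, Measure.prod_prod]; simp
  exact setIntegral_measure_zero _ this

namespace Solution

variable {J₁} (X : Solution κ U₀ V₀ S) {x : ℝ}

theorem s_axis (x : ℝ) : X.s (x, V₀) = X.f x := by
  simp only [Background.s, X.g_zero]; ring

/-- The constraint on the initial hypersurface, in terms of the Ricci scalar. -/
theorem constraint_axis (hf : X.f = J₁.f) (hf₁ : X.f₁ = J₁.f₁) (hf₂ : X.f₂ = J₁.f₂)
    (hα : X.α = D₁.a) (hc : ∀ x, (x, V₀) ∈ S → X.c (x, V₀) = J₁.c x)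
    (hd : ∀ x, (x, V₀) ∈ S → x ∈ J₁.domain) :
    ∀ᵐ x : ℝ, (x, V₀) ∈ S → X.constraint (x, V₀)
      = J₁.f x * (D₁.ricciCoeff k₁ x - κ * X.ψU (x, V₀) ^ 2) := by
  refine X.domain.ae_fst fun x hx => ?_
  have hl : ∀ t ∈ uIcc U₀ x, (t, V₀) ∈ S := fun t ht => X.domain.mem_line hx ht
  have d1 : HasACDeriv (fun t => X.c (t, V₀)) (fun t => X.cU (t, V₀)) U₀ x := X.wave_c.deriv_U hx
  have d2 := (J₁.c_deriv (hd x hx)).congr (f₁ := fun t => X.c (t, V₀)) fun t ht => (hc t (hl t ht)).symm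
  filter_upwards [d1.deriv_eq, d2.deriv_eq] with t h1 h2 ht
  have hcU := (h1 ht).symm.trans (h2 ht)
  obtain ⟨pA, pB⟩ := (hd t (hl t ht)).2 t ⟨(hd t (hl t ht)).1, le_rfl⟩
  have haU : X.aU (t, V₀) = deriv D₁.a t := by
    simp only [aU, hα, intervalIntegral.integral_same, add_zero]
  have hb : X.bU (t, V₀) = J₁.f₁ t / (2 * J₁.f t) := by
    simp only [Background.bU, s_axis, hf, hf₁]
  simp only [constraint, haU, hb, hcU, s_axis, hf, hf₂, Axis.f₂, Axis.f₁, Axis.f]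
  have a1 := pA.ne'
  have a2 := pB.ne'
  field_simp
  ring

end Solution

namespace IsCanonical

variable {J₁ J₂} {X : Solution κ U₀ V₀ S} (h : IsCanonical J₁ J₂ X) {x : ℝ} {p : ℝ × ℝ}
include h

theorem swap : IsCanonical J₂ J₁ X.swap :=
  ⟨h.g_eq, h.g₁_eq, h.g₂_eq, h.f_eq, h.f₁_eq, h.f₂_eq, h.v_eq, h.u_eq, h.vψ_eq, h.uψ_eq, h.β_eq,
    h.α_eq, fun p hp => ⟨(h.mem p.swap hp).2, (h.mem p.swap hp).1⟩⟩

theorem s_eq (p : ℝ × ℝ) : X.s p = J₁.f p.1 + J₂.f p.2 - 1 := by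
  simp only [Background.s, h.f_eq, h.g_eq]

theorem r_axis (x : ℝ) : X.r (x, V₀) = √(J₁.f x) := by
  rw [Background.r, X.s_axis, h.f_eq]

theorem c_axis (hx : (x, V₀) ∈ S) : X.c (x, V₀) = J₁.c x := by
  have e := X.wave_c.eq _ hx
  have hr := X.r_pos hx
  rw [integral_past_axis, h.u_eq, h.v_eq] at e
  simp only [h.r_axis, J₂.c_zero, mul_zero, add_zero, sub_zero] at e
  rw [h.r_axis] at hr
  exact mul_left_cancel₀ hr.ne' e

theorem ψ_axis (hx : (x, V₀) ∈ S) : X.ψ (x, V₀) = D₁.potential k₁ κ U₀ x := by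
  have e := X.wave_ψ.eq _ hx
  have hr := X.r_pos hx
  rw [integral_past_axis, h.uψ_eq, h.vψ_eq] at e
  simp only [h.r_axis, potential_zero, mul_zero, add_zero, sub_zero] at e
  rw [h.r_axis] at hr
  exact mul_left_cancel₀ hr.ne' e

theorem a_axis (hx : (x, V₀) ∈ S) : X.a (x, V₀) = D₁.a x := by
  rw [X.a_eq _ hx, integral_past_axis, h.α_eq, h.β_eq]
  simp only [J₂.regular.a_zero, add_zero]

theorem ψU_axis (hκ : 0 < κ) :
    ∀ᵐ x : ℝ, (x, V₀) ∈ S → deriv (fun t => X.ψ (t, V₀)) x = √(D₁.ricciCoeff k₁ x / κ) ∧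
      X.ψU (x, V₀) = √(D₁.ricciCoeff k₁ x / κ) := by
  refine X.domain.ae_fst fun x hx => ?_
  have hl : ∀ t ∈ uIcc U₀ x, (t, V₀) ∈ S := fun t ht => X.domain.mem_line hx ht
  have d1 : HasACDeriv (fun t => X.ψ (t, V₀)) (fun t => X.ψU (t, V₀)) U₀ x := X.wave_ψ.deriv_U hx
  have d2 := (J₁.regular.potential_deriv k₁ hκ (h.mem _ hx).1.1).congr
    (f₁ := fun t => X.ψ (t, V₀)) fun t ht => (h.ψ_axis (hl t ht)).symm
  filter_upwards [d1.deriv_eq, d2.deriv_eq] with t h1 h2 ht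
  exact ⟨h2 ht, (h1 ht).symm.trans (h2 ht)⟩

theorem constraint_zero (hκ : 0 < κ) : ∀ᵐ x : ℝ, (x, V₀) ∈ S → X.constraint (x, V₀) = 0 := by
  filter_upwards [X.constraint_axis h.f_eq h.f₁_eq h.f₂_eq h.α_eq (fun x hx => h.c_axis hx)
    (fun x hx => (h.mem _ hx).1), h.ψU_axis hκ, J₁.regular.potential_sq k₁ hκ] with t h1 h2 h3 ht
  rw [h1 ht, (h2 ht).2, h3 (h.mem _ ht).1.1]
  field_simp
  ring

theorem isRiccati_axis (hx : (x, V₀) ∈ S) : IsRiccati k₁ (deriv D₁.a) (D₁.ricciCoeff k₁)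
    (D₁.weylCoeff k₁) (fun t => X.b (t, V₀)) (fun t => X.c (t, V₀))
    (fun t => (J₁.z t / J₁.A t + J₁.y t / J₁.B t) / 2)
    (fun t => (J₁.z t / J₁.A t - J₁.y t / J₁.B t) / 2) U₀ x := by
  have hl : ∀ t ∈ uIcc U₀ x, (t, V₀) ∈ S := fun t ht => X.domain.mem_line hx ht
  obtain ⟨r1, r2, r3, r4⟩ := J₁.isRiccati (h.mem _ hx).1
  refine ⟨r1.congr fun t ht => ?_, r2.congr fun t ht => (h.c_axis (hl t ht)).symm, r3, r4⟩
  obtain ⟨pA, pB⟩ := (h.mem _ (hl t ht)).1.2 t ⟨(h.mem _ (hl t ht)).1.1, le_rfl⟩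
  simp only [Background.b, X.s_axis, h.f_eq, Axis.f]
  rw [Real.log_mul pA.ne' pB.ne']; ring

/-- The integrated solution takes the prescribed scalars on the outgoing hypersurface. -/
theorem hasNPData : HasNPData k₁ U₀ {x | (x, V₀) ∈ S} D₁ (fun t => X.b (t, V₀))
    (fun t => X.c (t, V₀)) β₁ γ₁ := by
  refine hasNPData_of_isRiccati J₁.regular X.domain.mem (fun x hx => ?_)
    (fun x hx => h.isRiccati_axis hx) ?_ ?_
  · obtain ⟨p', hp', l1, -⟩ := X.domain.exists_gt hx
    exact ⟨X.domain.le_fst hx, p'.1, X.domain.mem_fst hp', l1⟩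
  · simp only [J₁.z_zero, J₁.y_zero, J₁.A_zero, J₁.B_zero]; ring
  · simp only [J₁.z_zero, J₁.y_zero, J₁.A_zero, J₁.B_zero]; ring

end IsCanonical

/-- The solution with given data is a development. -/
theorem IsCanonical.isDevelopment {D : InitialData} {J₁ : Axis 0 D.U₀ (- D.ρ₀) (- D.σ₀) D.out}
    {J₂ : Axis 4 D.V₀ D.μ₀ D.lam₀ D.inc} {X : Solution κ D.U₀ D.V₀ S} (h : IsCanonical J₁ J₂ X)
    (hκ : 0 < κ) : IsDevelopment κ D S X.fields where
  domain := X.domain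
  solution := ⟨X.derivs, X.isRegular, X.solvesEinstein (h.constraint_zero hκ)
    (h.swap.constraint_zero hκ)⟩
  b_zero := by
    change 1 / 2 * Real.log (X.s _) = 0
    rw [X.s_axis, X.f_zero]; simp
  c_zero := by
    change X.c _ = 0
    rw [h.c_axis X.domain.mem, J₁.c_zero]
  ψ_zero := by
    change X.ψ _ = 0
    rw [h.ψ_axis X.domain.mem, potential_zero]
  a_out := fun U hU => h.a_axis hU
  a_inc := fun V hV => h.swap.a_axis hV
  np_out := h.hasNPData
  np_inc := by
    have := h.swap.hasNPData
    rw [X.swap_b] at this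
    exact this
  ψ_out := by
    filter_upwards [h.ψU_axis hκ] with t ht hm
    exact (ht hm).1.symm ▸ Real.sqrt_nonneg _
  ψ_inc := by
    filter_upwards [h.swap.ψU_axis hκ] with t ht hm
    exact (ht hm).1.symm ▸ Real.sqrt_nonneg _

end

section

/-! ### Developments in integrated form -/

theorem HasACDeriv.eqOn_of_continuousOn {f g g' : ℝ → ℝ} {a b : ℝ} (hab : a < b)
    (h : HasACDeriv f g a b) (h' : HasACDeriv f g' a b) (hg : ContinuousOn g (Icc a b))
    (hg' : ContinuousOn g' (Icc a b)) : EqOn g g' (Icc a b) := by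
  refine Measure.eqOn_Icc_of_ae_eq volume hab.ne ?_ hg hg'
  rw [EventuallyEq, ae_restrict_iff' measurableSet_Icc]
  filter_upwards [h.deriv_eq, h'.deriv_eq] with t h1 h2 ht
  rw [← uIcc_of_le hab.le] at ht
  rw [← h1 ht, h2 ht]

theorem isWeakDU_of_integral {P R : ℝ × ℝ → ℝ} (hP : LocallyIntegrableOn P S)
    (hR : LocallyIntegrableOn R S) (h : ∀ φ, IsTest S φ → ∫ p, (P p * dU φ p + R p * φ p) = 0) :
    IsWeakDU S P R := by
  intro φ hφ
  have := h φ hφ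
  rw [integral_add (hφ.integrable_mul_dU hP) (hφ.integrable_mul hR)] at this
  linarith

theorem isWeakDV_of_integral {P R : ℝ × ℝ → ℝ} (hP : LocallyIntegrableOn P S)
    (hR : LocallyIntegrableOn R S) (h : ∀ φ, IsTest S φ → ∫ p, (- P p * dV φ p + R p * φ p) = 0) :
    IsWeakDV S P (fun p => - R p) := by
  intro φ hφ
  have h1 := h φ hφ
  have h2 := (hφ.integrable_mul_dV hP).neg
  simp only [Pi.neg_def, ← neg_mul] at h2
  rw [integral_add h2 (hφ.integrable_mul hR)] at h1
  simp only [neg_mul, integral_neg] at h1 ⊢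
  linarith

/-- The weak form of a second mixed derivative, tested against products. -/
theorem IsFutureDomain.integral_mixed (hS : IsFutureDomain U₀ V₀ S) {P R Q : ℝ × ℝ → ℝ}
    (hP : IsWeakDU S P R) (hR : IsWeakDV S R Q) {p : ℝ × ℝ} (hp : p ∈ S) {χ η : ℝ → ℝ}
    (k1 : ContDiff ℝ ∞ χ) (k2 : HasCompactSupport χ) (k3 : tsupport χ ⊆ Ioo U₀ p.1)
    (h1 : ContDiff ℝ ∞ η) (h2 : HasCompactSupport η) (h3 : tsupport η ⊆ Ioo V₀ p.2) :
    ∫ z : ℝ × ℝ, P z * (deriv χ z.1 * deriv η z.2) = ∫ z : ℝ × ℝ, Q z * (χ z.1 * η z.2) := by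
  have d1 : ContDiff ℝ ∞ (deriv η) := by
    have := (contDiff_infty_iff_deriv.1 h1).2; exact this
  have t1 := hS.isTest_mul hp k1 k2 k3 d1 h2.deriv (tsupport_deriv_subset.trans h3)
  have t2 := hS.isTest_mul hp k1 k2 k3 h1 h2 h3
  have e1 := hP _ t1
  have e2 := hR _ t2
  simp only [dU_mul k1 d1] at e1
  simp only [dV_mul k1 h1] at e2
  rw [e1, e2, neg_neg]

theorem SliceBoundU.integrableOn_sq {w : ℝ × ℝ → ℝ} (h : SliceBoundU S 2 w) (mw : Measurable w)
    {p : ℝ × ℝ} (hp : past U₀ V₀ p ⊆ S) : IntegrableOn w (past U₀ V₀ p) ∧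
      IntegrableOn (fun z => w z ^ 2) (past U₀ V₀ p) := by
  have := (SliceBoundU.integrableOn_pow (n := 2) (by exact_mod_cast h) mw hp).1
  exact ⟨integrableOn_of_sq (isCompact_past p).measure_lt_top.ne mw this, this⟩

theorem SliceBoundV.swap {r : ℝ} {w : ℝ × ℝ → ℝ} (h : SliceBoundV S r w) :
    SliceBoundU (Prod.swap ⁻¹' S) r (fun p => w p.swap) :=
  fun U₁ U₂ V₁ V₂ hsub => h V₁ V₂ U₁ U₂ fun p hp => hsub (show p.swap ∈ _ from ⟨hp.2, hp.1⟩)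

theorem SliceBoundV.integrableOn_sq {w : ℝ × ℝ → ℝ} (h : SliceBoundV S 2 w) (mw : Measurable w)
    {p : ℝ × ℝ} (hp : past U₀ V₀ p ⊆ S) : IntegrableOn w (past U₀ V₀ p) := by
  have := (h.swap.integrableOn_sq (U₀ := V₀) (V₀ := U₀) (p := p.swap)
    (mw.comp measurable_swap) (fun z hz => hp (by
      rw [mem_past] at hz ⊢; exact ⟨hz.2, hz.1⟩))).1
  exact IntegrableOn.past_swap this

theorem IsFutureDomain.ae_pos (hS : IsFutureDomain U₀ V₀ S) {p : ℝ × ℝ} :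
    ∀ᵐ z ∂(volume.restrict (PlaneSymmetric.past U₀ V₀ p)), U₀ < z.1 ∧ V₀ < z.2 := by
  rw [ae_restrict_iff' (measurableSet_past p)]
  have h1 : ∀ᵐ z : ℝ × ℝ, z.1 ≠ U₀ := by
    have : volume ({U₀} ×ˢ (univ : Set ℝ)) = 0 := by
      rw [Measure.volume_eq_prod, Measure.prod_prod]; simp
    refine (measure_eq_zero_iff_ae_notMem.1 this).mono fun z hz h => hz ⟨h, mem_univ _⟩
  have h2 : ∀ᵐ z : ℝ × ℝ, z.2 ≠ V₀ := by
    have : volume ((univ : Set ℝ) ×ˢ {V₀}) = 0 := by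
      rw [Measure.volume_eq_prod, Measure.prod_prod]; simp
    refine (measure_eq_zero_iff_ae_notMem.1 this).mono fun z hz h => hz ⟨mem_univ _, h⟩
  filter_upwards [h1, h2] with z g1 g2 hz
  rw [mem_past] at hz
  exact ⟨lt_of_le_of_ne hz.1.1 g1.symm, lt_of_le_of_ne hz.2.1 g2.symm⟩

theorem IsFutureDomain.deriv_congr (hS : IsFutureDomain U₀ V₀ S) {u u' : ℝ → ℝ}
    (h : ∀ x, (x, V₀) ∈ S → u x = u' x) {z : ℝ × ℝ} (hz : z ∈ S) (h1 : U₀ < z.1) :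
    deriv u z.1 = deriv u' z.1 := by
  obtain ⟨p, hp, l1, l2⟩ := hS.exists_gt hz
  refine EventuallyEq.deriv_eq ?_
  filter_upwards [Ioo_mem_nhds h1 l1] with t ht
  exact h t (hS.past_subset (hS.mem_fst hp) ⟨⟨ht.1.le, ht.2.le⟩, le_rfl, le_rfl⟩)

namespace Background

variable {B : Background U₀ V₀ S}

theorem slopeU_congr {u u' : ℝ → ℝ} {c : ℝ × ℝ → ℝ} (h : ∀ x, (x, V₀) ∈ S → u x = u' x)
    {z : ℝ × ℝ} (hz : z ∈ S) (h1 : U₀ < z.1) : B.slopeU u c z = B.slopeU u' c z := by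
  rw [slopeU, slopeU, B.domain.deriv_congr h hz h1]

theorem slopeV_congr {v v' : ℝ → ℝ} {c : ℝ × ℝ → ℝ} (h : ∀ y, (U₀, y) ∈ S → v y = v' y)
    {z : ℝ × ℝ} (hz : z ∈ S) (h1 : V₀ < z.2) : B.slopeV v c z = B.slopeV v' c z :=
  slopeU_congr (B := B.swap) h (z := z.swap) hz h1

end Background

/-- The area function is a sum of functions of `U` and of `V`, because `2 b_U e^{2b}` does not
depend on `V`. -/
theorem IsFutureDomain.area_eq (hS : IsFutureDomain U₀ V₀ S) {b bU bV : ℝ × ℝ → ℝ}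
    (cb : ContinuousOn b S) (cU : ContinuousOn bU S) (cV : ContinuousOn bV S)
    (wU : IsWeakDU S b bU) (wV : IsWeakDV S b bV)
    (wUV : IsWeakDV S bU (fun p => - (2 * bU p * bV p))) {p : ℝ × ℝ} (hp : p ∈ S) :
    2 * bU p * Real.exp (2 * b p) = 2 * bU (p.1, V₀) * Real.exp (2 * b (p.1, V₀)) ∧
    Real.exp (2 * b p) = Real.exp (2 * b (p.1, V₀)) + Real.exp (2 * b (U₀, p.2))
      - Real.exp (2 * b (U₀, V₀)) := by
  have hM : ∀ p ∈ S, 2 * bU p * Real.exp (2 * b p)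
      = 2 * bU (p.1, V₀) * Real.exp (2 * b (p.1, V₀)) := fun p hp => by
    have d1 := hS.hasACDeriv_of_isWeakDV cb cV wV hp
    have d2 := hS.hasACDeriv_of_isWeakDV cU ((continuousOn_const.mul cU).mul cV).neg wUV hp
    exact ((d2.const_mul 2).mul (d1.const_mul 2).exp).eq_of_deriv_zero
      (Eventually.of_forall fun t _ => by simp only [Pi.neg_apply, Pi.mul_apply]; ring)
  refine ⟨hM p hp, ?_⟩
  have hE : ∀ y, (p.1, y) ∈ S → HasACDeriv (fun x => Real.exp (2 * b (x, y)))
      (fun x => Real.exp (2 * b (x, y)) * (2 * bU (x, y))) U₀ p.1 := fun y hy =>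
    ((hS.hasACDeriv_of_isWeakDU cb cU wU (r := (p.1, y)) hy).const_mul 2).exp
  have := ((hE _ hp).sub (hE _ (hS.mem_fst hp))).eq_of_deriv_zero
    (Eventually.of_forall fun t ht => by
      have := hM _ (hS.mem_line hp ht)
      simp only at this
      linarith)
  linarith

end

section

theorem IsFutureDomain.exists_past_supset (hS : IsFutureDomain U₀ V₀ S) {p : ℝ × ℝ} (hp : p ∈ S) :
    ∃ p' ∈ S, U₀ < p'.1 ∧ V₀ < p'.2 ∧
      PlaneSymmetric.past U₀ V₀ p ⊆ PlaneSymmetric.past U₀ V₀ p' := by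
  obtain ⟨p', h, l1, l2⟩ := hS.exists_gt hp
  exact ⟨p', h, (hS.le_fst hp).trans_lt l1, (hS.le_snd hp).trans_lt l2, past_mono l1.le l2.le⟩

/-- Weak derivatives are unique. -/
theorem IsWeakDU.ae_eq (hS : IsFutureDomain U₀ V₀ S) {P R R' : ℝ × ℝ → ℝ} (h : IsWeakDU S P R)
    (h' : IsWeakDU S P R') (hP : ContinuousOn P S) (m : Measurable R) (m' : Measurable R')
    (i : ∀ p ∈ S, IntegrableOn R (past U₀ V₀ p)) (i' : ∀ p ∈ S, IntegrableOn R' (past U₀ V₀ p))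
    {p : ℝ × ℝ} (hp : p ∈ S) : ∀ᵐ z ∂(volume.restrict (past U₀ V₀ p)), R z = R' z := by
  obtain ⟨p', hp', h1, h2, hsub⟩ := hS.exists_past_supset hp
  refine ae_restrict_of_ae_restrict_of_subset hsub ?_
  have e := hS.ae_slice_of_isWeakDU hp' h1 h2 hP (i p' hp') h
  have e' := hS.ae_slice_of_isWeakDU hp' h1 h2 hP (i' p' hp') h'
  have key : ∀ᵐ z ∂(volume.restrict (past V₀ U₀ p'.swap)), R z.swap = R' z.swap := by
    rw [past, Measure.volume_eq_prod, ← Measure.prod_restrict]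
    refine (Measure.ae_prod_iff_ae_ae (measurableSet_eq_fun (m.comp measurable_swap)
      (m'.comp measurable_swap))).2 ?_
    simp only [Prod.fst_swap, Prod.snd_swap]
    filter_upwards [e, e'] with y g g'
    rw [ae_restrict_iff' measurableSet_Icc]
    filter_upwards [g.deriv_eq, g'.deriv_eq] with x q q' hx
    rw [← uIcc_of_le h1.le] at hx
    exact (q hx).symm.trans (q' hx)
  simpa only [Prod.swap_swap] using ae_past_swap key

theorem IsWeakDV.ae_eq (hS : IsFutureDomain U₀ V₀ S) {P R R' : ℝ × ℝ → ℝ} (h : IsWeakDV S P R)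
    (h' : IsWeakDV S P R') (hP : ContinuousOn P S) (m : Measurable R) (m' : Measurable R')
    (i : ∀ p ∈ S, IntegrableOn R (past U₀ V₀ p)) (i' : ∀ p ∈ S, IntegrableOn R' (past U₀ V₀ p))
    {p : ℝ × ℝ} (hp : p ∈ S) : ∀ᵐ z ∂(volume.restrict (past U₀ V₀ p)), R z = R' z := by
  have key := IsWeakDU.ae_eq hS.swap (P := fun z => P z.swap) (R := fun z => R z.swap)
    (R' := fun z => R' z.swap) (isWeakDU_of_swap h)
    (isWeakDU_of_swap h')
    (hP.comp continuous_swap.continuousOn fun _ hp => hp) (m.comp measurable_swap)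
    (m'.comp measurable_swap) (fun q hq => IntegrableOn.past_swap (p := q.swap) (i q.swap hq))
    (fun q hq => IntegrableOn.past_swap (p := q.swap) (i' q.swap hq)) (p := p.swap) hp
  simpa only [Prod.swap_swap] using ae_past_swap key

namespace IsRegular

variable {f : Fields} {d : Derivs} (h : IsRegular S f d)
include h

theorem integrable_aU {p : ℝ × ℝ} (hp : past U₀ V₀ p ⊆ S) :
    IntegrableOn d.aU (past U₀ V₀ p) := by
  have := (SliceBoundU.integrableOn_pow (n := 1) (by exact_mod_cast h.aU_bound) h.aU_meas hp).1
  simpa only [pow_one] using this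

theorem integrable_aV {p : ℝ × ℝ} (hp : past U₀ V₀ p ⊆ S) :
    IntegrableOn d.aV (past U₀ V₀ p) := by
  have := (SliceBoundU.integrableOn_pow (n := 1) (S := Prod.swap ⁻¹' S)
    (by exact_mod_cast h.aV_bound.swap) (h.aV_meas.comp measurable_swap)
    (U₀ := V₀) (V₀ := U₀) (p := p.swap) (fun z hz => hp (by
      rw [mem_past] at hz ⊢; exact ⟨hz.2, hz.1⟩))).1
  simp only [pow_one] at this
  exact IntegrableOn.past_swap this

theorem integrable_cU {p : ℝ × ℝ} (hp : past U₀ V₀ p ⊆ S) : IntegrableOn d.cU (past U₀ V₀ p) :=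
  (h.cU_bound.integrableOn_sq h.cU_meas hp).1

theorem integrable_cV {p : ℝ × ℝ} (hp : past U₀ V₀ p ⊆ S) : IntegrableOn d.cV (past U₀ V₀ p) :=
  h.cV_bound.integrableOn_sq h.cV_meas hp

theorem integrable_ψU {p : ℝ × ℝ} (hp : past U₀ V₀ p ⊆ S) : IntegrableOn d.ψU (past U₀ V₀ p) :=
  (h.ψU_bound.integrableOn_sq h.ψU_meas hp).1

theorem integrable_ψV {p : ℝ × ℝ} (hp : past U₀ V₀ p ⊆ S) : IntegrableOn d.ψV (past U₀ V₀ p) :=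
  h.ψV_bound.integrableOn_sq h.ψV_meas hp

/-- The derivatives of a regular spacetime are determined almost everywhere. -/
theorem ae_eq (hS : IsFutureDomain U₀ V₀ S) {d' : Derivs} {a' b' : ℝ × ℝ → ℝ}
    (h' : IsRegular S { f with a := a', b := b' } d') {p : ℝ × ℝ} (hp : p ∈ S) :
    ∀ᵐ z ∂(volume.restrict (past U₀ V₀ p)), d.cU z = d'.cU z ∧ d.cV z = d'.cV z ∧
      d.ψU z = d'.ψU z ∧ d.ψV z = d'.ψV z := by
  have hs := fun p (hp : p ∈ S) => hS.past_subset hp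
  filter_upwards [
    h.cU_weak.ae_eq hS h'.cU_weak h.c_cont h.cU_meas h'.cU_meas
      (fun p hp => h.integrable_cU (hs p hp)) (fun p hp => h'.integrable_cU (hs p hp)) hp,
    h.cV_weak.ae_eq hS h'.cV_weak h.c_cont h.cV_meas h'.cV_meas
      (fun p hp => h.integrable_cV (hs p hp)) (fun p hp => h'.integrable_cV (hs p hp)) hp,
    h.ψU_weak.ae_eq hS h'.ψU_weak h.ψ_cont h.ψU_meas h'.ψU_meas
      (fun p hp => h.integrable_ψU (hs p hp)) (fun p hp => h'.integrable_ψU (hs p hp)) hp,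
    h.ψV_weak.ae_eq hS h'.ψV_weak h.ψ_cont h.ψV_meas h'.ψV_meas
      (fun p hp => h.integrable_ψV (hs p hp)) (fun p hp => h'.integrable_ψV (hs p hp)) hp]
    with z h1 h2 h3 h4
  exact ⟨h1, h2, h3, h4⟩

/-- Weak solutions of the wave equation satisfy its Volterra form. -/
theorem isWeakWave {B : Background U₀ V₀ S} (hU : EqOn B.bU d.bU S) (hV : EqOn B.bV d.bV S)
    {w wU wV : ℝ × ℝ → ℝ} (cw : ContinuousOn w S) (mU : Measurable wU) (mV : Measurable wV)
    (eU : IsWeakDU S w wU) (eV : IsWeakDV S w wV) (bU : SliceBoundU S 2 wU) (bV : SliceBoundV S 2 wV)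
    (hw : ∀ φ, IsTest S φ →
      ∫ p, (- wU p * dV φ p + (d.bV p * wU p + d.bU p * wV p) * φ p) = 0) :
    B.IsWeakWave w wU wV where
  cont := cw
  measU := mU
  measV := mV
  weakU := eU
  weakV := eV
  boundU := bU
  boundV := bV
  wave := fun p hp χ η k1 k2 k3 h1 h2 h3 => by
    have hs := fun p (hp : p ∈ S) => B.domain.past_subset hp
    have l := isWeakDV_of_integral
      (B.domain.locallyIntegrableOn fun p hp => (bU.integrableOn_sq mU (hs p hp)).1)
      (B.domain.locallyIntegrableOn (g := fun p => d.bV p * wU p + d.bU p * wV p) fun p hp =>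
        ((bU.integrableOn_sq mU (hs p hp)).1.continuousOn_mul (h.bV_cont.mono (hs p hp))
          (isCompact_past p)).add ((bV.integrableOn_sq mV (hs p hp)).continuousOn_mul
          (h.bU_cont.mono (hs p hp)) (isCompact_past p))) hw
    refine B.domain.integral_mixed eU (l.congr (g' := fun z => - (B.bV z * wU z + B.bU z * wV z))
      fun z hz => ?_) hp k1 k2 k3 h1 h2 h3
    simp only [hU hz, hV hz]

/-- Weak solutions of the Einstein equations with a given area function satisfy the integrated
equations. -/
theorem exists_solution {κ : ℝ} (hE : SolvesEinstein κ S d) {B : Background U₀ V₀ S}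
    (hU : EqOn B.bU d.bU S) (hV : EqOn B.bV d.bV S) {α β : ℝ → ℝ}
    (hα : ∀ p ∈ S, AbsolutelyContinuousOnInterval α U₀ p.1)
    (hβ : ∀ p ∈ S, AbsolutelyContinuousOnInterval β V₀ p.2)
    (aα : ∀ x, (x, V₀) ∈ S → f.a (x, V₀) = α x) (aβ : ∀ y, (U₀, y) ∈ S → f.a (U₀, y) = β y)
    (hβ0 : β V₀ = 0) : ∃ X : Solution κ U₀ V₀ S, X.toBackground = B ∧ X.α = α ∧ X.β = β ∧
      X.a = f.a ∧ X.c = f.c ∧ X.ψ = f.ψ := by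
  have hc := (h.isWeakWave hU hV h.c_cont h.cU_meas h.cV_meas h.cU_weak h.cV_weak h.cU_bound
    h.cV_bound hE.wave_c).isWave
  have hψ := (h.isWeakWave hU hV h.ψ_cont h.ψU_meas h.ψV_meas h.ψU_weak h.ψV_weak h.ψU_bound
    h.ψV_bound hE.potential).isWave
  -- an auxiliary solution with the same `c` and `ψ`
  let Y : Solution κ U₀ V₀ S := {
    toBackground := B, u := _, v := _, uψ := _, vψ := _, c := f.c, ψ := f.ψ
    α := fun _ => 0, β := fun _ => 0, a := fun p => 0 + 0 + ∫ z in past U₀ V₀ p, _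
    wave_c := hc, wave_ψ := hψ
    α_ac := fun p hp => (HasACDeriv.const 0).ac
    β_ac := fun p hp => (HasACDeriv.const 0).ac
    a_eq := fun p hp => rfl }
  have hYi : ∀ p ∈ S, IntegrableOn Y.aUV (past U₀ V₀ p) := fun p hp =>
    Y.isKernel_aUV.integrableOn B.domain hp
  have hQ : ∀ p ∈ S, ∀ᵐ z ∂(volume.restrict (past U₀ V₀ p)), - (- d.bU z * d.bV z
      + d.cU z * d.cV z + κ * d.ψU z * d.ψV z) = Y.aUV z := fun p hp => by
    filter_upwards [h.ae_eq B.domain (a' := Y.a) (b' := Y.b) Y.isRegular hp, ae_restrict_mem (measurableSet_past p)] with z hz hm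
    have hzS := B.domain.past_subset hp hm
    rw [hz.1, hz.2.1, hz.2.2.1, hz.2.2.2]
    simp only [Solution.derivs, indicator_of_mem hzS, Solution.aUV]
    change _ = B.bU z * B.bV z - _ - _
    rw [hU hzS, hV hzS]
    ring
  have hRi : ∀ p ∈ S, IntegrableOn (fun z => - d.bU z * d.bV z
      + d.cU z * d.cV z + κ * d.ψU z * d.ψV z) (past U₀ V₀ p) := fun p hp => by
    refine ((hYi p hp).neg).congr ?_
    filter_upwards [hQ p hp] with z hz
    simp only [Pi.neg_apply, ← hz, neg_neg]
  have hweak := isWeakDV_of_integral (B.domain.locallyIntegrableOn fun p hp =>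
    h.integrable_aU (B.domain.past_subset hp)) (B.domain.locallyIntegrableOn hRi) hE.wave_a
  have corner : ∀ p ∈ S, f.a p = α p.1 + β p.2 + ∫ z in past U₀ V₀ p, Y.aUV z := fun p hp => by
    obtain ⟨p', hp', h1, h2, hsub⟩ := B.domain.exists_past_supset hp
    have := B.domain.corner_of_weak hp' h1 h2 h.a_cont ((hRi p' hp').neg)
      (fun χ η k1 k2 k3 h1 h2 h3 => B.domain.integral_mixed h.aU_weak hweak hp' k1 k2 k3 h1 h2 h3)
      p (hsub (B.domain.self_mem_past hp))
    rw [this, aα _ (B.domain.mem_fst hp), aβ _ (B.domain.mem_snd hp), aβ _ B.domain.mem, hβ0,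
      sub_zero]
    congr 1
    exact integral_congr_ae (hQ p hp)
  refine ⟨{ Y with α := α, β := β, a := f.a, α_ac := hα, β_ac := hβ, a_eq := corner },
    rfl, rfl, rfl, rfl, rfl, rfl⟩

end IsRegular

end

section

/-! ### Uniqueness -/

theorem IsWeakDU.congr_left {f f' g : ℝ × ℝ → ℝ} (h : IsWeakDU S f g) (he : EqOn f' f S) :
    IsWeakDU S f' g := by
  intro φ hφ
  rw [← h φ hφ]
  congr 1
  ext p
  by_cases hp : p ∈ S
  · rw [he hp]
  · rw [(hφ.eq_zero hp).2.1, mul_zero, mul_zero]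

theorem IsWeakDV.swap {f g : ℝ × ℝ → ℝ} (h : IsWeakDV S f g) :
    IsWeakDU (Prod.swap ⁻¹' S) (fun p => f p.swap) (fun p => g p.swap) :=
  isWeakDU_of_swap h

namespace Solution

variable {κ : ℝ} (X : Solution κ U₀ V₀ S)

/-- The weak constraint holds pointwise on almost every line `V = y`. On one such line it holds
almost everywhere, and the propagation identity carries it to `V = V₀`. -/
theorem constraint_of_isWeakDU {W : ℝ × ℝ → ℝ} (hW : IsWeakDU S X.bU W)
    (iW : ∀ p ∈ S, IntegrableOn W (past U₀ V₀ p))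
    (e : ∀ p ∈ S, ∀ᵐ z ∂(volume.restrict (past U₀ V₀ p)), W z = 2 * X.aU z * X.bU z
      - X.bU z ^ 2 - X.cU z ^ 2 - κ * X.ψU z ^ 2) :
    ∀ᵐ x : ℝ, (x, V₀) ∈ S → X.constraint (x, V₀) = 0 := by
  refine X.domain.ae_fst fun x hx => ?_
  obtain ⟨p, hp, h1, h2⟩ := X.domain.exists_gt hx
  simp only at h1 h2
  have h0 := X.domain.le_fst hx
  have s1 := X.domain.ae_slice_of_isWeakDU hp (h0.trans_lt h1) h2 X.continuousOn_bU (iW p hp) hW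
  have s2 := ae_ae_of_ae_past (ae_past_swap (e p hp))
  have : (ae (volume.restrict (Icc V₀ p.2))).NeBot := by
    rw [ae_neBot, Ne, Measure.restrict_eq_zero, Real.volume_Icc]
    simp [h2]
  -- one good line suffices
  obtain ⟨y, ⟨g1, g2⟩, hy⟩ := ((s1.and s2).and (ae_restrict_mem measurableSet_Icc)).exists
  have hS : (p.1, y) ∈ S := X.domain.past_subset hp ⟨⟨h0.trans h1.le, le_rfl⟩, hy⟩
  have g3 := X.bU_deriv hS
  rw [ae_restrict_iff' measurableSet_Icc] at g2
  have hsub : uIcc U₀ x ⊆ uIcc U₀ p.1 := by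
    rw [uIcc_of_le h0, uIcc_of_le (h0.trans h1.le)]; exact Icc_subset_Icc_right h1.le
  filter_upwards [g1.deriv_eq, g2, g3.deriv_eq] with t q1 q2 q3 ht
  have ht' := hsub ht
  have hm : (t, y) ∈ S := X.domain.mem_line hS ht'
  have q4 := (q1 ht').symm.trans (q3 ht')
  rw [uIcc_of_le (h0.trans h1.le)] at ht'
  have q5 := q2 ht'
  simp only [Prod.swap_prod_mk] at q5
  have q6 := X.constraint_eq hm
  rw [← q6, constraint]
  have hs := (X.s_pos hm).ne'
  rw [q5] at q4
  field_simp at q4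
  linear_combination (1 / 2) * q4

theorem constraint_of_weak {aU cU ψU : ℝ × ℝ → ℝ} (a1 : IsWeakDU S X.a aU) (a2 : Measurable aU)
    (a3 : ∀ p ∈ S, IntegrableOn aU (past U₀ V₀ p))
    (c1 : IsWeakDU S X.c cU) (c2 : Measurable cU) (c3 : SliceBoundU S 2 cU)
    (ψ1 : IsWeakDU S X.ψ ψU) (ψ2 : Measurable ψU) (ψ3 : SliceBoundU S 2 ψU)
    (hW : ∀ φ, IsTest S φ → ∫ p, (X.bU p * dU φ p + (2 * aU p * X.bU p - X.bU p ^ 2 - cU p ^ 2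
      - κ * ψU p ^ 2) * φ p) = 0) :
    ∀ᵐ x : ℝ, (x, V₀) ∈ S → X.constraint (x, V₀) = 0 := by
  have hs := fun p (hp : p ∈ S) => X.domain.past_subset hp
  have hR := X.isRegular
  have iW : ∀ p ∈ S, IntegrableOn (fun z => 2 * aU z * X.bU z - X.bU z ^ 2 - cU z ^ 2
      - κ * ψU z ^ 2) (past U₀ V₀ p) := fun p hp => by
    have i1 := ((a3 p hp).continuousOn_mul (X.continuousOn_bU.mono (hs p hp))
      (isCompact_past p)).const_mul 2
    have i2 := ((X.continuousOn_bU.pow 2).mono (hs p hp)).integrableOn_compact (μ := volume)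
      (isCompact_past p)
    refine (((i1.sub i2).sub (c3.integrableOn_sq c2 (hs p hp)).2).sub
      ((ψ3.integrableOn_sq ψ2 (hs p hp)).2.const_mul κ)).congr (Eventually.of_forall fun z => ?_)
    simp only [Pi.sub_apply, Pi.pow_apply]
    ring
  refine X.constraint_of_isWeakDU (isWeakDU_of_integral
    (X.domain.locallyIntegrableOn_of_continuousOn X.continuousOn_bU)
    (X.domain.locallyIntegrableOn iW) hW) iW fun p hp => ?_
  filter_upwards [
    a1.ae_eq X.domain hR.aU_weak hR.a_cont a2 hR.aU_meas a3
      (fun p hp => hR.integrable_aU (hs p hp)) hp,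
    c1.ae_eq X.domain hR.cU_weak hR.c_cont c2 hR.cU_meas
      (fun p hp => (c3.integrableOn_sq c2 (hs p hp)).1) (fun p hp => hR.integrable_cU (hs p hp)) hp,
    ψ1.ae_eq X.domain hR.ψU_weak hR.ψ_cont ψ2 hR.ψU_meas
      (fun p hp => (ψ3.integrableOn_sq ψ2 (hs p hp)).1) (fun p hp => hR.integrable_ψU (hs p hp)) hp,
    ae_restrict_mem (measurableSet_past p)] with z h1 h2 h3 hz
  rw [h1, h2, h3]
  simp only [derivs, indicator_of_mem (hs p hp hz)]

end Solution

namespace Background.IsWave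

variable {B : Background U₀ V₀ S} {u v u' v' : ℝ → ℝ} {c : ℝ × ℝ → ℝ}

/-- The functions `u`, `v` in the representation of a wave are determined by it only up to a
constant, and only where the initial hypersurfaces meet `S`. They may be replaced by the boundary
values. -/
theorem replace (h : B.IsWave u v c) (hu : ∀ x, (x, V₀) ∈ S → u' x = B.r (x, V₀) * c (x, V₀))
    (hv : ∀ y, (U₀, y) ∈ S → v' y = B.r (U₀, y) * c (U₀, y)) (h0 : c (U₀, V₀) = 0)
    (du : ∀ p ∈ S, AbsolutelyContinuousOnInterval u' U₀ p.1 ∧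
      IntegrableOn (fun t => deriv u' t ^ 2) (Icc U₀ p.1))
    (dv : ∀ p ∈ S, AbsolutelyContinuousOnInterval v' V₀ p.2 ∧
      IntegrableOn (fun t => deriv v' t ^ 2) (Icc V₀ p.2)) :
    B.IsWave u' v' c ∧ ∀ z ∈ S, U₀ < z.1 → V₀ < z.2 →
      B.slopeU u c z = B.slopeU u' c z ∧ B.slopeV v c z = B.slopeV v' c z := by
  have e1 : ∀ x, (x, V₀) ∈ S → u' x = u x + v V₀ := fun x hx => by
    rw [hu x hx, h.eq _ hx, integral_past_axis, sub_zero]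
  have e2 : ∀ y, (U₀, y) ∈ S → v' y = u U₀ + v y := fun y hy => by
    have := h.swap.eq (y, U₀) hy
    rw [integral_past_axis, sub_zero] at this
    simp only [B.r_swap, Prod.swap_prod_mk] at this
    rw [hv y hy, this, add_comm]
  have e0 : u U₀ + v V₀ = 0 := by
    rw [← e1 _ B.domain.mem, hu _ B.domain.mem, h0, mul_zero]
  refine ⟨⟨h.cont, fun p hp => (du p hp).1, fun p hp => (du p hp).2, fun p hp => (dv p hp).1,
    fun p hp => (dv p hp).2, fun p hp => ?_⟩, fun z hz h1 h2 => ⟨?_, ?_⟩⟩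
  · rw [h.eq p hp, e1 _ (B.domain.mem_fst hp), e2 _ (B.domain.mem_snd hp)]
    linear_combination -e0
  · rw [slopeU_congr (u' := fun x => u x + v V₀) e1 hz h1]
    simp only [slopeU, deriv_add_const]
  · have := slopeV_congr (B := B) (c := c) (v := v') (v' := fun x => v x + u U₀)
      (fun y hy => (e2 y hy).trans (add_comm _ _)) hz h2
    rw [this]
    simp only [slopeV, slopeU, deriv_add_const]

end Background.IsWave

variable {k₁ k₂ β₁ γ₁ β₂ γ₂ κ : ℝ} {D₁ D₂ : NullData} {J₁ : Axis k₁ U₀ β₁ γ₁ D₁}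
  {J₂ : Axis k₂ V₀ β₂ γ₂ D₂}

/-- The potential on an initial hypersurface is determined by the constraint and by its sign. -/
theorem Solution.ψ_axis_of_constraint (X : Solution κ U₀ V₀ S) (hκ : 0 < κ) (hf : X.f = J₁.f)
    (hf₁ : X.f₁ = J₁.f₁) (hf₂ : X.f₂ = J₁.f₂) (hα : X.α = D₁.a)
    (hc : ∀ x, (x, V₀) ∈ S → X.c (x, V₀) = J₁.c x) (hd : ∀ x, (x, V₀) ∈ S → x ∈ J₁.domain)
    (h0 : ∀ᵐ x : ℝ, (x, V₀) ∈ S → X.constraint (x, V₀) = 0) (hψ0 : X.ψ (U₀, V₀) = 0)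
    (hψ : ∀ᵐ x : ℝ, (x, V₀) ∈ S → 0 ≤ deriv (fun t => X.ψ (t, V₀)) x) {x : ℝ}
    (hx : (x, V₀) ∈ S) : X.ψ (x, V₀) = D₁.potential k₁ κ U₀ x := by
  have d1 : HasACDeriv (fun t => X.ψ (t, V₀)) (fun t => X.ψU (t, V₀)) U₀ x := X.wave_ψ.deriv_U hx
  have d2 := d1.integral_eq
  rw [hψ0, sub_zero] at d2
  rw [← d2, NullData.potential]
  refine intervalIntegral.integral_congr_ae ?_
  filter_upwards [d1.deriv_eq, h0, hψ, X.constraint_axis hf hf₁ hf₂ hα hc hd] with t g1 g2 g3 g4 ht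
  have ht' := uIoc_subset_uIcc ht
  have hm : (t, V₀) ∈ S := X.domain.mem_line hx ht'
  have g5 := g4 hm
  rw [g2 hm] at g5
  have g6 : 0 ≤ X.ψU (t, V₀) := (g1 ht').symm ▸ g3 hm
  have hp := (J₁.f_pos (hd t hm)).ne'
  have g7 : D₁.ricciCoeff k₁ t - κ * X.ψU (t, V₀) ^ 2 = 0 := by
    rcases mul_eq_zero.1 g5.symm with h | h
    · exact absurd h hp
    · exact h
  have g8 : D₁.ricciCoeff k₁ t / κ = X.ψU (t, V₀) ^ 2 := by
    field_simp
    linarith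
  rw [g8, Real.sqrt_sq g6]

/-- The derivative of the area function, read off from the continuous derivative of `b`. -/
theorem Axis.f₁_eq {k x₀ β γ x m : ℝ} {D : NullData} (J : Axis k x₀ β γ D) {b b' : ℝ → ℝ}
    (hx : x₀ < x) (hb : HasACDeriv b b' x₀ x) (cb : ContinuousOn b' (Icc x₀ x))
    (h : ∀ t ∈ Icc x₀ x, J.f t + m = Real.exp (2 * b t)) :
    ∀ t ∈ Icc x₀ x, J.f₁ t = 2 * b' t * Real.exp (2 * b t) := by
  have h0 := uIcc_of_le hx.le
  have c1 := hb.continuousOn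
  have c2 := (J.f₁_deriv hx.le).continuousOn
  rw [h0] at c1 c2
  have d := ((hb.const_mul 2).exp).congr (f₁ := fun t => J.f t + m) fun t ht => (h t (h0 ▸ ht)).symm
  have d' := ((J.f_deriv hx.le).add (HasACDeriv.const m)).congr_deriv (g₁ := J.f₁)
    (Eventually.of_forall fun t _ => by simp)
  intro t ht
  rw [d'.eqOn_of_continuousOn hx d c2 ((continuousOn_const.mul c1).rexp.mul
    (continuousOn_const.mul cb)) ht, mul_comm]

/-- A development satisfies the integrated equations. -/
theorem IsDevelopment.exists_isCanonical {D : InitialData} {f : Fields} (hκ : 0 < κ)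
    {J₁ : Axis 0 D.U₀ (- D.ρ₀) (- D.σ₀) D.out} {J₂ : Axis 4 D.V₀ D.μ₀ D.lam₀ D.inc}
    (h : IsDevelopment κ D S f) :
    (∀ p ∈ S, p.1 ∈ J₁.domain ∧ p.2 ∈ J₂.domain ∧ 0 < J₁.f p.1 + J₂.f p.2 - 1) ∧
    ∃ X : Solution κ D.U₀ D.V₀ S, IsCanonical J₁ J₂ X ∧ X.a = f.a ∧ (∀ p ∈ S, X.b p = f.b p) ∧
      X.c = f.c ∧ X.ψ = f.ψ := by
  obtain ⟨d, hR, hE⟩ := h.solution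
  have hS := h.domain
  have out : ∀ x, (x, D.V₀) ∈ S → x ∈ J₁.domain ∧ J₁.f x = Real.exp (2 * f.b (x, D.V₀)) ∧
      J₁.c x = f.c (x, D.V₀) := fun x hx =>
    J₁.mem_domain_of_hasNPData h.np_out h.b_zero h.c_zero (hS.le_fst hx)
      fun t ht => hS.past_subset hx ⟨ht, le_rfl, le_rfl⟩
  have inc : ∀ y, (D.U₀, y) ∈ S → y ∈ J₂.domain ∧ J₂.f y = Real.exp (2 * f.b (D.U₀, y)) ∧
      J₂.c y = f.c (D.U₀, y) := fun y hy =>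
    J₂.mem_domain_of_hasNPData h.np_inc h.b_zero h.c_zero (hS.le_snd hy)
      fun t ht => hS.past_subset hy ⟨⟨le_rfl, le_rfl⟩, ht⟩
  -- the area function
  have wUV : IsWeakDV S d.bU (fun p => - (2 * d.bU p * d.bV p)) :=
    isWeakDV_of_integral (hS.locallyIntegrableOn_of_continuousOn hR.bU_cont)
      (hS.locallyIntegrableOn_of_continuousOn
        ((continuousOn_const.mul hR.bU_cont).mul hR.bV_cont)) hE.wave_b
  have area := fun p (hp : p ∈ S) =>
    hS.area_eq hR.b_cont hR.bU_cont hR.bV_cont hR.bU_weak hR.bV_weak wUV hp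
  have hs : ∀ p ∈ S, J₁.f p.1 + J₂.f p.2 - 1 = Real.exp (2 * f.b p) := fun p hp => by
    rw [(area p hp).2, (out _ (hS.mem_fst hp)).2.1, (inc _ (hS.mem_snd hp)).2.1, h.b_zero]
    simp
  have hdom : ∀ p ∈ S, p.1 ∈ J₁.domain ∧ p.2 ∈ J₂.domain ∧ 0 < J₁.f p.1 + J₂.f p.2 - 1 :=
    fun p hp => ⟨(out _ (hS.mem_fst hp)).1, (inc _ (hS.mem_snd hp)).1, by
      rw [hs p hp]; exact Real.exp_pos _⟩
  refine ⟨hdom, ?_⟩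
  set B := background J₁ J₂ hS hdom with hB
  have hsB : ∀ p ∈ S, B.s p = Real.exp (2 * f.b p) := hs
  have hU : EqOn B.bU d.bU S := fun p hp => by
    obtain ⟨p', hp', l1, l2⟩ := hS.exists_gt hp
    have q1 := hS.le_fst hp
    have q2 := hS.le_snd hp
    have q3 := hS.le_fst hp'
    have q4 := hS.le_snd hp'
    have hm : (p'.1, p.2) ∈ S := hS.past_subset hp' ⟨⟨q3, le_rfl⟩, q2, l2.le⟩
    have hl : ∀ t ∈ Icc D.U₀ p'.1, (t, p.2) ∈ S := fun t ht =>
      hS.past_subset hp' ⟨ht, q2, l2.le⟩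
    have e := J₁.f₁_eq (b := fun t => f.b (t, p.2)) (b' := fun t => d.bU (t, p.2))
      (m := J₂.f p.2 - 1) ((hS.le_fst hp).trans_lt l1)
      (hS.hasACDeriv_of_isWeakDU hR.b_cont hR.bU_cont hR.bU_weak hm)
      (hR.bU_cont.comp (by fun_prop) hl) (fun t ht => by
        rw [← hs _ (hl t ht)]; ring) p.1 ⟨hS.le_fst hp, l1.le⟩
    have e' : B.bU p = J₁.f₁ p.1 / (2 * B.s p) := rfl
    rw [e', e, hsB p hp]
    have := (Real.exp_pos (2 * f.b p)).ne'
    field_simp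
  have hV : EqOn B.bV d.bV S := fun p hp => by
    obtain ⟨p', hp', l1, l2⟩ := hS.exists_gt hp
    have q1 := hS.le_fst hp
    have q2 := hS.le_snd hp
    have q3 := hS.le_fst hp'
    have q4 := hS.le_snd hp'
    have hm : (p.1, p'.2) ∈ S := hS.past_subset hp' ⟨⟨q1, l1.le⟩, q4, le_rfl⟩
    have hl : ∀ t ∈ Icc D.V₀ p'.2, (p.1, t) ∈ S := fun t ht =>
      hS.past_subset hp' ⟨⟨q1, l1.le⟩, ht⟩
    have e := J₂.f₁_eq (b := fun t => f.b (p.1, t)) (b' := fun t => d.bV (p.1, t))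
      (m := J₁.f p.1 - 1) ((hS.le_snd hp).trans_lt l2)
      (hS.hasACDeriv_of_isWeakDV hR.b_cont hR.bV_cont hR.bV_weak hm)
      (hR.bV_cont.comp (by fun_prop) hl) (fun t ht => by
        rw [← hs _ (hl t ht)]; ring) p.2 ⟨hS.le_snd hp, l2.le⟩
    have e' : B.bV p = J₂.f₁ p.2 / (2 * B.s p) := rfl
    rw [e', e, hsB p hp]
    have := (Real.exp_pos (2 * f.b p)).ne'
    field_simp
  obtain ⟨X, hXB, hXα, hXβ, hXa, hXc, hXψ⟩ := hR.exists_solution hE (B := B) hU hV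
    (fun p hp => J₁.regular.a_ac _ (hdom p hp).1.1)
    (fun p hp => J₂.regular.a_ac _ (hdom p hp).2.1.1) h.a_out h.a_inc J₂.regular.a_zero
  have hXU : EqOn X.bU d.bU S := by rw [hXB]; exact hU
  have hXV : EqOn X.bV d.bV S := by rw [hXB]; exact hV
  -- the constraints on the initial hypersurfaces
  have con1 : ∀ᵐ x : ℝ, (x, D.V₀) ∈ S → X.constraint (x, D.V₀) = 0 :=
    X.constraint_of_weak (hXa ▸ hR.aU_weak) hR.aU_meas
      (fun p hp => hR.integrable_aU (hS.past_subset hp)) (hXc ▸ hR.cU_weak) hR.cU_meas hR.cU_bound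
      (hXψ ▸ hR.ψU_weak) hR.ψU_meas hR.ψU_bound fun φ hφ => by
        rw [← hE.constraint_U φ hφ]
        congr 1
        ext z
        by_cases hz : z ∈ S
        · rw [hXU hz]
        · rw [(hφ.eq_zero hz).1, (hφ.eq_zero hz).2.1]; ring
  have con2 : ∀ᵐ y : ℝ, (D.U₀, y) ∈ S → X.swap.constraint (y, D.U₀) = 0 := by
    have ea : X.swap.a = fun z => f.a z.swap := by rw [← hXa]; rfl
    have ec : X.swap.c = fun z => f.c z.swap := by rw [← hXc]; rfl
    have eψ : X.swap.ψ = fun z => f.ψ z.swap := by rw [← hXψ]; rfl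
    refine X.swap.constraint_of_weak (aU := fun z => d.aV z.swap) (cU := fun z => d.cV z.swap)
      (ψU := fun z => d.ψV z.swap) (ea ▸ hR.aV_weak.swap) (hR.aV_meas.comp measurable_swap)
      (fun p hp => IntegrableOn.past_swap (p := p.swap) (hR.integrable_aV (hS.past_subset hp)))
      (ec ▸ hR.cV_weak.swap) (hR.cV_meas.comp measurable_swap) hR.cV_bound.swap
      (eψ ▸ hR.ψV_weak.swap) (hR.ψV_meas.comp measurable_swap) hR.ψV_bound.swap fun φ hφ => ?_
    have hφ' : IsTest S (fun z => φ z.swap) := hφ.swap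
    rw [← hE.constraint_V _ hφ', ← integral_swap]
    congr 1
    ext z
    have e1 : dV (fun z => φ z.swap) z = dU φ z.swap := by
      have := dU_swap hφ'.smooth z.swap
      simpa only [Prod.swap_swap] using this.symm
    by_cases hz : z ∈ S
    · simp only [e1, Prod.swap_swap, X.swap_bU, hXV hz]
    · have := (hφ'.eq_zero hz)
      rw [this.1, e1] at *
      rw [this.2.2, this.1]
      ring
  have sX : ∀ p ∈ S, X.s p = J₁.f p.1 + J₂.f p.2 - 1 := fun p hp => by
    simp only [Background.s, hXB]; rfl
  have rX₁ : ∀ x, X.r (x, D.V₀) = √(J₁.f x) := fun x => by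
    rw [Background.r, X.s_axis, hXB]; rfl
  have rX₂ : ∀ y, X.r (D.U₀, y) = √(J₂.f y) := fun y => by
    have := X.swap.s_axis y
    rw [Background.r, ← Prod.swap_prod_mk, ← X.s_swap]
    erw [this]
    change √(X.g y) = _
    rw [hXB]; rfl
  -- the constraints and the sign of the derivative determine the potential on the hypersurfaces
  have ψ₁ : ∀ x, (x, D.V₀) ∈ S → X.ψ (x, D.V₀) = D.out.potential 0 κ D.U₀ x := fun x hx =>
    X.ψ_axis_of_constraint (J₁ := J₁) hκ (by rw [hXB]; rfl) (by rw [hXB]; rfl) (by rw [hXB]; rfl)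
      hXα (fun x hx => by rw [hXc, (out x hx).2.2]) (fun x hx => (out x hx).1) con1
      (by rw [hXψ, h.ψ_zero]) (by rw [hXψ]; exact h.ψ_out) hx
  have ψ₂ : ∀ y, (D.U₀, y) ∈ S → X.ψ (D.U₀, y) = D.inc.potential 4 κ D.V₀ y := fun y hy =>
    X.swap.ψ_axis_of_constraint (J₁ := J₂) hκ (by change X.g = _; rw [hXB]; rfl)
      (by change X.g₁ = _; rw [hXB]; rfl) (by change X.g₂ = _; rw [hXB]; rfl)
      hXβ (fun x hx => by change X.c _ = _; rw [hXc, (inc x hx).2.2]; rfl)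
      (fun x hx => (inc x hx).1) con2
      (by change X.ψ _ = _; rw [hXψ]; exact h.ψ_zero)
      (by change ∀ᵐ y : ℝ, _ → 0 ≤ deriv (fun t => X.ψ (D.U₀, t)) y
          rw [hXψ]; exact h.ψ_inc) hy
  -- the representing functions are normalized by the data
  obtain ⟨w1, m1⟩ := X.wave_c.replace (u' := fun x => √(J₁.f x) * J₁.c x)
    (v' := fun y => √(J₂.f y) * J₂.c y) (fun x hx => by rw [rX₁, hXc, (out x hx).2.2])
    (fun y hy => by rw [rX₂, hXc, (inc y hy).2.2]) (by rw [hXc, h.c_zero])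
    (fun p hp => J₁.c_data (hdom p hp).1) (fun p hp => J₂.c_data (hdom p hp).2.1)
  obtain ⟨w2, m2⟩ := X.wave_ψ.replace (u' := fun x => √(J₁.f x) * D.out.potential 0 κ D.U₀ x)
    (v' := fun y => √(J₂.f y) * D.inc.potential 4 κ D.V₀ y) (fun x hx => by rw [rX₁, ψ₁ x hx])
    (fun y hy => by rw [rX₂, ψ₂ y hy]) (by rw [hXψ, h.ψ_zero])
    (fun p hp => J₁.potential_data hκ (hdom p hp).1)
    (fun p hp => J₂.potential_data hκ (hdom p hp).2.1)
  refine ⟨{ X with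
                     u := _, v := _, uψ := _, vψ := _, wave_c := w1, wave_ψ := w2
                     a_eq := fun p hp => ?_ }, ⟨by rw [hXB]; rfl, by rw [hXB]; rfl, by rw [hXB]; rfl,
    by rw [hXB]; rfl, by rw [hXB]; rfl, by rw [hXB]; rfl, rfl, rfl, rfl, rfl, hXα, hXβ,
    fun p hp => ⟨(hdom p hp).1, (hdom p hp).2.1⟩⟩, hXa, fun p hp => ?_, hXc, hXψ⟩
  · rw [X.a_eq p hp]
    congr 1
    refine integral_congr_ae ?_
    filter_upwards [hS.ae_pos (p := p), ae_restrict_mem (measurableSet_past p)] with z hz hm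
    have hzS := hS.past_subset hp hm
    rw [(m1 z hzS hz.1 hz.2).1, (m1 z hzS hz.1 hz.2).2, (m2 z hzS hz.1 hz.2).1,
      (m2 z hzS hz.1 hz.2).2]
  · change 1 / 2 * Real.log (X.s p) = _
    rw [sX p hp, hs p hp, Real.log_exp]; ring

namespace IsCanonical

variable {S' : Set (ℝ × ℝ)} {X : Solution κ U₀ V₀ S} {X' : Solution κ U₀ V₀ S'}

/-- Waves with the same characteristic data agree on the smaller domain. -/
theorem wave_unique {B : Background U₀ V₀ S} {B' : Background U₀ V₀ S'} (hS : S' ⊆ S)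
    (hs : ∀ p, B.s p = B'.s p) (hq : ∀ p, B.q p = B'.q p) {u v : ℝ → ℝ} {c c' : ℝ × ℝ → ℝ}
    (h : B.IsWave u v c) (h' : B'.IsWave u v c') : ∀ p ∈ S', c' p = c p := by
  intro p hp
  have hr : ∀ p, B.r p = B'.r p := fun p => by rw [Background.r, Background.r, hs]
  have hsub := B'.domain.past_subset hp
  have key := volterra_unique (q := fun z => - B'.q z) (h := fun r => u r.1 + v r.2)
    (w := fun z => B'.r z * c' z) (w' := fun z => B'.r z * c z)
    (B'.domain.le_fst hp) (B'.domain.le_snd hp) (B'.continuousOn_q.mono hsub).neg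
    ((B'.continuousOn_r.mul h'.cont).mono hsub)
    ((B'.continuousOn_r.mono hsub).mul (h.cont.mono (hsub.trans hS)))
    (fun r hr => by
      rw [h'.eq r (hsub hr), sub_eq_add_neg, ← integral_neg]
      simp only [neg_mul])
    (fun r hr' => by
      have := h.eq r (hS (hsub hr'))
      simp only [hr, hq] at this
      rw [this, sub_eq_add_neg, ← integral_neg]
      simp only [neg_mul]) p (B'.domain.self_mem_past hp)
  exact mul_left_cancel₀ (B'.r_pos hp).ne' key

/-- Solutions with the same initial data agree on common domains. -/
theorem unique (h : IsCanonical J₁ J₂ X) (h' : IsCanonical J₁ J₂ X') (hS : S' ⊆ S) :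
    ∀ p ∈ S', X'.a p = X.a p ∧ X'.b p = X.b p ∧ X'.c p = X.c p ∧ X'.ψ p = X.ψ p := by
  have hs : ∀ p, X.s p = X'.s p := fun p => by rw [h.s_eq, h'.s_eq]
  have hr : ∀ p, X.r p = X'.r p := fun p => by rw [Background.r, Background.r, hs]
  have hbU : ∀ p, X.bU p = X'.bU p := fun p => by
    rw [Background.bU, Background.bU, hs, h.f₁_eq, h'.f₁_eq]
  have hbV : ∀ p, X.bV p = X'.bV p := fun p => by
    rw [Background.bV, Background.bV, hs, h.g₁_eq, h'.g₁_eq]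
  have hq : ∀ p, X.q p = X'.q p := fun p => by
    rw [Background.q, Background.q, hbU, hbV]
  have hc := wave_unique hS hs hq (by have := X.wave_c; rwa [h.u_eq, h.v_eq] at this)
    (by have := X'.wave_c; rwa [h'.u_eq, h'.v_eq] at this)
  have hψ := wave_unique hS hs hq (by have := X.wave_ψ; rwa [h.uψ_eq, h.vψ_eq] at this)
    (by have := X'.wave_ψ; rwa [h'.uψ_eq, h'.vψ_eq] at this)
  have sU : ∀ {u : ℝ → ℝ} {c c' : ℝ × ℝ → ℝ}, (∀ p ∈ S', c' p = c p) → ∀ z ∈ S',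
      X'.slopeU u c' z = X.slopeU u c z := fun {u c c'} hc z hz => by
    simp only [Background.slopeU, hr, hbU, hq, hc z hz]
    congr 3
    refine intervalIntegral.integral_congr fun y hy => ?_
    simp only [hc _ (X'.domain.mem_line' hz hy)]
  have sV : ∀ {v : ℝ → ℝ} {c c' : ℝ × ℝ → ℝ}, (∀ p ∈ S', c' p = c p) → ∀ z ∈ S',
      X'.slopeV v c' z = X.slopeV v c z := fun {v c c'} hc z hz => by
    simp only [Background.slopeV, Background.slopeU, Background.r_swap, Background.bU_swap,
      Background.q_swap, hr, hbV, hq, Prod.swap_swap, hc z hz, Prod.swap_prod_mk, Prod.fst_swap,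
      Prod.snd_swap]
    congr 3
    refine intervalIntegral.integral_congr fun x hx => ?_
    simp only [hc _ (X'.domain.mem_line hz hx)]
  intro p hp
  refine ⟨?_, by rw [Background.b, Background.b, hs], hc p hp, hψ p hp⟩
  rw [X'.a_eq p hp, X.a_eq p (hS hp), h.α_eq, h.β_eq, h'.α_eq, h'.β_eq]
  congr 1
  refine setIntegral_congr_fun (measurableSet_past p) fun z hz => ?_
  have hz' := X'.domain.past_subset hp hz
  rw [hq, sU hc z hz', sV hc z hz', sU hψ z hz', sV hψ z hz', h.u_eq, h.v_eq, h.uψ_eq, h.vψ_eq,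
    h'.u_eq, h'.v_eq, h'.uψ_eq, h'.vψ_eq]

end IsCanonical

end

section

/-! ### The area function on a contracting initial hypersurface -/

/-- A negative initial value is preserved by a linear equation with non-positive source. -/
theorem HasACDeriv.neg_of_linear {f g m n : ℝ → ℝ} {a b : ℝ} (h : HasACDeriv f g a b)
    (hab : a ≤ b) (hm : IntervalIntegrable m volume a b) (ha : f a < 0)
    (hg : ∀ᵐ t : ℝ, t ∈ Icc a b → g t = m t * f t - n t)
    (hn : ∀ᵐ t : ℝ, t ∈ Icc a b → 0 ≤ n t) : f b < 0 := by
  have dE := (HasACDeriv.of_integral hm left_mem_uIcc).exp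
  have key := (h.sub (dE.const_mul (f a))).nonpos_of_linear (m := m) (n := n) hab hm (by simp)
    (by filter_upwards [hg] with t ht h
        rw [ht h]; ring) hn
  have := mul_neg_of_neg_of_pos ha (Real.exp_pos (∫ t in a..b, m t))
  linarith

/-- A function given by two successive integrations of a locally integrable function. -/
theorem isW21_of_integral {x₀ F₀ G₀ : ℝ} {F G h : ℝ → ℝ}
    (hh : ∀ x, x₀ ≤ x → IntervalIntegrable h volume x₀ x)
    (hG : ∀ x, G x = G₀ + ∫ t in x₀..x, h t) (hF : ∀ x, F x = F₀ + ∫ t in x₀..x, G t) :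
    IsW21 x₀ F ∧ (∀ x, x₀ ≤ x → HasACDeriv G h x₀ x) ∧ ∀ x, x₀ ≤ x → HasACDeriv F G x₀ x := by
  have dG : ∀ x, x₀ ≤ x → HasACDeriv G h x₀ x := fun x hx =>
    ((HasACDeriv.const G₀).add (HasACDeriv.of_integral (hh x hx) left_mem_uIcc)).congr
      (fun t _ => (hG t).symm) |>.congr_deriv (Eventually.of_forall fun t _ => zero_add _)
  have cG : ContinuousOn G (Ici x₀) := by
    intro x hx
    have h1 := (dG (x + 1) (le_trans hx (by linarith))).continuousOn
    rw [uIcc_of_le (le_trans hx (by linarith))] at h1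
    refine (h1 x ⟨hx, by linarith⟩).mono_of_mem_nhdsWithin ?_
    exact mem_nhdsWithin.2 ⟨Iio (x + 1), isOpen_Iio, by simp, fun t ht => ⟨ht.2, ht.1.le⟩⟩
  have cE : Continuous fun t => G (max x₀ t) :=
    cG.comp_continuous (by fun_prop) fun t => mem_Ici.2 (le_max_left _ _)
  have eF : ∀ x, x₀ ≤ x → F x = F₀ + ∫ t in x₀..x, G (max x₀ t) := fun x hx => by
    rw [hF]
    congr 1
    refine intervalIntegral.integral_congr fun t ht => ?_
    rw [uIcc_of_le hx] at ht
    simp only [max_eq_right ht.1]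
  refine ⟨⟨G, fun x hx => ?_, fun x hx => (dG x hx).ac⟩, dG, fun x hx => ?_⟩
  · have d := (cE.integral_hasStrictDerivAt x₀ x).hasDerivAt.const_add F₀
    rw [max_eq_right hx] at d
    exact d.hasDerivWithinAt.congr (fun t ht => eF t ht) (eF x hx)
  · have hi : IntervalIntegrable G volume x₀ x := by
      refine ContinuousOn.intervalIntegrable ?_
      rw [uIcc_of_le hx]; exact cG.mono Icc_subset_Ici_self
    exact ((HasACDeriv.const F₀).add (HasACDeriv.of_integral hi left_mem_uIcc)).congr
      (fun t _ => (hF t).symm) |>.congr_deriv (Eventually.of_forall fun t _ => zero_add _)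

theorem exists_endpoint {x₀ : ℝ} {I : Set ℝ} (h0 : x₀ ∈ I) (hle : ∀ x ∈ I, x₀ ≤ x)
    (hI : ∀ x ∈ I, Icc x₀ x ⊆ I) (hgt : ∀ x ∈ I, ∃ x' ∈ I, x < x') :
    ∃ b : EReal, (x₀ : EReal) < b ∧ ∀ x : ℝ, x ∈ I ↔ x₀ ≤ x ∧ (x : EReal) < b := by
  have hlt : ∀ x ∈ I, (x : EReal) < sSup ((fun x : ℝ => (x : EReal)) '' I) := fun x hx => by
    obtain ⟨x', hx', h⟩ := hgt x hx
    exact (EReal.coe_lt_coe_iff.2 h).trans_le (le_sSup (mem_image_of_mem _ hx'))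
  refine ⟨_, hlt x₀ h0, fun x => ⟨fun hx => ⟨hle x hx, hlt x hx⟩, fun hx => ?_⟩⟩
  obtain ⟨_, ⟨x', hx', rfl⟩, h⟩ := lt_sSup_iff.1 hx.2
  exact hI x' hx' ⟨hx.1, (EReal.coe_lt_coe_iff.1 h).le⟩

namespace Axis

variable {k x₀ β γ : ℝ} {D : NullData} (J : Axis k x₀ β γ D) {x : ℝ}

theorem continuousOn_f : ContinuousOn J.f (Ici x₀) := by
  intro x hx
  have h1 := (J.f_deriv (x := x + 1) (le_trans hx (by linarith))).continuousOn
  rw [uIcc_of_le (le_trans hx (by linarith))] at h1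
  refine (h1 x ⟨hx, by linarith⟩).mono_of_mem_nhdsWithin ?_
  exact mem_nhdsWithin.2 ⟨Iio (x + 1), isOpen_Iio, by simp, fun t ht => ⟨ht.2, ht.1.le⟩⟩

theorem zero_mem_domain : x₀ ∈ J.domain := by
  refine ⟨le_rfl, fun t ht => ?_⟩
  rw [Icc_self] at ht
  rw [mem_singleton_iff.1 ht, J.A_zero, J.B_zero]
  exact ⟨one_pos, one_pos⟩

theorem ordConnected_domain : OrdConnected J.domain :=
  ⟨fun x hx y hy t ht => J.mem_domain_of_le hy (hx.1.trans ht.1) ht.2⟩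

/-- The equation for the second derivative of the area function, as a linear equation for the
first derivative with a source of definite sign. -/
theorem f₂_eq (hx : x ∈ J.domain) : J.f₂ x = (2 * deriv D.a x + J.f₁ x / (2 * J.f x)) * J.f₁ x
    - 2 * J.f x * (D.ricciCoeff k x + (((J.z x - D.weylCoeff k x * J.A x) / J.A x
      - (J.y x + D.weylCoeff k x * J.B x) / J.B x) / 2) ^ 2) := by
  obtain ⟨pA, pB⟩ := hx.2 x ⟨hx.1, le_rfl⟩
  have a1 := pA.ne'
  have a2 := pB.ne'
  simp only [f₂, f₁, f]
  field_simp
  ring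

theorem source_nonneg (hx : x ∈ J.domain) : ∀ᵐ t : ℝ, t ∈ Icc x₀ x →
    0 ≤ 2 * J.f t * (D.ricciCoeff k t + (((J.z t - D.weylCoeff k t * J.A t) / J.A t
      - (J.y t + D.weylCoeff k t * J.B t) / J.B t) / 2) ^ 2) := by
  filter_upwards [J.regular.ricciCoeff_nonneg k] with t ht h
  have h1 := J.f_pos (J.mem_domain_of_le hx h.1 h.2)
  have h2 := ht h.1
  positivity

theorem factor_int {x' : ℝ} (hx' : x₀ ≤ x') (h : x' ≤ x) (hx : x ∈ J.domain) :
    IntervalIntegrable (fun t => 2 * deriv D.a t + J.f₁ t / (2 * J.f t)) volume x' x := by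
  have hsub : uIcc x' x ⊆ uIcc x₀ x := by
    rw [uIcc_of_le h, uIcc_of_le hx.1]; exact Icc_subset_Icc_left hx'
  refine IntervalIntegrable.mono_set ?_ hsub
  refine ((J.regular.a_deriv hx.1).intervalIntegrable.const_mul 2).add
    (ContinuousOn.intervalIntegrable ?_)
  refine (J.f₁_deriv hx.1).continuousOn.div
    (continuousOn_const.mul (J.f_deriv hx.1).continuousOn) fun t ht => ?_
  rw [uIcc_of_le hx.1] at ht
  exact (mul_pos two_pos (J.f_pos (J.mem_domain_of_le hx ht.1 ht.2))).ne'

theorem f₁_deriv_of_le {x' : ℝ} (hx' : x₀ ≤ x') (h : x' ≤ x) : HasACDeriv J.f₁ J.f₂ x' x :=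
  (J.f₁_deriv (hx'.trans h)).mono (by
    rw [uIcc_of_le h, uIcc_of_le (hx'.trans h)]; exact Icc_subset_Icc_left hx')

/-- If the area is initially non-increasing, it remains so. -/
theorem f₁_nonpos (hβ : β ≤ 0) (hx : x ∈ J.domain) : J.f₁ x ≤ 0 := by
  refine (J.f₁_deriv hx.1).nonpos_of_linear hx.1 (J.factor_int le_rfl hx.1 hx)
    (by rw [J.f₁_zero]; linarith) (Eventually.of_forall fun t ht => ?_) (J.source_nonneg hx)
  exact J.f₂_eq (J.mem_domain_of_le hx ht.1 ht.2)

/-- Once the area decreases, it keeps decreasing. -/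
theorem f₁_neg_of_le {x' : ℝ} (hx' : x₀ ≤ x') (h : x' ≤ x) (hx : x ∈ J.domain)
    (hneg : J.f₁ x' < 0) : J.f₁ x < 0 := by
  refine (J.f₁_deriv_of_le hx' h).neg_of_linear h (J.factor_int hx' h hx) hneg
    (Eventually.of_forall fun t ht => J.f₂_eq (J.mem_domain_of_le hx (hx'.trans ht.1) ht.2)) ?_
  filter_upwards [J.source_nonneg hx] with t ht hm
  exact ht ⟨hx'.trans hm.1, hm.2⟩

theorem antitoneOn_f (hβ : β ≤ 0) : AntitoneOn J.f J.domain := by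
  intro x hx y hy hxy
  have d := (J.f_deriv hy.1).mono (c := x) (d := y) (by
    rw [uIcc_of_le hxy, uIcc_of_le hy.1]; exact Icc_subset_Icc_left hx.1)
  exact d.antitone_of_nonpos hxy (Eventually.of_forall fun t ht =>
    J.f₁_nonpos hβ (J.mem_domain_of_le hy (hx.1.trans ht.1) ht.2))

theorem f_le_one (hβ : β ≤ 0) (hx : x ∈ J.domain) : J.f x ≤ 1 := by
  rw [← J.f_zero]
  exact J.antitoneOn_f hβ J.zero_mem_domain hx hx.1

/-- At the end of the domain the area vanishes. -/
theorem exists_sup (hx₀ : x₀ ≤ x) (hx : x ∉ J.domain) : ∃ X, x₀ < X ∧ X ≤ x ∧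
    (∀ t, t ∈ J.domain ↔ x₀ ≤ t ∧ t < X) ∧ J.f X = 0 := by
  have hb : ∀ t ∈ J.domain, t ≤ x := fun t ht => by
    by_contra hlt
    exact hx (J.mem_domain_of_le ht hx₀ (not_le.1 hlt).le)
  have hbdd : BddAbove J.domain := ⟨x, hb⟩
  have hne : J.domain.Nonempty := ⟨x₀, J.zero_mem_domain⟩
  have hlt : ∀ t ∈ J.domain, t < sSup J.domain := fun t ht => by
    obtain ⟨t', ht', h⟩ := J.exists_gt_mem_domain ht
    exact h.trans_le (le_csSup hbdd ht')
  have h0 := hlt x₀ J.zero_mem_domain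
  have hiff : ∀ t, t ∈ J.domain ↔ x₀ ≤ t ∧ t < sSup J.domain := fun t =>
    ⟨fun ht => ⟨ht.1, hlt t ht⟩, fun ht => by
      obtain ⟨t', ht', h⟩ := exists_lt_of_lt_csSup hne ht.2
      exact J.mem_domain_of_le ht' ht.1 h.le⟩
  refine ⟨sSup J.domain, h0, csSup_le hne hb, hiff, ?_⟩
  set X := sSup J.domain
  have lim : ∀ {w w' : ℝ → ℝ}, HasACDeriv w w' x₀ X → (∀ t ∈ J.domain, 0 < w t) → 0 ≤ w X := by
    intro w w' hw hpos
    have c := hw.continuousOn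
    rw [uIcc_of_le h0.le] at c
    have c1 : ContinuousWithinAt w (Ioo x₀ X) X :=
      (c X ⟨h0.le, le_rfl⟩).mono Ioo_subset_Icc_self
    have : (𝓝[Ioo x₀ X] X).NeBot := by
      rw [← mem_closure_iff_nhdsWithin_neBot, closure_Ioo h0.ne]; exact ⟨h0.le, le_rfl⟩
    exact ge_of_tendsto c1 (by
      filter_upwards [self_mem_nhdsWithin] with t ht
      exact (hpos t ((hiff t).2 ⟨ht.1.le, ht.2⟩)).le)
  have pA := lim (J.jacobi_A X h0.le).A_deriv fun t ht => (ht.2 t ⟨ht.1, le_rfl⟩).1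
  have pB := lim (J.jacobi_B X h0.le).A_deriv fun t ht => (ht.2 t ⟨ht.1, le_rfl⟩).2
  by_contra hne0
  have hX : X ∈ J.domain := by
    refine ⟨h0.le, fun t ht => ?_⟩
    rcases ht.2.eq_or_lt with rfl | h
    · exact ⟨lt_of_le_of_ne pA fun h => hne0 (by rw [f, ← h, zero_mul]),
        lt_of_le_of_ne pB fun h => hne0 (by rw [f, ← h, mul_zero])⟩
    · exact ((hiff t).2 ⟨ht.1, h⟩).2 t ⟨ht.1, le_rfl⟩
  exact lt_irrefl _ (hlt X hX)

end Axis

end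

section

theorem HasACDeriv.sub_of_le {f g : ℝ → ℝ} {a b c d : ℝ} (h : HasACDeriv f g a b) (h1 : a ≤ c)
    (h2 : c ≤ d) (h3 : d ≤ b) : HasACDeriv f g c d :=
  h.mono (by
    rw [uIcc_of_le h2, uIcc_of_le (h1.trans (h2.trans h3))]; exact Icc_subset_Icc h1 h3)

namespace Axis

variable {k x₀ β γ : ℝ} {D : NullData} (J : Axis k x₀ β γ D) {x : ℝ}

theorem measurableSet_domain : MeasurableSet J.domain := J.ordConnected_domain.measurableSet

/-- The function `1 - 2 f` on the domain, continued to a function that increases strictly beyond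
the end of the domain. -/
theorem exists_extension (hβ : β ≤ 0) : ∃ F : ℝ → ℝ, IsW21 x₀ F ∧ MonotoneOn F (Ici x₀) ∧
    (∀ x ∈ J.domain, F x = 1 - 2 * J.f x) ∧ (∀ x, x₀ ≤ x → x ∉ J.domain → 1 ≤ F x) ∧
    ContinuousOn F (Ici x₀) ∧ F x₀ = -1 ∧
    ∀ x, x₀ < x → (∀ t, x₀ ≤ t → t < x → F t < F x) ∨ F x = -1 := by
  classical
  set h : ℝ → ℝ := J.domain.piecewise (fun t => -2 * J.f₂ t) (fun _ => 2) with hh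
  have hd : ∀ t ∈ J.domain, h t = -2 * J.f₂ t := fun t ht => piecewise_eq_of_mem _ _ _ ht
  have hn : ∀ t ∉ J.domain, h t = 2 := fun t ht => piecewise_eq_of_notMem _ _ _ ht
  have hi : ∀ x, x₀ ≤ x → IntervalIntegrable h volume x₀ x := fun x hx => by
    have i1 := ((J.f₁_deriv hx).const_mul (-2)).intervalIntegrable
    rw [intervalIntegrable_iff_integrableOn_Ioc_of_le hx] at i1 ⊢
    exact Integrable.piecewise J.measurableSet_domain i1.integrableOn
      (integrableOn_const (by simp)).integrableOn
  set G : ℝ → ℝ := fun x => -2 * J.f₁ x₀ + ∫ t in x₀..x, h t with hG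
  set F : ℝ → ℝ := fun x => -1 + ∫ t in x₀..x, G t with hF
  obtain ⟨w, dG, dF⟩ := isW21_of_integral (G := G) (F := F) hi (fun x => rfl) (fun x => rfl)
  have G0 : G x₀ = -2 * J.f₁ x₀ := by simp [hG]
  have F0 : F x₀ = -1 := by simp [hF]
  -- up to the end of the domain
  have low : ∀ x, x₀ ≤ x → (∀ t, x₀ ≤ t → t < x → t ∈ J.domain) →
      G x = -2 * J.f₁ x ∧ F x = 1 - 2 * J.f x := by
    intro x hx hdom
    have g : ∀ s ∈ Icc x₀ x, G s = -2 * J.f₁ s := fun s hs => by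
      have d := ((dG s hs.1).sub ((J.f₁_deriv hs.1).const_mul (-2))).eq_of_deriv_zero (by
        filter_upwards [Measure.ae_ne volume s] with t hne ht
        rw [uIcc_of_le hs.1] at ht
        rw [hd t (hdom t ht.1 ((lt_of_le_of_ne ht.2 hne).trans_le hs.2)), sub_self])
      rw [G0] at d
      linarith
    refine ⟨g x ⟨hx, le_rfl⟩, ?_⟩
    have d := ((dF x hx).sub ((J.f_deriv hx).const_mul (-2))).eq_of_deriv_zero
      (Eventually.of_forall fun t ht => by
        rw [uIcc_of_le hx] at ht
        rw [g t ht, sub_self])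
    rw [F0, J.f_zero] at d
    linarith
  have lowd : ∀ x ∈ J.domain, G x = -2 * J.f₁ x ∧ F x = 1 - 2 * J.f x := fun x hx =>
    low x hx.1 fun t h1 h2 => J.mem_domain_of_le hx h1 h2.le
  -- beyond the end of the domain
  have high : ∀ x, x₀ ≤ x → x ∉ J.domain → 0 ≤ G x ∧ 1 ≤ F x ∧
      ∀ t, x₀ ≤ t → t < x → F t < F x := by
    intro x hx hxd
    obtain ⟨X, h0, hXx, hiff, hX⟩ := J.exists_sup hx hxd
    have eX := low X h0.le fun t h1 h2 => (hiff t).2 ⟨h1, h2⟩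
    have hG0 : 0 ≤ G X := by
      have c := (dG X h0.le).continuousOn
      rw [uIcc_of_le h0.le] at c
      have : (𝓝[Ioo x₀ X] X).NeBot := by
        rw [← mem_closure_iff_nhdsWithin_neBot, closure_Ioo h0.ne]; exact ⟨h0.le, le_rfl⟩
      exact ge_of_tendsto ((c X ⟨h0.le, le_rfl⟩).mono Ioo_subset_Icc_self) (by
        filter_upwards [self_mem_nhdsWithin] with t ht
        have hm := (hiff t).2 ⟨ht.1.le, ht.2⟩
        rw [(lowd t hm).1]
        linarith [J.f₁_nonpos hβ hm])
    have gX : ∀ t, X ≤ t → G t = G X + 2 * (t - X) := fun t ht => by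
      have d1 := (dG t (h0.le.trans ht)).sub_of_le h0.le ht le_rfl
      have d2 : HasACDeriv (fun s : ℝ => 2 * (s - X)) (fun _ => 2) X t :=
        HasACDeriv.of_hasDerivAt (fun s _ => by
          simpa using ((hasDerivAt_id s).sub_const X).const_mul 2) continuousOn_const
      have d := (d1.sub d2).eq_of_deriv_zero (by
        filter_upwards [Measure.ae_ne volume X] with s hne hs
        rw [uIcc_of_le ht] at hs
        rw [hn s fun hm => absurd ((hiff s).1 hm).2 (not_lt.2 hs.1), sub_self])
      linarith
    have fX : ∀ s t, X ≤ s → s ≤ t → F s + (t - s) ^ 2 ≤ F t := by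
      intro s t hs hst
      have d1 := (dF t (h0.le.trans (hs.trans hst))).sub_of_le (h0.le.trans hs) hst le_rfl
      have d2 : HasACDeriv (fun r : ℝ => (r - s) ^ 2) (fun r => 2 * (r - s)) s t :=
        HasACDeriv.of_hasDerivAt (fun r _ => by
          have := ((hasDerivAt_id r).sub_const s).fun_pow 2
          simpa using this) (by fun_prop)
      have d := (d2.sub d1).antitone_of_nonpos hst (Eventually.of_forall fun r hr => by
        rw [gX r (hs.trans hr.1)]; linarith)
      simp only [sub_self, ne_eq, OfNat.ofNat_ne_zero, not_false_eq_true, zero_pow, zero_sub] at d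
      linarith
    rw [hX] at eX
    refine ⟨by rw [gX x hXx]; linarith, ?_, fun t ht htx => ?_⟩
    · have := fX X x le_rfl hXx
      nlinarith [sq_nonneg (x - X), eX.2]
    · rcases lt_or_ge t X with h | h
      · have hm := (hiff t).2 ⟨ht, h⟩
        have e1 := (lowd t hm).2
        have e2 := J.f_pos hm
        have := fX X x le_rfl hXx
        nlinarith [sq_nonneg (x - X), eX.2]
      · have := fX t x h htx.le
        nlinarith [sub_pos.2 htx]
  have cF : ContinuousOn F (Ici x₀) := by
    obtain ⟨F', hF', -⟩ := w
    exact fun x hx => (hF' x hx).continuousWithinAt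
  have mono : MonotoneOn F (Ici x₀) := by
    intro s hs t ht hst
    have d := ((dF t ht).sub_of_le hs hst le_rfl).neg.antitone_of_nonpos hst
      (Eventually.of_forall fun r hr => by
        by_cases hr' : r ∈ J.domain
        · rw [(lowd r hr').1]; linarith [J.f₁_nonpos hβ hr']
        · linarith [(high r (le_trans hs hr.1) hr').1])
    linarith
  refine ⟨F, w, mono, fun x hx => (lowd x hx).2, fun x h1 h2 => (high x h1 h2).2.1, cF, F0,
    fun x hx => ?_⟩
  by_cases hxd : x ∈ J.domain
  · by_contra hcon
    push Not at hcon
    obtain ⟨⟨t, ht, htx, hle⟩, hne⟩ := hcon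
    refine hne ?_
    have htd := J.mem_domain_of_le hxd ht htx.le
    -- `f` is constant on `[t, x]`, so that `f₁` vanishes at `t`, and hence on `[x₀, t]`
    have eq : ∀ s, t ≤ s → s ≤ x → J.f s = J.f t := fun s h1 h2 => by
      have hsd := J.mem_domain_of_le hxd (ht.trans h1) h2
      have a1 := J.antitoneOn_f hβ htd hsd h1
      have a2 := J.antitoneOn_f hβ hsd hxd h2
      rw [(lowd x hxd).2, (lowd t htd).2] at hle
      linarith
    have z : J.f₁ t = 0 := by
      have d1 := (J.f_deriv hxd.1).sub_of_le ht htx.le le_rfl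
      have d2 : HasACDeriv J.f (fun _ => 0) t x := (HasACDeriv.const (J.f t)).congr fun s hs => by
        rw [uIcc_of_le htx.le] at hs
        exact (eq s hs.1 hs.2).symm
      have c := (J.f₁_deriv_of_le ht htx.le).continuousOn
      rw [uIcc_of_le htx.le] at c
      exact d1.eqOn_of_continuousOn htx d2 c continuousOn_const ⟨le_rfl, htx.le⟩
    have z' : ∀ s ∈ Icc x₀ t, J.f₁ s = 0 := fun s hs => by
      by_contra hs0
      have := J.f₁_neg_of_le hs.1 hs.2 htd (lt_of_le_of_ne
        (J.f₁_nonpos hβ (J.mem_domain_of_le htd hs.1 hs.2)) hs0)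
      linarith
    have e : J.f t = J.f x₀ := (J.f_deriv ht).eq_of_deriv_zero
      (Eventually.of_forall fun s hs => z' s (by rwa [uIcc_of_le ht] at hs))
    rw [(lowd x hxd).2, eq x htx.le le_rfl, e, J.f_zero]
    norm_num
  · exact Or.inl (high x hx.le hxd).2.2

end Axis

end

section

/-! ### The maximal development -/

variable {k₁ k₂ β₁ γ₁ β₂ γ₂ κ : ℝ} {D₁ D₂ : NullData} (J₁ : Axis k₁ U₀ β₁ γ₁ D₁)
  (J₂ : Axis k₂ V₀ β₂ γ₂ D₂)

/-- The largest future domain on which the metrics on the initial hypersurfaces are not degenerate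
and the area function determined by them is positive. -/
def maximalDomain : Set (ℝ × ℝ) :=
  {p | p.1 ∈ J₁.domain ∧ p.2 ∈ J₂.domain ∧ ∀ z ∈ past U₀ V₀ p, 0 < J₁.f z.1 + J₂.f z.2 - 1}

theorem past_subset_maximalDomain {p : ℝ × ℝ} (hp : p ∈ maximalDomain J₁ J₂) :
    past U₀ V₀ p ⊆ maximalDomain J₁ J₂ := fun q hq => by
  rw [mem_past] at hq
  exact ⟨J₁.mem_domain_of_le hp.1 hq.1.1 hq.1.2, J₂.mem_domain_of_le hp.2.1 hq.2.1 hq.2.2,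
    fun z hz => hp.2.2 z (past_mono hq.1.2 hq.2.2 hz)⟩

theorem Axis.exists_gt_of_lt {k x₀ β γ : ℝ} {D : NullData} (J : Axis k x₀ β γ D) {x m : ℝ}
    (hx : x ∈ J.domain) (h : ∀ t ∈ Icc x₀ x, m < J.f t) :
    ∃ x' ∈ J.domain, x < x' ∧ ∀ t ∈ Icc x₀ x', m < J.f t := by
  obtain ⟨x₁, h1, hlt⟩ := J.exists_gt_mem_domain hx
  have e : ∀ᶠ t in 𝓝[Ici x₀] x, m < J.f t :=
    (J.continuousOn_f x hx.1).eventually (lt_mem_nhds (h x ⟨hx.1, le_rfl⟩))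
  have e' : ∀ᶠ t in 𝓝[≥] x, m < J.f t :=
    nhdsWithin_mono x (Ici_subset_Ici.2 hx.1) e
  obtain ⟨u, hu, hu'⟩ := mem_nhdsGE_iff_exists_Ico_subset.1 e'
  have hu1 : x < u := hu
  have hm : x < min x₁ ((x + u) / 2) := lt_min hlt (by linarith)
  refine ⟨min x₁ ((x + u) / 2), J.mem_domain_of_le h1 (hx.1.trans hm.le) (min_le_left _ _), hm,
    fun t ht => ?_⟩
  rcases le_or_gt t x with h2 | h2
  · exact h t ⟨ht.1, h2⟩
  · exact hu' ⟨h2.le, by linarith [ht.2.trans (min_le_right x₁ ((x + u) / 2))]⟩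

/-- The set `maximalDomain` is open to the future. -/
theorem exists_gt_maximalDomain {p : ℝ × ℝ} (hp : p ∈ maximalDomain J₁ J₂) :
    ∃ p' ∈ maximalDomain J₁ J₂, p.1 < p'.1 ∧ p.2 < p'.2 := by
  obtain ⟨h1, h2, h3⟩ := hp
  obtain ⟨x, hx, mx⟩ := isCompact_Icc.exists_isMinOn (nonempty_Icc.2 h1.1)
    (J₁.continuousOn_f.mono Icc_subset_Ici_self)
  obtain ⟨y, hy, my⟩ := isCompact_Icc.exists_isMinOn (nonempty_Icc.2 h2.1)
    (J₂.continuousOn_f.mono Icc_subset_Ici_self)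
  have hpos : 0 < J₁.f x + J₂.f y - 1 := h3 (x, y) ⟨hx, hy⟩
  obtain ⟨x', hx', l1, m1⟩ := J₁.exists_gt_of_lt h1 (m := J₁.f x - (J₁.f x + J₂.f y - 1) / 2)
    fun t ht => by linarith [isMinOn_iff.1 mx t ht]
  obtain ⟨y', hy', l2, m2⟩ := J₂.exists_gt_of_lt h2 (m := J₂.f y - (J₁.f x + J₂.f y - 1) / 2)
    fun t ht => by linarith [isMinOn_iff.1 my t ht]
  exact ⟨(x', y'), ⟨hx', hy', fun z hz => by linarith [m1 z.1 hz.1, m2 z.2 hz.2]⟩, l1, l2⟩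

theorem isFutureDomain_maximalDomain : IsFutureDomain U₀ V₀ (maximalDomain J₁ J₂) where
  mem := ⟨J₁.zero_mem_domain, J₂.zero_mem_domain, fun z hz => by
    obtain ⟨⟨h1, h2⟩, h3, h4⟩ := mem_past.1 hz
    simp only at h2 h4
    rw [le_antisymm h2 h1, le_antisymm h4 h3, J₁.f_zero, J₂.f_zero]
    norm_num⟩
  subset := fun p hp => ⟨hp.1.1, hp.2.1.1⟩
  past := fun p hp => past_subset_maximalDomain J₁ J₂ hp
  relOpen := by
    refine ⟨⋃ p ∈ maximalDomain J₁ J₂, Iio p.1 ×ˢ Iio p.2,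
      isOpen_biUnion fun p _ => isOpen_Iio.prod isOpen_Iio, ?_⟩
    ext p
    simp only [mem_inter_iff, mem_iUnion, exists_prop]
    refine ⟨fun hp => ⟨?_, hp.1.1, hp.2.1.1⟩, fun ⟨⟨p', hp', h1, h2⟩, h3, h4⟩ => ?_⟩
    · obtain ⟨p', hp', l1, l2⟩ := exists_gt_maximalDomain J₁ J₂ hp
      exact ⟨p', hp', l1, l2⟩
    · exact past_subset_maximalDomain J₁ J₂ hp' (mem_past.2 ⟨⟨h3, le_of_lt h1⟩, h4, le_of_lt h2⟩)

theorem maximalDomain_pos : ∀ p ∈ maximalDomain J₁ J₂,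
    p.1 ∈ J₁.domain ∧ p.2 ∈ J₂.domain ∧ 0 < J₁.f p.1 + J₂.f p.2 - 1 := fun p hp =>
  ⟨hp.1, hp.2.1, hp.2.2 p ((isFutureDomain_maximalDomain J₁ J₂).self_mem_past hp)⟩

variable {J₁ J₂}

theorem IsFutureDomain.subset_maximalDomain (hS : IsFutureDomain U₀ V₀ S)
    (h : ∀ p ∈ S, p.1 ∈ J₁.domain ∧ p.2 ∈ J₂.domain ∧ 0 < J₁.f p.1 + J₂.f p.2 - 1) :
    S ⊆ maximalDomain J₁ J₂ := fun p hp =>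
  ⟨(h p hp).1, (h p hp).2.1, fun z hz => (h z (hS.past_subset hp hz)).2.2⟩

section WithData

variable {D : InitialData} {J₁ : Axis 0 D.U₀ (- D.ρ₀) (- D.σ₀) D.out}
  {J₂ : Axis 4 D.V₀ D.μ₀ D.lam₀ D.inc}

/-- Every development lives inside `maximalDomain` and is in integrated form, so uniqueness of the
latter makes it a restriction of the solution there. -/
theorem IsCanonical.isMaximalDevelopment {X : Solution κ D.U₀ D.V₀ (maximalDomain J₁ J₂)}
    (h : IsCanonical J₁ J₂ X) (hκ : 0 < κ) :
    IsMaximalDevelopment κ D (maximalDomain J₁ J₂) X.fields := by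
  refine ⟨h.isDevelopment hκ, fun S' f' h' => ?_⟩
  obtain ⟨hdom, X', hX', ea, eb, ec, eψ⟩ := h'.exists_isCanonical hκ (J₁ := J₁) (J₂ := J₂)
  have hsub := h'.domain.subset_maximalDomain hdom
  refine ⟨hsub, fun p hp => ?_⟩
  obtain ⟨h1, h2, h3, h4⟩ := h.unique hX' hsub p hp
  exact ⟨by rw [← ea, h1]; rfl, by rw [← eb p hp, h2]; rfl, by rw [← ec, h3]; rfl,
    by rw [← eψ, h4]; rfl⟩

theorem exists_isMaximalDevelopment (hκ : 0 < κ) (J₁ : Axis 0 D.U₀ (- D.ρ₀) (- D.σ₀) D.out)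
    (J₂ : Axis 4 D.V₀ D.μ₀ D.lam₀ D.inc) :
    ∃ X : Solution κ D.U₀ D.V₀ (maximalDomain J₁ J₂), IsCanonical J₁ J₂ X :=
  exists_isCanonical J₁ J₂ hκ (isFutureDomain_maximalDomain J₁ J₂) (maximalDomain_pos J₁ J₂)

theorem IsMaximalDevelopment.domain_eq {f : Fields} (h : IsMaximalDevelopment κ D S f)
    (hκ : 0 < κ) : S = maximalDomain J₁ J₂ := by
  obtain ⟨X, hX⟩ := exists_isMaximalDevelopment hκ J₁ J₂
  exact Subset.antisymm ((hX.isMaximalDevelopment hκ).2 S f h.1).1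
    (h.2 _ _ (hX.isDevelopment hκ)).1

end WithData

/-! ### The boundary of the maximal development -/

theorem mem_maximalDomain (hβ₁ : β₁ ≤ 0) (hβ₂ : β₂ ≤ 0) {p : ℝ × ℝ} :
    p ∈ maximalDomain J₁ J₂ ↔ p.1 ∈ J₁.domain ∧ p.2 ∈ J₂.domain ∧
      0 < J₁.f p.1 + J₂.f p.2 - 1 := by
  refine ⟨fun h => maximalDomain_pos J₁ J₂ p h, fun ⟨h1, h2, h3⟩ => ⟨h1, h2, fun z hz => ?_⟩⟩
  obtain ⟨⟨z1, z2⟩, z3, z4⟩ := mem_past.1 hz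
  have a1 := J₁.antitoneOn_f hβ₁ (J₁.mem_domain_of_le h1 z1 z2) h1 z2
  have a2 := J₂.antitoneOn_f hβ₂ (J₂.mem_domain_of_le h2 z3 z4) h2 z4
  linarith

theorem mem_maximalDomain_axis (hβ₁ : β₁ ≤ 0) (hβ₂ : β₂ ≤ 0) {x : ℝ} :
    (x, V₀) ∈ maximalDomain J₁ J₂ ↔ x ∈ J₁.domain := by
  rw [mem_maximalDomain hβ₁ hβ₂]
  refine ⟨fun h => h.1, fun h => ⟨h, J₂.zero_mem_domain, ?_⟩⟩
  simp only [J₂.f_zero]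
  linarith [J₁.f_pos h]

theorem mem_maximalDomain_axis' (hβ₁ : β₁ ≤ 0) (hβ₂ : β₂ ≤ 0) {y : ℝ} :
    (U₀, y) ∈ maximalDomain J₁ J₂ ↔ y ∈ J₂.domain := by
  rw [mem_maximalDomain hβ₁ hβ₂]
  refine ⟨fun h => h.2.1, fun h => ⟨J₁.zero_mem_domain, h, ?_⟩⟩
  simp only [J₁.f_zero]
  linarith [J₂.f_pos h]

theorem Axis.exists_endpoint {k x₀ β γ : ℝ} {D : NullData} (J : Axis k x₀ β γ D) :
    ∃ b : EReal, (x₀ : EReal) < b ∧ ∀ x : ℝ, x ∈ J.domain ↔ x₀ ≤ x ∧ (x : EReal) < b :=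
  PlaneSymmetric.exists_endpoint J.zero_mem_domain (fun _ hx => hx.1)
    (fun _ hx _ ht => J.mem_domain_of_le hx ht.1 ht.2) fun _ hx => J.exists_gt_mem_domain hx

/-- The functions `F = 1 - 2 f`, `G = 1 - 2 g`, continued beyond the end of the data so that they
are at least `1` there, describe the maximal domain and its future boundary. -/
theorem maximalDomain_structure (hβ₁ : β₁ ≤ 0) (hβ₂ : β₂ ≤ 0) : ∃ F G : ℝ → ℝ,
    IsW21 U₀ F ∧ IsW21 V₀ G ∧ MonotoneOn F (Ici U₀) ∧ MonotoneOn G (Ici V₀) ∧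
    maximalDomain J₁ J₂ = {p : ℝ × ℝ | U₀ ≤ p.1 ∧ V₀ ≤ p.2 ∧ F p.1 + G p.2 < 0} ∧
    (∀ p ∈ maximalDomain J₁ J₂, J₁.f p.1 + J₂.f p.2 - 1 = - (1 / 2) * (F p.1 + G p.2)) ∧
    futureBoundary U₀ V₀ (maximalDomain J₁ J₂)
      = {p : ℝ × ℝ | U₀ < p.1 ∧ V₀ < p.2 ∧ F p.1 + G p.2 = 0} ∧
    ((∀ x ∈ J₁.domain, F x = 1 - 2 * J₁.f x) ∧ ∀ x, U₀ ≤ x → x ∉ J₁.domain → 1 ≤ F x) ∧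
    (∀ y ∈ J₂.domain, G y = 1 - 2 * J₂.f y) ∧ ∀ y, V₀ ≤ y → y ∉ J₂.domain → 1 ≤ G y := by
  obtain ⟨F, wF, mF, eF, oF, cF, zF, sF⟩ := J₁.exists_extension hβ₁
  obtain ⟨G, wG, mG, eG, oG, cG, zG, sG⟩ := J₂.exists_extension hβ₂
  have hS : maximalDomain J₁ J₂ = {p : ℝ × ℝ | U₀ ≤ p.1 ∧ V₀ ≤ p.2 ∧ F p.1 + G p.2 < 0} := by
    ext p
    rw [mem_maximalDomain hβ₁ hβ₂]
    refine ⟨fun ⟨h1, h2, h3⟩ => ⟨h1.1, h2.1, ?_⟩, fun ⟨h1, h2, h3⟩ => ?_⟩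
    · rw [eF _ h1, eG _ h2]; linarith
    · have gF := mF self_mem_Ici h1 h1
      have gG := mG self_mem_Ici h2 h2
      have d1 : p.1 ∈ J₁.domain := by
        by_contra h; linarith [oF _ h1 h]
      have d2 : p.2 ∈ J₂.domain := by
        by_contra h; linarith [oG _ h2 h]
      refine ⟨d1, d2, ?_⟩
      rw [eF _ d1, eG _ d2] at h3
      linarith
  refine ⟨F, G, wF, wG, mF, mG, hS, fun p hp => ?_, ?_, ⟨eF, oF⟩, eG, oG⟩
  · rw [eF _ hp.1, eG _ hp.2.1]; ring
  have cH : ContinuousOn (fun p : ℝ × ℝ => F p.1 + G p.2) (Ici U₀ ×ˢ Ici V₀) :=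
    (cF.comp continuous_fst.continuousOn fun p hp => hp.1).add
      (cG.comp continuous_snd.continuousOn fun p hp => hp.2)
  have cO := cH.mono (prod_mono (Ioi_subset_Ici_self (a := U₀)) (Ioi_subset_Ici_self (a := V₀)))
  have oO : IsOpen (Ioi U₀ ×ˢ Ioi V₀) := isOpen_Ioi.prod isOpen_Ioi
  ext p
  simp only [futureBoundary, mem_inter_iff, mem_prod, mem_Ioi, mem_ofPred_eq]
  constructor
  · rintro ⟨hfr, h1, h2⟩
    refine ⟨h1, h2, ?_⟩
    have cp : ContinuousAt (fun p : ℝ × ℝ => F p.1 + G p.2) p :=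
      cO.continuousAt (oO.mem_nhds ⟨h1, h2⟩)
    refine le_antisymm ?_ ?_
    · have : (𝓝[maximalDomain J₁ J₂] p).NeBot :=
        mem_closure_iff_nhdsWithin_neBot.1 (frontier_subset_closure hfr)
      have ct : Tendsto (fun p : ℝ × ℝ => F p.1 + G p.2) (𝓝[maximalDomain J₁ J₂] p)
          (𝓝 (F p.1 + G p.2)) := cp.tendsto.mono_left nhdsWithin_le_nhds
      refine le_of_tendsto ct (eventually_nhdsWithin_of_forall fun q hq => ?_)
      rw [hS] at hq
      exact hq.2.2.le
    · by_contra hlt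
      refine hfr.2 (mem_interior_iff_mem_nhds.2 ?_)
      filter_upwards [cp.eventually (gt_mem_nhds (not_le.1 hlt)), oO.mem_nhds ⟨h1, h2⟩] with q q1 q2
      rw [hS]
      exact ⟨(mem_Ioi.1 q2.1).le, (mem_Ioi.1 q2.2).le, q1⟩
  · rintro ⟨h1, h2, h3⟩
    refine ⟨⟨?_, fun hi => ?_⟩, h1, h2⟩
    -- one of the two functions is strictly increasing up to the point: otherwise both still have
    -- their initial value `-1`, and `F + G = -2` there
    · have key : (∀ t, U₀ ≤ t → t < p.1 → F t < F p.1) ∨ (∀ t, V₀ ≤ t → t < p.2 → G t < G p.2) := by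
        rcases sF p.1 h1 with h | h
        · exact Or.inl h
        · rcases sG p.2 h2 with h' | h'
          · exact Or.inr h'
          · linarith
      rcases key with h | h
      · have hcl : p.1 ∈ closure (Ioo U₀ p.1) := by rw [closure_Ioo h1.ne]; exact ⟨h1.le, le_rfl⟩
        refine closure_mono (s := (fun x => (x, p.2)) '' Ioo U₀ p.1) ?_
          (image_closure_subset_closure_image (by fun_prop) ⟨p.1, hcl, rfl⟩)
        rintro _ ⟨t, ht, rfl⟩
        rw [hS]
        exact ⟨ht.1.le, h2.le, by linarith [h t ht.1.le ht.2]⟩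
      · have hcl : p.2 ∈ closure (Ioo V₀ p.2) := by rw [closure_Ioo h2.ne]; exact ⟨h2.le, le_rfl⟩
        refine closure_mono (s := (fun y => (p.1, y)) '' Ioo V₀ p.2) ?_
          (image_closure_subset_closure_image (by fun_prop) ⟨p.2, hcl, rfl⟩)
        rintro _ ⟨t, ht, rfl⟩
        rw [hS]
        exact ⟨h1.le, ht.1.le, by linarith [h t ht.1.le ht.2]⟩
    · have := interior_subset hi
      rw [hS] at this
      linarith [this.2.2]

/-- The maximal development, and the structure of its boundary for contracting data. -/
theorem exists_maximal_development (hκ : 0 < κ) (D : InitialData) (hD : D.IsWeaklyRegular) :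
    ∃ (S : Set (ℝ × ℝ)) (f : Fields), IsMaximalDevelopment κ D S f ∧ (D.NonExpanding →
      (∃ Ubar Vbar : EReal, (D.U₀ : EReal) < Ubar ∧ (D.V₀ : EReal) < Vbar ∧
        (∀ U : ℝ, (U, D.V₀) ∈ S ↔ D.U₀ ≤ U ∧ (U : EReal) < Ubar) ∧
        (∀ V : ℝ, (D.U₀, V) ∈ S ↔ D.V₀ ≤ V ∧ (V : EReal) < Vbar)) ∧
      ∃ F G : ℝ → ℝ, IsW21 D.U₀ F ∧ IsW21 D.V₀ G ∧
        MonotoneOn F (Ici D.U₀) ∧ MonotoneOn G (Ici D.V₀) ∧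
        S = {p : ℝ × ℝ | D.U₀ ≤ p.1 ∧ D.V₀ ≤ p.2 ∧ F p.1 + G p.2 < 0} ∧
        (∀ p ∈ S, Real.exp (2 * f.b p) = - (1 / 2) * (F p.1 + G p.2)) ∧
        futureBoundary D.U₀ D.V₀ S
          = {p : ℝ × ℝ | D.U₀ < p.1 ∧ D.V₀ < p.2 ∧ F p.1 + G p.2 = 0}) := by
  obtain ⟨J₁⟩ := exists_axis hD.1 0 (- D.ρ₀) (- D.σ₀)
  obtain ⟨J₂⟩ := exists_axis hD.2 4 D.μ₀ D.lam₀
  obtain ⟨X, hX⟩ := exists_isMaximalDevelopment hκ J₁ J₂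
  refine ⟨_, _, hX.isMaximalDevelopment hκ, fun hN => ?_⟩
  have h1 : - D.ρ₀ ≤ 0 := neg_nonpos.2 hN.1
  have h2 : D.μ₀ ≤ 0 := hN.2
  obtain ⟨Ub, hUb, eU⟩ := J₁.exists_endpoint
  obtain ⟨Vb, hVb, eV⟩ := J₂.exists_endpoint
  obtain ⟨F, G, wF, wG, mF, mG, hS, hs, hB, -⟩ :=
    maximalDomain_structure (J₁ := J₁) (J₂ := J₂) h1 h2
  refine ⟨⟨Ub, Vb, hUb, hVb, fun U => (mem_maximalDomain_axis h1 h2).trans (eU U),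
    fun V => (mem_maximalDomain_axis' h1 h2).trans (eV V)⟩, F, G, wF, wG, mF, mG, hS,
    fun p hp => ?_, hB⟩
  rw [← hs p hp, ← hX.s_eq]
  change Real.exp (2 * (1 / 2 * Real.log (X.s p))) = _
  rw [← mul_assoc, mul_one_div_cancel two_ne_zero, one_mul, Real.exp_log (X.s_pos hp)]

end

section

/-! ### Perturbation of the data -/

/-- The data with matter added. In the norm weighted by `e^a`, the added function has `L¹`-norm
`ε`. -/
def NullData.addMatter (D : NullData) (x₀ ε : ℝ) : NullData where
  a := D.a
  Φ := fun x => D.Φ x + ε * (Real.exp (- D.a x) * Real.exp (- (x - x₀)))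
  Ψ₁ := D.Ψ₁

/-- The data with a positive amount of matter and of convergence added. -/
def InitialData.addMatter (D : InitialData) (ε : ℝ) : InitialData where
  U₀ := D.U₀
  V₀ := D.V₀
  out := D.out.addMatter D.U₀ ε
  inc := D.inc.addMatter D.V₀ ε
  ρ₀ := D.ρ₀ + ε
  σ₀ := D.σ₀
  lam₀ := D.lam₀
  μ₀ := D.μ₀ - ε

theorem integrableOn_exp_neg (x₀ : ℝ) :
    IntegrableOn (fun x => Real.exp (- (x - x₀))) (Ici x₀) := by
  rw [integrableOn_Ici_iff_integrableOn_Ioi]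
  have := (integrableOn_exp_neg_Ioi x₀).const_mul (Real.exp x₀)
  refine this.congr (Eventually.of_forall fun x => ?_)
  simp only [← Real.exp_add]
  congr 1; ring

theorem integral_exp_neg (x₀ : ℝ) : ∫ x in Ici x₀, Real.exp (- (x - x₀)) = 1 := by
  have : ∀ x, Real.exp (- (x - x₀)) = Real.exp x₀ * Real.exp (- x) := fun x => by
    rw [← Real.exp_add]; congr 1; ring
  simp only [this]
  rw [integral_Ici_eq_integral_Ioi, integral_const_mul, integral_exp_neg_Ioi, ← Real.exp_add]
  simp

namespace NullData

variable {D : NullData} {x₀ ε : ℝ}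

theorem matter_mul_exp (x : ℝ) : ε * (Real.exp (- D.a x) * Real.exp (- (x - x₀)))
    * Real.exp (D.a x) = ε * Real.exp (- (x - x₀)) := by
  have : Real.exp (- D.a x) * Real.exp (D.a x) = 1 := by rw [← Real.exp_add]; simp
  linear_combination ε * Real.exp (- (x - x₀)) * this

theorem IsWeaklyRegular.addMatter (h : D.IsWeaklyRegular x₀) (hε : 0 ≤ ε) :
    (D.addMatter x₀ ε).IsWeaklyRegular x₀ where
  a_ac := h.a_ac
  a_int := h.a_int
  a_zero := h.a_zero
  Φ_nonneg := by
    filter_upwards [h.Φ_nonneg] with x hx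
    exact add_nonneg hx (by positivity)
  Φ_int := by
    refine (h.Φ_int.add ((integrableOn_exp_neg x₀).const_mul ε)).congr
      (Eventually.of_forall fun x => ?_)
    simp only [NullData.addMatter, Pi.add_apply]
    rw [add_mul, matter_mul_exp]
  Ψ_meas := h.Ψ_meas
  Ψ_int := h.Ψ_int
  product_int := h.product_int

theorem dist_addMatter (hε : 0 ≤ ε) : D.dist x₀ (D.addMatter x₀ ε) = ENNReal.ofReal ε := by
  have h2 : ∫⁻ x in Ici x₀, ‖ε * (Real.exp (- D.a x) * Real.exp (- (x - x₀)))‖ₑ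
      * ENNReal.ofReal (Real.exp (D.a x)) = ENNReal.ofReal ε := by
    have e : ∀ x, ‖ε * (Real.exp (- D.a x) * Real.exp (- (x - x₀)))‖ₑ
        * ENNReal.ofReal (Real.exp (D.a x)) = ENNReal.ofReal (ε * Real.exp (- (x - x₀))) := fun x => by
      rw [Real.enorm_of_nonneg (by positivity), ← ENNReal.ofReal_mul (by positivity),
        matter_mul_exp]
    simp only [e]
    rw [← ofReal_integral_eq_lintegral_ofReal ((integrableOn_exp_neg x₀).const_mul ε)
      (Eventually.of_forall fun x => by positivity), integral_const_mul, integral_exp_neg, mul_one]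
  simp only [dist, addMatter, sub_self, enorm_zero, add_zero, zero_mul, lintegral_zero, zero_add,
    add_sub_cancel_left, h2]
  simp

theorem ricciCoeff_le_addMatter (hε : 0 ≤ ε) (k x : ℝ) :
    D.ricciCoeff k x ≤ (D.addMatter x₀ ε).ricciCoeff k x := by
  refine mul_le_mul_of_nonneg_left ?_ (Real.exp_pos _).le
  simp only [addMatter]
  linarith [mul_nonneg hε (mul_pos (Real.exp_pos (- D.a x)) (Real.exp_pos (- (x - x₀)))).le]

/-- The added matter has a positive lower bound on bounded intervals. -/
theorem IsWeaklyRegular.exists_le_addMatter (h : D.IsWeaklyRegular x₀) (hε : 0 < ε) (k : ℝ)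
    {x : ℝ} (hx : x₀ ≤ x) : ∃ m, 0 < m ∧
      ∀ᵐ t : ℝ, t ∈ Icc x₀ x → m ≤ (D.addMatter x₀ ε).ricciCoeff k t := by
  have ca := (HasACDeriv.of_ac (h.a_ac x hx)).continuousOn
  rw [uIcc_of_le hx] at ca
  have cw : ContinuousOn (fun t => Real.exp (k * D.a t)
      * (ε * (Real.exp (- D.a t) * Real.exp (- (t - x₀))))) (Icc x₀ x) := by fun_prop
  obtain ⟨y, hy, hmin⟩ := isCompact_Icc.exists_isMinOn (nonempty_Icc.2 hx) cw
  refine ⟨Real.exp (k * D.a y) * (ε * (Real.exp (- D.a y) * Real.exp (- (y - x₀)))),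
    by positivity, ?_⟩
  filter_upwards [(ae_restrict_iff' measurableSet_Ici).1 h.Φ_nonneg] with t h1 ht
  refine (isMinOn_iff.1 hmin t ht).trans (mul_le_mul_of_nonneg_left ?_ (Real.exp_pos _).le)
  exact le_add_of_nonneg_left (h1 ht.1)

end NullData

/-- More matter and more convergence lead to a smaller area. -/
theorem Axis.comparison {k x₀ β β' γ ε : ℝ} {D : NullData} (hε : 0 ≤ ε) (J : Axis k x₀ β γ D)
    (J' : Axis k x₀ β' γ (D.addMatter x₀ ε)) (hβ : β' ≤ β) {x : ℝ} (hx : x ∈ J'.domain) :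
    x ∈ J.domain ∧ J'.f x ≤ J.f x := by
  have hα := (J.regular.a_deriv hx.1).intervalIntegrable
  have hφ : ∀ᵐ t : ℝ, t ∈ Icc x₀ x → D.ricciCoeff k t ≤ (D.addMatter x₀ ε).ricciCoeff k t :=
    Eventually.of_forall fun t _ => NullData.ricciCoeff_le_addMatter hε k t
  have cA := (J.jacobi_A x hx.1).comparison hx.1 (J'.jacobi_A x hx.1) hα
    (fun t ht => (hx.2 t ht).1) hφ (by rw [J.A_zero, J'.A_zero])
    (by rw [J.z_zero, J'.z_zero]; linarith)
  have cB := (J.jacobi_B x hx.1).comparison hx.1 (J'.jacobi_B x hx.1) hα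
    (fun t ht => (hx.2 t ht).2) hφ (by rw [J.B_zero, J'.B_zero])
    (by rw [J.y_zero, J'.y_zero]; linarith)
  have hm : x ∈ Icc x₀ x := ⟨hx.1, le_rfl⟩
  refine ⟨⟨hx.1, fun t ht => ⟨(hx.2 t ht).1.trans_le (cA t ht), (hx.2 t ht).2.trans_le (cB t ht)⟩⟩,
    mul_le_mul (cA x hm) (cB x hm) (hx.2 x hm).2.le ((hx.2 x hm).1.le.trans (cA x hm))⟩

variable {k₁ k₂ β₁ γ₁ β₂ γ₂ κ : ℝ} {D₁ D₂ : NullData} {J₁ : Axis k₁ U₀ β₁ γ₁ D₁}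
  {J₂ : Axis k₂ V₀ β₂ γ₂ D₂}

/-- If some point to the future of the vertex is missing from the maximal domain, then `F + G`
vanishes somewhere on the segment from the vertex to this point. -/
theorem futureBoundary_nonempty (hβ₁ : β₁ ≤ 0) (hβ₂ : β₂ ≤ 0) {p : ℝ × ℝ} (h1 : U₀ < p.1)
    (h2 : V₀ < p.2) (hp : p ∉ maximalDomain J₁ J₂) :
    (futureBoundary U₀ V₀ (maximalDomain J₁ J₂)).Nonempty := by
  obtain ⟨F, G, ⟨F', wF, -⟩, ⟨G', wG, -⟩, -, -, hS, -, hB, -⟩ :=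
    maximalDomain_structure (J₁ := J₁) (J₂ := J₂) hβ₁ hβ₂
  have h0 := (isFutureDomain_maximalDomain J₁ J₂).mem
  rw [hS] at hp h0
  have cF : ContinuousOn F (Ici U₀) := fun x hx => (wF x hx).continuousWithinAt
  have cG : ContinuousOn G (Ici V₀) := fun x hx => (wG x hx).continuousWithinAt
  have l1 : ∀ t ∈ Icc (0 : ℝ) 1, U₀ ≤ U₀ + t * (p.1 - U₀) := fun t ht => by
    nlinarith [mul_nonneg ht.1 (sub_pos.2 h1).le]
  have l2 : ∀ t ∈ Icc (0 : ℝ) 1, V₀ ≤ V₀ + t * (p.2 - V₀) := fun t ht => by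
    nlinarith [mul_nonneg ht.1 (sub_pos.2 h2).le]
  have c : ContinuousOn (fun t : ℝ => F (U₀ + t * (p.1 - U₀)) + G (V₀ + t * (p.2 - V₀)))
      (Icc 0 1) := (cF.comp (by fun_prop) l1).add (cG.comp (by fun_prop) l2)
  have e1 : 0 ≤ F p.1 + G p.2 := by
    by_contra hlt
    exact hp ⟨h1.le, h2.le, not_le.1 hlt⟩
  obtain ⟨t, ht, e⟩ := intermediate_value_Icc zero_le_one c (show (0 : ℝ) ∈ Icc _ _ from
    ⟨by simpa using h0.2.2.le, by simpa using e1⟩)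
  simp only at e
  have ht0 : 0 < t := by
    refine lt_of_le_of_ne ht.1 fun h => ?_
    rw [← h] at e
    have h02 := h0.2.2
    simp only [zero_mul, add_zero] at e h02
    linarith
  refine ⟨(U₀ + t * (p.1 - U₀), V₀ + t * (p.2 - V₀)), ?_⟩
  rw [hB]
  exact ⟨by nlinarith [mul_pos ht0 (sub_pos.2 h1)], by nlinarith [mul_pos ht0 (sub_pos.2 h2)], e⟩

namespace InitialData

variable {D : InitialData} {ε : ℝ}

theorem dist_addMatter (hε : 0 < ε) : D.dist (D.addMatter ε) = ENNReal.ofReal (4 * ε) := by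
  have e1 : ‖(D.addMatter ε).ρ₀ - D.ρ₀‖ₑ = ENNReal.ofReal ε := by
    simp only [addMatter, add_sub_cancel_left]
    exact Real.enorm_of_nonneg hε.le
  have e2 : ‖(D.addMatter ε).μ₀ - D.μ₀‖ₑ = ENNReal.ofReal ε := by
    simp only [addMatter, sub_sub_cancel_left, enorm_neg]
    exact Real.enorm_of_nonneg hε.le
  rw [dist, e1, e2]
  simp only [addMatter, sub_self, enorm_zero, add_zero, NullData.dist_addMatter hε.le]
  rw [← ENNReal.ofReal_add hε.le hε.le, ← ENNReal.ofReal_add (by linarith) hε.le,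
    ← ENNReal.ofReal_add (by linarith) hε.le]
  congr 1; ring

/-- Adding matter and convergence does not remove the boundary: by comparison, the maximal domain of
the perturbed data is contained in that of the given data. -/
theorem boundary_addMatter (hκ : 0 < κ) (hD : D.IsWeaklyRegular) (hN : D.NonExpanding)
    (hε : 0 < ε) {S S' : Set (ℝ × ℝ)} {f f' : Fields} (h : IsMaximalDevelopment κ D S f)
    (h' : IsMaximalDevelopment κ (D.addMatter ε) S' f')
    (hne : (futureBoundary D.U₀ D.V₀ S).Nonempty) :
    (futureBoundary (D.addMatter ε).U₀ (D.addMatter ε).V₀ S').Nonempty := by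
  have hD' : (D.addMatter ε).IsWeaklyRegular := ⟨hD.1.addMatter hε.le, hD.2.addMatter hε.le⟩
  obtain ⟨J₁⟩ := exists_axis hD.1 0 (- D.ρ₀) (- D.σ₀)
  obtain ⟨J₂⟩ := exists_axis hD.2 4 D.μ₀ D.lam₀
  obtain ⟨J₁'⟩ := exists_axis hD'.1 0 (- (D.addMatter ε).ρ₀) (- (D.addMatter ε).σ₀)
  obtain ⟨J₂'⟩ := exists_axis hD'.2 4 (D.addMatter ε).μ₀ (D.addMatter ε).lam₀
  have b1 : - D.ρ₀ ≤ 0 := neg_nonpos.2 hN.1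
  have b2 : D.μ₀ ≤ 0 := hN.2
  have c1 : - (D.addMatter ε).ρ₀ ≤ - D.ρ₀ :=
    neg_le_neg (le_add_of_nonneg_right hε.le)
  have c2 : (D.addMatter ε).μ₀ ≤ D.μ₀ := sub_le_self _ hε.le
  rw [h.domain_eq hκ (J₁ := J₁) (J₂ := J₂)] at hne
  rw [h'.domain_eq hκ (J₁ := J₁') (J₂ := J₂')]
  obtain ⟨p, hp⟩ := hne
  obtain ⟨F, G, -, -, -, -, hS, -, hB, -⟩ := maximalDomain_structure (J₁ := J₁) (J₂ := J₂) b1 b2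
  rw [hB] at hp
  obtain ⟨h1, h2, h3⟩ := hp
  -- a boundary point of the given development cannot belong to the perturbed domain
  refine futureBoundary_nonempty (c1.trans b1) (c2.trans b2) (p := p) h1 h2 fun hp' => ?_
  obtain ⟨m1, m2, m3⟩ := maximalDomain_pos _ _ p hp'
  obtain ⟨n1, l1⟩ := J₁.comparison hε.le J₁' c1 m1
  obtain ⟨n2, l2⟩ := J₂.comparison hε.le J₂' c2 m2
  have hpS : p ∈ maximalDomain J₁ J₂ :=
    (mem_maximalDomain b1 b2).2 ⟨n1, n2,
      lt_of_lt_of_le m3 (sub_le_sub_right (add_le_add l1 l2) 1)⟩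
  rw [hS] at hpS
  linarith [hpS.2.2]

end InitialData

end

section

/-! ### Lower bounds for the fluid -/

theorem IsKernel.negPart {Q : ℝ × ℝ → ℝ} (h : IsKernel U₀ V₀ S Q) :
    IsKernel U₀ V₀ S (fun z => max (- Q z) 0) where
  meas := by
    have e : S.indicator (fun z => max (- Q z) 0) = fun z => max (- S.indicator Q z) 0 := by
      ext z
      by_cases hz : z ∈ S
      · simp only [indicator_of_mem hz]
      · simp only [indicator_of_notMem hz, neg_zero, max_self]
    rw [e]
    exact h.meas.neg.max measurable_const
  bound := fun p hp => by
    obtain ⟨m, n, hm, hn, hb⟩ := h.bound p hp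
    refine ⟨m, n, hm, hn, fun z hz => le_trans ?_ (hb z hz)⟩
    rw [abs_of_nonneg (le_max_right _ _)]
    exact max_le (neg_le_abs _) (abs_nonneg _)

theorem ae_past_of_ae_fst {p : ℝ × ℝ} {A : ℝ × ℝ → Prop}
    (h : ∀ᵐ x : ℝ, x ∈ Icc U₀ p.1 → ∀ y ∈ Icc V₀ p.2, A (x, y)) :
    ∀ᵐ z ∂(volume.restrict (past U₀ V₀ p)), A z := by
  rw [ae_restrict_iff' (measurableSet_past p), Measure.volume_eq_prod]
  filter_upwards [Measure.quasiMeasurePreserving_fst.ae h] with z hz hm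
  exact hz hm.1 z.2 hm.2

theorem ae_past_of_ae_snd {p : ℝ × ℝ} {A : ℝ × ℝ → Prop}
    (h : ∀ᵐ y : ℝ, y ∈ Icc V₀ p.2 → ∀ x ∈ Icc U₀ p.1, A (x, y)) :
    ∀ᵐ z ∂(volume.restrict (past U₀ V₀ p)), A z := by
  rw [ae_restrict_iff' (measurableSet_past p), Measure.volume_eq_prod]
  filter_upwards [Measure.quasiMeasurePreserving_snd.ae h] with z hz hm
  exact hz hm.2 z.1 hm.1

/-- A Gronwall inequality for a pair of non-negative functions that are transported along the two
null directions. -/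
theorem IsKernel.nonpos_of_coupled (hS : IsFutureDomain U₀ V₀ S) {A C : ℝ × ℝ → ℝ}
    (hA : IsKernel U₀ V₀ S A) (hC : IsKernel U₀ V₀ S C) (A0 : ∀ z, 0 ≤ A z) {p : ℝ × ℝ}
    (hp : p ∈ S) {M : ℝ} (hM : 0 ≤ M)
    (h1 : ∀ᵐ x : ℝ, x ∈ Icc U₀ p.1 → ∀ y ∈ Icc V₀ p.2, A (x, y) ≤ M * ∫ t in V₀..y, C (x, t))
    (h2 : ∀ᵐ y : ℝ, y ∈ Icc V₀ p.2 → ∀ x ∈ Icc U₀ p.1, C (x, y) ≤ M * ∫ t in U₀..x, A (t, y)) :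
    ∀ᵐ z ∂(volume.restrict (past U₀ V₀ p)), A z ≤ 0 ∧ C z ≤ 0 := by
  have l1 := hS.le_fst hp
  have l2 := hS.le_snd hp
  -- inserting the second inequality into the first gives a double integral of `A`
  have key : ∀ᵐ x : ℝ, x ∈ Icc U₀ p.1 → ∀ y ∈ Icc V₀ p.2,
      A (x, y) ≤ M ^ 2 * ∫ z in past U₀ V₀ (x, y), A z := by
    filter_upwards [h1] with x hx hm y hy
    have hq : (x, y) ∈ S := hS.past_subset hp ⟨hm, hy⟩
    refine (hx hm y hy).trans ?_
    have e : ∫ z in past U₀ V₀ (x, y), A z = ∫ t in V₀..y, ∫ s in U₀..x, A (s, t) := by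
      rw [← setIntegral_past_swap]
      exact setIntegral_past hy.1 hm.1 (IntegrableOn.past_swap (hA.integrableOn hS hq))
    rw [e, sq, mul_assoc]
    refine mul_le_mul_of_nonneg_left ?_ hM
    rw [← intervalIntegral.integral_const_mul]
    have i1 := (hA.swap.integral_slice hS.swap (p := (y, x)) hq).const_mul M
    refine intervalIntegral.integral_mono_ae_restrict hy.1 (hC.slice hS hq) i1 ?_
    rw [EventuallyLE, ae_restrict_iff' measurableSet_Icc]
    filter_upwards [h2] with t ht htm
    exact ht ⟨htm.1, htm.2.trans hy.2⟩ x hm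
  -- Gronwall for the double integral of `A`, which is continuous although `A` need not be
  have zero := eq_zero_of_le_integral l1 l2 (sq_nonneg M)
    (g := fun q => ∫ z in past U₀ V₀ q, A z)
    ((hA.continuousOn_integral hS).mono (hS.past_subset hp))
    (fun q _ => integral_nonneg A0) (fun q hq => by
      have hsub := past_mono (U₀ := U₀) (V₀ := V₀) (mem_past.1 hq).1.2 (mem_past.1 hq).2.2
      have hqS := hS.past_subset hp hq
      rw [← integral_const_mul]
      refine integral_mono_ae (hA.integrableOn hS hqS) ?_ ?_
      · exact ((hS.isKernel_of_continuousOn (hA.continuousOn_integral hS)).integrableOn hS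
          hqS).const_mul _
      · exact ae_restrict_of_ae_restrict_of_subset hsub (ae_past_of_ae_fst key))
  have hA0 : ∀ᵐ x : ℝ, x ∈ Icc U₀ p.1 → ∀ y ∈ Icc V₀ p.2, A (x, y) ≤ 0 := by
    filter_upwards [key] with x hx hm y hy
    have := hx hm y hy
    rwa [zero (x, y) ⟨hm, hy⟩, mul_zero] at this
  refine (ae_past_of_ae_fst hA0).and (ae_past_of_ae_snd ?_)
  filter_upwards [h2] with y hy hm x hx
  refine (hy hm x hx).trans ?_
  have : ∫ t in U₀..x, A (t, y) ≤ 0 := by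
    rw [← intervalIntegral.integral_zero (a := U₀) (b := x) (μ := volume) (E := ℝ)]
    refine intervalIntegral.integral_mono_ae_restrict hx.1
      (hA.swap.slice hS.swap (p := (y, x)) (hS.past_subset hp ⟨hx, hm⟩))
      intervalIntegrable_const ?_
    rw [EventuallyLE, ae_restrict_iff' measurableSet_Icc]
    filter_upwards [hA0] with t ht htm
    exact ht ⟨htm.1, htm.2.trans hx.2⟩ y hm
  exact mul_nonpos_of_nonneg_of_nonpos hM this

/-- If a property holds almost everywhere in the past of each point, it holds almost
everywhere. -/
theorem IsFutureDomain.ae_of_past (hS : IsFutureDomain U₀ V₀ S) {U₁ V₁ : ℝ} {A : ℝ × ℝ → Prop}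
    (h : ∀ p ∈ S, p.1 ≤ U₁ → p.2 ≤ V₁ →
      ∀ᵐ z ∂(volume.restrict (PlaneSymmetric.past U₀ V₀ p)), A z) :
    ∀ᵐ z : ℝ × ℝ, z ∈ S → z.1 < U₁ → z.2 < V₁ → A z := by
  have hq : ∀ᵐ z : ℝ × ℝ, ∀ q : ℚ × ℚ, ((q.1 : ℝ), (q.2 : ℝ)) ∈ S → (q.1 : ℝ) ≤ U₁ →
      (q.2 : ℝ) ≤ V₁ → z ∈ PlaneSymmetric.past U₀ V₀ ((q.1 : ℝ), (q.2 : ℝ)) → A z := by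
    refine ae_all_iff.2 fun q => ?_
    by_cases hq : ((q.1 : ℝ), (q.2 : ℝ)) ∈ S ∧ (q.1 : ℝ) ≤ U₁ ∧ (q.2 : ℝ) ≤ V₁
    · filter_upwards [(ae_restrict_iff' (measurableSet_past _)).1 (h _ hq.1 hq.2.1 hq.2.2)]
        with z hz _ _ _ using hz
    · exact Eventually.of_forall fun z a b c => absurd ⟨a, b, c⟩ hq
  filter_upwards [hq] with z hz hm l1 l2
  obtain ⟨p', hp', g1, g2⟩ := hS.exists_gt hm
  obtain ⟨x, x1, x2⟩ := exists_rat_btwn (lt_min g1 l1)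
  obtain ⟨y, y1, y2⟩ := exists_rat_btwn (lt_min g2 l2)
  have a1 := hS.le_fst hm
  have a2 := hS.le_snd hm
  exact hz (x, y) (hS.past_subset hp' ⟨⟨a1.trans x1.le, x2.le.trans (min_le_left _ _)⟩,
    a2.trans y1.le, y2.le.trans (min_le_left _ _)⟩) (x2.le.trans (min_le_right _ _))
    (y2.le.trans (min_le_right _ _)) ⟨⟨a1, x1.le⟩, a2, y1.le⟩

namespace Solution

variable {κ : ℝ} (X : Solution κ U₀ V₀ S) (δ : ℝ) {p : ℝ × ℝ}

/-- The rescaled derivative `e^b (ψ + δ b)_U`. As `b` satisfies the same wave equation as `ψ`, so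
does `ψ + δ b`. -/
def fluxU (z : ℝ × ℝ) : ℝ := X.r z * (X.ψU z + δ * X.bU z)

/-- The rescaled derivative `e^b (ψ + δ b)_V`. -/
def fluxV (z : ℝ × ℝ) : ℝ := X.r z * (X.ψV z + δ * X.bV z)

theorem fluxU_swap (z : ℝ × ℝ) : X.swap.fluxU δ z = X.fluxV δ z.swap := by
  have h1 : X.swap.r z = X.r z.swap := X.r_swap z
  rw [fluxU, fluxV, h1, X.ψU_swap, X.swap_bU]

theorem fluxV_swap (z : ℝ × ℝ) : X.swap.fluxV δ z = X.fluxU δ z.swap := by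
  have h1 : X.swap.r z = X.r z.swap := X.r_swap z
  rw [fluxU, fluxV, h1, X.ψV_swap, X.swap_bV]

theorem isKernel_fluxU : IsKernel U₀ V₀ S (X.fluxU δ) := by
  have := (X.ψU_dominated.mul_continuousOn X.domain X.continuousOn_r).isKernel.add
    (X.domain.isKernel_of_continuousOn
      (X.continuousOn_r.mul (continuousOn_const.mul X.continuousOn_bU)) (k := fun z =>
        X.r z * (δ * X.bU z)))
  convert this using 1
  ext z; simp only [fluxU]; ring

theorem isKernel_fluxV : IsKernel U₀ V₀ S (X.fluxV δ) := by
  have := (X.swap.isKernel_fluxU δ).swap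
  simp only [fluxU_swap, Prod.swap_swap] at this
  exact this

theorem fluxU_deriv (hp : p ∈ S) : HasACDeriv (fun y => X.fluxU δ (p.1, y))
    (fun y => - X.bU (p.1, y) * X.fluxV δ (p.1, y)) V₀ p.2 := by
  have h5 : HasACDeriv (fun y => X.ψU (p.1, y)) (fun y => - (X.bV (p.1, y) * X.ψU (p.1, y)
      + X.bU (p.1, y) * X.ψV (p.1, y))) V₀ p.2 := X.wave_ψ.slopeU_deriv hp
  exact ((X.r_deriv' hp).mul (h5.add ((X.bU_deriv' hp).const_mul δ))).congr_deriv
    (Eventually.of_forall fun t _ => by simp only [fluxV]; ring)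

/-- As `b_U ≤ 0`, the negative part of one rescaled derivative of `ψ + δ b` is bounded by an
integral of the negative part of the other. -/
theorem fluxU_bound (hp : p ∈ S) {M : ℝ} (hM : ∀ z ∈ past U₀ V₀ p, |X.bU z| ≤ M)
    (hb : ∀ z ∈ past U₀ V₀ p, X.bU z ≤ 0)
    (h : ∀ᵐ x : ℝ, x ∈ Icc U₀ p.1 → 0 ≤ X.fluxU δ (x, V₀)) :
    ∀ᵐ x : ℝ, x ∈ Icc U₀ p.1 → ∀ y ∈ Icc V₀ p.2,
      max (- X.fluxU δ (x, y)) 0 ≤ M * ∫ t in V₀..y, max (- X.fluxV δ (x, t)) 0 := by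
  filter_upwards [h] with x hx hm y hy
  have hq : (x, y) ∈ S := X.domain.past_subset hp ⟨hm, hy⟩
  have M0 : 0 ≤ M := (abs_nonneg _).trans (hM _ (X.domain.self_mem_past hp))
  have d := X.fluxU_deriv δ hq
  refine max_le ?_ (mul_nonneg M0 (intervalIntegral.integral_nonneg hy.1 fun t _ =>
    le_max_right _ _))
  have e := d.integral_eq
  have i : ∫ t in V₀..y, -(- X.bU (x, t) * X.fluxV δ (x, t))
      ≤ ∫ t in V₀..y, M * max (- X.fluxV δ (x, t)) 0 := by
    refine intervalIntegral.integral_mono_on hy.1 d.intervalIntegrable.neg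
      (((X.isKernel_fluxV δ).negPart.slice X.domain hq).const_mul M) fun t ht => ?_
    have hz : (x, t) ∈ past U₀ V₀ p := ⟨hm, ht.1, ht.2.trans hy.2⟩
    have b1 := hb _ hz
    have b2 := hM _ hz
    rw [abs_of_nonpos b1] at b2
    calc -(- X.bU (x, t) * X.fluxV δ (x, t)) = - X.bU (x, t) * (- X.fluxV δ (x, t)) := by ring
      _ ≤ - X.bU (x, t) * max (- X.fluxV δ (x, t)) 0 :=
        mul_le_mul_of_nonneg_left (le_max_left _ _) (by linarith)
      _ ≤ _ := mul_le_mul_of_nonneg_right b2 (le_max_right _ _)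
  rw [intervalIntegral.integral_neg, e, intervalIntegral.integral_const_mul] at i
  linarith [hx hm]

/-- If both derivatives of `ψ` dominate those of `- δ b` on the initial hypersurfaces of a
contracting spacetime, they do so in the future. -/
theorem le_ψ_of_axis (hp : p ∈ S) (hU : ∀ z ∈ past U₀ V₀ p, X.bU z ≤ 0)
    (hV : ∀ z ∈ past U₀ V₀ p, X.bV z ≤ 0)
    (h₁ : ∀ᵐ x : ℝ, x ∈ Icc U₀ p.1 → - δ * X.bU (x, V₀) ≤ X.ψU (x, V₀))
    (h₂ : ∀ᵐ y : ℝ, y ∈ Icc V₀ p.2 → - δ * X.bV (U₀, y) ≤ X.ψV (U₀, y)) :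
    ∀ᵐ z ∂(volume.restrict (past U₀ V₀ p)), - δ * X.bU z ≤ X.ψU z ∧ - δ * X.bV z ≤ X.ψV z := by
  obtain ⟨M₁, p1, b1⟩ := X.domain.exists_bound X.continuousOn_bU hp
  obtain ⟨M₂, p2, b2⟩ := X.domain.exists_bound X.continuousOn_bV hp
  have l1 := X.domain.le_fst hp
  have l2 := X.domain.le_snd hp
  have k1 := X.fluxU_bound δ hp (M := M₁ + M₂) (fun z hz => (b1 z hz).trans (by linarith)) hU (by
    filter_upwards [h₁] with x hx hm
    have hx' : (x, V₀) ∈ S := X.domain.past_subset hp ⟨hm, le_rfl, l2⟩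
    have hr := (X.r_pos hx').le
    exact mul_nonneg hr (by linarith [hx hm]))
  have k2 := X.swap.fluxU_bound δ (p := p.swap) (M := M₁ + M₂) hp (fun z hz => by
    rw [X.swap_bU]
    exact (b2 z.swap ⟨hz.2, hz.1⟩).trans (by linarith)) (fun z hz => by
      rw [X.swap_bU]; exact hV z.swap ⟨hz.2, hz.1⟩) (by
    filter_upwards [h₂] with y hy hm
    have hy' : (U₀, y) ∈ S := X.domain.past_subset hp ⟨⟨le_rfl, l1⟩, hm⟩
    have hr := (X.r_pos hy').le
    rw [fluxU_swap]
    exact mul_nonneg hr (by simp only [Prod.swap_prod_mk]; linarith [hy hm]))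
  simp only [fluxU_swap, fluxV_swap, Prod.swap_prod_mk, Prod.fst_swap, Prod.snd_swap] at k2
  have key := IsKernel.nonpos_of_coupled X.domain (X.isKernel_fluxU δ).negPart
    (X.isKernel_fluxV δ).negPart (fun z => le_max_right _ _) hp (by linarith : 0 ≤ M₁ + M₂) k1 k2
  filter_upwards [key, ae_restrict_mem (measurableSet_past p)] with z hz hm
  have hr := X.r_pos (X.domain.past_subset hp hm)
  have e1 : 0 ≤ X.fluxU δ z := by linarith [(le_max_left _ _).trans hz.1]
  have e2 : 0 ≤ X.fluxV δ z := by linarith [(le_max_left _ _).trans hz.2]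
  constructor
  · linarith [nonneg_of_mul_nonneg_right e1 hr]
  · linarith [nonneg_of_mul_nonneg_right e2 hr]

end Solution

end

section

/-! ### Lower bounds for the curvature -/

/-- For strictly contracting data, the slope of the area function is bounded away from zero on
compact parts of the domain, and so are its difference quotients. -/
theorem Axis.exists_slope_bounds {k x₀ β γ x : ℝ} {D : NullData} (J : Axis k x₀ β γ D)
    (hβ : β < 0) (hx : x ∈ J.domain) : ∃ m M, 0 < m ∧ 0 < M ∧
      (∀ t ∈ Icc x₀ x, m ≤ - J.f₁ t ∧ - J.f₁ t ≤ M) ∧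
      ∀ s t, x₀ ≤ s → s ≤ t → t ≤ x → m * (t - s) ≤ J.f s - J.f t ∧
        J.f s - J.f t ≤ M * (t - s) := by
  have c := (J.f₁_deriv hx.1).continuousOn
  rw [uIcc_of_le hx.1] at c
  obtain ⟨y, hy, my⟩ := isCompact_Icc.exists_isMaxOn (nonempty_Icc.2 hx.1) c
  obtain ⟨w, hw, mw⟩ := isCompact_Icc.exists_isMinOn (nonempty_Icc.2 hx.1) c
  have neg : ∀ t ∈ Icc x₀ x, J.f₁ t < 0 := fun t ht =>
    J.f₁_neg_of_le le_rfl ht.1 (J.mem_domain_of_le hx ht.1 ht.2) (by rw [J.f₁_zero]; linarith)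
  have b1 : ∀ t ∈ Icc x₀ x, - J.f₁ y ≤ - J.f₁ t := fun t ht => neg_le_neg (isMaxOn_iff.1 my t ht)
  have b2 : ∀ t ∈ Icc x₀ x, - J.f₁ t ≤ - J.f₁ w := fun t ht => neg_le_neg (isMinOn_iff.1 mw t ht)
  refine ⟨- J.f₁ y, - J.f₁ w, neg_pos.2 (neg y hy), neg_pos.2 (neg w hw),
    fun t ht => ⟨b1 t ht, b2 t ht⟩, fun s t hs hst ht => ?_⟩
  have d := (J.f_deriv hx.1).sub_of_le hs hst ht
  have dl : ∀ r : ℝ, HasACDeriv (fun q : ℝ => r * q) (fun _ => r) s t := fun r =>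
    HasACDeriv.of_hasDerivAt (fun q _ => by simpa using (hasDerivAt_id q).const_mul r)
      continuousOn_const
  have e1 := (d.add (dl (- J.f₁ y))).antitone_of_nonpos hst (Eventually.of_forall fun q hq => by
    linarith [b1 q ⟨hs.trans hq.1, hq.2.trans ht⟩])
  have e2 := ((dl (J.f₁ w)).sub d).antitone_of_nonpos hst (Eventually.of_forall fun q hq => by
    linarith [b2 q ⟨hs.trans hq.1, hq.2.trans ht⟩])
  constructor <;> linarith

variable {k₁ k₂ β₁ γ₁ β₂ γ₂ κ : ℝ} {D₁ D₂ : NullData} {J₁ : Axis k₁ U₀ β₁ γ₁ D₁}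
  {J₂ : Axis k₂ V₀ β₂ γ₂ D₂}

theorem Axis.f_lt_one {k x₀ β γ x : ℝ} {D : NullData} (J : Axis k x₀ β γ D)
    (hβ : β < 0) (hx : x ∈ J.domain) (h : x₀ < x) : J.f x < 1 := by
  obtain ⟨m, M, hm, -, -, hb⟩ := J.exists_slope_bounds hβ hx
  have := (hb x₀ x le_rfl hx.1 le_rfl).1
  rw [J.f_zero] at this
  nlinarith [mul_pos hm (sub_pos.2 h)]

/-- For strictly contracting data, the boundary lies over the interior of the domains of the initial
data: `F` and `G` exceed `-1` away from the initial plane, so neither can be `≥ 1` where they add up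
to zero. -/
theorem mem_futureBoundary (hβ₁ : β₁ < 0) (hβ₂ : β₂ < 0) {p : ℝ × ℝ}
    (hp : p ∈ futureBoundary U₀ V₀ (maximalDomain J₁ J₂)) : U₀ < p.1 ∧ V₀ < p.2 ∧
      p.1 ∈ J₁.domain ∧ p.2 ∈ J₂.domain ∧ J₁.f p.1 + J₂.f p.2 - 1 = 0 := by
  obtain ⟨F, G, -, -, -, -, -, -, hB, ⟨eF, oF⟩, eG, oG⟩ :=
    maximalDomain_structure (J₁ := J₁) (J₂ := J₂) hβ₁.le hβ₂.le
  rw [hB] at hp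
  obtain ⟨h1, h2, h3⟩ := hp
  have gF : -1 < F p.1 := by
    by_cases h : p.1 ∈ J₁.domain
    · rw [eF _ h]; linarith [J₁.f_lt_one hβ₁ h h1]
    · linarith [oF _ h1.le h]
  have gG : -1 < G p.2 := by
    by_cases h : p.2 ∈ J₂.domain
    · rw [eG _ h]; linarith [J₂.f_lt_one hβ₂ h h2]
    · linarith [oG _ h2.le h]
  have m1 : p.1 ∈ J₁.domain := by
    by_contra h; linarith [oF _ h1.le h]
  have m2 : p.2 ∈ J₂.domain := by
    by_contra h; linarith [oG _ h2.le h]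
  rw [eF _ m1, eG _ m2] at h3
  exact ⟨h1, h2, m1, m2, by linarith⟩

/-- The data contain matter everywhere: the Ricci scalar is bounded below on bounded intervals. -/
def Axis.HasMatter {k x₀ β γ : ℝ} {D : NullData} (_ : Axis k x₀ β γ D) : Prop :=
  ∀ x, x₀ ≤ x → ∃ m, 0 < m ∧ ∀ᵐ t : ℝ, t ∈ Icc x₀ x → m ≤ D.ricciCoeff k t

namespace IsCanonical

variable {X : Solution κ U₀ V₀ S} {x : ℝ}

theorem bU_eq (h : IsCanonical J₁ J₂ X) (p : ℝ × ℝ) : X.bU p = J₁.f₁ p.1 / (2 * X.s p) := by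
  rw [Background.bU, h.f₁_eq]

theorem bV_eq (h : IsCanonical J₁ J₂ X) (p : ℝ × ℝ) : X.bV p = J₂.f₁ p.2 / (2 * X.s p) := by
  rw [Background.bV, h.g₁_eq]

theorem bU_neg (h : IsCanonical J₁ J₂ X) (hβ : β₁ < 0) {p : ℝ × ℝ} (hp : p ∈ S) :
    X.bU p < 0 := by
  rw [h.bU_eq]
  have hm := (h.mem p hp).1
  exact div_neg_of_neg_of_pos (J₁.f₁_neg_of_le le_rfl hm.1 hm (by rw [J₁.f₁_zero]; linarith))
    (mul_pos two_pos (X.s_pos hp))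

theorem bV_neg (h : IsCanonical J₁ J₂ X) (hβ : β₂ < 0) {p : ℝ × ℝ} (hp : p ∈ S) :
    X.bV p < 0 := by
  have := h.swap.bU_neg hβ (p := p.swap) hp
  rwa [X.swap_bU] at this

/-- On the initial hypersurface the fluid dominates the contraction, because its potential has
derivative `√(Φ / κ)`, which is bounded below. -/
theorem exists_le_ψ_axis (h : IsCanonical J₁ J₂ X) (hκ : 0 < κ) (hβ : β₁ < 0) (hm : J₁.HasMatter)
    (hx : x ∈ J₁.domain) : ∃ δ, 0 < δ ∧ ∀ δ', 0 ≤ δ' → δ' ≤ δ → ∀ᵐ t : ℝ, t ∈ Icc U₀ x →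
      (t, V₀) ∈ S → - δ' * X.bU (t, V₀) ≤ X.ψU (t, V₀) := by
  obtain ⟨m, hm0, hm⟩ := hm x hx.1
  obtain ⟨m', M, -, hM0, hb, -⟩ := J₁.exists_slope_bounds hβ hx
  have hf := J₁.f_pos hx
  have hpos : 0 < √(m / κ) := Real.sqrt_pos.2 (div_pos hm0 hκ)
  refine ⟨√(m / κ) * (2 * J₁.f x) / M, by positivity, fun δ' h0 hδ => ?_⟩
  filter_upwards [hm, h.ψU_axis hκ] with t h1 h2 ht hS
  rw [(h2 hS).2, h.bU_eq, X.s_axis, h.f_eq]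
  change - δ' * (J₁.f₁ t / (2 * J₁.f t)) ≤ _
  have b1 := (hb t ht).2
  have b2 : J₁.f x ≤ J₁.f t :=
    J₁.antitoneOn_f hβ.le (J₁.mem_domain_of_le hx ht.1 ht.2) hx ht.2
  have b3 : √(m / κ) ≤ √(D₁.ricciCoeff k₁ t / κ) :=
    Real.sqrt_le_sqrt (div_le_div_of_nonneg_right (h1 ht) hκ.le)
  refine le_trans ?_ b3
  calc - δ' * (J₁.f₁ t / (2 * J₁.f t)) = δ' * (- J₁.f₁ t / (2 * J₁.f t)) := by ring
    _ ≤ √(m / κ) * (2 * J₁.f x) / M * (M / (2 * J₁.f x)) := by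
        refine mul_le_mul hδ ?_ ?_ (by positivity)
        · exact div_le_div₀ hM0.le b1 (by linarith) (by linarith)
        · refine div_nonneg ?_ (by linarith)
          exact neg_nonneg.2 (J₁.f₁_nonpos hβ.le (J₁.mem_domain_of_le hx ht.1 ht.2))
    _ = √(m / κ) := by field_simp

theorem s_le_one (h : IsCanonical J₁ J₂ X) (hβ₁ : β₁ < 0) (hβ₂ : β₂ < 0) {p : ℝ × ℝ}
    (hp : p ∈ S) : X.s p ≤ 1 := by
  rw [h.s_eq]
  linarith [J₁.f_le_one hβ₁.le (h.mem p hp).1, J₂.f_le_one hβ₂.le (h.mem p hp).2]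

/-- The constraint bounds the conformal coefficient by `- b_U`, because `2 a - b - log (- b_U)` is
non-increasing along the lines `V = const`. -/
theorem exists_exp_le (h : IsCanonical J₁ J₂ X) (hκ : 0 < κ) (hβ₁ : β₁ < 0) (hβ₂ : β₂ < 0)
    {y : ℝ} (hy : (U₀, y) ∈ S) : ∃ C, 0 < C ∧ ∀ p ∈ S, p.2 ≤ y →
      Real.exp (2 * X.a p) ≤ C * (- X.bU p) := by
  have neg : ∀ z ∈ S, 0 < - X.bU z := fun z hz => neg_pos.2 (h.bU_neg hβ₁ hz)
  have cont : ContinuousOn (fun z => 2 * X.a z - X.b z - Real.log (- X.bU z)) S :=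
    ((continuousOn_const.mul X.continuousOn_a).sub X.continuousOn_b).sub
      (X.continuousOn_bU.neg.log fun z hz => (neg z hz).ne')
  obtain ⟨M, -, hM⟩ := X.domain.exists_bound cont hy
  refine ⟨Real.exp M, Real.exp_pos _, fun p hp hpy => ?_⟩
  have hl : ∀ t ∈ uIcc U₀ p.1, (t, p.2) ∈ S := fun t ht => X.domain.mem_line hp ht
  have dU := X.constraint_U_of_axis (h.constraint_zero hκ) hp
  have d := (((X.a_deriv hp).const_mul 2).sub (X.b_deriv hp)).sub
    (dU.neg.log fun t ht => neg _ (hl t ht))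
  have l1 := X.domain.le_fst hp
  have l2 := X.domain.le_snd hp
  have e := d.antitone_of_nonpos l1 (Eventually.of_forall fun t ht => by
    have h1 := h.bU_neg hβ₁ (hl t (by rwa [uIcc_of_le l1]))
    have h2 : 2 * X.aU (t, p.2) - X.bU (t, p.2) - (- X.bU (t, p.2))⁻¹ * -(2 * X.aU (t, p.2)
        * X.bU (t, p.2) - X.bU (t, p.2) ^ 2 - X.cU (t, p.2) ^ 2 - κ * X.ψU (t, p.2) ^ 2)
        = (X.cU (t, p.2) ^ 2 + κ * X.ψU (t, p.2) ^ 2) / X.bU (t, p.2) := by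
      have h1' := h1.ne
      field_simp
      ring
    rw [h2]
    exact div_nonpos_of_nonneg_of_nonpos (by positivity) h1.le)
  have e2 := (le_abs_self _).trans (hM (U₀, p.2) ⟨⟨le_rfl, le_rfl⟩, l2, hpy⟩)
  have e3 : X.b p ≤ 0 := by
    have := Real.log_nonpos (X.s_pos hp).le (h.s_le_one hβ₁ hβ₂ hp)
    simp only [Background.b]; linarith
  calc Real.exp (2 * X.a p) ≤ Real.exp (M + Real.log (- X.bU p)) :=
        Real.exp_le_exp.2 (by linarith)
    _ = _ := by rw [Real.exp_add, Real.exp_log (neg p hp)]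

/-- The fluid concentrates where the area tends to zero. -/
theorem exists_curvature_bound (h : IsCanonical J₁ J₂ X) (hκ : 0 < κ) (hβ₁ : β₁ < 0)
    (hβ₂ : β₂ < 0) (m₁ : J₁.HasMatter) (m₂ : J₂.HasMatter) {U₁ V₁ : ℝ} (hU : U₁ ∈ J₁.domain)
    (hV : V₁ ∈ J₂.domain) (hy : (U₀, V₁) ∈ S) : ∃ c, 0 < c ∧ ∀ᵐ z : ℝ × ℝ, z ∈ S → z.1 < U₁ →
      z.2 < V₁ → c / X.s z ≤ κ / 6 * Real.exp (- 2 * X.a z) * (X.ψU z * X.ψV z) ∧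
        c / X.s z ≤ κ / 6 * X.s z * (X.ψU z * X.ψV z) := by
  obtain ⟨δ₁, d1, ax1⟩ := h.exists_le_ψ_axis hκ hβ₁ m₁ hU
  obtain ⟨δ₂, d2, ax2⟩ := h.swap.exists_le_ψ_axis hκ hβ₂ m₂ hV
  obtain ⟨C, hC, hexp⟩ := h.exists_exp_le hκ hβ₁ hβ₂ hy
  obtain ⟨n₁, N₁, n1, -, s1, -⟩ := J₁.exists_slope_bounds hβ₁ hU
  obtain ⟨n₂, N₂, n2, -, s2, -⟩ := J₂.exists_slope_bounds hβ₂ hV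
  set δ := min δ₁ δ₂ with hδ
  have d0 : 0 < δ := lt_min d1 d2
  have low := X.domain.ae_of_past (U₁ := U₁) (V₁ := V₁) (A := fun z =>
    - δ * X.bU z ≤ X.ψU z ∧ - δ * X.bV z ≤ X.ψV z) fun p hp h1 h2 => by
    have l1 := X.domain.le_fst hp
    have l2 := X.domain.le_snd hp
    refine X.le_ψ_of_axis δ hp (fun z hz => (h.bU_neg hβ₁ (X.domain.past_subset hp hz)).le)
      (fun z hz => (h.bV_neg hβ₂ (X.domain.past_subset hp hz)).le) ?_ ?_
    · filter_upwards [ax1 δ d0.le (min_le_left _ _)] with t ht hm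
      exact ht ⟨hm.1, hm.2.trans h1⟩ (X.domain.past_subset hp ⟨hm, le_rfl, l2⟩)
    · filter_upwards [ax2 δ d0.le (min_le_right _ _)] with t ht hm
      have hS : (U₀, t) ∈ S := X.domain.past_subset hp ⟨⟨le_rfl, l1⟩, hm⟩
      have := ht ⟨hm.1, hm.2.trans h2⟩ hS
      rwa [X.swap_bU, X.ψU_swap] at this
  -- the first constant comes from `e^{2a} ≤ C (- b_U)` and `- b_V ≥ n₂ / (2 s)`, the second from
  -- `b_U b_V ≥ n₁ n₂ / (4 s ^ 2)`
  refine ⟨min (κ * δ ^ 2 * n₂ / (12 * C)) (κ * δ ^ 2 * n₁ * n₂ / 24), by positivity, ?_⟩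
  filter_upwards [low] with z hz hm h1 h2
  obtain ⟨g1, g2⟩ := hz hm h1 h2
  have hs := X.s_pos hm
  have u1 : n₁ / (2 * X.s z) ≤ - X.bU z := by
    rw [h.bU_eq, ← neg_div]
    exact div_le_div_of_nonneg_right (s1 z.1 ⟨X.domain.le_fst hm, h1.le⟩).1 (by linarith)
  have u2 : n₂ / (2 * X.s z) ≤ - X.bV z := by
    rw [h.bV_eq, ← neg_div]
    exact div_le_div_of_nonneg_right (s2 z.2 ⟨X.domain.le_snd hm, h2.le⟩).1 (by linarith)
  have bu := neg_pos.2 (h.bU_neg hβ₁ hm)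
  have bv := neg_pos.2 (h.bV_neg hβ₂ hm)
  have prod : δ ^ 2 * ((- X.bU z) * (- X.bV z)) ≤ X.ψU z * X.ψV z := by
    calc δ ^ 2 * ((- X.bU z) * (- X.bV z)) = (- δ * X.bU z) * (- δ * X.bV z) := by ring
      _ ≤ _ := mul_le_mul g1 g2 (by nlinarith) ((by nlinarith : 0 ≤ - δ * X.bU z).trans g1)
  constructor
  · have he : Real.exp (- 2 * X.a z) * Real.exp (2 * X.a z) = 1 := by
      rw [← Real.exp_add]; simp
    have e1 : 1 / C ≤ Real.exp (- 2 * X.a z) * (- X.bU z) := by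
      rw [div_le_iff₀ hC]
      have := mul_le_mul_of_nonneg_left (hexp z hm h2.le) (Real.exp_pos (- 2 * X.a z)).le
      linarith
    calc _ ≤ κ * δ ^ 2 * n₂ / (12 * C) / X.s z :=
          div_le_div_of_nonneg_right (min_le_left _ _) hs.le
      _ = κ / 6 * δ ^ 2 * (1 / C * (n₂ / (2 * X.s z))) := by field_simp; ring
      _ ≤ κ / 6 * δ ^ 2 * ((Real.exp (- 2 * X.a z) * (- X.bU z)) * (- X.bV z)) := by
          refine mul_le_mul_of_nonneg_left ?_ (by positivity)
          exact mul_le_mul e1 u2 (by positivity) (by positivity)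
      _ = κ / 6 * Real.exp (- 2 * X.a z) * (δ ^ 2 * ((- X.bU z) * (- X.bV z))) := by ring
      _ ≤ _ := mul_le_mul_of_nonneg_left prod (by positivity)
  · calc _ ≤ κ * δ ^ 2 * n₁ * n₂ / 24 / X.s z :=
          div_le_div_of_nonneg_right (min_le_right _ _) hs.le
      _ = κ / 6 * X.s z * (δ ^ 2 * (n₁ / (2 * X.s z) * (n₂ / (2 * X.s z)))) := by
          field_simp; ring
      _ ≤ κ / 6 * X.s z * (δ ^ 2 * ((- X.bU z) * (- X.bV z))) := by
          refine mul_le_mul_of_nonneg_left (mul_le_mul_of_nonneg_left ?_ (by positivity))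
            (by positivity)
          exact mul_le_mul u1 u2 (by positivity) (by positivity)
      _ ≤ _ := mul_le_mul_of_nonneg_left prod (by positivity)

end IsCanonical

end

section

/-! ### Singularity of the future boundary -/

/-- In a solution the field equations reduce `Λ` to a multiple of `ψ_U ψ_V`. -/
theorem Solution.areCurvatureScalars {κ : ℝ} (X : Solution κ U₀ V₀ S) :
    ∃ P, AreCurvatureScalars S X.fields
      (fun z => - (κ / 6 * Real.exp (- 2 * X.a z) * (X.ψU z * X.ψV z))) P := by
  have cb : ContinuousOn (fun z => - (2 * X.bU z * X.bV z)) S :=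
    ((continuousOn_const.mul X.continuousOn_bU).mul X.continuousOn_bV).neg
  have la := X.isKernel_aUV.locallyIntegrableOn X.domain
  have lb := X.domain.locallyIntegrableOn_of_continuousOn cb
  have wa : IsWeakDV S X.aU X.aUV :=
    X.domain.isWeakDV (X.aU_dominated.isKernel.locallyIntegrableOn X.domain) la
      fun _ hp => X.aU_deriv hp
  refine ⟨_, X.derivs, X.aUV, fun z => - (2 * X.bU z * X.bV z), X.isRegular,
    la.mono_set interior_subset, lb.mono_set interior_subset,
    isWeakDV_of_swap (wa.swap.congr_left fun z hz => indicator_of_mem (mem_preimage.1 hz) _),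
    X.domain.isWeakDV (X.domain.locallyIntegrableOn_of_continuousOn X.continuousOn_bU) lb
      fun _ hp => X.bU_deriv' hp, fun z hz => ?_, fun _ _ => rfl⟩
  simp only [derivs, fields, indicator_of_mem hz, aUV, Background.q]
  ring

variable {k₁ k₂ β₁ γ₁ β₂ γ₂ κ : ℝ} {D₁ D₂ : NullData} {J₁ : Axis k₁ U₀ β₁ γ₁ D₁}
  {J₂ : Axis k₂ V₀ β₂ γ₂ D₂}

theorem Axis.continuousAt_f {k x₀ β γ x : ℝ} {D : NullData} (J : Axis k x₀ β γ D) (h : x₀ < x) :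
    ContinuousAt J.f x :=
  J.continuousOn_f.continuousAt (Ici_mem_nhds h)

/-- The inverse of the area function is not integrable near the boundary, because the area function
is Lipschitz along null lines. -/
theorem not_integrableOn_inv_area (hβ₁ : β₁ < 0) (hβ₂ : β₂ < 0) {p : ℝ × ℝ}
    (hp : p ∈ futureBoundary U₀ V₀ (maximalDomain J₁ J₂)) {N : Set (ℝ × ℝ)} (hN : N ∈ 𝓝 p) :
    ∃ T : Set (ℝ × ℝ), MeasurableSet T ∧ T ⊆ N ∩ maximalDomain J₁ J₂ ∧
      (∀ z ∈ T, 0 < J₁.f z.1 + J₂.f z.2 - 1) ∧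
      ContinuousOn (fun z : ℝ × ℝ => (J₁.f z.1 + J₂.f z.2 - 1)⁻¹) T ∧
      ¬ IntegrableOn (fun z : ℝ × ℝ => (J₁.f z.1 + J₂.f z.2 - 1)⁻¹) T := by
  obtain ⟨h1, h2, m1, m2, h0⟩ := mem_futureBoundary hβ₁ hβ₂ hp
  obtain ⟨V₁, hV₁, l2⟩ := J₂.exists_gt_mem_domain m2
  obtain ⟨n₁, M₁, n10, -, -, s1⟩ := J₁.exists_slope_bounds hβ₁ m1
  obtain ⟨n₂, M₂, n20, hM₂, -, s2⟩ := J₂.exists_slope_bounds hβ₂ hV₁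
  obtain ⟨r, hr, hball⟩ := Metric.mem_nhds_iff.1 hN
  obtain ⟨y, hy⟩ : ∃ y, y = min V₁ (p.2 + r) := ⟨_, rfl⟩
  have y1 : p.2 < y := hy ▸ lt_min l2 (by linarith)
  have y2 : y ≤ V₁ := hy ▸ min_le_left _ _
  have y3 : y ≤ p.2 + r := hy ▸ min_le_right _ _
  -- the point `(p.1, y)` lies beyond the boundary, and so do the points `(x, y)` with `x` near
  -- `p.1`
  have gy : J₁.f p.1 + J₂.f y - 1 < 0 := by
    have := (s2 p.2 y h2.le y1.le y2).1
    nlinarith [mul_pos n20 (sub_pos.2 y1)]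
  have ev : ∀ᶠ x in 𝓝[<] p.1, J₁.f x + J₂.f y - 1 < 0 ∧ U₀ < x ∧ p.1 - r < x := by
    refine Filter.Eventually.filter_mono nhdsWithin_le_nhds ?_
    have c : ContinuousAt (fun x => J₁.f x + J₂.f y - 1) p.1 :=
      ((J₁.continuousAt_f h1).add continuousAt_const).sub continuousAt_const
    exact (c.eventually (gt_mem_nhds gy)).and
      ((eventually_gt_nhds h1).and (eventually_gt_nhds (sub_lt_self _ hr)))
  obtain ⟨l, hl, hsub⟩ := mem_nhdsLT_iff_exists_Ioo_subset.1 ev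
  have hS := isFutureDomain_maximalDomain J₁ J₂
  have hpos : ∀ z ∈ maximalDomain J₁ J₂, 0 < J₁.f z.1 + J₂.f z.2 - 1 := fun z hz =>
    (maximalDomain_pos J₁ J₂ z hz).2.2
  have mT : MeasurableSet (maximalDomain J₁ J₂ ∩ (Ioo l p.1 ×ˢ Ioo p.2 y)) :=
    hS.measurableSet.inter (measurableSet_Ioo.prod measurableSet_Ioo)
  refine ⟨maximalDomain J₁ J₂ ∩ (Ioo l p.1 ×ˢ Ioo p.2 y), mT, ?_, fun z hz => hpos z hz.1, ?_,
    fun hI => ?_⟩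
  · rintro z ⟨hz, z1, z2⟩
    refine ⟨hball ?_, hz⟩
    have := (hsub z1).2.2
    have e1 := z1.2
    have e2 := z2.1
    have e3 := z2.2
    rw [Metric.mem_ball, Prod.dist_eq, max_lt_iff, Real.dist_eq, Real.dist_eq, abs_lt, abs_lt]
    exact ⟨⟨by linarith, by linarith⟩, by linarith, by linarith⟩
  · refine ContinuousOn.inv₀ ?_ fun z hz => (hpos z hz.1).ne'
    refine ContinuousOn.sub (ContinuousOn.add ?_ ?_) continuousOn_const
    · exact J₁.continuousOn_f.comp continuous_fst.continuousOn fun z hz => hz.1.1.1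
    · exact J₂.continuousOn_f.comp continuous_snd.continuousOn fun z hz => hz.1.2.1.1
  · -- on almost every null line the inverse is integrable up to the boundary point `V'`
    rw [← integrable_indicator_iff mT, Measure.volume_eq_prod] at hI
    have hne : volume (Ioo l p.1) ≠ 0 := by
      rw [Real.volume_Ioo]; simpa using hl
    obtain ⟨x, hx, hxi⟩ := Measure.exists_mem_of_measure_ne_zero_of_ae hne
      (ae_restrict_of_ae hI.prod_right_ae)
    obtain ⟨x1, x2, x3⟩ := hsub hx
    have fx : 0 < J₁.f x + J₂.f p.2 - 1 := by
      have := (s1 x p.1 x2.le hx.2.le le_rfl).1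
      nlinarith [mul_pos n10 (sub_pos.2 hx.2)]
    have cg : ContinuousOn (fun t => J₁.f x + J₂.f t - 1) (Icc p.2 y) :=
      (continuousOn_const.add (J₂.continuousOn_f.mono fun t ht => h2.le.trans ht.1)).sub
        continuousOn_const
    -- the boundary point on the null line through `x`; near it the inverse is at least a multiple
    -- of `1 / (V' - t)`
    obtain ⟨V', hV', e'⟩ := intermediate_value_Ioo' y1.le cg ⟨x1, fx⟩
    simp only at e'
    have hi : IntegrableOn (fun t => (J₁.f x + J₂.f t - 1)⁻¹) (Ioo p.2 V') := by
      refine (hxi.integrableOn (s := Ioo p.2 V')).congr_fun (fun t ht => ?_) measurableSet_Ioo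
      refine indicator_of_mem (s := maximalDomain J₁ J₂ ∩ (Ioo l p.1 ×ˢ Ioo p.2 y)) ?_ _
      have ty : t < y := ht.2.trans hV'.2
      refine ⟨(mem_maximalDomain hβ₁.le hβ₂.le).2 ⟨J₁.mem_domain_of_le m1 x2.le hx.2.le,
        J₂.mem_domain_of_le hV₁ (h2.le.trans ht.1.le) (ty.le.trans y2), ?_⟩, hx, ht.1, ty⟩
      have := (s2 t V' (h2.le.trans ht.1.le) ht.2.le (hV'.2.le.trans y2)).1
      simp only
      nlinarith [mul_pos n20 (sub_pos.2 ht.2)]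
    have hj : IntegrableOn (fun t => (t - V')⁻¹) (Ioo p.2 V') := by
      refine (hi.const_mul M₂).mono' (by fun_prop) ?_
      filter_upwards [ae_restrict_mem measurableSet_Ioo] with t ht
      have a1 := (s2 t V' (h2.le.trans ht.1.le) ht.2.le (hV'.2.le.trans y2)).1
      have a2 := (s2 t V' (h2.le.trans ht.1.le) ht.2.le (hV'.2.le.trans y2)).2
      have a3 : 0 < V' - t := sub_pos.2 ht.2
      have a4 : 0 < J₁.f x + J₂.f t - 1 := by nlinarith [mul_pos n20 a3]
      rw [Real.norm_eq_abs, abs_inv, abs_sub_comm, abs_of_pos a3, ← div_eq_mul_inv,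
        le_div_iff₀ a4, inv_mul_le_iff₀ a3]
      linarith
    have hk : IntervalIntegrable (fun t => (t - V')⁻¹) volume p.2 V' := by
      rw [intervalIntegrable_iff_integrableOn_Ioo_of_le hV'.1.le]; exact hj
    rcases intervalIntegrable_sub_inv_iff.1 hk with h | h
    · exact hV'.1.ne h
    · exact h right_mem_uIcc

namespace IsCanonical

variable {X : Solution κ U₀ V₀ (maximalDomain J₁ J₂)}

/-- Already `|Λ|` tends to infinity and fails to be integrable at every point of the boundary. -/
theorem curvatureBlowsUpOn (h : IsCanonical J₁ J₂ X) (hκ : 0 < κ) (hβ₁ : β₁ < 0) (hβ₂ : β₂ < 0)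
    (m₁ : J₁.HasMatter) (m₂ : J₂.HasMatter) :
    CurvatureBlowsUpOn (maximalDomain J₁ J₂) X.fields
      (futureBoundary U₀ V₀ (maximalDomain J₁ J₂)) := by
  obtain ⟨P, hP⟩ := X.areCurvatureScalars
  refine ⟨_, P, hP, fun p hp => ?_⟩
  obtain ⟨h1, h2, n1, n2, h0⟩ := mem_futureBoundary hβ₁ hβ₂ hp
  obtain ⟨U₁, hU₁, l1⟩ := J₁.exists_gt_mem_domain n1
  obtain ⟨V₁, hV₁, l2⟩ := J₂.exists_gt_mem_domain n2
  obtain ⟨c, hc, hb⟩ := h.exists_curvature_bound hκ hβ₁ hβ₂ m₁ m₂ hU₁ hV₁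
    ((mem_maximalDomain_axis' hβ₁.le hβ₂.le).2 hV₁)
  have nbhd : Iio U₁ ×ˢ Iio V₁ ∈ 𝓝 p := prod_mem_nhds (Iio_mem_nhds l1) (Iio_mem_nhds l2)
  have mS : MeasurableSet (maximalDomain J₁ J₂) := X.domain.measurableSet
  constructor
  · intro K
    have cs : ContinuousAt (fun z : ℝ × ℝ => J₁.f z.1 + J₂.f z.2 - 1) p :=
      (((J₁.continuousAt_f h1).comp (f := Prod.fst) continuousAt_fst).add
        ((J₂.continuousAt_f h2).comp (f := Prod.snd) continuousAt_snd)).sub continuousAt_const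
    have hK : (0 : ℝ) < c / (|K| + 1) := by positivity
    have ev := cs.eventually (gt_mem_nhds (h0.trans_lt hK))
    obtain ⟨N, hN, hNo, hpN⟩ := mem_nhds_iff.1 (inter_mem nbhd ev)
    refine ⟨N, hNo.mem_nhds hpN, (ae_restrict_iff' (hNo.measurableSet.inter mS)).2 ?_⟩
    filter_upwards [hb] with z hz hm
    obtain ⟨⟨z1, z2⟩, z3⟩ := hN hm.1
    have hs := X.s_pos hm.2
    have z4 : X.s z < c / (|K| + 1) := by rw [h.s_eq]; exact z3
    have e := (hz hm.2 z1 z2).1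
    have e2 : |K| + 1 ≤ c / X.s z := by
      rw [le_div_iff₀ hs]
      rw [lt_div_iff₀ (by positivity)] at z4
      linarith
    rw [abs_neg]
    linarith [le_abs_self K, le_abs_self (κ / 6 * Real.exp (- 2 * X.a z) * (X.ψU z * X.ψV z)),
      abs_nonneg (P z)]
  · intro N hN hI
    obtain ⟨T, mT, hT, pT, cT, nT⟩ := not_integrableOn_inv_area hβ₁ hβ₂ hp (inter_mem hN nbhd)
    have hI' := hI.mono_set (s := T) fun z hz => ⟨(hT hz).1.1, (hT hz).2⟩
    refine nT ((hI'.const_mul c⁻¹).mono' (cT.aestronglyMeasurable mT) ?_)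
    rw [ae_restrict_iff' mT]
    filter_upwards [hb] with z hz hm
    have hS := (hT hm).2
    have hs := X.s_pos hS
    have e := (hz hS (hT hm).1.2.1 (hT hm).1.2.2).2
    have es : Real.exp (2 * X.a z + 2 * X.b z) = Real.exp (2 * X.a z) * X.s z := by
      rw [Real.exp_add, show 2 * X.b z = Real.log (X.s z) by rw [Background.b]; ring,
        Real.exp_log hs]
    have ea : Real.exp (- 2 * X.a z) * Real.exp (2 * X.a z) = 1 := by
      rw [← Real.exp_add]; simp
    rw [Real.norm_of_nonneg (inv_nonneg.2 (pT z hm).le), ← h.s_eq, abs_neg,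
      le_inv_mul_iff₀ hc, ← div_eq_mul_inv]
    refine e.trans ?_
    change _ ≤ _ * Real.exp (2 * X.a z + 2 * X.b z)
    rw [es]
    calc κ / 6 * X.s z * (X.ψU z * X.ψV z)
        = κ / 6 * X.s z * (X.ψU z * X.ψV z)
          * (Real.exp (- 2 * X.a z) * Real.exp (2 * X.a z)) := by rw [ea, mul_one]
      _ = κ / 6 * Real.exp (- 2 * X.a z) * (X.ψU z * X.ψV z)
          * (Real.exp (2 * X.a z) * X.s z) := by ring
      _ ≤ _ := mul_le_mul_of_nonneg_right
          ((le_abs_self _).trans (le_add_of_nonneg_right (abs_nonneg _))) (by positivity)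

/-- The logarithm of the area radius is a scalar that tends to `-∞` at the boundary. -/
theorem not_extendsThrough (h : IsCanonical J₁ J₂ X) (hβ₁ : β₁ < 0) (hβ₂ : β₂ < 0) {p : ℝ × ℝ}
    (hp : p ∈ futureBoundary U₀ V₀ (maximalDomain J₁ J₂)) :
    ¬ ExtendsThrough (maximalDomain J₁ J₂) X.fields p := by
  rintro ⟨O, f', d', W, x, y, β, γ, q₀, hO, hreg, -, hWS, hpW, hq₀, hlim, hW⟩
  obtain ⟨h1, h2, -, -, h0⟩ := mem_futureBoundary hβ₁ hβ₂ hp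
  have : (𝓝[W] p).NeBot := mem_closure_iff_nhdsWithin_neBot.1 hpW
  have t1 : Tendsto (fun q : ℝ × ℝ => f'.b (x q.1, y q.2)) (𝓝[W] p) (𝓝 (f'.b q₀)) :=
    (hreg.b_cont.continuousAt (hO.mem_nhds hq₀)).tendsto.comp hlim
  have cs : ContinuousAt (fun z : ℝ × ℝ => J₁.f z.1 + J₂.f z.2 - 1) p :=
    (((J₁.continuousAt_f h1).comp (f := Prod.fst) continuousAt_fst).add
      ((J₂.continuousAt_f h2).comp (f := Prod.snd) continuousAt_snd)).sub continuousAt_const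
  have t2 : Tendsto X.s (𝓝[W] p) (𝓝[>] 0) := by
    refine tendsto_nhdsWithin_iff.2 ⟨?_, ?_⟩
    · have := cs.tendsto.mono_left (nhdsWithin_le_nhds (s := W))
      rw [h0] at this
      exact this.congr fun q => (h.s_eq q).symm
    · filter_upwards [self_mem_nhdsWithin] with q hq using X.s_pos (hWS hq)
  have t3 : Tendsto (fun q => X.b q + β) (𝓝[W] p) atBot :=
    tendsto_atBot_add_const_right _ _
      ((Real.tendsto_log_nhdsGT_zero.comp t2).const_mul_atBot (by norm_num : (0 : ℝ) < 1 / 2))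
  refine not_tendsto_nhds_of_tendsto_atBot t3 _ (t1.congr' ?_)
  filter_upwards [self_mem_nhdsWithin] with q hq using (hW q hq).2.2.2.2.1

end IsCanonical

/-- The perturbed data are strictly contracting and contain matter everywhere, which is all that the
lower bounds for the curvature need. -/
theorem InitialData.hasSingularDevelopment_addMatter {D : InitialData} {ε : ℝ} (hκ : 0 < κ)
    (hD : D.IsWeaklyRegular) (hN : D.NonExpanding) (hε : 0 < ε) :
    HasSingularDevelopment κ (D.addMatter ε) := by
  have hD' : (D.addMatter ε).IsWeaklyRegular := ⟨hD.1.addMatter hε.le, hD.2.addMatter hε.le⟩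
  obtain ⟨J₁⟩ := exists_axis hD'.1 0 (- (D.addMatter ε).ρ₀) (- (D.addMatter ε).σ₀)
  obtain ⟨J₂⟩ := exists_axis hD'.2 4 (D.addMatter ε).μ₀ (D.addMatter ε).lam₀
  obtain ⟨X, hX⟩ := exists_isMaximalDevelopment hκ J₁ J₂
  have b1 : - (D.addMatter ε).ρ₀ < 0 := neg_lt_zero.2 (add_pos_of_nonneg_of_pos hN.1 hε)
  have b2 : (D.addMatter ε).μ₀ < 0 := by
    have := hN.2
    simp only [addMatter]; linarith
  exact ⟨_, _, hX.isMaximalDevelopment hκ, hX.curvatureBlowsUpOn hκ b1 b2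
    (fun _ hx => hD.1.exists_le_addMatter hε 0 hx) (fun _ hx => hD.2.exists_le_addMatter hε 4 hx),
    fun _ hp => hX.not_extendsThrough b1 b2 hp⟩

end

end PlaneSymmetric

end

theorem theorem2 (κ : ℝ) (hκ : 0 < κ) :
    -- existence and uniqueness of the future development of arbitrary data
    (∀ D : PlaneSymmetric.InitialData, D.IsWeaklyRegular →
      ∃ (S : Set (ℝ × ℝ)) (f : PlaneSymmetric.Fields),
        PlaneSymmetric.IsMaximalDevelopment κ D S f ∧
        -- its past and future boundaries, when the area is decreasing toward the future
        (D.NonExpanding →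
          (∃ Ubar Vbar : EReal, (D.U₀ : EReal) < Ubar ∧ (D.V₀ : EReal) < Vbar ∧
            (∀ U : ℝ, (U, D.V₀) ∈ S ↔ D.U₀ ≤ U ∧ (U : EReal) < Ubar) ∧
            (∀ V : ℝ, (D.U₀, V) ∈ S ↔ D.V₀ ≤ V ∧ (V : EReal) < Vbar)) ∧
          ∃ F G : ℝ → ℝ,
            PlaneSymmetric.IsW21 D.U₀ F ∧ PlaneSymmetric.IsW21 D.V₀ G ∧
            MonotoneOn F (Set.Ici D.U₀) ∧ MonotoneOn G (Set.Ici D.V₀) ∧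
            S = {p : ℝ × ℝ | D.U₀ ≤ p.1 ∧ D.V₀ ≤ p.2 ∧ F p.1 + G p.2 < 0} ∧
            (∀ p ∈ S, Real.exp (2 * f.b p) = - (1 / 2) * (F p.1 + G p.2)) ∧
            PlaneSymmetric.futureBoundary D.U₀ D.V₀ S
              = {p : ℝ × ℝ | D.U₀ < p.1 ∧ D.V₀ < p.2 ∧ F p.1 + G p.2 = 0})) ∧
    -- generic data have a singular, inextendible development
    (∀ D : PlaneSymmetric.InitialData, D.IsWeaklyRegular → D.NonExpanding →
      ∀ ε : ℝ, 0 < ε →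
        ∃ D' : PlaneSymmetric.InitialData,
          D'.U₀ = D.U₀ ∧ D'.V₀ = D.V₀ ∧ D'.IsWeaklyRegular ∧ D'.NonExpanding ∧
          D.dist D' < ENNReal.ofReal ε ∧
          PlaneSymmetric.HasSingularDevelopment κ D' ∧
          -- the perturbation does not remove the future boundary
          (∀ (S S' : Set (ℝ × ℝ)) (f f' : PlaneSymmetric.Fields),
            PlaneSymmetric.IsMaximalDevelopment κ D S f →
            PlaneSymmetric.IsMaximalDevelopment κ D' S' f' →
            (PlaneSymmetric.futureBoundary D.U₀ D.V₀ S).Nonempty →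
            (PlaneSymmetric.futureBoundary D'.U₀ D'.V₀ S').Nonempty)) := by
  refine ⟨PlaneSymmetric.exists_maximal_development hκ, fun D hD hN ε hε => ?_⟩
  have hε' : 0 < ε / 8 := by positivity
  refine ⟨D.addMatter (ε / 8), rfl, rfl, ⟨hD.1.addMatter hε'.le, hD.2.addMatter hε'.le⟩,
    ⟨add_nonneg hN.1 hε'.le, ?_⟩, ?_,
    PlaneSymmetric.InitialData.hasSingularDevelopment_addMatter hκ hD hN hε',
    fun S S' f f' => PlaneSymmetric.InitialData.boundary_addMatter hκ hD hN hε'⟩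
  · simp only [PlaneSymmetric.InitialData.addMatter]
    linarith [hN.2]
  · rw [PlaneSymmetric.InitialData.dist_addMatter hε']
    exact (ENNReal.ofReal_lt_ofReal_iff hε).2 (by linarith)
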